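/- **Setting.** Gates are $H$, $T=\mathrm{diag}(1,e^{i\pi/4})$ and CNOT. For $n\in\mathbb N$, pure $n$-qubit states $\psi_1,\dots,\psi_n$, a bit $f$ and $\kappa\in(\tfrac12,1)$, let $\Phi_{\kappa,f,\psi}$ be the quantum channel whose input is $n$ registers of $n$ qubits and one further qubit and whose output is one qubit: it performs a swap test between register $j$ and $\psi_j$ for every $j$, applies Pauli $X$ to the last qubit if $f=1$ and at least $\kappa n$ tests are passed, and outputs the last qubit. For $L\subseteq\mathbb N$ and a family $\psi=(\psi_{n,j})_{1\le j\le n}$ of pure $n$-qubit states, the channel oracle $\Phi=\Phi_{\kappa,L,\psi}$ is the family $\Phi_n=\Phi_{\kappa,[n\in L],(\psi_{n,1},\dots,\psi_{n,n})}$, $n\in\mathbb N$. Relative to $\Phi$ and to public strings $D=(D_m)_{m\in\mathbb N}$, a verifier is a polynomial-time Turing machine that, given an input $x$ and $D_0,\dots,D_{k-1}$ with $k$ a fixed polynomial in $|x|$, outputs a quantum circuit with calls to $\Phi$. $\mathrm{QMA}^{\Phi,D}$ (resp. $\mathrm{QCMA}^{\Phi,D}$) is the class of languages for which some verifier accepts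 each $x$ in the language with probability $\ge 2/3$ for some quantum (resp. classical) witness of polynomial length, and each $x$ not in the language with probability $\le 1/3$ for all such witnesses. A subscript bounds the number of calls to $\Phi$; without subscript the number is not bounded (beyond the polynomial running time). Calls are "unrestricted" if all $\Phi_m$ may be called and "own-length" if on inputs of length $n$ only $\Phi_n$ may be called. No $D$ means that there is no public information. We say that $L$ *separates* relative to $\Phi,D$ if the unary language $1^L=\{1^n:n\in L\}$ is in $\mathrm{QMA}^{\Phi}$ by a verifier making at most one, own-length call and using no public information, while $1^L\notin \mathrm{QCMA}^{\Phi,D}$ with an unbounded number of calls; in particular then $\mathrm{QMA}^{\Phi,D}_q\ne\mathrm{QCMA}^{\Phi,D}_q$ for every bound $1\le q\le\infty$ on the number of calls. **Theorem.** (a) For every $\kappa\in(\tfrac12,1)$ there are $L\subseteq\mathbb N$ and marked states $\psi_{n,j}$ such that $L$ separates relative to $\Phi=\Phi_{\kappa,L,\psi}$ (unrestricted calls, no public information); in particular $\mathrm{QMA}^\Phi\neq\mathrm{QCMA}^\Phi$. (b) Let $s$ be a polynomial and $\kappa\in(\tfrac12,1)$ rational. To generate a marked state on $n$ qubits, apply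 a circuit $c$ of $s(n)$ random gates (kind and wires chosen independently and uniformly; a CNOT whose two wires coincide is the identity) to $|0\rangle^{\otimes 2n}$ and measure the first $n$ qubits in the computational basis; if the result is $m$, the marked state $\psi_{c,m}$ is the state of the other $n$ qubits, and $(c,m)$ is its classical description. An instance of length $n$ consists of $n$ independently generated marked states and an independent fair private bit $b_n$. 1. A quantum computer with classical control (registers, uniform random choices, gates, measurements, and a public tape) generates, given $n$, an instance of length $n$ in time and space polynomial in $n$: with exactly the above probabilities it ends with the private bit in a register, the descriptions $(c_1,m_1),\dots,(c_n,m_n)$ announced on the public tape, and one copy of each marked state in its quantum memory. The announced string has length polynomial in $n$ and determines $(c_1,m_1),\dots,(c_n,m_n)$. 2. From $n$, a bit $f$ and a single copy of each of any $n$ pure $n$-qubit states $\psi_1,\dots,\psi_n$, such a computer applies $\Phi_{\kappa,f,\psi}$ once, exactly, to the input of a caller, in time and space polynomial in $n$. 3. Assume that the generated states are complex: for every $k$, the probability that some circuit of at most $n^k$ gates, started on $|0\rangle$s, prepares a state whose marginal on the first $n$ qubits has fidelity at least $n^{-k}$ with $\psi_{c,m}$ is negligible, i.e. $o(n^{-l})$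 for every $l$. Let $S\subseteq\mathbb N$ be infinite, generate independent instances of all lengths, and let $L=\{n\in S: b_n=1\}$, $\Phi=\Phi_{\kappa,L,\psi}$ with the generated marked states $\psi$, and $D_n$ the public string announced for length $n$. Then with probability $1$, for own-length calls, $L$ separates relative to $\Phi$, both without public information and with public information $D$. If moreover $2^m\le n$ for all $m<n$ in $S$, then with probability $1$ the same holds for unrestricted calls. In particular $\mathrm{QMA}^{\Phi}\ne\mathrm{QCMA}^{\Phi}$ and $\mathrm{QMA}^{\Phi,D}\ne\mathrm{QCMA}^{\Phi,D}$, also when $\Phi$ may be called only once. -/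

import Mathlib

noncomputable section

namespace ChannelOracles

open Finset

/-! ### Qubits, gates, channels -/

/-- Strings of `k` bits; they label the computational basis of `k` qubits. -/
abbrev Bits (k : ℕ) : Type := Fin k → Bool

/-- Pure states of `k` qubits. -/
abbrev PureState (k : ℕ) : Type :=
  {ψ : Bits k → ℂ // ∑ x, Complex.normSq (ψ x) = 1}

/-- The workspace of a quantum computation: wires `0, 1, 2, …`, all but finitely many of them in
the state `|0⟩`. The basis vector labelled by a finite set `s` has exactly the wires in `s` in
the state `|1⟩`. -/
abbrev Workspace : Type := Finset ℕ →₀ ℂ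

/-- The basis vector labelled by `s`. -/
def ket (s : Finset ℕ) : Workspace := Finsupp.single s 1

/-- The linear operator with prescribed values on the basis vectors. -/
def ofBasis (f : Finset ℕ → Workspace) : Workspace →ₗ[ℂ] Workspace :=
  Finsupp.linearCombination ℂ f

/-- Squared norm. -/
def sqNorm (v : Workspace) : ℝ := ∑ s ∈ v.support, Complex.normSq (v s)

/-- The wires in state `|1⟩` when the string `x` is written on the wires `a, a + 1, …`. -/
def place (a : ℕ) {k : ℕ} (x : Bits k) : Finset ℕ :=
  (univ.filter fun i => x i = true).image fun i : Fin k => a + (i : ℕ)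

/-- The string found on the wires `a, …, a + k - 1`. -/
def readAt (a k : ℕ) (s : Finset ℕ) : Bits k := fun i => decide (a + (i : ℕ) ∈ s)

/-- Reset the wires `a, …, a + k - 1` to `0`. -/
def clearAt (a k : ℕ) (s : Finset ℕ) : Finset ℕ := s \ Finset.Ico a (a + k)

/-- The state `φ` on the wires `a, …, a + k - 1`, all other wires being `|0⟩`. -/
def loadAt (a : ℕ) {k : ℕ} (φ : Bits k → ℂ) : Workspace := ∑ x, φ x • ket (place a x)

/-- The operator `K` from `k` to `l ≤ k` qubits, applied to the wires `a, …, a + k - 1`; its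
output is found on the wires `a, …, a + l - 1` and the other wires of the window are left in the
state `|0⟩`. -/
def window {k l : ℕ} (K : Matrix (Bits l) (Bits k) ℂ) (a : ℕ) : Workspace →ₗ[ℂ] Workspace :=
  ofBasis fun s => ∑ y, K y (readAt a k s) • ket (clearAt a k s ∪ place a y)

/-- The elementary gates: Hadamard, the `π/8` gate `T = diag (1, exp (iπ/4))` and CNOT (control
first). `cnot i i` is read as the identity. -/
inductive Gate : Type
  | had (i : ℕ)
  | tee (i : ℕ)
  | cnot (i j : ℕ)

/-- The action of a gate. -/
def Gate.op : Gate → (Workspace →ₗ[ℂ] Workspace)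
  | .had i => ofBasis fun s =>
      ((Real.sqrt 2 : ℝ) : ℂ)⁻¹ •
        (ket (s.erase i) + (if i ∈ s then (-1 : ℂ) else 1) • ket (insert i s))
  | .tee i => ofBasis fun s =>
      (if i ∈ s then Complex.exp (Real.pi / 4 * Complex.I) else 1) • ket s
  | .cnot i j => ofBasis fun s =>
      if i ∈ s ∧ i ≠ j then ket (symmDiff s {j}) else ket s

/-- Run a list of gates, the head of the list first. -/
def runGates : List Gate → Workspace → Workspace
  | [], v => v
  | g :: c, v => runGates c (g.op v)

/-- The fidelity `⟨ψ|ρ|ψ⟩` of the pure state `ψ` with the marginal `ρ` of `v` on the first `n`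
wires. -/
def fidelity {n : ℕ} (ψ : PureState n) (v : Workspace) : ℝ :=
  sqNorm (window (fun (_ : Bits 0) (x : Bits n) => (starRingEnd ℂ) (ψ.1 x)) 0 v)

/-- Quantum channels (completely positive trace-preserving maps) from `k` qubits to `l` qubits,
in Kraus form. -/
structure QChannel (k l : ℕ) where
  ι : Type
  fin : Fintype ι
  kraus : ι → Matrix (Bits l) (Bits k) ℂ
  tracePreserving : ∑ e, (kraus e).conjTranspose * kraus e = 1

attribute [instance] QChannel.fin

/-- The action of a channel on density matrices. -/
def QChannel.apply {k l : ℕ} (Φ : QChannel k l) (ρ : Matrix (Bits k) (Bits k) ℂ) :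
    Matrix (Bits l) (Bits l) ℂ :=
  ∑ e, Φ.kraus e * ρ * (Φ.kraus e).conjTranspose

/-- A quantum channel oracle: a family of channels, one for each length. -/
structure ChannelOracle where
  inp : ℕ → ℕ
  out : ℕ → ℕ
  out_le : ∀ n, out n ≤ inp n
  chan : ∀ n, QChannel (inp n) (out n)

/-! ### Oracle circuits and the classes QMA and QCMA relative to a channel oracle -/

/-- Instructions of an oracle circuit. `query m a` applies the `m`-th channel of the oracle to
the wires `a, a + 1, …`; its output replaces the first wires of that window, the remaining ones
are discarded and replaced by fresh `|0⟩`s. -/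
inductive Instr : Type
  | gate (g : Gate)
  | query (m a : ℕ)

/-- Oracle circuits. -/
abbrev Circuit : Type := List Instr

/-- The probability that the circuit, run on the (unnormalised) state `v`, ends with outcome `1`
in a measurement of wire `0`. -/
def acceptProb (Φ : ChannelOracle) : Circuit → Workspace → ℝ
  | [], v => ∑ s ∈ v.support.filter (fun s => 0 ∈ s), Complex.normSq (v s)
  | .gate g :: c, v => acceptProb Φ c (g.op v)
  | .query m a :: c, v => ∑ e, acceptProb Φ c (window ((Φ.chan m).kraus e) a v)

/-- The lengths at which a circuit queries the oracle, with repetitions. -/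
def queries : Circuit → List ℕ
  | [] => []
  | .gate _ :: c => queries c
  | .query m _ :: c => m :: queries c

/-- Instructions as words over a six-letter alphabet: a letter for the kind, and two numbers in
unary notation (letter `4`, with end marker `5`). -/
def encodeInstr : Instr → List (Fin 6)
  | .gate (.had i) => 0 :: (List.replicate i 4 ++ 5 :: 5 :: [])
  | .gate (.tee i) => 1 :: (List.replicate i 4 ++ 5 :: 5 :: [])
  | .gate (.cnot i j) => 2 :: (List.replicate i 4 ++ 5 :: (List.replicate j 4 ++ [5]))
  | .query m a => 3 :: (List.replicate m 4 ++ 5 :: (List.replicate a 4 ++ [5]))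

/-- Circuits as words. -/
def encodeCircuit (c : Circuit) : List (Fin 6) := c.flatMap encodeInstr

theorem replicate_stop_inj {i j : ℕ} {u v : List (Fin 6)}
    (h : List.replicate i (4 : Fin 6) ++ 5 :: u = List.replicate j 4 ++ 5 :: v) :
    i = j ∧ u = v := by
  induction i generalizing j with
  | zero =>
    cases j with
    | zero => simpa using h
    | succ j => simp [List.replicate_succ] at h
  | succ i ih =>
    cases j with
    | zero => simp [List.replicate_succ] at h
    | succ j =>
      simp only [List.replicate_succ, List.cons_append, List.cons.injEq, true_and] at h
      obtain ⟨h1, h2⟩ := ih h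
      exact ⟨by rw [h1], h2⟩

theorem encodeInstr_prefix {a b : Instr} {u v : List (Fin 6)}
    (h : encodeInstr a ++ u = encodeInstr b ++ v) : a = b ∧ u = v := by
  rcases a with (i | i | ⟨i, j⟩) | ⟨m, o⟩ <;> rcases b with (k | k | ⟨k, l⟩) | ⟨k, l⟩ <;>
    simp only [encodeInstr, List.cons_append, List.cons.injEq, List.append_assoc,
      List.nil_append] at h <;>
    first
    | exact absurd h.1 (by decide)
    | (obtain ⟨h1, h2⟩ := replicate_stop_inj h.2
       first
       | (obtain ⟨h3, h4⟩ := replicate_stop_inj h2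
          exact ⟨by rw [h1, h3], h4⟩)
       | exact ⟨by rw [h1], by simpa using h2⟩)

/-- The code of a circuit determines the circuit. -/
theorem encodeCircuit_injective : Function.Injective encodeCircuit := by
  intro c
  induction c with
  | nil =>
    intro d h
    cases d with
    | nil => rfl
    | cons b d =>
      rcases b with (i | i | ⟨i, j⟩) | ⟨i, j⟩ <;> simp [encodeCircuit, encodeInstr] at h
  | cons a c ih =>
    intro d h
    cases d with
    | nil => rcases a with (i | i | ⟨i, j⟩) | ⟨i, j⟩ <;> simp [encodeCircuit, encodeInstr] at h
    | cons b d =>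
      simp only [encodeCircuit, List.flatMap_cons] at h
      obtain ⟨h1, h2⟩ := encodeInstr_prefix h
      rw [h1, ih h2]

/-- What the classical computer that sets up the verification sees: the input `x`, followed by
the public strings `D 0, …, D (k - 1)`, each preceded by a separator. -/
def verifierInput (x : List Bool) (D : ℕ → List Bool) (k : ℕ) : List (Option Bool) :=
  x.map some ++ (List.range k).flatMap fun m => none :: (D m).map some

/-- `V` is computed by a Turing machine in polynomial time. -/
def PolyTime (V : List (Option Bool) → Circuit) : Prop :=
  Nonempty (Turing.TM2ComputableInPolyTime (id : List (Option Bool) → List (Option Bool))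
    encodeCircuit V)

/-- A rule saying which channels may be queried: `acc n m` means that on inputs of length `n` the
`m`-th channel of the oracle may be queried. -/
abbrev Access : Type := ℕ → ℕ → Prop

/-- All channels of the oracle may be queried. -/
def anyLength : Access := fun _ _ => True

/-- On inputs of length `n` only the `n`-th channel may be queried. -/
def ownLength : Access := fun n m => m = n

/-- No public information. -/
def noInfo : ℕ → List Bool := fun _ => []

/-- The verifier set up by `V` makes at most `q` queries, all of them permitted. -/
def Legal (q : ℕ∞) (acc : Access) (n : ℕ) (c : Circuit) : Prop :=
  ((queries c).length : ℕ∞) ≤ q ∧ ∀ m ∈ queries c, acc n m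

/-- Languages with polynomial-time quantum verifiers that receive a quantum witness, make at most
`q` calls (permitted by `acc`) to the channel oracle `Φ`, and know the public strings `D`.
The witness is on the wires `1, …, w`, all other wires start as `|0⟩`. -/
def QMA (q : ℕ∞) (acc : Access) (Φ : ChannelOracle) (D : ℕ → List Bool) :
    Set (Set (List Bool)) :=
  {A | ∃ (V : List (Option Bool) → Circuit) (d w : Polynomial ℕ), PolyTime V ∧
    ∀ x : List Bool,
      let c := V (verifierInput x D (d.eval x.length))
      Legal q acc x.length c ∧
      (x ∈ A → ∃ φ : PureState (w.eval x.length), 2 / 3 ≤ acceptProb Φ c (loadAt 1 φ.1)) ∧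
      (x ∉ A → ∀ φ : PureState (w.eval x.length), acceptProb Φ c (loadAt 1 φ.1) ≤ 1 / 3)}

/-- The same with a classical witness. -/
def QCMA (q : ℕ∞) (acc : Access) (Φ : ChannelOracle) (D : ℕ → List Bool) :
    Set (Set (List Bool)) :=
  {A | ∃ (V : List (Option Bool) → Circuit) (d w : Polynomial ℕ), PolyTime V ∧
    ∀ x : List Bool,
      let c := V (verifierInput x D (d.eval x.length))
      Legal q acc x.length c ∧
      (x ∈ A → ∃ y : Bits (w.eval x.length), 2 / 3 ≤ acceptProb Φ c (ket (place 1 y))) ∧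
      (x ∉ A → ∀ y : Bits (w.eval x.length), acceptProb Φ c (ket (place 1 y)) ≤ 1 / 3)}

/-- The unary language of a set of lengths. -/
def unary (L : Set ℕ) : Set (List Bool) := {x | ∃ n ∈ L, x = List.replicate n true}

/-- The unary language of `L` separates QMA from QCMA relative to `Φ`: a verifier with a quantum
witness needs one call, at its own length, and no public information; no verifier with a
classical witness decides it, with any number of calls permitted by `acc` and with the public
information `D`. In particular the two classes differ, for every bound `q ≥ 1` on the number of
calls. -/
structure Separates (acc : Access) (Φ : ChannelOracle) (D : ℕ → List Bool) (L : Set ℕ) :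
    Prop where
  mem_QMA : unary L ∈ QMA 1 ownLength Φ noInfo
  not_mem_QCMA : unary L ∉ QCMA ⊤ acc Φ D
  ne : ∀ q : ℕ∞, 1 ≤ q → QMA q acc Φ D ≠ QCMA q acc Φ D

/-! ### The swap-test channel -/

/-- The amplitude of `|a⟩|b⟩` in `(1 + SWAP)/2 |x⟩|ψ⟩` (test passed, `t = true`) or in
`(1 - SWAP)/2 |x⟩|ψ⟩` (test failed, `t = false`). -/
def swapAmp {n : ℕ} (ψ : Bits n → ℂ) (t : Bool) (a b x : Bits n) : ℂ :=
  ((if a = x then ψ b else 0) + (if t then 1 else -1) * (if b = x then ψ a else 0)) / 2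

/-- The `j`-th `n`-bit block of a string of length `n * n`. -/
def block {n : ℕ} (x : Bits (n * n)) (j : Fin n) : Bits n := fun i => x (finProdFinEquiv (j, i))

/-- The Kraus operators of the swap-test channel. The index records the outcomes `t` of the `n`
swap tests and the basis states `a`, `b` of the discarded registers after the tests. The last
input qubit is the output qubit; it is flipped if `flag` is set and at least `κ n` tests have
been passed. -/
def swapKraus {n : ℕ} (κ : ℝ) (flag : Bool) (ψ : Fin n → PureState n)
    (e : Bits n × (Fin n → Bits n) × (Fin n → Bits n)) :
    Matrix (Bits 1) (Bits (n * n + 1)) ℂ := fun y x =>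
  open scoped Classical in
  (∏ j, swapAmp (ψ j).1 (e.1 j) (e.2.1 j) (e.2.2 j) (block (fun i => x i.castSucc) j)) *
    (if y 0 = xor (x (Fin.last (n * n)))
        (flag && decide (κ * n ≤ ((univ.filter fun j => e.1 j = true).card : ℝ)))
      then 1 else 0)

theorem swapAmp_sum {n : ℕ} (ψ : PureState n) (x x' : Bits n) :
    ∑ t, ∑ a, ∑ b, (starRingEnd ℂ) (swapAmp ψ.1 t a b x) * swapAmp ψ.1 t a b x' =
      if x = x' then 1 else 0 := by
  have hψ : ∑ b, (starRingEnd ℂ) (ψ.1 b) * ψ.1 b = 1 := by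
    have h := congrArg (fun r : ℝ => (r : ℂ)) ψ.2
    simp only [Complex.ofReal_sum, Complex.normSq_eq_conj_mul_self, Complex.ofReal_one] at h
    exact h
  have key : ∀ a b : Bits n,
      ∑ t, (starRingEnd ℂ) (swapAmp ψ.1 t a b x) * swapAmp ψ.1 t a b x' =
      ((if a = x then (if a = x' then 1 else 0) else 0) * ((starRingEnd ℂ) (ψ.1 b) * ψ.1 b) +
       (if b = x then (if b = x' then 1 else 0) else 0) * ((starRingEnd ℂ) (ψ.1 a) * ψ.1 a)) / 2
      := by
    intro a b
    have h2 : (starRingEnd ℂ) 2 = 2 := Complex.conj_ofNat 2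
    simp only [swapAmp, Fintype.sum_bool, if_true, Bool.false_eq_true, if_false, map_div₀, h2,
      map_add, map_mul, map_neg, map_one]
    split_ifs <;> (try simp only [map_zero]) <;> ring
  rw [Finset.sum_comm]
  have : ∀ a : Bits n, ∑ t, ∑ b, (starRingEnd ℂ) (swapAmp ψ.1 t a b x) * swapAmp ψ.1 t a b x' =
      ∑ b, ∑ t, (starRingEnd ℂ) (swapAmp ψ.1 t a b x) * swapAmp ψ.1 t a b x' :=
    fun a => Finset.sum_comm
  simp only [this, key]
  simp only [← Finset.sum_div, Finset.sum_add_distrib, ← Finset.mul_sum, ← Finset.sum_mul, hψ]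
  simp only [Finset.sum_ite_eq', Finset.mem_univ, if_true, mul_one]
  split_ifs <;> norm_num

theorem sum_prod_three {n : ℕ} {α β γ : Type} [Fintype α] [Fintype β] [Fintype γ]
    (f : Fin n → α → β → γ → ℂ) :
    ∑ e : (Fin n → α) × (Fin n → β) × (Fin n → γ), ∏ j, f j (e.1 j) (e.2.1 j) (e.2.2 j) =
      ∏ j, ∑ t, ∑ a, ∑ b, f j t a b := by
  classical
  rw [Fintype.sum_prod_type]
  simp only [Fintype.sum_prod_type]
  rw [Finset.prod_univ_sum]
  simp only [Fintype.piFinset_univ, Finset.prod_univ_sum]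

theorem block_ext {n : ℕ} {x x' : Bits (n * n + 1)} :
    x = x' ↔ (∀ j, block (fun i => x i.castSucc) j = block (fun i => x' i.castSucc) j) ∧
      x (Fin.last _) = x' (Fin.last _) := by
  constructor
  · rintro rfl
    exact ⟨fun _ => rfl, rfl⟩
  · rintro ⟨h, hl⟩
    funext i
    refine Fin.lastCases hl (fun i => ?_) i
    have := congrFun (h (finProdFinEquiv.symm i).1) (finProdFinEquiv.symm i).2
    simp only [block, Prod.mk.eta, Equiv.apply_symm_apply] at this
    exact this

theorem swapKraus_tracePreserving {n : ℕ} (κ : ℝ) (flag : Bool) (ψ : Fin n → PureState n) :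
    ∑ e, (swapKraus κ flag ψ e).conjTranspose * swapKraus κ flag ψ e = 1 := by
  classical
  ext x x'
  rw [Matrix.sum_apply]
  have h1 : ∀ e, ((swapKraus κ flag ψ e).conjTranspose * swapKraus κ flag ψ e) x x' =
      (if x (Fin.last _) = x' (Fin.last _) then 1 else 0) *
      ∏ j, ((starRingEnd ℂ)
          (swapAmp (ψ j).1 (e.1 j) (e.2.1 j) (e.2.2 j) (block (fun i => x i.castSucc) j)) *
        swapAmp (ψ j).1 (e.1 j) (e.2.1 j) (e.2.2 j) (block (fun i => x' i.castSucc) j)) := by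
    intro e
    rw [Matrix.mul_apply]
    simp only [Matrix.conjTranspose_apply, swapKraus, star_mul', Finset.prod_mul_distrib]
    generalize (flag && decide (κ * n ≤ ((univ.filter fun j => e.1 j = true).card : ℝ))) = f
    rw [← (Equiv.funUnique (Fin 1) Bool).symm.sum_comp, Fintype.sum_bool]
    simp only [← map_prod]
    generalize (∏ j, swapAmp (ψ j).1 (e.1 j) (e.2.1 j) (e.2.2 j)
      (block (fun i => x i.castSucc) j)) = p
    generalize (∏ j, swapAmp (ψ j).1 (e.1 j) (e.2.1 j) (e.2.2 j)
      (block (fun i => x' i.castSucc) j)) = p'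
    generalize x (Fin.last _) = l
    generalize x' (Fin.last _) = l'
    cases f <;> cases l <;> cases l' <;> simp
  simp only [h1, ← Finset.mul_sum]
  rw [sum_prod_three (fun j t a b => (starRingEnd ℂ)
          (swapAmp (ψ j).1 t a b (block (fun i => x i.castSucc) j)) *
        swapAmp (ψ j).1 t a b (block (fun i => x' i.castSucc) j))]
  simp only [swapAmp_sum, Matrix.one_apply]
  by_cases h : x = x'
  · subst h; simp
  · rw [if_neg h]
    rw [block_ext, not_and_or] at h
    rcases h with h | h
    · push Not at h
      obtain ⟨j, hj⟩ := h
      rw [Finset.prod_eq_zero (Finset.mem_univ j) (by rw [if_neg hj]), mul_zero]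
    · rw [if_neg h, zero_mul]

/-- The channel with input `n` registers of `n` qubits and one further qubit. It performs a swap
test between the `j`-th register and the marked state `ψ j` for every `j`, applies a Pauli `X` to
the last qubit if `flag` is set and at least `κ n` tests have been passed, and outputs the last
qubit. -/
def swapChannel {n : ℕ} (κ : ℝ) (flag : Bool) (ψ : Fin n → PureState n) :
    QChannel (n * n + 1) 1 where
  ι := Bits n × (Fin n → Bits n) × (Fin n → Bits n)
  fin := inferInstance
  kraus := swapKraus κ flag ψ
  tracePreserving := swapKraus_tracePreserving κ flag ψ

/-- The swap-test channel oracle for the lengths in `L` and the marked states `ψ n j`. -/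
def swapOracle (κ : ℝ) (L : Set ℕ) (ψ : ∀ n, Fin n → PureState n) : ChannelOracle where
  inp n := n * n + 1
  out _ := 1
  out_le n := Nat.le_add_left 1 (n * n)
  chan n := swapChannel κ (open scoped Classical in decide (n ∈ L)) (ψ n)

/-! ### Random circuits with measurement -/

theorem Gate.had_apply (i : ℕ) (v : Workspace) (s : Finset ℕ) :
    (Gate.had i).op v s = ((Real.sqrt 2 : ℝ) : ℂ)⁻¹ *
      (v (s.erase i) + (if i ∈ s then (-1 : ℂ) else 1) * v (insert i s)) := by
  induction v using Finsupp.induction_linear with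
  | zero => simp
  | add f g hf hg => simp only [map_add, Finsupp.add_apply, hf, hg]; ring
  | single u r =>
    simp only [Gate.op, ofBasis, Finsupp.linearCombination_single, ket, Finsupp.smul_apply,
      Finsupp.add_apply, Finsupp.single_apply, smul_eq_mul]
    by_cases hs : i ∈ s
    · have e1 : u.erase i ≠ s := by rintro rfl; simp at hs
      have e2 : insert i s = s := Finset.insert_eq_of_mem hs
      by_cases hu : i ∈ u
      · have e3 : insert i u = u := Finset.insert_eq_of_mem hu
        have e4 : u ≠ s.erase i := by rintro rfl; simp at hu
        simp [e1, e2, e3, e4, hu, hs]; split_ifs <;> ring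
      · have e3 : insert i u = s ↔ u = s.erase i := by
          constructor
          · rintro rfl; simp [hu]
          · rintro rfl; simp [hs]
        have e4 : u ≠ s := by rintro rfl; exact hu hs
        simp [e1, e2, e3, e4, hu, hs]; split_ifs <;> ring
    · have e1 : insert i u ≠ s := by rintro rfl; simp at hs
      have e2 : s.erase i = s := Finset.erase_eq_of_notMem hs
      by_cases hu : i ∈ u
      · have e3 : u.erase i = s ↔ u = insert i s := by
          constructor
          · rintro rfl; simp [hu]
          · rintro rfl; simp [hs]
        have e4 : u ≠ s := by rintro rfl; exact hs hu
        simp [e1, e2, e3, e4, hu, hs]; split_ifs <;> ring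
      · have e3 : u.erase i = u := Finset.erase_eq_of_notMem hu
        have e4 : u ≠ insert i s := by rintro rfl; simp at hu
        simp [e1, e2, e3, e4, hu, hs]; split_ifs <;> ring

theorem Gate.tee_apply (i : ℕ) (v : Workspace) (s : Finset ℕ) :
    (Gate.tee i).op v s =
      (if i ∈ s then Complex.exp (Real.pi / 4 * Complex.I) else 1) * v s := by
  induction v using Finsupp.induction_linear with
  | zero => simp
  | add f g hf hg => simp only [map_add, Finsupp.add_apply, hf, hg]; ring
  | single u r =>
    simp only [Gate.op, ofBasis, Finsupp.linearCombination_single, ket, Finsupp.smul_apply,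
      Finsupp.single_apply, smul_eq_mul]
    by_cases h : u = s
    · subst h; simp [mul_comm]
    · simp [h]

theorem Gate.cnot_apply (i j : ℕ) (v : Workspace) (s : Finset ℕ) :
    (Gate.cnot i j).op v s = v (if i ∈ s ∧ i ≠ j then symmDiff s {j} else s) := by
  induction v using Finsupp.induction_linear with
  | zero => simp
  | add f g hf hg => simp only [map_add, Finsupp.add_apply, hf, hg]
  | single u r =>
    simp only [Gate.op, ofBasis, Finsupp.linearCombination_single, ket, Finsupp.smul_apply,
      smul_eq_mul]
    have key : ∀ w : Finset ℕ, i ≠ j → (i ∈ symmDiff w {j} ↔ i ∈ w) := by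
      intro w hij
      simp [Finset.mem_symmDiff, hij]
    by_cases hij : i = j
    · simp [hij, Finsupp.single_apply]
    · by_cases hu : i ∈ u <;> by_cases hs : i ∈ s
      · have : symmDiff u {j} = s ↔ u = symmDiff s {j} := by
          constructor
          · rintro rfl; simp
          · rintro rfl; simp
        simp [hu, hs, hij, Finsupp.single_apply, this]
      · have h1 : symmDiff u {j} ≠ s := by rintro rfl; exact hs ((key u hij).2 hu)
        have h2 : u ≠ s := by rintro rfl; exact hs hu
        simp [hu, hs, hij, Finsupp.single_apply, h1, h2]
      · have h1 : u ≠ symmDiff s {j} := by rintro rfl; exact hu ((key s hij).2 hs)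
        have h2 : u ≠ s := by rintro rfl; exact hu hs
        simp [hu, hs, hij, Finsupp.single_apply, h1, h2]
      · simp [hu, hs, hij, Finsupp.single_apply]

/-- All wires of the gate are below `N`. -/
def Gate.Below (N : ℕ) : Gate → Prop
  | .had i => i < N
  | .tee i => i < N
  | .cnot i j => i < N ∧ j < N

theorem sqNorm_eq {N : ℕ} {v : Workspace} (h : v.support ⊆ (range N).powerset) :
    sqNorm v = ∑ s ∈ (range N).powerset, Complex.normSq (v s) :=
  Finset.sum_subset h fun s _ hs => by simp [Finsupp.notMem_support_iff.1 hs]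

theorem Gate.op_support {N : ℕ} {g : Gate} (hg : g.Below N) {v : Workspace}
    (h : v.support ⊆ (range N).powerset) : (g.op v).support ⊆ (range N).powerset := by
  intro s hs
  have hv : ∀ u, v u ≠ 0 → u ⊆ range N := fun u hu =>
    Finset.mem_powerset.1 (h (Finsupp.mem_support_iff.2 hu))
  rw [Finsupp.mem_support_iff] at hs
  rw [Finset.mem_powerset]
  cases g with
  | had i =>
    rw [Gate.had_apply] at hs
    have hi : i ∈ range N := Finset.mem_range.2 hg
    by_cases h1 : v (s.erase i) = 0
    · have h2 : v (insert i s) ≠ 0 := by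
        intro h2; simp [h1, h2] at hs
      exact (Finset.subset_insert i s).trans (hv _ h2)
    · intro a ha
      by_cases hai : a = i
      · rw [hai]; exact hi
      · exact hv _ h1 (Finset.mem_erase.2 ⟨hai, ha⟩)
  | tee i =>
    rw [Gate.tee_apply] at hs
    exact hv _ (right_ne_zero_of_mul hs)
  | cnot i j =>
    rw [Gate.cnot_apply] at hs
    have hj : j ∈ range N := Finset.mem_range.2 hg.2
    split_ifs at hs
    · intro a ha
      by_cases haj : a = j
      · rw [haj]; exact hj
      · exact hv _ hs (by simp [Finset.mem_symmDiff, ha, haj])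
    · exact hv _ hs

theorem Gate.op_sqNorm {N : ℕ} {g : Gate} (hg : g.Below N) {v : Workspace}
    (h : v.support ⊆ (range N).powerset) : sqNorm (g.op v) = sqNorm v := by
  rw [sqNorm_eq h, sqNorm_eq (Gate.op_support hg h)]
  cases g with
  | had i =>
    have hi : i ∈ range N := Finset.mem_range.2 hg
    rw [← Finset.insert_erase hi, Finset.sum_powerset_insert (Finset.notMem_erase _ _),
      Finset.sum_powerset_insert (Finset.notMem_erase _ _), ← Finset.sum_add_distrib,
      ← Finset.sum_add_distrib]
    refine Finset.sum_congr rfl fun s hs => ?_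
    have his : i ∉ s := fun hh => by
      have := Finset.mem_powerset.1 hs hh
      simp at this
    rw [Gate.had_apply, Gate.had_apply]
    have h2 : Complex.normSq (((Real.sqrt 2 : ℝ) : ℂ)⁻¹) = 1 / 2 := by
      rw [map_inv₀, Complex.normSq_ofReal, Real.mul_self_sqrt (by norm_num)]; norm_num
    simp only [his, if_false, Finset.erase_eq_of_notMem his, Finset.erase_insert his,
      Finset.mem_insert_self, if_true, Finset.insert_idem, map_mul, h2]
    simp only [Complex.normSq_apply, Complex.add_re, Complex.add_im, Complex.mul_re,
      Complex.mul_im, Complex.one_re, Complex.one_im, Complex.neg_re, Complex.neg_im]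
    ring
  | tee i =>
    refine Finset.sum_congr rfl fun s _ => ?_
    rw [Gate.tee_apply, map_mul]
    have h2 : Complex.normSq (Complex.exp (Real.pi / 4 * Complex.I)) = 1 := by
      rw [Complex.normSq_eq_norm_sq]
      have := Complex.norm_exp_ofReal_mul_I (Real.pi / 4)
      push_cast at this
      rw [this]; norm_num
    split_ifs <;> simp [h2]
  | cnot i j =>
    have hj : j ∈ range N := Finset.mem_range.2 hg.2
    simp only [Gate.cnot_apply]
    have hmem : ∀ s ∈ (range N).powerset,
        (if i ∈ s ∧ i ≠ j then symmDiff s {j} else s) ∈ (range N).powerset := by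
      intro s hs
      rw [Finset.mem_powerset] at hs ⊢
      split_ifs
      · intro a ha
        rcases Finset.mem_symmDiff.1 ha with ⟨h1, _⟩ | ⟨h1, _⟩
        · exact hs h1
        · rw [Finset.mem_singleton.1 h1]; exact hj
      · exact hs
    have hinv : ∀ s : Finset ℕ, (if i ∈ (if i ∈ s ∧ i ≠ j then symmDiff s {j} else s) ∧ i ≠ j
        then symmDiff (if i ∈ s ∧ i ≠ j then symmDiff s {j} else s) {j}
        else (if i ∈ s ∧ i ≠ j then symmDiff s {j} else s)) = s := by
      intro s
      by_cases hij : i = j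
      · simp [hij]
      · by_cases his : i ∈ s <;> simp [his, hij, Finset.mem_symmDiff]
    exact Finset.sum_nbij' (fun s => if i ∈ s ∧ i ≠ j then symmDiff s {j} else s)
      (fun s => if i ∈ s ∧ i ≠ j then symmDiff s {j} else s) hmem hmem
      (fun s _ => hinv s) (fun s _ => hinv s) (fun s _ => rfl)

theorem runGates_isometry {N : ℕ} {c : List Gate} (hc : ∀ g ∈ c, g.Below N) {v : Workspace}
    (h : v.support ⊆ (range N).powerset) :
    (runGates c v).support ⊆ (range N).powerset ∧ sqNorm (runGates c v) = sqNorm v := by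
  induction c generalizing v with
  | nil => exact ⟨h, rfl⟩
  | cons g c ih =>
    have hg := hc g (by simp)
    obtain ⟨h1, h2⟩ := ih (fun g' hg' => hc g' (by simp [hg'])) (Gate.op_support hg h)
    exact ⟨h1, h2.trans (Gate.op_sqNorm hg h)⟩

theorem mem_place {a k u : ℕ} {x : Bits k} :
    u ∈ place a x ↔ ∃ i : Fin k, x i = true ∧ a + (i : ℕ) = u := by
  simp [place]

theorem sum_place_place {n : ℕ} (f : Finset ℕ → ℝ) :
    ∑ m : Bits n, ∑ y : Bits n, f (place 0 m ∪ place n y) =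
      ∑ s ∈ (range (2 * n)).powerset, f s := by
  rw [← Fintype.sum_prod_type' (f := fun m y : Bits n => f (place 0 m ∪ place n y))]
  refine Finset.sum_nbij' (fun p => place 0 p.1 ∪ place n p.2)
    (fun s => (readAt 0 n s, readAt n n s)) ?_ ?_ ?_ ?_ ?_
  · rintro ⟨m, y⟩ _
    rw [Finset.mem_powerset]
    intro a ha
    rcases Finset.mem_union.1 ha with ha | ha <;> obtain ⟨i, _, rfl⟩ := mem_place.1 ha <;>
      (rw [Finset.mem_range]; have := i.2; omega)
  · intro s _; simp
  · rintro ⟨m, y⟩ _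
    refine Prod.ext (funext fun i => ?_) (funext fun i => ?_)
    · have h1 : (0 + (i : ℕ) ∈ place 0 m ∪ place n y) ↔ m i = true := by
        rw [Finset.mem_union, mem_place, mem_place]
        constructor
        · rintro (⟨k, hk, he⟩ | ⟨k, hk, he⟩)
          · rwa [show k = i from Fin.ext (by omega)] at hk
          · exact absurd i.2 (by omega)
        · exact fun h => Or.inl ⟨i, h, rfl⟩
      simp only [readAt, h1]
      cases m i <;> rfl
    · have h1 : (n + (i : ℕ) ∈ place 0 m ∪ place n y) ↔ y i = true := by
        rw [Finset.mem_union, mem_place, mem_place]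
        constructor
        · rintro (⟨k, hk, he⟩ | ⟨k, hk, he⟩)
          · exact absurd k.2 (by omega)
          · rwa [show k = i from Fin.ext (by omega)] at hk
        · exact fun h => Or.inr ⟨i, h, rfl⟩
      simp only [readAt, h1]
      cases y i <;> rfl
  · intro s hs
    ext a
    rw [Finset.mem_union, mem_place, mem_place]
    simp only [readAt, decide_eq_true_eq]
    constructor
    · rintro (⟨i, hi, rfl⟩ | ⟨i, hi, rfl⟩) <;> exact hi
    · intro ha
      have h2 := Finset.mem_range.1 (Finset.mem_powerset.1 hs ha)
      by_cases han : a < n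
      · exact Or.inl ⟨⟨a, han⟩, by simpa using ha, by simp⟩
      · refine Or.inr ⟨⟨a - n, by omega⟩, ?_, ?_⟩ <;> simp only [Nat.add_sub_cancel' (not_lt.1 han)]
        exact ha
  · intro p _; rfl

/-- The random choices for one gate on `2 n` qubits: its kind, and two wires. -/
abbrev GateChoice (n : ℕ) : Type := Fin 3 × Fin (2 * n) × Fin (2 * n)

/-- The gate chosen; kinds `0` and `1` ignore the second wire. -/
def GateChoice.toGate {n : ℕ} (x : GateChoice n) : Gate :=
  if x.1 = 0 then .had x.2.1 else if x.1 = 1 then .tee x.2.1 else .cnot x.2.1 x.2.2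

/-- Circuits of `s n` gates on `2 n` qubits. -/
abbrev RandomCircuit (s : Polynomial ℕ) (n : ℕ) : Type := Fin (s.eval n) → GateChoice n

/-- The output of the circuit on `2 n` qubits in the state `|0⟩`. -/
def RandomCircuit.output {s : Polynomial ℕ} {n : ℕ} (c : RandomCircuit s n) : Workspace :=
  runGates (List.ofFn fun t => (c t).toGate) (ket ∅)

/-- A classical description of one marked state: a circuit `c` and a measurement result `m`. -/
abbrev Descr (s : Polynomial ℕ) (n : ℕ) : Type := RandomCircuit s n × Bits n

/-- The unnormalised state of the last `n` qubits when the measurement of the first `n` of the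
`2 n` output qubits of `c` yields `m`. -/
def Descr.branch {s : Polynomial ℕ} {n : ℕ} (d : Descr s n) : Bits n → ℂ :=
  fun y => d.1.output (place 0 d.2 ∪ place n y)

/-- The probability of `(c, m)` when `c` is chosen uniformly at random and `m` is measured. -/
def Descr.prob {s : Polynomial ℕ} {n : ℕ} (d : Descr s n) : ℝ :=
  (Fintype.card (RandomCircuit s n) : ℝ)⁻¹ * ∑ y, Complex.normSq (d.branch y)

theorem normalize_sum {n : ℕ} (φ : Bits n → ℂ) (h : ∑ y, Complex.normSq (φ y) ≠ 0) :
    ∑ x, Complex.normSq (φ x / (Real.sqrt (∑ y, Complex.normSq (φ y)) : ℝ)) = 1 := by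
  have h0 : 0 ≤ ∑ y, Complex.normSq (φ y) := Finset.sum_nonneg fun _ _ => Complex.normSq_nonneg _
  simp only [Complex.normSq_div, Complex.normSq_ofReal, Real.mul_self_sqrt h0, ← Finset.sum_div]
  exact div_self h

/-- The marked state `ψ_{c,m}`: the state of the last `n` qubits after the measurement of the
first `n` output qubits of `c` has yielded `m` (and `|0⟩`, if this result is impossible). -/
def Descr.state {s : Polynomial ℕ} {n : ℕ} (d : Descr s n) : PureState n :=
  open scoped Classical in
  if h : ∑ y, Complex.normSq (d.branch y) = 0 then
    ⟨fun x => if x = fun _ => false then 1 else 0, by simp [apply_ite]⟩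
  else ⟨fun x => d.branch x / (Real.sqrt (∑ y, Complex.normSq (d.branch y)) : ℝ),
    normalize_sum _ h⟩

theorem Descr.prob_nonneg {s : Polynomial ℕ} {n : ℕ} (d : Descr s n) : 0 ≤ d.prob :=
  mul_nonneg (by positivity) (Finset.sum_nonneg fun _ _ => Complex.normSq_nonneg _)

theorem Descr.sum_prob (s : Polynomial ℕ) {n : ℕ} (hn : n ≠ 0) :
    ∑ d : Descr s n, d.prob = 1 := by
  have hc : ∀ c : RandomCircuit s n, ∑ m : Bits n, ∑ y : Bits n,
      Complex.normSq (c.output (place 0 m ∪ place n y)) = 1 := by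
    intro c
    rw [sum_place_place (fun u => Complex.normSq (c.output u))]
    have h0 : (ket ∅).support ⊆ (range (2 * n)).powerset := by
      intro u hu
      have := Finsupp.support_single_subset hu
      simp at this
      simp [this]
    have hb : ∀ g ∈ List.ofFn (fun t => (c t).toGate), g.Below (2 * n) := by
      intro g hg
      rw [List.mem_ofFn] at hg
      obtain ⟨t, rfl⟩ := hg
      simp only [GateChoice.toGate]
      split_ifs <;> simp [Gate.Below]
    obtain ⟨h1, h2⟩ := runGates_isometry hb h0
    rw [show c.output = runGates (List.ofFn fun t => (c t).toGate) (ket ∅) from rfl,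
      ← sqNorm_eq h1, h2]
    simp [sqNorm, ket]
  rw [Fintype.sum_prod_type]
  simp only [Descr.prob, Descr.branch, ← Finset.mul_sum, hc]
  have : Nonempty (Fin (2 * n)) := ⟨⟨0, by omega⟩⟩
  simp only [Finset.sum_const, Finset.card_univ, mul_one, nsmul_eq_mul]
  exact inv_mul_cancel₀ (Nat.cast_ne_zero.2 Fintype.card_ne_zero)

/-- The random data of one instance of length `n`: a private bit, which decides whether `n` is in
the language, and the classical descriptions of the `n` marked states. -/
abbrev Sample (s : Polynomial ℕ) (n : ℕ) : Type := Bool × (Fin n → Descr s n)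

/-- The bit is fair, the marked states are generated independently. -/
def Sample.prob {s : Polynomial ℕ} {n : ℕ} (x : Sample s n) : ℝ := 1 / 2 * ∏ j, (x.2 j).prob

theorem Sample.prob_nonneg {s : Polynomial ℕ} {n : ℕ} (x : Sample s n) : 0 ≤ x.prob :=
  mul_nonneg (by norm_num) (Finset.prod_nonneg fun _ _ => Descr.prob_nonneg _)

theorem Sample.sum_prob (s : Polynomial ℕ) (n : ℕ) : ∑ x : Sample s n, x.prob = 1 := by
  classical
  have h : ∑ d : Fin n → Descr s n, ∏ j, (d j).prob = 1 := by
    rw [← Fintype.piFinset_univ, ← Finset.prod_univ_sum]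
    exact Finset.prod_eq_one fun j _ => Descr.sum_prob s (Fin.pos j).ne'
  rw [Fintype.sum_prod_type]
  simp only [Sample.prob, ← Finset.mul_sum, h, Fintype.sum_bool]
  norm_num

/-- The law of one instance. -/
def samplePMF (s : Polynomial ℕ) (n : ℕ) : PMF (Sample s n) :=
  PMF.ofFintype (fun x => ENNReal.ofReal x.prob) <| by
    rw [← ENNReal.ofReal_sum_of_nonneg fun x _ => Sample.prob_nonneg x, Sample.sum_prob,
      ENNReal.ofReal_one]

/-- The law of the data of the whole oracle: independent instances of all lengths. -/
def oracleLaw (s : Polynomial ℕ) : MeasureTheory.Measure (∀ n, Sample s n) :=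
  MeasureTheory.Measure.infinitePi fun n => (samplePMF s n).toMeasure

/-- The `n`-qubit state `ψ` has a marginal-fidelity approximation by a small circuit: some circuit
of at most `n ^ k` gates, started on `|0⟩`s, has fidelity at least `n ^ (-k)` with `ψ` on its
first `n` wires. -/
def Easy {n : ℕ} (k : ℕ) (ψ : PureState n) : Prop :=
  ∃ c : List Gate, c.length ≤ n ^ k ∧ ((n : ℝ) ^ k)⁻¹ ≤ fidelity ψ (runGates c (ket ∅))

/-- The complexity assumption: except with negligible probability, the state generated by a random
circuit of `s n` gates with measurement is not prepared, even with inverse polynomial fidelity, by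
any circuit of polynomial size. -/
def GeneratesComplexStates (s : Polynomial ℕ) : Prop :=
  ∀ k : ℕ, Asymptotics.SuperpolynomialDecay Filter.atTop (fun n : ℕ => (n : ℝ))
    (fun n : ℕ => open scoped Classical in
      ∑ d : Descr s n, if Easy k d.state then d.prob else 0)

/-- The bit string describing one gate. -/
def encodeChoice {n : ℕ} (x : GateChoice n) : List Bool :=
  List.replicate x.1 true ++ false :: (List.replicate x.2.1 true ++
    false :: (List.replicate x.2.2 true ++ [false]))

/-- The bit string describing the circuit `c` and the measurement result `m`. -/
def encodeDescr {s : Polynomial ℕ} {n : ℕ} (d : Descr s n) : List Bool :=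
  (List.ofFn d.1).flatMap encodeChoice ++ List.ofFn d.2

/-- The public classical description of the marked states of one instance. -/
def publicInfo {s : Polynomial ℕ} {n : ℕ} (d : Fin n → Descr s n) : List Bool :=
  (List.ofFn d).flatMap encodeDescr

/-- The product state `ψ 0 ⊗ ⋯ ⊗ ψ (n - 1)`. -/
def jointState {n : ℕ} (ψ : Fin n → PureState n) : Bits (n * n) → ℂ :=
  fun x => ∏ j, (ψ j).1 (block x j)

/-- The language given by the private bits, restricted to the lengths in `S`. -/
def langOf {s : Polynomial ℕ} (S : Set ℕ) (ω : ∀ n, Sample s n) : Set ℕ :=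
  {n | n ∈ S ∧ (ω n).1 = true}

/-- The channel oracle given by the random data, for the lengths in `S`. -/
def oracleOf {s : Polynomial ℕ} (κ : ℝ) (S : Set ℕ) (ω : ∀ n, Sample s n) : ChannelOracle :=
  swapOracle κ (langOf S ω) fun n j => ((ω n).2 j).state

/-- The public classical descriptions of all marked states. -/
def infoOf {s : Polynomial ℕ} (ω : ∀ n, Sample s n) : ℕ → List Bool := fun n => publicInfo (ω n).2

/-! ### A quantum computer with classical control -/

/-- Programs of a quantum computer with classical control: it has classical registers holding
natural numbers, random choices, a work space of qubits addressed by registers, and a public tape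
on which bits can be announced. -/
inductive Prog : Type
  /-- `r := k` -/
  | const (r k : ℕ)
  /-- `r := r + 1` -/
  | inc (r : ℕ)
  /-- `r := r - 1` (truncated) -/
  | dec (r : ℕ)
  /-- `r :=` a uniformly random number below (the content of) `k` -/
  | rand (r k : ℕ)
  /-- Hadamard gate on the wire with number `r` -/
  | had (r : ℕ)
  /-- `T` gate on the wire with number `r` -/
  | tee (r : ℕ)
  /-- CNOT on the wires with numbers `r` (control) and `r'` -/
  | cnot (r r' : ℕ)
  /-- `r :=` the result of a measurement of the wire with number `a` -/
  | meas (r a : ℕ)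
  /-- announce the bit `r ≠ 0` -/
  | emit (r : ℕ)
  | seq (p q : Prog)
  /-- `p` if `r = 0`, otherwise `q` -/
  | ifZero (r : ℕ) (p q : Prog)
  /-- repeat `p`, as often as `r` says at the start -/
  | loop (r : ℕ) (p : Prog)

/-- A configuration: registers, unnormalised quantum state (its squared norm is the probability of
the configuration), public tape, number of steps so far, number of qubits used so far. -/
structure Config where
  regs : ℕ → ℕ
  vec : Workspace
  tape : List Bool
  time : ℕ
  space : ℕ

/-- Count one step. -/
def Config.tick (β : Config) : Config := { β with time := β.time + 1 }

/-- Count one step and set a register. -/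
def Config.set (β : Config) (r k : ℕ) : Config :=
  { β with regs := Function.update β.regs r k, time := β.time + 1 }

/-- Apply a gate whose largest wire number is `i`. -/
def Config.gate (β : Config) (g : Gate) (i : ℕ) : Config :=
  { β with vec := g.op β.vec, time := β.time + 1, space := max β.space (i + 1) }

/-- The configurations in which a program may end, when it is started in a given configuration. -/
def Prog.run : Prog → Config → List Config
  | .const r k, β => [β.set r k]
  | .inc r, β => [β.set r (β.regs r + 1)]
  | .dec r, β => [β.set r (β.regs r - 1)]
  | .rand r k, β => (List.range (max 1 (β.regs k))).map fun x =>
      { β.set r x with vec := ((Real.sqrt (max 1 (β.regs k) : ℕ) : ℝ) : ℂ)⁻¹ • β.vec }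
  | .had r, β => [β.gate (.had (β.regs r)) (β.regs r)]
  | .tee r, β => [β.gate (.tee (β.regs r)) (β.regs r)]
  | .cnot r r', β => [β.gate (.cnot (β.regs r) (β.regs r')) (max (β.regs r) (β.regs r'))]
  | .meas r a, β =>
      [{ β.set r 0 with vec := β.vec.filter (fun s => β.regs a ∉ s),
                        space := max β.space (β.regs a + 1) },
       { β.set r 1 with vec := β.vec.filter (fun s => β.regs a ∈ s),
                        space := max β.space (β.regs a + 1) }]
  | .emit r, β => [{ β.tick with tape := β.tape ++ [decide (β.regs r ≠ 0)] }]
  | .seq p q, β => (p.run β).flatMap q.run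
  | .ifZero r p q, β => if β.regs r = 0 then p.run β.tick else q.run β.tick
  | .loop r p, β => (fun l : List Config => l.flatMap p.run)^[β.regs r] [β.tick]

/-- All runs that start in `β` stay within `b` steps and `b` qubits. -/
def Prog.Bounded (p : Prog) (β : Config) (b : ℕ) : Prop :=
  ∀ β' ∈ p.run β, β'.time ≤ b ∧ β'.space ≤ b

/-- The initial configuration with the numbers `n` and `b` in registers `0` and `1` and quantum
state `v`. -/
def startConfig (n b : ℕ) (v : Workspace) : Config where
  regs := fun r => if r = 0 then n else if r = 1 then b else 0
  vec := v
  tape := []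
  time := 0
  space := 0

open scoped Classical in
/-- The density matrix of the part of an ensemble that has register contents `R` and public tape
`o`. -/
def cqDensity (l : List Config) (R : ℕ → ℕ) (o : List Bool) (u u' : Finset ℕ) : ℂ :=
  (l.map fun β =>
    if β.regs = R ∧ β.tape = o then β.vec u * (starRingEnd ℂ) (β.vec u') else 0).sum

/-- The density matrix of the single wire `a`. -/
def wireDensity (v : Workspace) (a : ℕ) : Matrix (Bits 1) (Bits 1) ℂ := fun y y' =>
  ∑ u ∈ v.support.image (clearAt a 1),
    v (u ∪ place a y) * (starRingEnd ℂ) (v (u ∪ place a y'))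

/-- Started with the number `n`, the program `G` generates an instance of length `n` in time and
space `T n`: it ends, with the right probabilities, with the private bit in register `1`, the
classical description of the marked states announced on the public tape, and one copy of every
marked state on the wires `0, …, n * n - 1`. -/
def GeneratesInstances (s : Polynomial ℕ) (G : Prog) (T : Polynomial ℕ) : Prop :=
  ∀ n : ℕ, G.Bounded (startConfig n 0 (ket ∅)) (T.eval n) ∧
    ∀ (R : ℕ → ℕ) (o : List Bool) (u u' : Finset ℕ),
      cqDensity (G.run (startConfig n 0 (ket ∅))) R o u u' =
        ∑ x : Sample s n, open scoped Classical in
          if R = (startConfig n x.1.toNat (ket ∅)).regs ∧ o = publicInfo x.2 then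
            (x.prob : ℂ) * loadAt 0 (jointState fun j => (x.2 j).state) u *
              (starRingEnd ℂ) (loadAt 0 (jointState fun j => (x.2 j).state) u')
          else 0

/-- Started with the number `n`, the private bit, one copy of the marked states on the wires
`0, …, n * n - 1` and the input of a caller on the next `n * n + 1` wires, the program `P` applies
the swap-test channel to the input of the caller, in time and space `T n`; the output is found in
place of the last input qubit. -/
def AppliesChannel (κ : ℝ) (P : Prog) (T : Polynomial ℕ) : Prop :=
  ∀ (n : ℕ) (b : Bool) (ψ : Fin n → PureState n) (v : Bits (n * n + 1) → ℂ),
    let β := startConfig n b.toNat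
      (∑ x : Bits (n * n), ∑ z : Bits (n * n + 1),
        (jointState ψ x * v z) • ket (place 0 x ∪ place (n * n) z))
    P.Bounded β (T.eval n) ∧
    ((P.run β).map fun β' => wireDensity β'.vec (2 * (n * n))).sum =
      (swapChannel κ b ψ).apply (Matrix.vecMulVec v (star v))

/-- A set of lengths with exponentially growing gaps. -/
def Sparse (S : Set ℕ) : Prop := ∀ m ∈ S, ∀ n ∈ S, m < n → 2 ^ m ≤ n

end ChannelOracles

open ChannelOracles

namespace ChannelOracles

open Finset

/-! ### The workspace -/

@[simp] theorem ofBasis_ket (f : Finset ℕ → Workspace) (s : Finset ℕ) :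
    ofBasis f (ket s) = f s := by
  simp [ofBasis, ket]

theorem ofBasis_eq_sum (f : Finset ℕ → Workspace) (v : Workspace) {S : Finset (Finset ℕ)}
    (h : v.support ⊆ S) : ofBasis f v = ∑ s ∈ S, v s • f s := by
  rw [ofBasis, Finsupp.linearCombination_apply]
  exact Finsupp.sum_of_support_subset _ h _ (by simp)

theorem eq_sum_ket (v : Workspace) {S : Finset (Finset ℕ)} (h : v.support ⊆ S) :
    v = ∑ s ∈ S, v s • ket s := by
  conv_lhs => rw [← Finsupp.sum_single v]
  rw [Finsupp.sum_of_support_subset _ h _ (by simp)]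
  simp [ket]

theorem ket_apply (s t : Finset ℕ) : ket s t = if s = t then 1 else 0 := by
  simp [ket, Finsupp.single_apply]

theorem linearMap_ext_ket {A B : Workspace →ₗ[ℂ] Workspace} (h : ∀ s, A (ket s) = B (ket s)) :
    A = B := by
  ext s : 2
  simpa [ket] using h s

/-- The vectors that involve only wires below `N`. -/
def low (N : ℕ) : Submodule ℂ Workspace := Finsupp.supported ℂ ℂ {s | s ⊆ range N}

theorem mem_low_iff_support {N : ℕ} {v : Workspace} :
    v ∈ low N ↔ v.support ⊆ (range N).powerset := by
  rw [low, Finsupp.mem_supported]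
  constructor
  · intro h s hs; exact mem_powerset.2 (h hs)
  · intro h s hs; exact mem_powerset.1 (h hs)

theorem mem_low {N : ℕ} {v : Workspace} : v ∈ low N ↔ ∀ s, v s ≠ 0 → s ⊆ range N := by
  rw [mem_low_iff_support]
  constructor
  · intro h s hs; exact mem_powerset.1 (h (Finsupp.mem_support_iff.2 hs))
  · intro h s hs; exact mem_powerset.2 (h s (Finsupp.mem_support_iff.1 hs))

theorem ket_mem_low {N : ℕ} {s : Finset ℕ} (h : s ⊆ range N) : ket s ∈ low N := by
  rw [mem_low]
  intro t ht
  rw [ket_apply] at ht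
  split_ifs at ht with hst
  · rwa [← hst]
  · exact absurd rfl ht

theorem low_mono {N M : ℕ} (h : N ≤ M) : low N ≤ low M := by
  intro v hv
  rw [mem_low] at hv ⊢
  exact fun s hs => (hv s hs).trans (Finset.range_subset_range.2 h)

theorem exists_mem_low (v : Workspace) : ∃ N, v ∈ low N := by
  refine ⟨(v.support.biUnion id).sup id + 1, ?_⟩
  rw [mem_low]
  intro s hs a ha
  rw [Finset.mem_range, Nat.lt_succ_iff]
  exact Finset.le_sup (f := id)
    (mem_biUnion.2 ⟨s, Finsupp.mem_support_iff.2 hs, ha⟩)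

theorem eq_on_low {N : ℕ} {A B : Workspace →ₗ[ℂ] Workspace}
    (h : ∀ s ⊆ range N, A (ket s) = B (ket s)) {v : Workspace} (hv : v ∈ low N) : A v = B v := by
  rw [eq_sum_ket v (mem_low_iff_support.1 hv)]
  simp only [map_sum, map_smul]
  exact sum_congr rfl fun s hs => by rw [h s (mem_powerset.1 hs)]

theorem map_mem_of_low {N : ℕ} {A : Workspace →ₗ[ℂ] Workspace} {W : Submodule ℂ Workspace}
    (h : ∀ s ⊆ range N, A (ket s) ∈ W) {v : Workspace} (hv : v ∈ low N) : A v ∈ W := by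
  rw [eq_sum_ket v (mem_low_iff_support.1 hv)]
  simp only [map_sum, map_smul]
  exact W.sum_mem fun s hs => W.smul_mem _ (h s (mem_powerset.1 hs))

theorem sqNorm_eq_sum {v : Workspace} {S : Finset (Finset ℕ)} (h : v.support ⊆ S) :
    sqNorm v = ∑ s ∈ S, Complex.normSq (v s) :=
  Finset.sum_subset h fun s _ hs => by simp [Finsupp.notMem_support_iff.1 hs]

theorem sqNorm_low {N : ℕ} {v : Workspace} (h : v ∈ low N) :
    sqNorm v = ∑ s ∈ (range N).powerset, Complex.normSq (v s) :=
  sqNorm_eq_sum (mem_low_iff_support.1 h)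

theorem sqNorm_nonneg (v : Workspace) : 0 ≤ sqNorm v :=
  sum_nonneg fun _ _ => Complex.normSq_nonneg _

theorem sqNorm_smul (z : ℂ) (v : Workspace) : sqNorm (z • v) = Complex.normSq z * sqNorm v := by
  rw [sqNorm_eq_sum (v := z • v) Finsupp.support_smul, sqNorm, mul_sum]
  simp

@[simp] theorem sqNorm_zero : sqNorm 0 = 0 := by simp [sqNorm]

@[simp] theorem sqNorm_ket (s : Finset ℕ) : sqNorm (ket s) = 1 := by
  rw [sqNorm_eq_sum (v := ket s) (S := {s}) Finsupp.support_single_subset]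
  simp [ket_apply]

/-! ### Gates as linear maps -/

/-- A list of gates as a linear map. -/
def gatesOp : List Gate → (Workspace →ₗ[ℂ] Workspace)
  | [] => LinearMap.id
  | g :: c => gatesOp c ∘ₗ g.op

theorem runGates_eq (c : List Gate) (v : Workspace) : runGates c v = gatesOp c v := by
  induction c generalizing v with
  | nil => rfl
  | cons g c ih => simp [runGates, gatesOp, ih]

theorem gatesOp_append (c d : List Gate) : gatesOp (c ++ d) = gatesOp d ∘ₗ gatesOp c := by
  induction c with
  | nil => simp [gatesOp]
  | cons g c ih => simp [gatesOp, ih, LinearMap.comp_assoc]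

theorem gatesOp_append_apply (c d : List Gate) (v : Workspace) :
    gatesOp (c ++ d) v = gatesOp d (gatesOp c v) := by
  rw [gatesOp_append]; rfl

@[simp] theorem gatesOp_nil (v : Workspace) : gatesOp [] v = v := rfl

@[simp] theorem gatesOp_cons (g : Gate) (c : List Gate) (v : Workspace) :
    gatesOp (g :: c) v = gatesOp c (g.op v) := rfl

theorem Gate.Below.mono {N M : ℕ} (h : N ≤ M) {g : Gate} (hg : g.Below N) : g.Below M := by
  cases g <;> simp only [Gate.Below] at hg ⊢ <;> omega

theorem gatesOp_low {N : ℕ} {c : List Gate} (hc : ∀ g ∈ c, g.Below N) {v : Workspace}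
    (h : v ∈ low N) : gatesOp c v ∈ low N := by
  rw [mem_low_iff_support] at h ⊢
  rw [← runGates_eq]
  exact (runGates_isometry hc h).1

theorem Gate.exists_below (g : Gate) : ∃ N, g.Below N := by
  rcases g with i | i | ⟨i, j⟩
  · exact ⟨i + 1, by simp [Gate.Below]⟩
  · exact ⟨i + 1, by simp [Gate.Below]⟩
  · exact ⟨i + j + 1, by simp only [Gate.Below]; omega⟩

theorem Gate.sqNorm_op (g : Gate) (v : Workspace) : sqNorm (g.op v) = sqNorm v := by
  obtain ⟨N, hN⟩ := g.exists_below
  obtain ⟨M, hM⟩ := exists_mem_low v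
  exact Gate.op_sqNorm (hN.mono (le_max_left N M))
    (mem_low_iff_support.1 (low_mono (le_max_right N M) hM))

theorem sqNorm_gatesOp (c : List Gate) (v : Workspace) : sqNorm (gatesOp c v) = sqNorm v := by
  induction c generalizing v with
  | nil => rfl
  | cons g c ih => rw [gatesOp_cons, ih, Gate.sqNorm_op]

/-! ### Windows -/

theorem notMem_place {a k u : ℕ} {x : Bits k} (h : u < a ∨ a + k ≤ u) : u ∉ place a x := by
  rw [mem_place]
  rintro ⟨i, _, rfl⟩
  have := i.2
  omega

theorem place_subset {a k : ℕ} (x : Bits k) : place a x ⊆ Ico a (a + k) := by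
  intro u hu
  obtain ⟨i, _, rfl⟩ := mem_place.1 hu
  rw [mem_Ico]
  have := i.2
  omega

theorem mem_place_add {a k : ℕ} {x : Bits k} (i : Fin k) : a + (i : ℕ) ∈ place a x ↔ x i = true := by
  rw [mem_place]
  constructor
  · rintro ⟨j, hj, he⟩
    rwa [show j = i from Fin.ext (by omega)] at hj
  · exact fun h => ⟨i, h, rfl⟩

theorem mem_clearAt {a k u : ℕ} {s : Finset ℕ} : u ∈ clearAt a k s ↔ u ∈ s ∧ (u < a ∨ a + k ≤ u) := by
  rw [clearAt, mem_sdiff, mem_Ico]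
  constructor <;> rintro ⟨h1, h2⟩ <;> exact ⟨h1, by omega⟩

theorem readAt_eq {a k : ℕ} {s : Finset ℕ} {x : Bits k} :
    readAt a k s = x ↔ ∀ i : Fin k, a + (i : ℕ) ∈ s ↔ x i = true := by
  constructor
  · rintro rfl i; simp [readAt]
  · intro h; funext i
    simp only [readAt, h i]
    cases x i <;> rfl

@[simp] theorem readAt_union_place {a k : ℕ} (s : Finset ℕ) (x : Bits k) :
    readAt a k (clearAt a k s ∪ place a x) = x := by
  rw [readAt_eq]
  intro i
  rw [mem_union, mem_place_add, mem_clearAt]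
  have := i.2
  constructor
  · rintro (⟨_, h⟩ | h)
    · omega
    · exact h
  · exact Or.inr

@[simp] theorem clearAt_union_place (a k : ℕ) (s : Finset ℕ) (x : Bits k) :
    clearAt a k (clearAt a k s ∪ place a x) = clearAt a k s := by
  ext u
  simp only [mem_clearAt, mem_union]
  constructor
  · rintro ⟨h | h, h'⟩
    · exact h
    · exact absurd h (notMem_place h')
  · exact fun h => ⟨Or.inl h, h.2⟩

@[simp] theorem clearAt_union_readAt (a k : ℕ) (s : Finset ℕ) :
    clearAt a k s ∪ place a (readAt a k s) = s := by
  ext u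
  simp only [mem_clearAt, mem_union, mem_place, readAt, decide_eq_true_eq]
  constructor
  · rintro (h | ⟨i, h, rfl⟩)
    · exact h.1
    · exact h
  · intro h
    by_cases hu : u < a ∨ a + k ≤ u
    · exact Or.inl ⟨h, hu⟩
    · refine Or.inr ⟨⟨u - a, by omega⟩, ?_, ?_⟩
      · simpa [Nat.add_sub_cancel' (show a ≤ u by omega)] using h
      · simp only; omega

theorem clearAt_of_disjoint {a k : ℕ} {s : Finset ℕ} (h : Disjoint s (Ico a (a + k))) :
    clearAt a k s = s := Finset.sdiff_eq_self_of_disjoint h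

theorem clearAt_of_mem {a k N : ℕ} {r : Finset ℕ} (h : r ∈ (range N \ Ico a (a + k)).powerset) :
    clearAt a k r = r := by
  apply clearAt_of_disjoint
  rw [mem_powerset] at h
  exact Finset.disjoint_of_subset_left h sdiff_disjoint

theorem union_place_subset {a k N : ℕ} (hN : a + k ≤ N) {r : Finset ℕ}
    (hr : r ⊆ range N) (x : Bits k) : r ∪ place a x ⊆ range N := by
  refine Finset.union_subset hr ((place_subset x).trans ?_)
  intro u hu
  rw [mem_Ico] at hu
  rw [Finset.mem_range]; omega

theorem sum_powerset_window {E : Type*} [AddCommMonoid E] {a k N : ℕ} (hN : a + k ≤ N)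
    (f : Finset ℕ → E) :
    ∑ s ∈ (range N).powerset, f s =
      ∑ r ∈ (range N \ Ico a (a + k)).powerset, ∑ x : Bits k, f (r ∪ place a x) := by
  rw [← Finset.sum_product']
  symm
  refine Finset.sum_nbij' (fun p => p.1 ∪ place a p.2) (fun s => (clearAt a k s, readAt a k s))
    ?_ ?_ ?_ ?_ ?_
  · rintro ⟨r, x⟩ h
    rw [Finset.mem_product, mem_powerset] at h
    exact mem_powerset.2 (union_place_subset hN (h.1.trans Finset.sdiff_subset) x)
  · intro s hs
    rw [Finset.mem_product, mem_powerset]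
    exact ⟨Finset.sdiff_subset_sdiff (mem_powerset.1 hs) le_rfl, mem_univ _⟩
  · rintro ⟨r, x⟩ h
    rw [Finset.mem_product] at h
    have hr := clearAt_of_mem h.1
    have h1 := clearAt_union_place a k r x
    have h2 := readAt_union_place (a := a) r x
    rw [hr] at h1 h2
    exact Prod.ext h1 h2
  · intro s _; exact clearAt_union_readAt a k s
  · intro _ _; rfl

theorem window_ket {k l : ℕ} (K : Matrix (Bits l) (Bits k) ℂ) (a : ℕ) (s : Finset ℕ) :
    window K a (ket s) = ∑ y, K y (readAt a k s) • ket (clearAt a k s ∪ place a y) := by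
  simp [window]

theorem window_low {k l N a : ℕ} (hl : l ≤ k) (hN : a + k ≤ N) (K : Matrix (Bits l) (Bits k) ℂ)
    {v : Workspace} (hv : v ∈ low N) : window K a v ∈ low N := by
  refine map_mem_of_low (fun s hs => ?_) hv
  rw [window_ket]
  refine Submodule.sum_mem _ fun y _ => Submodule.smul_mem _ _ (ket_mem_low ?_)
  exact union_place_subset (by omega) (Finset.sdiff_subset.trans hs) y

theorem window_eq_sum {k l N a : ℕ} (hN : a + k ≤ N) (K : Matrix (Bits l) (Bits k) ℂ)
    {v : Workspace} (hv : v ∈ low N) :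
    window K a v = ∑ r ∈ (range N \ Ico a (a + k)).powerset, ∑ y,
      (∑ x, K y x * v (r ∪ place a x)) • ket (r ∪ place a y) := by
  rw [window, ofBasis_eq_sum _ _ (mem_low_iff_support.1 hv), sum_powerset_window hN]
  refine sum_congr rfl fun r hr => ?_
  have hc := clearAt_of_mem hr
  have h1 := fun x => clearAt_union_place a k r x
  have h2 := fun x => readAt_union_place (a := a) (k := k) r x
  rw [hc] at h1 h2
  simp only [h1, h2, smul_sum, sum_smul, smul_smul]
  rw [sum_comm]
  simp only [mul_comm]

theorem union_place_inj {a k l N : ℕ} (hl : l ≤ k) {r r' : Finset ℕ}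
    (hr : r ∈ (range N \ Ico a (a + k)).powerset) (hr' : r' ∈ (range N \ Ico a (a + k)).powerset)
    {y y' : Bits l} (h : r ∪ place a y = r' ∪ place a y') : r = r' ∧ y = y' := by
  have hd : ∀ r ∈ (range N \ Ico a (a + k)).powerset, clearAt a l r = r := by
    intro r hr
    apply clearAt_of_disjoint
    refine Finset.disjoint_of_subset_right ?_ (Finset.disjoint_of_subset_left
      (mem_powerset.1 hr) sdiff_disjoint)
    exact Finset.Ico_subset_Ico le_rfl (by omega)
  have h1 := clearAt_union_place a l r y
  have h2 := clearAt_union_place a l r' y'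
  have h3 := readAt_union_place (a := a) r y
  have h4 := readAt_union_place (a := a) r' y'
  rw [hd r hr] at h1 h3
  rw [hd r' hr'] at h2 h4
  rw [h] at h1 h3
  exact ⟨h1.symm.trans h2, h3.symm.trans h4⟩

theorem window_apply {k l N a : ℕ} (hl : l ≤ k) (hN : a + k ≤ N) (K : Matrix (Bits l) (Bits k) ℂ)
    {v : Workspace} (hv : v ∈ low N) {r : Finset ℕ} (hr : r ∈ (range N \ Ico a (a + k)).powerset)
    (y : Bits l) :
    window K a v (r ∪ place a y) = ∑ x, K y x * v (r ∪ place a x) := by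
  rw [window_eq_sum hN K hv, Finsupp.finsetSum_apply, sum_eq_single r]
  · rw [Finsupp.finsetSum_apply, sum_eq_single y]
    · simp [ket_apply]
    · intro y' _ hy
      rw [Finsupp.smul_apply, ket_apply, if_neg, smul_zero]
      exact fun h => hy (union_place_inj hl hr hr h).2
    · simp
  · intro r' hr' hrr
    rw [Finsupp.finsetSum_apply]
    refine sum_eq_zero fun y' _ => ?_
    rw [Finsupp.smul_apply, ket_apply, if_neg, smul_zero]
    exact fun h => hrr (union_place_inj hl hr' hr h).1
  · exact fun h => absurd hr h

theorem sqNorm_window {k l N a : ℕ} (hl : l ≤ k) (hN : a + k ≤ N) (K : Matrix (Bits l) (Bits k) ℂ)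
    {v : Workspace} (hv : v ∈ low N) :
    sqNorm (window K a v) = ∑ r ∈ (range N \ Ico a (a + k)).powerset, ∑ y,
      Complex.normSq (∑ x, K y x * v (r ∪ place a x)) := by
  have hsupp : (window K a v).support ⊆
      ((range N \ Ico a (a + k)).powerset ×ˢ (univ : Finset (Bits l))).image
        (fun p => p.1 ∪ place a p.2) := by
    intro s hs
    by_contra hn
    rw [Finsupp.mem_support_iff] at hs
    apply hs
    rw [window_eq_sum hN K hv, Finsupp.finsetSum_apply]
    refine sum_eq_zero fun r hr => ?_
    rw [Finsupp.finsetSum_apply]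
    refine sum_eq_zero fun y _ => ?_
    rw [Finsupp.smul_apply, ket_apply, if_neg, smul_zero]
    intro h
    exact hn (mem_image.2 ⟨(r, y), by simpa using hr, h⟩)
  rw [sqNorm_eq_sum hsupp, Finset.sum_image, sum_product]
  · refine sum_congr rfl fun r hr => sum_congr rfl fun y _ => ?_
    rw [window_apply hl hN K hv hr]
  · rintro ⟨r, y⟩ h ⟨r', y'⟩ h' he
    obtain ⟨h1, h2⟩ := union_place_inj hl (Finset.mem_product.1 h).1 (Finset.mem_product.1 h').1 he
    exact Prod.ext h1 h2

theorem sqNorm_eq_window {k N a : ℕ} (hN : a + k ≤ N) {v : Workspace} (hv : v ∈ low N) :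
    sqNorm v = ∑ r ∈ (range N \ Ico a (a + k)).powerset, ∑ x : Bits k,
      Complex.normSq (v (r ∪ place a x)) := by
  rw [sqNorm_low hv, sum_powerset_window hN]

/-- Mixing vectors with an isometry preserves the sum of the squared norms. -/
theorem sum_normSq_mix {ι κ : Type*} [Fintype ι] [Fintype κ] [DecidableEq κ] (M : ι → κ → ℂ)
    (hM : ∀ x x', ∑ e, (starRingEnd ℂ) (M e x) * M e x' = if x = x' then 1 else 0) (w : κ → ℂ) :
    ∑ e, Complex.normSq (∑ x, M e x * w x) = ∑ x, Complex.normSq (w x) := by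
  apply Complex.ofReal_injective
  simp only [Complex.ofReal_sum, Complex.normSq_eq_conj_mul_self, map_sum, map_mul,
    sum_mul_sum]
  rw [sum_comm]
  simp_rw [sum_comm (s := (univ : Finset ι))]
  have : ∀ x x', ∑ e, (starRingEnd ℂ) (M e x) * (starRingEnd ℂ) (w x) * (M e x' * w x') =
      (if x = x' then 1 else 0) * ((starRingEnd ℂ) (w x) * w x') := by
    intro x x'
    rw [← hM, sum_mul]
    exact sum_congr rfl fun e _ => by ring
  simp [this]

theorem QChannel.isometry {k l : ℕ} (Φ : QChannel k l) (x x' : Bits k) :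
    ∑ p : Φ.ι × Bits l, (starRingEnd ℂ) (Φ.kraus p.1 p.2 x) * Φ.kraus p.1 p.2 x' =
      if x = x' then 1 else 0 := by
  have h := congrFun (congrFun Φ.tracePreserving x) x'
  rw [Matrix.sum_apply, Matrix.one_apply] at h
  rw [← h, Fintype.sum_prod_type]
  exact sum_congr rfl fun e _ => by simp [Matrix.mul_apply]

theorem QChannel.sum_sqNorm {k l : ℕ} (Φ : QChannel k l) (hl : l ≤ k) (a : ℕ) (v : Workspace) :
    ∑ e, sqNorm (window (Φ.kraus e) a v) = sqNorm v := by
  obtain ⟨N₀, hv⟩ := exists_mem_low v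
  have hv := low_mono (le_max_left N₀ (a + k)) hv
  have hN := le_max_right N₀ (a + k)
  simp only [sqNorm_window hl hN _ hv, sqNorm_eq_window hN hv]
  rw [sum_comm]
  refine sum_congr rfl fun r _ => ?_
  rw [← Fintype.sum_prod_type' (f := fun e y => Complex.normSq (∑ x, Φ.kraus e y x *
    v (r ∪ place a x)))]
  exact sum_normSq_mix (fun (p : Φ.ι × Bits l) x => Φ.kraus p.1 p.2 x) Φ.isometry _

/-! ### Quadratic functionals and expectations -/

/-- Functionals of the form `v ↦ ∑ i, ‖A i v‖²`. -/
def IsSumSq (F : Workspace → ℝ) : Prop :=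
  ∃ (ι : Type) (_ : Fintype ι) (A : ι → Workspace →ₗ[ℂ] Workspace), ∀ v, F v = ∑ i, sqNorm (A i v)

theorem IsSumSq.nonneg {F : Workspace → ℝ} (h : IsSumSq F) (v : Workspace) : 0 ≤ F v := by
  obtain ⟨ι, _, A, hA⟩ := h
  rw [hA]
  exact sum_nonneg fun _ _ => sqNorm_nonneg _

theorem IsSumSq.smul {F : Workspace → ℝ} (h : IsSumSq F) (z : ℂ) (v : Workspace) :
    F (z • v) = Complex.normSq z * F v := by
  obtain ⟨ι, _, A, hA⟩ := h
  simp only [hA, map_smul, sqNorm_smul, mul_sum]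

theorem IsSumSq.zero {F : Workspace → ℝ} (h : IsSumSq F) : F 0 = 0 := by
  have := h.smul 0 0
  simpa using this

theorem isSumSq_sqNorm (A : Workspace →ₗ[ℂ] Workspace) : IsSumSq fun v => sqNorm (A v) :=
  ⟨Unit, inferInstance, fun _ => A, fun v => by simp⟩

theorem IsSumSq.comp {F : Workspace → ℝ} (h : IsSumSq F) (B : Workspace →ₗ[ℂ] Workspace) :
    IsSumSq fun v => F (B v) := by
  obtain ⟨ι, _, A, hA⟩ := h
  exact ⟨ι, inferInstance, fun i => A i ∘ₗ B, fun v => by simp [hA]⟩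

theorem IsSumSq.sum {ι : Type} [Fintype ι] {F : ι → Workspace → ℝ} (h : ∀ i, IsSumSq (F i)) :
    IsSumSq fun v => ∑ i, F i v := by
  choose κ inst A hA using h
  exact ⟨Σ i, κ i, inferInstance, fun p => A p.1 p.2, fun v => by
    rw [Fintype.sum_sigma]; exact sum_congr rfl fun i _ => hA i v⟩

theorem IsSumSq.mix {F : Workspace → ℝ} (h : IsSumSq F) {ι κ : Type*} [Fintype ι] [Fintype κ]
    [DecidableEq κ] (M : ι → κ → ℂ)
    (hM : ∀ x x', ∑ e, (starRingEnd ℂ) (M e x) * M e x' = if x = x' then 1 else 0)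
    (u : κ → Workspace) : ∑ e, F (∑ x, M e x • u x) = ∑ x, F (u x) := by
  classical
  obtain ⟨J, _, A, hA⟩ := h
  have key : ∀ i, ∑ e, sqNorm (A i (∑ x, M e x • u x)) = ∑ x, sqNorm (A i (u x)) := by
    intro i
    set S : Finset (Finset ℕ) := univ.biUnion fun x => (A i (u x)).support
    have h1 : ∀ x, (A i (u x)).support ⊆ S := fun x =>
      Finset.subset_biUnion_of_mem (fun x => (A i (u x)).support) (mem_univ x)
    have h2 : ∀ e, (A i (∑ x, M e x • u x)).support ⊆ S := by
      intro e s hs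
      by_contra hn
      rw [Finsupp.mem_support_iff] at hs
      apply hs
      simp only [map_sum, map_smul, Finsupp.finsetSum_apply, Finsupp.smul_apply]
      refine sum_eq_zero fun x _ => ?_
      rw [Finsupp.notMem_support_iff.1 fun hx => hn (h1 x hx), smul_zero]
    simp only [fun e => sqNorm_eq_sum (h2 e), fun x => sqNorm_eq_sum (h1 x)]
    rw [sum_comm, sum_comm (s := univ)]
    refine sum_congr rfl fun s _ => ?_
    rw [← sum_normSq_mix M hM]
    exact sum_congr rfl fun e _ => by
      simp [map_sum, map_smul, Finsupp.finsetSum_apply]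
  simp only [hA]
  exact sum_comm.trans ((sum_congr rfl fun i _ => key i).trans sum_comm)

/-- The expectation of a functional `F` after a run of a circuit (a sum over the branches). -/
def expect (Φ : ChannelOracle) : Circuit → (Workspace → ℝ) → Workspace → ℝ
  | [], F, v => F v
  | .gate g :: c, F, v => expect Φ c F (g.op v)
  | .query m a :: c, F, v => ∑ e, expect Φ c F (window ((Φ.chan m).kraus e) a v)

/-- The projection onto the basis states that satisfy `p`. -/
def proj (p : Finset ℕ → Prop) [DecidablePred p] : Workspace →ₗ[ℂ] Workspace :=
  ofBasis fun s => if p s then ket s else 0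

theorem proj_apply (p : Finset ℕ → Prop) [DecidablePred p] (v : Workspace) (s : Finset ℕ) :
    proj p v s = if p s then v s else 0 := by
  rw [proj, ofBasis_eq_sum _ v le_rfl, Finsupp.finsetSum_apply]
  rw [sum_eq_single s]
  · split_ifs <;> simp [ket_apply]
  · intro t _ hts
    split_ifs <;> simp [ket_apply, hts]
  · intro h
    simp [Finsupp.notMem_support_iff.1 h]

theorem proj_eq_filter (p : Finset ℕ → Prop) [DecidablePred p] (v : Workspace) :
    proj p v = v.filter p := by
  ext s
  rw [proj_apply, Finsupp.filter_apply]

theorem acceptProb_eq (Φ : ChannelOracle) (c : Circuit) (v : Workspace) :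
    acceptProb Φ c v = expect Φ c (fun v => sqNorm (proj (fun s => 0 ∈ s) v)) v := by
  induction c generalizing v with
  | nil =>
    simp only [acceptProb, expect]
    have h : (proj (fun s => 0 ∈ s) v).support ⊆ v.support.filter (fun s => 0 ∈ s) := by
      intro s hs
      rw [Finsupp.mem_support_iff, proj_apply] at hs
      simp only [mem_filter, Finsupp.mem_support_iff]
      split_ifs at hs with h0
      · exact ⟨hs, h0⟩
      · exact absurd rfl hs
    rw [sqNorm_eq_sum h]
    refine sum_congr rfl fun s hs => ?_
    rw [proj_apply, if_pos (mem_filter.1 hs).2]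
  | cons i c ih => cases i <;> simp [acceptProb, expect, ih]

theorem sqNorm_proj_le (p : Finset ℕ → Prop) [DecidablePred p] (v : Workspace) :
    sqNorm (proj p v) ≤ sqNorm v := by
  have h : (proj p v).support ⊆ v.support := by
    intro s hs
    rw [Finsupp.mem_support_iff, proj_apply] at hs
    rw [Finsupp.mem_support_iff]
    intro h; rw [h] at hs; simp at hs
  rw [sqNorm_eq_sum h]
  refine sum_le_sum fun s _ => ?_
  rw [proj_apply]
  split_ifs
  · rfl
  · simpa using Complex.normSq_nonneg _

theorem IsSumSq.expect {F : Workspace → ℝ} (h : IsSumSq F) (Φ : ChannelOracle) (c : Circuit) :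
    IsSumSq (expect Φ c F) := by
  induction c with
  | nil => exact h
  | cons i c ih =>
    cases i with
    | gate g => exact ih.comp g.op
    | query m a => exact IsSumSq.sum fun e => ih.comp (window ((Φ.chan m).kraus e) a)

theorem expect_mono (Φ : ChannelOracle) (c : Circuit) {F G : Workspace → ℝ} (h : ∀ v, F v ≤ G v)
    (v : Workspace) : expect Φ c F v ≤ expect Φ c G v := by
  induction c generalizing v with
  | nil => exact h v
  | cons i c ih =>
    cases i with
    | gate g => exact ih _
    | query m a => exact sum_le_sum fun e _ => ih _

theorem expect_add (Φ : ChannelOracle) (c : Circuit) (F G : Workspace → ℝ) (v : Workspace) :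
    expect Φ c (fun v => F v + G v) v = expect Φ c F v + expect Φ c G v := by
  induction c generalizing v with
  | nil => rfl
  | cons i c ih =>
    cases i with
    | gate g => exact ih _
    | query m a => simp only [expect, ih, sum_add_distrib]

theorem expect_const_mul (Φ : ChannelOracle) (c : Circuit) (r : ℝ) (F : Workspace → ℝ)
    (v : Workspace) : expect Φ c (fun v => r * F v) v = r * expect Φ c F v := by
  induction c generalizing v with
  | nil => rfl
  | cons i c ih =>
    cases i with
    | gate g => exact ih _
    | query m a => simp only [expect, ih, mul_sum]

theorem expect_sum (Φ : ChannelOracle) (c : Circuit) {ι : Type*} (S : Finset ι)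
    (F : ι → Workspace → ℝ) (v : Workspace) :
    expect Φ c (fun v => ∑ i ∈ S, F i v) v = ∑ i ∈ S, expect Φ c (F i) v := by
  induction c generalizing v with
  | nil => rfl
  | cons i c ih =>
    cases i with
    | gate g => exact ih _
    | query m a => simp only [expect, ih]; rw [sum_comm]

theorem expect_sqNorm (Φ : ChannelOracle) (c : Circuit) (v : Workspace) :
    expect Φ c sqNorm v = sqNorm v := by
  induction c generalizing v with
  | nil => rfl
  | cons i c ih =>
    cases i with
    | gate g => rw [expect, ih, Gate.sqNorm_op]
    | query m a => simp only [expect, ih]; exact QChannel.sum_sqNorm _ (Φ.out_le m) a v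

theorem acceptProb_le (Φ : ChannelOracle) (c : Circuit) (v : Workspace) :
    acceptProb Φ c v ≤ sqNorm v := by
  rw [acceptProb_eq, ← expect_sqNorm Φ c v]
  exact expect_mono Φ c (fun v => sqNorm_proj_le _ v) v

/-! ### Products of local kernels -/

theorem sum_normSq_prod {n : ℕ} {X E : Type} [Fintype X] [Fintype E]
    (A : Fin n → E → X → ℂ) (w : (Fin n → X) → ℂ) :
    ((∑ e : Fin n → E, Complex.normSq (∑ x, (∏ j, A j (e j) (x j)) * w x) : ℝ) : ℂ) =
      ∑ x, ∑ x', (starRingEnd ℂ) (w x) * w x' *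
        ∏ j, ∑ e, (starRingEnd ℂ) (A j e (x j)) * A j e (x' j) := by
  classical
  simp only [Complex.ofReal_sum, Complex.normSq_eq_conj_mul_self, map_sum, map_mul, map_prod,
    sum_mul_sum, prod_univ_sum, Fintype.piFinset_univ]
  rw [sum_comm]
  refine sum_congr rfl fun x _ => ?_
  rw [sum_comm]
  refine sum_congr rfl fun x' _ => ?_
  rw [mul_sum]
  refine sum_congr rfl fun e _ => ?_
  rw [prod_mul_distrib]
  ring

/-- The kernels of the projections onto `ψ` (`q = true`) and onto its complement. -/
def splitKernel {n : ℕ} (ψ : PureState n) (q : Bool) (y x : Bits n) : ℂ :=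
  if q then ψ.1 y * (starRingEnd ℂ) (ψ.1 x)
  else (if y = x then 1 else 0) - ψ.1 y * (starRingEnd ℂ) (ψ.1 x)

theorem PureState.sum_conj_mul {n : ℕ} (ψ : PureState n) :
    ∑ b, (starRingEnd ℂ) (ψ.1 b) * ψ.1 b = 1 := by
  have h := congrArg (fun r : ℝ => (r : ℂ)) ψ.2
  simp only [Complex.ofReal_sum, Complex.normSq_eq_conj_mul_self, Complex.ofReal_one] at h
  exact h

theorem splitKernel_gram {n : ℕ} (ψ : PureState n) (q : Bool) (x x' : Bits n) :
    ∑ y, (starRingEnd ℂ) (splitKernel ψ q y x) * splitKernel ψ q y x' =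
      if q then ψ.1 x * (starRingEnd ℂ) (ψ.1 x')
      else (if x = x' then 1 else 0) - ψ.1 x * (starRingEnd ℂ) (ψ.1 x') := by
  have h := ψ.sum_conj_mul
  have hh : ∑ y, (starRingEnd ℂ) (ψ.1 y) * ψ.1 x * (ψ.1 y * (starRingEnd ℂ) (ψ.1 x')) =
      ψ.1 x * (starRingEnd ℂ) (ψ.1 x') := by
    calc _ = ∑ y, (starRingEnd ℂ) (ψ.1 y) * ψ.1 y * (ψ.1 x * (starRingEnd ℂ) (ψ.1 x')) :=
          sum_congr rfl fun y _ => by ring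
      _ = _ := by rw [← sum_mul, h, one_mul]
  cases q
  · simp only [splitKernel, Bool.false_eq_true, if_false, map_sub, map_mul, Complex.conj_conj,
      apply_ite (starRingEnd ℂ), map_one, map_zero]
    have e1 : ∀ y, ((if y = x then (1 : ℂ) else 0) - (starRingEnd ℂ) (ψ.1 y) * ψ.1 x) *
        ((if y = x' then (1 : ℂ) else 0) - ψ.1 y * (starRingEnd ℂ) (ψ.1 x')) =
        (if y = x then (if y = x' then (1 : ℂ) else 0) else 0) -
        (if y = x then ψ.1 y * (starRingEnd ℂ) (ψ.1 x') else 0) -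
        (if y = x' then (starRingEnd ℂ) (ψ.1 y) * ψ.1 x else 0) +
        (starRingEnd ℂ) (ψ.1 y) * ψ.1 x * (ψ.1 y * (starRingEnd ℂ) (ψ.1 x')) := by
      intro y; split_ifs <;> ring
    simp only [e1, sum_add_distrib, sum_sub_distrib, Finset.sum_ite_eq',
      mem_univ, if_true, hh]
    ring
  · simp only [splitKernel, if_true, map_mul, Complex.conj_conj]
    exact hh

/-- The probabilities of the outcome `t` of a swap test on the marked state (`q = true`) and on
its complement. -/
def swapCoeff (t q : Bool) : ℝ := if q then (if t then 1 else 0) else 1 / 2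

theorem swapAmp_gram {n : ℕ} (ψ : PureState n) (t : Bool) (x x' : Bits n) :
    ∑ p : Bits n × Bits n, (starRingEnd ℂ) (swapAmp ψ.1 t p.1 p.2 x) * swapAmp ψ.1 t p.1 p.2 x' =
      ∑ q, (swapCoeff t q : ℂ) *
        ∑ y, (starRingEnd ℂ) (splitKernel ψ q y x) * splitKernel ψ q y x' := by
  have hψ := ψ.sum_conj_mul
  have key : ∀ a b : Bits n, (starRingEnd ℂ) (swapAmp ψ.1 t a b x) * swapAmp ψ.1 t a b x' =
      ((if a = x then (if a = x' then 1 else 0) else 0) * ((starRingEnd ℂ) (ψ.1 b) * ψ.1 b) +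
       (if b = x then (if b = x' then 1 else 0) else 0) * ((starRingEnd ℂ) (ψ.1 a) * ψ.1 a) +
       (if t then 1 else -1) * ((if a = x then (if b = x' then ψ.1 a * (starRingEnd ℂ) (ψ.1 b)
          else 0) else 0) +
        (if b = x then (if a = x' then ψ.1 b * (starRingEnd ℂ) (ψ.1 a) else 0) else 0))) / 4 := by
    intro a b
    have h2 : (starRingEnd ℂ) 2 = 2 := Complex.conj_ofNat 2
    simp only [swapAmp, map_div₀, h2, map_add, map_mul, apply_ite (starRingEnd ℂ), map_neg,
      map_one, map_zero]
    split_ifs <;> subst_vars <;> ring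
  rw [Fintype.sum_prod_type]
  simp only [key, splitKernel_gram, Fintype.sum_bool, swapCoeff]
  simp only [← sum_div, sum_add_distrib, ← mul_sum, ← sum_mul, hψ]
  simp only [Finset.sum_ite_eq', mem_univ, if_true, sum_ite_irrel,
    sum_const_zero, Bool.false_eq_true, if_false]
  cases t <;> by_cases h : x = x' <;> simp [h] <;> ring

/-- The weight of `w` on product subspaces: `ψ j` for `q j = true`, its complement otherwise. -/
def splitWeight {n : ℕ} (ψ : Fin n → PureState n) (w : (Fin n → Bits n) → ℂ) (q : Fin n → Bool) :
    ℝ :=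
  ∑ y : Fin n → Bits n, Complex.normSq (∑ x, (∏ j, splitKernel (ψ j) (q j) (y j) (x j)) * w x)

theorem splitWeight_nonneg {n : ℕ} (ψ : Fin n → PureState n) (w : (Fin n → Bits n) → ℂ)
    (q : Fin n → Bool) : 0 ≤ splitWeight ψ w q :=
  sum_nonneg fun _ _ => Complex.normSq_nonneg _

theorem swapAmp_weight {n : ℕ} (ψ : Fin n → PureState n) (w : (Fin n → Bits n) → ℂ)
    (t : Fin n → Bool) :
    ∑ p : (Fin n → Bits n) × (Fin n → Bits n), Complex.normSq
        (∑ x, (∏ j, swapAmp (ψ j).1 (t j) (p.1 j) (p.2 j) (x j)) * w x) =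
      ∑ q, (∏ j, swapCoeff (t j) (q j)) * splitWeight ψ w q := by
  classical
  apply Complex.ofReal_injective
  rw [← (Equiv.arrowProdEquivProdArrow (Fin n) (fun _ => Bits n) (fun _ => Bits n)).sum_comp]
  have := sum_normSq_prod (fun j (p : Bits n × Bits n) x => swapAmp (ψ j).1 (t j) p.1 p.2 x) w
  refine Eq.trans this ?_
  simp only [swapAmp_gram, Complex.ofReal_sum, Complex.ofReal_mul, Complex.ofReal_prod,
    prod_univ_sum, Fintype.piFinset_univ]
  have h2 : ∀ q : Fin n → Bool, ((splitWeight ψ w q : ℝ) : ℂ) = _ := fun q =>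
    sum_normSq_prod (fun j => splitKernel (ψ j) (q j)) w
  simp only [h2, mul_sum]
  simp_rw [sum_comm (s := (univ : Finset (Fin n → Bool)))]
  refine sum_congr rfl fun x _ => sum_congr rfl fun x' _ =>
    sum_congr rfl fun q _ => ?_
  simp only [prod_mul_distrib, prod_univ_sum, Fintype.piFinset_univ,
    mul_sum]
  exact sum_congr rfl fun y _ => by ring

theorem sum_splitWeight {n : ℕ} (ψ : Fin n → PureState n) (w : (Fin n → Bits n) → ℂ) :
    ∑ q, splitWeight ψ w q = ∑ x, Complex.normSq (w x) := by
  classical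
  have h := fun t => swapAmp_weight ψ w t
  have h1 : ∑ t : Fin n → Bool, ∑ q, (∏ j, swapCoeff (t j) (q j)) * splitWeight ψ w q =
      ∑ q, splitWeight ψ w q := by
    rw [sum_comm]
    refine sum_congr rfl fun q _ => ?_
    rw [← sum_mul]
    have : ∑ t : Fin n → Bool, ∏ j, swapCoeff (t j) (q j) = ∏ j, ∑ t, swapCoeff t (q j) := by
      rw [prod_univ_sum, Fintype.piFinset_univ]
    rw [this, prod_eq_one, one_mul]
    intro j _
    rw [Fintype.sum_bool]
    cases q j <;> norm_num [swapCoeff]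
  rw [← h1]
  simp only [← h]
  rw [← Fintype.sum_prod_type' (f := fun (t : Fin n → Bool)
    (p : (Fin n → Bits n) × (Fin n → Bits n)) => Complex.normSq
        (∑ x, (∏ j, swapAmp (ψ j).1 (t j) (p.1 j) (p.2 j) (x j)) * w x))]
  refine sum_normSq_mix (fun (e : (Fin n → Bool) × (Fin n → Bits n) × (Fin n → Bits n))
    (x : Fin n → Bits n) => ∏ j, swapAmp (ψ j).1 (e.1 j) (e.2.1 j) (e.2.2 j) (x j)) ?_ w
  intro x x'
  simp only [map_prod, ← prod_mul_distrib]
  rw [sum_prod_three (fun j t a b => (starRingEnd ℂ) (swapAmp (ψ j).1 t a b (x j)) *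
    swapAmp (ψ j).1 t a b (x' j))]
  simp only [swapAmp_sum]
  by_cases hx : x = x'
  · subst hx; simp
  · rw [if_neg hx]
    obtain ⟨j, hj⟩ := Function.ne_iff.1 hx
    exact prod_eq_zero (mem_univ j) (if_neg hj)

/-- The weight on the subspace where factor `j` is in the state `ψ`. -/
def markedWeight {n : ℕ} (ψ : PureState n) (j : Fin n) (w : (Fin n → Bits n) → ℂ) : ℝ :=
  ∑ y : Fin n → Bits n, Complex.normSq (ψ.1 (y j)) *
    Complex.normSq (∑ z, (starRingEnd ℂ) (ψ.1 z) * w (Function.update y j z))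

theorem sum_splitWeight_marked {n : ℕ} (ψ : Fin n → PureState n) (w : (Fin n → Bits n) → ℂ)
    (j : Fin n) :
    ∑ q ∈ univ.filter (fun q : Fin n → Bool => q j = true), splitWeight ψ w q =
      markedWeight (ψ j) j w := by
  classical
  have hm : markedWeight (ψ j) j w = ∑ y : Fin n → Bits n, Complex.normSq (∑ x, (∏ i,
      (if i = j then splitKernel (ψ j) true (y i) (x i) else if y i = x i then 1 else 0)) * w x) := by
    refine sum_congr rfl fun y _ => ?_
    rw [← map_mul, mul_sum]
    congr 1
    have hinj : Function.Injective fun z : Bits n => Function.update y j z :=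
      Function.update_injective y j
    rw [← Finset.sum_subset (subset_univ
      (univ.image fun z : Bits n => Function.update y j z)), Finset.sum_image hinj.injOn]
    · refine sum_congr rfl fun z _ => ?_
      rw [prod_eq_single j]
      · simp [splitKernel, mul_assoc]
      · intro i _ hij
        simp [hij]
      · simp
    · intro x _ hx
      have : ∃ i, i ≠ j ∧ y i ≠ x i := by
        by_contra hcon
        push Not at hcon
        refine hx (mem_image.2 ⟨x j, mem_univ _, ?_⟩)
        funext i
        by_cases hij : i = j
        · subst hij; simp
        · simp [hij, hcon i hij]
      obtain ⟨i, hij, hi⟩ := this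
      rw [prod_eq_zero (mem_univ i), zero_mul]
      simp [hij, hi]
  apply Complex.ofReal_injective
  rw [hm]
  have h1 := sum_normSq_prod (fun i y x => if i = j then splitKernel (ψ j) true y x else
    if y = x then 1 else 0) w
  rw [h1]
  have h2 : ∀ q : Fin n → Bool, ((splitWeight ψ w q : ℝ) : ℂ) = _ := fun q =>
    sum_normSq_prod (fun j => splitKernel (ψ j) (q j)) w
  rw [sum_filter]
  simp only [Complex.ofReal_sum, apply_ite Complex.ofReal, Complex.ofReal_zero, h2]
  rw [← sum_filter, sum_comm]
  refine sum_congr rfl fun x _ => ?_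
  rw [sum_comm]
  refine sum_congr rfl fun x' _ => ?_
  rw [← mul_sum]
  congr 1
  rw [sum_filter]
  have h3 : ∀ q : Fin n → Bool, (if q j = true then ∏ i, ∑ y, (starRingEnd ℂ)
      (splitKernel (ψ i) (q i) y (x i)) * splitKernel (ψ i) (q i) y (x' i) else 0) =
      ∏ i, (if i = j ∧ q i = false then 0 else ∑ y, (starRingEnd ℂ)
      (splitKernel (ψ i) (q i) y (x i)) * splitKernel (ψ i) (q i) y (x' i)) := by
    intro q
    split_ifs with hq
    · refine prod_congr rfl fun i _ => ?_
      rw [if_neg]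
      rintro ⟨rfl, h⟩
      simp [hq] at h
    · symm
      refine prod_eq_zero (mem_univ j) ?_
      simp [hq]
  simp only [h3]
  rw [show (∑ q : Fin n → Bool, ∏ i, (if i = j ∧ q i = false then 0 else ∑ y, (starRingEnd ℂ)
      (splitKernel (ψ i) (q i) y (x i)) * splitKernel (ψ i) (q i) y (x' i))) =
      ∏ i, ∑ t : Bool, (if i = j ∧ t = false then 0 else ∑ y, (starRingEnd ℂ)
      (splitKernel (ψ i) t y (x i)) * splitKernel (ψ i) t y (x' i)) by
    rw [prod_univ_sum, Fintype.piFinset_univ]]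
  refine prod_congr rfl fun i _ => ?_
  rw [Fintype.sum_bool]
  by_cases hij : i = j
  · subst hij; simp
  · simp only [hij, false_and, if_false, splitKernel_gram, if_true, Bool.false_eq_true,
      apply_ite (starRingEnd ℂ), map_one, map_zero]
    simp [eq_comm]

/-- The probability that at least `κ n` of `n` fair coins show heads. -/
def coinTail (κ : ℝ) (n : ℕ) : ℝ :=
  open scoped Classical in
  ((univ.filter fun t : Fin n → Bool =>
    κ * n ≤ ((univ.filter fun j => t j = true).card : ℝ)).card : ℝ) / 2 ^ n

theorem coinTail_nonneg (κ : ℝ) (n : ℕ) : 0 ≤ coinTail κ n := by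
  unfold coinTail; positivity

open scoped Classical in
theorem swapAmp_tail_le {n : ℕ} (κ : ℝ) (ψ : Fin n → PureState n) (w : (Fin n → Bits n) → ℂ) :
    ∑ e ∈ univ.filter (fun e : (Fin n → Bool) × (Fin n → Bits n) × (Fin n → Bits n) =>
      κ * n ≤ ((univ.filter fun j => e.1 j = true).card : ℝ)), Complex.normSq
        (∑ x, (∏ j, swapAmp (ψ j).1 (e.1 j) (e.2.1 j) (e.2.2 j) (x j)) * w x) ≤
      coinTail κ n * (∑ x, Complex.normSq (w x)) + ∑ j, markedWeight (ψ j) j w := by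
  set T := univ.filter fun t : Fin n → Bool =>
    κ * n ≤ ((univ.filter fun j => t j = true).card : ℝ) with hT
  have h1 : ∑ e ∈ univ.filter (fun e : (Fin n → Bool) × (Fin n → Bits n) × (Fin n → Bits n) =>
      κ * n ≤ ((univ.filter fun j => e.1 j = true).card : ℝ)), Complex.normSq
        (∑ x, (∏ j, swapAmp (ψ j).1 (e.1 j) (e.2.1 j) (e.2.2 j) (x j)) * w x) =
      ∑ q, (∑ t ∈ T, ∏ j, swapCoeff (t j) (q j)) * splitWeight ψ w q := by
    rw [sum_filter, Fintype.sum_prod_type]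
    simp only [sum_mul]
    conv_rhs => rw [sum_comm, hT, sum_filter]
    refine sum_congr rfl fun t _ => ?_
    split_ifs
    · exact swapAmp_weight ψ w t
    · simp
  rw [h1]
  have hc : ∀ t q, 0 ≤ swapCoeff t q := by
    intro t q; unfold swapCoeff; split_ifs <;> norm_num
  have hle : ∀ q : Fin n → Bool, ∑ t ∈ T, ∏ j, swapCoeff (t j) (q j) ≤ 1 := by
    intro q
    calc ∑ t ∈ T, ∏ j, swapCoeff (t j) (q j) ≤ ∑ t : Fin n → Bool, ∏ j, swapCoeff (t j) (q j) :=
          sum_le_sum_of_subset_of_nonneg (subset_univ _)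
            fun t _ _ => prod_nonneg fun j _ => hc _ _
      _ = ∏ j, ∑ t, swapCoeff t (q j) := by rw [prod_univ_sum, Fintype.piFinset_univ]
      _ = 1 := by
          refine prod_eq_one fun j _ => ?_
          rw [Fintype.sum_bool]
          cases q j <;> norm_num [swapCoeff]
  have h0 : ∑ t ∈ T, ∏ j : Fin n, swapCoeff (t j) ((fun _ => false) j) = coinTail κ n := by
    simp [swapCoeff, coinTail, hT]; ring
  have hm : ∀ q : Fin n → Bool, (∑ t ∈ T, ∏ j, swapCoeff (t j) (q j)) * splitWeight ψ w q ≤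
      coinTail κ n * splitWeight ψ w q +
        ∑ j, if q j = true then splitWeight ψ w q else 0 := by
    intro q
    have hw := splitWeight_nonneg ψ w q
    have hnn : ∀ j, 0 ≤ if q j = true then splitWeight ψ w q else 0 := fun j => by
      split_ifs <;> simp [hw]
    by_cases hq : ∃ j, q j = true
    · obtain ⟨j, hj⟩ := hq
      have h2 : splitWeight ψ w q ≤ ∑ j, if q j = true then splitWeight ψ w q else 0 := by
        calc splitWeight ψ w q = if q j = true then splitWeight ψ w q else 0 := by rw [if_pos hj]
          _ ≤ _ := single_le_sum (f := fun j => if q j = true then splitWeight ψ w q else 0)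
            (fun i _ => hnn i) (mem_univ j)
      have h3 := mul_le_of_le_one_left hw (hle q)
      have h4 := mul_nonneg (coinTail_nonneg κ n) hw
      linarith
    · have : q = fun _ => false := by
        funext j
        simpa using fun h => hq ⟨j, h⟩
      subst this
      rw [h0]
      simp
  refine (sum_le_sum fun q _ => hm q).trans (le_of_eq ?_)
  rw [sum_add_distrib, ← mul_sum, sum_splitWeight, sum_comm]
  congr 1
  refine sum_congr rfl fun j _ => ?_
  rw [← sum_filter, sum_splitWeight_marked]

/-! ### Blocks -/

/-- Strings of length `n * n + 1` as `n` blocks of length `n` and one further bit. -/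
def joinBits {n : ℕ} (e : Fin n → Bits n) (l : Bool) : Bits (n * n + 1) :=
  Fin.snoc (α := fun _ => Bool)
    (fun i => e (finProdFinEquiv.symm i).1 (finProdFinEquiv.symm i).2) l

/-- Strings of length `n * n` as `n` blocks. -/
def flatEquiv (n : ℕ) : (Fin n → Bits n) ≃ Bits (n * n) where
  toFun e i := e (finProdFinEquiv.symm i).1 (finProdFinEquiv.symm i).2
  invFun x j := block x j
  left_inv e := by funext j i; simp only [block, Equiv.symm_apply_apply]
  right_inv x := by funext i; simp only [block, Prod.mk.eta, Equiv.apply_symm_apply]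

@[simp] theorem block_flatEquiv {n : ℕ} (e : Fin n → Bits n) (j : Fin n) :
    block (flatEquiv n e) j = e j := congrFun ((flatEquiv n).left_inv e) j

@[simp] theorem block_joinBits {n : ℕ} (e : Fin n → Bits n) (l : Bool) (j : Fin n) :
    block (fun i => joinBits e l i.castSucc) j = e j := by
  funext i; simp only [block, joinBits, Fin.snoc_castSucc, Equiv.symm_apply_apply]

@[simp] theorem joinBits_last {n : ℕ} (e : Fin n → Bits n) (l : Bool) :
    joinBits e l (Fin.last (n * n)) = l := by
  simp [joinBits]

theorem joinBits_castSucc {n : ℕ} (e : Fin n → Bits n) (l : Bool) (j i : Fin n) :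
    joinBits e l (Fin.castSucc (finProdFinEquiv (j, i))) = e j i := by
  simp only [joinBits, Fin.snoc_castSucc, Equiv.symm_apply_apply]

theorem sum_joinBits {E : Type*} [AddCommMonoid E] {n : ℕ} (f : Bits (n * n + 1) → E) :
    ∑ x, f x = ∑ e, ∑ l, f (joinBits e l) := by
  rw [← Fintype.sum_prod_type' (f := fun e l => f (joinBits e l))]
  symm
  refine Fintype.sum_bijective (fun p : (Fin n → Bits n) × Bool => joinBits p.1 p.2) ?_ _ _
    fun _ => rfl
  constructor
  · rintro ⟨e, l⟩ ⟨e', l'⟩ h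
    have h' : joinBits e l = joinBits e' l' := h
    refine Prod.ext (funext fun j => ?_) ?_
    · simpa using congrArg (fun x : Bits (n * n + 1) => block (fun i => x i.castSucc) j) h'
    · simpa using congrFun h' (Fin.last _)
  · intro x
    refine ⟨(fun j => block (fun i => x i.castSucc) j, x (Fin.last _)), ?_⟩
    rw [block_ext]
    simp

theorem readAt_block {n a : ℕ} (j : Fin n) (r : Finset ℕ) (e : Fin n → Bits n) (l : Bool)
    (hr : Disjoint r (Ico a (a + (n * n + 1)))) :
    readAt (a + n * j) n (r ∪ place a (joinBits e l)) = e j := by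
  rw [readAt_eq]
  intro i
  have hlt := (finProdFinEquiv (j, i)).2
  have hv : ((finProdFinEquiv (j, i) : Fin (n * n)) : ℕ) = i + n * j := rfl
  rw [hv] at hlt
  have h1 : a + n * j + (i : ℕ) = a + (Fin.castSucc (finProdFinEquiv (j, i)) : Fin (n * n + 1)) := by
    simp only [Fin.val_castSucc, hv]; omega
  rw [mem_union, h1, mem_place_add, joinBits_castSucc, or_iff_right]
  intro h
  refine disjoint_left.1 hr h ?_
  rw [mem_Ico, Fin.val_castSucc, hv]; omega

theorem mem_place_joinBits {n a u : ℕ} (e : Fin n → Bits n) (l : Bool) :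
    u ∈ place a (joinBits e l) ↔ (∃ j i : Fin n, e j i = true ∧ u = a + n * j + i) ∨
      (l = true ∧ u = a + n * n) := by
  rw [mem_place]
  constructor
  · rintro ⟨k, hk, rfl⟩
    refine Fin.lastCases (fun hk => ?_) (fun k hk => ?_) k hk
    · exact Or.inr ⟨by simpa using hk, by simp⟩
    · left
      refine ⟨(finProdFinEquiv.symm k).1, (finProdFinEquiv.symm k).2, ?_, ?_⟩
      · rw [← joinBits_castSucc e l, Prod.mk.eta, Equiv.apply_symm_apply]; exact hk
      · have : ((finProdFinEquiv (finProdFinEquiv.symm k) : Fin (n * n)) : ℕ) =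
            (finProdFinEquiv.symm k).2 + n * (finProdFinEquiv.symm k).1 := rfl
        rw [Equiv.apply_symm_apply] at this
        rw [Fin.val_castSucc, this]; ring
  · rintro (⟨j, i, h, rfl⟩ | ⟨h, rfl⟩)
    · refine ⟨Fin.castSucc (finProdFinEquiv (j, i)), by rwa [joinBits_castSucc], ?_⟩
      have hv : ((finProdFinEquiv (j, i) : Fin (n * n)) : ℕ) = i + n * j := rfl
      rw [Fin.val_castSucc, hv]; ring
    · exact ⟨Fin.last _, by simpa using h, by simp⟩

theorem block_index_lt {n : ℕ} (j i : Fin n) : n * (j : ℕ) + i < n * n := by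
  have := (finProdFinEquiv (j, i)).2
  have hv : ((finProdFinEquiv (j, i) : Fin (n * n)) : ℕ) = i + n * j := rfl
  omega

theorem block_index_inj {n : ℕ} {j i j' i' : Fin n}
    (h : n * (j : ℕ) + i = n * j' + i') : j = j' ∧ i = i' := by
  have h2 : finProdFinEquiv (j, i) = finProdFinEquiv (j', i') := by
    apply Fin.ext
    show (i : ℕ) + n * j = i' + n * j'
    omega
  have := finProdFinEquiv.injective h2
  exact ⟨congrArg Prod.fst this, congrArg Prod.snd this⟩

theorem clearAt_block {n a : ℕ} (j : Fin n) (r : Finset ℕ) (e : Fin n → Bits n) (l : Bool)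
    (hr : Disjoint r (Ico a (a + (n * n + 1)))) (z : Bits n) :
    clearAt (a + n * j) n (r ∪ place a (joinBits e l)) ∪ place (a + n * j) z =
      r ∪ place a (joinBits (Function.update e j z) l) := by
  ext u
  simp only [mem_union, mem_clearAt, mem_place_joinBits]
  have hb := fun i => block_index_lt j i
  constructor
  · rintro (⟨h | ⟨j', i', h, rfl⟩ | h, h2⟩ | h)
    · exact Or.inl h
    · refine Or.inr (Or.inl ⟨j', i', ?_, rfl⟩)
      rw [Function.update_of_ne]
      · exact h
      · rintro rfl
        have := i'.2
        omega
    · exact Or.inr (Or.inr h)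
    · obtain ⟨i, hi, rfl⟩ := mem_place.1 h
      exact Or.inr (Or.inl ⟨j, i, by simpa using hi, rfl⟩)
  · rintro (h | ⟨j', i', h, rfl⟩ | h)
    · refine Or.inl ⟨Or.inl h, ?_⟩
      by_contra hc
      refine disjoint_left.1 hr h ?_
      rw [mem_Ico]
      have hn : 0 < n := j.pos
      have := hb ⟨n - 1, by omega⟩
      simp only at this
      omega
    · by_cases hj : j' = j
      · subst hj
        right
        rw [mem_place_add]
        simpa using h
      · left
        rw [Function.update_of_ne hj] at h
        refine ⟨Or.inr (Or.inl ⟨j', i', h, rfl⟩), ?_⟩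
        by_contra hc
        apply hj
        have h1 : a + n * (j' : ℕ) + i' - (a + n * j) < n := by omega
        exact (block_index_inj (j := j') (i := i') (j' := j)
          (i' := ⟨a + n * (j' : ℕ) + i' - (a + n * j), h1⟩) (by simp only; omega)).1
    · refine Or.inl ⟨Or.inr (Or.inr h), ?_⟩
      have hn : 0 < n := j.pos
      have := hb ⟨n - 1, by omega⟩
      simp only at this
      rw [h.2]; omega

/-! ### Fidelity with a marked state and the weight of a query -/

/-- The fidelity with `ψ` of the marginal on the wires `b, b + 1, …`. -/
def fidAt {n : ℕ} (ψ : PureState n) (b : ℕ) (v : Workspace) : ℝ :=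
  sqNorm (window (fun (_ : Bits 0) (x : Bits n) => (starRingEnd ℂ) (ψ.1 x)) b v)

theorem isSumSq_fidAt {n : ℕ} (ψ : PureState n) (b : ℕ) : IsSumSq (fidAt ψ b) :=
  isSumSq_sqNorm _

theorem fidAt_eq {n N b : ℕ} (ψ : PureState n) (hN : b + n ≤ N) {v : Workspace} (hv : v ∈ low N) :
    fidAt ψ b v = ∑ r ∈ (range N \ Ico b (b + n)).powerset,
      Complex.normSq (∑ x, (starRingEnd ℂ) (ψ.1 x) * v (r ∪ place b x)) := by
  refine (sqNorm_window (Nat.zero_le n) hN _ hv).trans ?_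
  simp

theorem sum_markedWeight {n N a : ℕ} (ψ : PureState n) (j : Fin n) (hN : a + (n * n + 1) ≤ N)
    {v : Workspace} (hv : v ∈ low N) :
    ∑ r ∈ (range N \ Ico a (a + (n * n + 1))).powerset, ∑ l : Bool,
      markedWeight ψ j (fun e => v (r ∪ place a (joinBits e l))) = fidAt ψ (a + n * j) v := by
  have hn : 0 < n := j.pos
  have hb : a + n * j + n ≤ N := by
    have := block_index_lt j ⟨n - 1, by omega⟩
    simp only at this
    omega
  have h1 : ∑ s ∈ (range N).powerset, Complex.normSq (ψ.1 (readAt (a + n * j) n s)) *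
      Complex.normSq (∑ z, (starRingEnd ℂ) (ψ.1 z) *
        v (clearAt (a + n * j) n s ∪ place (a + n * j) z)) = fidAt ψ (a + n * j) v := by
    rw [fidAt_eq ψ hb hv, sum_powerset_window hb]
    refine sum_congr rfl fun r hr => ?_
    have hc := clearAt_of_mem hr
    have e1 := fun x => clearAt_union_place (a + n * j) n r x
    have e2 := fun x => readAt_union_place (a := a + n * j) (k := n) r x
    rw [hc] at e1 e2
    simp only [e1, e2, ← sum_mul, ψ.2, one_mul]
  rw [← h1, sum_powerset_window hN]
  refine sum_congr rfl fun r hr => ?_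
  have hd : Disjoint r (Ico a (a + (n * n + 1))) :=
    Finset.disjoint_of_subset_left (mem_powerset.1 hr) sdiff_disjoint
  rw [sum_joinBits, sum_comm]
  refine sum_congr rfl fun l _ => sum_congr rfl fun e _ => ?_
  rw [readAt_block j r e l hd]
  simp only [clearAt_block j r e l hd]

/-- The probability that a query to the `n`-th swap-test channel at the wires `a, a + 1, …`
passes at least `κ n` tests. -/
def passWeight (κ : ℝ) {n : ℕ} (ψ : Fin n → PureState n) (a : ℕ) (v : Workspace) : ℝ :=
  open scoped Classical in
  ∑ e ∈ univ.filter (fun e : Bits n × (Fin n → Bits n) × (Fin n → Bits n) =>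
      κ * n ≤ ((univ.filter fun j => e.1 j = true).card : ℝ)),
    sqNorm (window (swapKraus κ false ψ e) a v)

theorem passWeight_le (κ : ℝ) {n : ℕ} (ψ : Fin n → PureState n) (a : ℕ) (v : Workspace) :
    passWeight κ ψ a v ≤ coinTail κ n * sqNorm v + ∑ j, fidAt (ψ j) (a + n * j) v := by
  classical
  obtain ⟨N₀, hv⟩ := exists_mem_low v
  have hv := low_mono (le_max_left N₀ (a + (n * n + 1))) hv
  have hN := le_max_right N₀ (a + (n * n + 1))
  set N := max N₀ (a + (n * n + 1))
  have h1 : ∀ e, sqNorm (window (swapKraus κ false ψ e) a v) =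
      ∑ r ∈ (range N \ Ico a (a + (n * n + 1))).powerset, ∑ l : Bool, Complex.normSq
        (∑ x, (∏ j, swapAmp (ψ j).1 (e.1 j) (e.2.1 j) (e.2.2 j) (x j)) *
          v (r ∪ place a (joinBits x l))) := by
    intro e
    rw [sqNorm_window (by omega) hN _ hv]
    refine sum_congr rfl fun r _ => ?_
    rw [← (Equiv.funUnique (Fin 1) Bool).symm.sum_comp]
    refine sum_congr rfl fun l _ => ?_
    rw [sum_joinBits]
    congr 1
    refine sum_congr rfl fun x _ => ?_
    rw [Fintype.sum_bool]
    cases l <;> simp [swapKraus]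
  have h2 : sqNorm v = ∑ r ∈ (range N \ Ico a (a + (n * n + 1))).powerset, ∑ l : Bool,
      ∑ x : Fin n → Bits n, Complex.normSq (v (r ∪ place a (joinBits x l))) := by
    rw [sqNorm_eq_window hN hv]
    refine sum_congr rfl fun r _ => ?_
    rw [sum_joinBits, sum_comm]
  unfold passWeight
  simp only [h1]
  simp only [h2, ← sum_markedWeight _ _ hN hv]
  have hL : ∀ X : (Bits n × (Fin n → Bits n) × (Fin n → Bits n)) → Finset ℕ → Bool → ℝ,
      ∑ e ∈ univ.filter (fun e : Bits n × (Fin n → Bits n) × (Fin n → Bits n) =>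
        κ * n ≤ ((univ.filter fun j => e.1 j = true).card : ℝ)),
        ∑ r ∈ (range N \ Ico a (a + (n * n + 1))).powerset, ∑ l, X e r l =
      ∑ r ∈ (range N \ Ico a (a + (n * n + 1))).powerset, ∑ l,
        ∑ e ∈ univ.filter (fun e : Bits n × (Fin n → Bits n) × (Fin n → Bits n) =>
          κ * n ≤ ((univ.filter fun j => e.1 j = true).card : ℝ)), X e r l := by
    intro X
    rw [sum_comm]
    exact sum_congr rfl fun r _ => sum_comm
  have hR : ∀ (Y : Finset ℕ → Bool → ℝ) (Z : Fin n → Finset ℕ → Bool → ℝ),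
      coinTail κ n * (∑ r ∈ (range N \ Ico a (a + (n * n + 1))).powerset, ∑ l, Y r l) +
        ∑ j, ∑ r ∈ (range N \ Ico a (a + (n * n + 1))).powerset, ∑ l, Z j r l =
      ∑ r ∈ (range N \ Ico a (a + (n * n + 1))).powerset, ∑ l,
        (coinTail κ n * Y r l + ∑ j, Z j r l) := by
    intro Y Z
    simp only [sum_add_distrib, ← mul_sum]
    congr 1
    rw [sum_comm]
    exact sum_congr rfl fun r _ => sum_comm
  rw [hL, hR]
  exact sum_le_sum fun r _ => sum_le_sum fun l _ => swapAmp_tail_le κ ψ _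

theorem coinTail_le {κ : ℝ} (hκ : 1 / 2 < κ) (n : ℕ) :
    coinTail κ n ≤ Real.exp (-((2 * κ - 1) ^ 2 / 2)) ^ n := by
  classical
  set s := 2 * κ - 1 with hs
  have hs0 : 0 < s := by linarith
  set T := univ.filter fun t : Fin n → Bool =>
    κ * n ≤ ((univ.filter fun j => t j = true).card : ℝ) with hT
  have h1 : (T.card : ℝ) ≤ ∑ t : Fin n → Bool, Real.exp (-(2 * s * κ)) ^ n *
      ∏ j, (if t j = true then Real.exp (2 * s) else 1) := by
    have h2 : (T.card : ℝ) = ∑ t ∈ T, (1 : ℝ) := by simp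
    rw [h2]
    refine (sum_le_sum fun t ht => ?_).trans
      (sum_le_sum_of_subset_of_nonneg (subset_univ T) fun t _ _ => ?_)
    · rw [prod_ite, prod_const, prod_const_one, mul_one, ← Real.exp_nat_mul,
        ← Real.exp_nat_mul, ← Real.exp_add, Real.one_le_exp_iff]
      have := (mem_filter.1 ht).2
      nlinarith
    · refine mul_nonneg (by positivity) (prod_nonneg fun j _ => ?_)
      split_ifs <;> positivity
  have h3 : ∑ t : Fin n → Bool, ∏ j, (if t j = true then Real.exp (2 * s) else 1) =
      (1 + Real.exp (2 * s)) ^ n := by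
    have : ∑ t : Fin n → Bool, ∏ j, (if t j = true then Real.exp (2 * s) else 1) =
        ∏ j : Fin n, ∑ t : Bool, (if t = true then Real.exp (2 * s) else 1) := by
      rw [prod_univ_sum, Fintype.piFinset_univ]
    rw [this]
    simp [add_comm]
  have h4 : coinTail κ n = (T.card : ℝ) / 2 ^ n := by rw [coinTail, hT]
  rw [h4]
  rw [← mul_sum, h3] at h1
  calc (T.card : ℝ) / 2 ^ n ≤ (Real.exp (-(2 * s * κ)) ^ n * (1 + Real.exp (2 * s)) ^ n) / 2 ^ n := by
        gcongr
    _ = (Real.exp (-(2 * s * κ)) * (1 + Real.exp (2 * s)) / 2) ^ n := by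
        rw [div_pow, mul_pow]
    _ ≤ _ := by
        refine pow_le_pow_left₀ (by positivity) ?_ n
        have h5 : Real.exp (-(2 * s * κ)) * (1 + Real.exp (2 * s)) / 2 =
            Real.exp (-s * s) * Real.cosh s := by
          rw [Real.cosh_eq, show Real.exp (-(2 * s * κ)) = Real.exp (-s * s) * Real.exp (-s) by
            rw [← Real.exp_add]; congr 1; rw [hs]; ring, show Real.exp (2 * s) =
            Real.exp s * Real.exp s by rw [← Real.exp_add]; congr 1; ring]
          have : Real.exp (-s) * Real.exp s = 1 := by rw [← Real.exp_add]; simp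
          linear_combination (Real.exp (-s * s) * Real.exp s / 2) * this
        rw [h5]
        calc Real.exp (-s * s) * Real.cosh s ≤ Real.exp (-s * s) * Real.exp (s ^ 2 / 2) := by
              gcongr; exact Real.cosh_le_exp_half_sq s
          _ = _ := by rw [← Real.exp_add]; congr 1; ring

/-! ### Channels that do nothing but discard -/

/-- Discard the `n * n` first qubits. -/
def discardKraus {n : ℕ} (x : Bits (n * n)) : Matrix (Bits 1) (Bits (n * n + 1)) ℂ := fun y z =>
  if (fun i => z (Fin.castSucc i)) = x ∧ y 0 = z (Fin.last _) then 1 else 0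

theorem bits_ext {n : ℕ} {z z' : Bits (n * n + 1)} :
    z = z' ↔ (fun i => z (Fin.castSucc i)) = (fun i => z' (Fin.castSucc i)) ∧
      z (Fin.last _) = z' (Fin.last _) := by
  constructor
  · rintro rfl; exact ⟨rfl, rfl⟩
  · rintro ⟨h, hl⟩
    funext i
    exact Fin.lastCases hl (fun i => congrFun h i) i

theorem discardKraus_tracePreserving (n : ℕ) :
    ∑ x : Bits (n * n), (discardKraus x).conjTranspose * discardKraus x = 1 := by
  classical
  ext z z'
  rw [Matrix.sum_apply, Matrix.one_apply]
  have h : ∀ x : Bits (n * n), ((discardKraus x).conjTranspose * discardKraus x) z z' =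
      if (fun i => z (Fin.castSucc i)) = x then (if z = z' then 1 else 0) else 0 := by
    intro x
    rw [Matrix.mul_apply, ← (Equiv.funUnique (Fin 1) Bool).symm.sum_comp, Fintype.sum_bool]
    simp only [Matrix.conjTranspose_apply, discardKraus, bits_ext (z := z)]
    by_cases h1 : (fun i => z (Fin.castSucc i)) = x
    · subst h1
      generalize z (Fin.last _) = l
      generalize z' (Fin.last _) = l'
      cases l <;> cases l' <;> simp [eq_comm]
    · simp [h1]
  simp [h]

/-- The channel that discards the first `n * n` qubits and outputs the last one. -/
def discardChannel (n : ℕ) : QChannel (n * n + 1) 1 where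
  ι := Bits (n * n)
  fin := inferInstance
  kraus := discardKraus
  tracePreserving := discardKraus_tracePreserving n

/-- The channel oracle in which only the channels for the lengths in `L` are swap-test channels
with flag. -/
def truncOracle (κ : ℝ) (L : Set ℕ) (ψ : ∀ n, Fin n → PureState n) : ChannelOracle where
  inp n := n * n + 1
  out _ := 1
  out_le n := Nat.le_add_left 1 (n * n)
  chan n := open scoped Classical in
    if n ∈ L then swapChannel κ true (ψ n) else discardChannel n

theorem window_sum_smul {k l : ℕ} {ι : Type*} [Fintype ι] (z : ι → ℂ)
    (K : ι → Matrix (Bits l) (Bits k) ℂ) (a : ℕ) (v : Workspace) :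
    window (fun y x => ∑ i, z i * K i y x) a v = ∑ i, z i • window (K i) a v := by
  have : window (fun y x => ∑ i, z i * K i y x) a = ∑ i, z i • window (K i) a := by
    refine linearMap_ext_ket fun s => ?_
    refine (window_ket _ a s).trans ?_
    rw [LinearMap.sum_apply]
    simp only [LinearMap.smul_apply, window_ket, sum_smul, smul_sum, smul_smul]
    rw [sum_comm]
  rw [this, LinearMap.sum_apply]
  rfl

theorem swapKraus_false_eq {n : ℕ} (κ : ℝ) (ψ : Fin n → PureState n)
    (e : Bits n × (Fin n → Bits n) × (Fin n → Bits n)) :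
    swapKraus κ false ψ e = fun y z => ∑ x : Bits (n * n),
      (∏ j, swapAmp (ψ j).1 (e.1 j) (e.2.1 j) (e.2.2 j) (block x j)) * discardKraus x y z := by
  funext y z
  simp only [discardKraus, mul_ite, mul_one, mul_zero, ite_and]
  simp [swapKraus]

theorem swapAmp_isometry {n : ℕ} (ψ : Fin n → PureState n) (x x' : Bits (n * n)) :
    ∑ e : Bits n × (Fin n → Bits n) × (Fin n → Bits n), (starRingEnd ℂ)
      (∏ j, swapAmp (ψ j).1 (e.1 j) (e.2.1 j) (e.2.2 j) (block x j)) *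
      (∏ j, swapAmp (ψ j).1 (e.1 j) (e.2.1 j) (e.2.2 j) (block x' j)) = if x = x' then 1 else 0 := by
  simp only [map_prod, ← prod_mul_distrib]
  rw [sum_prod_three (fun j t a b => (starRingEnd ℂ) (swapAmp (ψ j).1 t a b (block x j)) *
    swapAmp (ψ j).1 t a b (block x' j))]
  simp only [swapAmp_sum]
  by_cases hx : x = x'
  · subst hx; simp
  · rw [if_neg hx]
    have : ∃ j, block x j ≠ block x' j := by
      by_contra hc
      push Not at hc
      exact hx ((flatEquiv n).symm.injective (funext hc))
    obtain ⟨j, hj⟩ := this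
    exact prod_eq_zero (mem_univ j) (if_neg hj)

theorem IsSumSq.swap_false {F : Workspace → ℝ} (hF : IsSumSq F) {n : ℕ} (κ : ℝ)
    (ψ : Fin n → PureState n) (a : ℕ) (v : Workspace) :
    ∑ e, F (window (swapKraus κ false ψ e) a v) =
      ∑ x : Bits (n * n), F (window (discardKraus x) a v) := by
  simp only [swapKraus_false_eq, window_sum_smul]
  exact hF.mix (fun (e : Bits n × (Fin n → Bits n) × (Fin n → Bits n)) (x : Bits (n * n)) =>
    ∏ j, swapAmp (ψ j).1 (e.1 j) (e.2.1 j) (e.2.2 j) (block x j)) (swapAmp_isometry ψ) _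

theorem swapKraus_true_of_lt {n : ℕ} {κ : ℝ} (ψ : Fin n → PureState n)
    {e : Bits n × (Fin n → Bits n) × (Fin n → Bits n)}
    (h : ¬ κ * n ≤ ((univ.filter fun j => e.1 j = true).card : ℝ)) :
    swapKraus κ true ψ e = swapKraus κ false ψ e := by
  funext y x
  simp [swapKraus, h]

theorem sqNorm_swapKraus_true {n : ℕ} (κ : ℝ) (ψ : Fin n → PureState n)
    (e : Bits n × (Fin n → Bits n) × (Fin n → Bits n)) (a : ℕ) (v : Workspace) :
    sqNorm (window (swapKraus κ true ψ e) a v) = sqNorm (window (swapKraus κ false ψ e) a v) := by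
  obtain ⟨N₀, hv⟩ := exists_mem_low v
  have hv := low_mono (le_max_left N₀ (a + (n * n + 1))) hv
  have hN := le_max_right N₀ (a + (n * n + 1))
  rw [sqNorm_window (by omega) hN _ hv, sqNorm_window (by omega) hN _ hv]
  refine sum_congr rfl fun r _ => ?_
  by_cases h : κ * n ≤ ((univ.filter fun j => e.1 j = true).card : ℝ)
  · rw [← (Equiv.funUnique (Fin 1) Bool).symm.sum_comp,
      ← (Equiv.funUnique (Fin 1) Bool).symm.sum_comp, Fintype.sum_bool, Fintype.sum_bool, add_comm]
    congr 2
    · refine sum_congr rfl fun x _ => ?_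
      cases hx : x (Fin.last _) <;> simp [swapKraus, h, hx]
    · refine sum_congr rfl fun x _ => ?_
      cases hx : x (Fin.last _) <;> simp [swapKraus, h, hx]
  · rw [swapKraus_true_of_lt ψ h]

/-! ### Replacing one channel of the oracle -/

/-- The accumulated weight `P` of the instructions of a circuit. -/
def totalWeight (Φ : ChannelOracle) (P : Instr → Workspace → ℝ) : Circuit → Workspace → ℝ
  | [], _ => 0
  | .gate g :: c, v => P (.gate g) v + totalWeight Φ P c (g.op v)
  | .query m a :: c, v => P (.query m a) v +
      ∑ e, totalWeight Φ P c (window ((Φ.chan m).kraus e) a v)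

theorem expect_append (Φ : ChannelOracle) (c d : Circuit) (F : Workspace → ℝ) (v : Workspace) :
    expect Φ (c ++ d) F v = expect Φ c (expect Φ d F) v := by
  induction c generalizing v with
  | nil => rfl
  | cons i c ih => cases i <;> simp [expect, ih]

theorem totalWeight_cons (Φ : ChannelOracle) (P : Instr → Workspace → ℝ) (i : Instr) (c : Circuit)
    (v : Workspace) :
    totalWeight Φ P (i :: c) v = P i v + expect Φ [i] (totalWeight Φ P c) v := by
  cases i <;> rfl

theorem totalWeight_le (Φ : ChannelOracle) (P : Instr → Workspace → ℝ) (δ : ℝ) (v : Workspace)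
    (c : Circuit) (h : ∀ p i r, c = p ++ i :: r → expect Φ p (P i) v ≤ δ) :
    totalWeight Φ P c v ≤ c.length * δ := by
  have key : ∀ (d p : Circuit), c = p ++ d → expect Φ p (totalWeight Φ P d) v ≤ d.length * δ := by
    intro d
    induction d with
    | nil =>
      intro p _
      have : expect Φ p (totalWeight Φ P []) v = 0 := by
        have := expect_const_mul Φ p 0 (fun _ => 0) v
        simpa [totalWeight] using this
      simp [this]
    | cons i d ih =>
      intro p hp
      have h1 : totalWeight Φ P (i :: d) = fun v => P i v + expect Φ [i] (totalWeight Φ P d) v :=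
        funext fun v => totalWeight_cons Φ P i d v
      rw [h1, expect_add, ← expect_append]
      have h2 := h p i d hp
      have h3 := ih (p ++ [i]) (by simp [hp])
      simp only [List.length_cons, Nat.cast_add, Nat.cast_one]
      linarith
  simpa [expect] using key c [] rfl

/-- The weight of the queries to the channel `n`. -/
def queryWeight (κ : ℝ) (n : ℕ) (ψ : Fin n → PureState n) : Instr → Workspace → ℝ
  | .gate _, _ => 0
  | .query m a, v => if m = n then passWeight κ ψ a v else 0

theorem isSumSq_accept (Φ : ChannelOracle) (c : Circuit) : IsSumSq (acceptProb Φ c) := by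
  have : acceptProb Φ c = expect Φ c fun v => sqNorm (proj (fun s => 0 ∈ s) v) :=
    funext fun v => acceptProb_eq Φ c v
  rw [this]
  exact (isSumSq_sqNorm _).expect Φ c

theorem acceptProb_query_of_notMem {κ : ℝ} {L : Set ℕ} {ψ : ∀ n, Fin n → PureState n} {m : ℕ}
    (hm : m ∉ L) (c : Circuit) (a : ℕ) (v : Workspace) :
    acceptProb (swapOracle κ L ψ) (.query m a :: c) v =
      ∑ x : Bits (m * m), acceptProb (swapOracle κ L ψ) c (window (discardKraus x) a v) := by
  have h : ((swapOracle κ L ψ).chan m) = swapChannel κ false (ψ m) := by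
    simp [swapOracle, hm]
  have h2 : acceptProb (swapOracle κ L ψ) (.query m a :: c) v =
      ∑ e, acceptProb (swapOracle κ L ψ) c (window ((swapChannel κ false (ψ m)).kraus e) a v) := by
    rw [← h]; rfl
  rw [h2]
  exact (isSumSq_accept _ c).swap_false κ (ψ m) a v

theorem expect_trunc_of_mem {κ : ℝ} {L : Set ℕ} {ψ : ∀ n, Fin n → PureState n} {m : ℕ}
    (hm : m ∈ L) (F : Workspace → ℝ) (a : ℕ) (v : Workspace) :
    ∑ e, F (window (((truncOracle κ L ψ).chan m).kraus e) a v) =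
      ∑ e, F (window (swapKraus κ true (ψ m) e) a v) := by
  have h : ((truncOracle κ L ψ).chan m) = swapChannel κ true (ψ m) := by
    simp [truncOracle, hm]
  rw [h]; rfl

theorem expect_trunc_of_notMem {κ : ℝ} {L : Set ℕ} {ψ : ∀ n, Fin n → PureState n} {m : ℕ}
    (hm : m ∉ L) (F : Workspace → ℝ) (a : ℕ) (v : Workspace) :
    ∑ e, F (window (((truncOracle κ L ψ).chan m).kraus e) a v) =
      ∑ x, F (window (discardKraus (n := m) x) a v) := by
  have h : ((truncOracle κ L ψ).chan m) = discardChannel m := by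
    simp [truncOracle, hm]
  rw [h]; rfl

theorem acceptProb_query_of_mem {κ : ℝ} {L : Set ℕ} {ψ : ∀ n, Fin n → PureState n} {m : ℕ}
    (hm : m ∈ L) (c : Circuit) (a : ℕ) (v : Workspace) :
    acceptProb (swapOracle κ L ψ) (.query m a :: c) v =
      ∑ e, acceptProb (swapOracle κ L ψ) c (window (swapKraus κ true (ψ m) e) a v) := by
  have h : ((swapOracle κ L ψ).chan m) = swapChannel κ true (ψ m) := by
    simp [swapOracle, hm]
  have h2 : acceptProb (swapOracle κ L ψ) (.query m a :: c) v =
      ∑ e, acceptProb (swapOracle κ L ψ) c (window ((swapChannel κ true (ψ m)).kraus e) a v) := by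
    rw [← h]; rfl
  rw [h2]; rfl

/-- Replacing the channels outside `L'` by discarding channels changes the acceptance probability
at most by the weight of the queries to the channel `n`, if this is the only flagged one among
them. -/
theorem acceptProb_le_trunc {κ : ℝ} {L L' : Set ℕ} {ψ : ∀ n, Fin n → PureState n} {n : ℕ}
    (hn : n ∉ L') (hL : L' ⊆ L) (c : Circuit) (hc : ∀ m ∈ queries c, m ∈ L → m ∈ L' ∨ m = n)
    (v : Workspace) :
    acceptProb (swapOracle κ L ψ) c v ≤ acceptProb (truncOracle κ L' ψ) c v +
      totalWeight (truncOracle κ L' ψ) (queryWeight κ n (ψ n)) c v := by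
  classical
  induction c generalizing v with
  | nil => simp [acceptProb, totalWeight]
  | cons i c ih =>
    cases i with
    | gate g =>
      simp only [acceptProb, totalWeight, queryWeight, zero_add]
      exact ih (fun m hm => hc m hm) _
    | query m a =>
      have ih := ih fun m hm => hc m (List.mem_cons_of_mem _ hm)
      have hP : ∀ (F : Workspace → ℝ), IsSumSq F → (∀ v, F v ≤ sqNorm v) →
          ∑ e, F (window (swapKraus κ true (ψ m) e) a v) ≤
          (∑ x, F (window (discardKraus (n := m) x) a v)) + passWeight κ (ψ m) a v := by
        intro F hF hF1
        rw [← hF.swap_false κ (ψ m) a v, passWeight, sum_filter, ← sum_add_distrib]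
        refine sum_le_sum fun e _ => ?_
        split_ifs with h
        · have h1 := hF1 (window (swapKraus κ true (ψ m) e) a v)
          rw [sqNorm_swapKraus_true] at h1
          have h2 := hF.nonneg (window (swapKraus κ false (ψ m) e) a v)
          linarith
        · rw [swapKraus_true_of_lt _ h, add_zero]
      have hmain : acceptProb (swapOracle κ L ψ) (.query m a :: c) v ≤
          queryWeight κ n (ψ n) (.query m a) v + ∑ e, acceptProb (swapOracle κ L ψ) c
            (window (((truncOracle κ L' ψ).chan m).kraus e) a v) := by
        by_cases hmL : m ∈ L
        · rw [acceptProb_query_of_mem hmL]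
          by_cases hmL' : m ∈ L'
          · rw [expect_trunc_of_mem hmL', queryWeight, if_neg, zero_add]
            rintro rfl; exact hn hmL'
          · obtain rfl : m = n := (hc m (by simp [queries]) hmL).resolve_left hmL'
            rw [expect_trunc_of_notMem hmL', queryWeight, if_pos rfl]
            exact (hP _ (isSumSq_accept _ c) fun v => acceptProb_le _ c v).trans
              (le_of_eq (add_comm _ _))
        · rw [acceptProb_query_of_notMem hmL, expect_trunc_of_notMem fun h => hmL (hL h)]
          refine le_add_of_nonneg_left ?_
          simp only [queryWeight]
          split_ifs
          · exact sum_nonneg fun e _ => sqNorm_nonneg _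
          · exact le_rfl
      refine hmain.trans ?_
      simp only [acceptProb, totalWeight]
      have := sum_le_sum (s := univ) fun e (_ : e ∈ univ) =>
        ih (window (((truncOracle κ L' ψ).chan m).kraus e) a v)
      rw [sum_add_distrib] at this
      linarith

theorem acceptProb_eq_trunc {κ : ℝ} {L L' : Set ℕ} {ψ : ∀ n, Fin n → PureState n}
    (hL : L' ⊆ L) (c : Circuit) (hc : ∀ m ∈ queries c, m ∈ L → m ∈ L') (v : Workspace) :
    acceptProb (swapOracle κ L ψ) c v = acceptProb (truncOracle κ L' ψ) c v := by
  classical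
  induction c generalizing v with
  | nil => simp [acceptProb]
  | cons i c ih =>
    cases i with
    | gate g => exact ih (fun m hm => hc m hm) _
    | query m a =>
      have ih := ih fun m hm => hc m (List.mem_cons_of_mem _ hm)
      have h2 : acceptProb (truncOracle κ L' ψ) (.query m a :: c) v = ∑ e,
          acceptProb (swapOracle κ L ψ) c (window (((truncOracle κ L' ψ).chan m).kraus e) a v) := by
        simp only [acceptProb, ih]
      rw [h2]
      by_cases hmL : m ∈ L
      · rw [acceptProb_query_of_mem hmL, expect_trunc_of_mem (hc m (by simp [queries]) hmL)]
      · rw [acceptProb_query_of_notMem hmL, expect_trunc_of_notMem fun h => hmL (hL h)]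

/-- If the marked states of length `n` have small fidelity with the states in which the channel
`n` is queried, the flag of this channel hardly matters. -/
theorem acceptProb_le_trunc_add {κ : ℝ} {L L' : Set ℕ} {ψ : ∀ n, Fin n → PureState n} {n : ℕ}
    (hn : n ∉ L') (hL : L' ⊆ L) (c : Circuit) (hc : ∀ m ∈ queries c, m ∈ L → m ∈ L' ∨ m = n)
    {v : Workspace} (hv : sqNorm v = 1) {δ : ℝ} (hδ : 0 ≤ δ)
    (h : ∀ p a r, c = p ++ .query n a :: r → ∀ j : Fin n,
      expect (truncOracle κ L' ψ) p (fidAt (ψ n j) (a + n * j)) v ≤ δ) :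
    acceptProb (swapOracle κ L ψ) c v ≤ acceptProb (truncOracle κ L' ψ) c v +
      c.length * (coinTail κ n + n * δ) := by
  refine (acceptProb_le_trunc hn hL c hc v).trans (add_le_add le_rfl ?_)
  refine totalWeight_le _ _ _ _ _ fun p i r hp => ?_
  have h0 : 0 ≤ coinTail κ n + n * δ := add_nonneg (coinTail_nonneg _ _) (by positivity)
  have hz : expect (truncOracle κ L' ψ) p (fun _ => 0) v ≤ coinTail κ n + n * δ := by
    have := expect_const_mul (truncOracle κ L' ψ) p 0 (fun _ => 0) v
    simp only [zero_mul] at this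
    rw [this]; exact h0
  cases i with
  | gate g => exact hz
  | query m a =>
    by_cases hm : m = n
    · subst hm
      have h1 : queryWeight κ m (ψ m) (.query m a) = passWeight κ (ψ m) a :=
        funext fun v => by simp [queryWeight]
      rw [h1]
      refine (expect_mono _ p (passWeight_le κ (ψ m) a) v).trans ?_
      rw [expect_add, expect_const_mul, expect_sqNorm, hv, mul_one, expect_sum]
      refine add_le_add le_rfl ((sum_le_sum fun j _ => h p a r hp j).trans ?_)
      simp
    · have h1 : queryWeight κ n (ψ n) (.query m a) = fun _ => 0 :=
        funext fun v => by simp [queryWeight, hm]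
      rw [h1]
      exact hz

/-! ### The verifier with a quantum witness -/

theorem swapOracle_accept_const {κ : ℝ} {L : Set ℕ} {ψ : ∀ n, Fin n → PureState n} {n : ℕ}
    (b : Bool) (v : Workspace)
    (h : ∀ e, window ((swapChannel κ (open scoped Classical in decide (n ∈ L)) (ψ n)).kraus e) 1 v = 0 ∨
      ∀ s, window ((swapChannel κ (open scoped Classical in decide (n ∈ L)) (ψ n)).kraus e) 1 v s ≠ 0 →
        (0 ∉ s ∧ (1 ∈ s ↔ b = true))) :
    acceptProb (swapOracle κ L ψ) [.query n 1, .gate (.cnot 1 0)] v =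
      if b then sqNorm v else 0 := by
  classical
  have hsum := QChannel.sum_sqNorm (swapChannel κ (open scoped Classical in decide (n ∈ L)) (ψ n))
    (Nat.le_add_left 1 (n * n)) 1 v
  have hstep : acceptProb (swapOracle κ L ψ) [.query n 1, .gate (.cnot 1 0)] v =
      ∑ e, sqNorm (proj (fun s => 0 ∈ s) ((Gate.cnot 1 0).op
        (window ((swapChannel κ (open scoped Classical in decide (n ∈ L)) (ψ n)).kraus e) 1 v))) := by
    rw [acceptProb_eq]; rfl
  rw [hstep]
  have key : ∀ e, sqNorm (proj (fun s => 0 ∈ s) ((Gate.cnot 1 0).op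
        (window ((swapChannel κ (open scoped Classical in decide (n ∈ L)) (ψ n)).kraus e) 1 v))) =
      if b then sqNorm (window ((swapChannel κ (open scoped Classical in decide (n ∈ L)) (ψ n)).kraus e) 1 v)
      else 0 := by
    intro e
    rcases h e with h | h
    · rw [h]; simp
    set u := window ((swapChannel κ (open scoped Classical in decide (n ∈ L)) (ψ n)).kraus e) 1 v
    rw [← Gate.sqNorm_op (.cnot 1 0) u]
    have hc : ∀ s, (Gate.cnot 1 0).op u s ≠ 0 → (0 ∈ s ↔ b = true) := by
      intro s hs
      rw [Gate.cnot_apply] at hs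
      have := h _ hs
      by_cases h1 : 1 ∈ s
      · simp only [h1, ne_eq, one_ne_zero, not_false_eq_true, and_self, if_true,
          mem_symmDiff, mem_singleton] at this
        simp at this
        exact ⟨fun _ => this.2, fun _ => this.1⟩
      · simp only [h1, false_and, if_false] at this
        simp only [false_iff] at this
        exact ⟨fun h => absurd h this.1, fun h => absurd h this.2⟩
    cases b with
    | true =>
      rw [if_pos rfl]
      congr 1
      ext s
      rw [proj_apply]
      split_ifs with hs
      · rfl
      · by_contra hne
        exact hs ((hc s (Ne.symm hne)).2 rfl)
    | false =>
      simp only [Bool.false_eq_true, if_false]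
      have : proj (fun s => 0 ∈ s) ((Gate.cnot 1 0).op u) = 0 := by
        ext s
        rw [proj_apply]
        split_ifs with hs
        · by_contra hne
          exact absurd ((hc s hne).1 hs) (by simp)
        · rfl
      simp [this]
  simp only [key]
  cases b
  · simp
  · simpa using hsum

theorem readAt_place_snoc {n : ℕ} (x : Bits (n * n)) :
    readAt 1 (n * n + 1) (place 1 x) = Fin.snoc (α := fun _ => Bool) x false := by
  rw [readAt_eq]
  intro i
  refine Fin.lastCases ?_ (fun i => ?_) i
  · simp only [Fin.val_last, Fin.snoc_last, Bool.false_eq_true, iff_false]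
    exact notMem_place (Or.inr le_rfl)
  · simp only [Fin.val_castSucc, Fin.snoc_castSucc]
    exact mem_place_add i

theorem window_loadAt {n : ℕ} (K : Matrix (Bits 1) (Bits (n * n + 1)) ℂ) (φ : Bits (n * n) → ℂ) :
    window K 1 (loadAt 1 φ) = ∑ y : Bits 1, (∑ x, φ x * K y (Fin.snoc (α := fun _ => Bool) x false)) •
      ket (place 1 y) := by
  rw [loadAt, map_sum]
  simp only [map_smul, window_ket, readAt_place_snoc]
  have : ∀ x : Bits (n * n), clearAt 1 (n * n + 1) (place 1 x) = ∅ := by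
    intro x
    rw [clearAt, Finset.sdiff_eq_empty_iff_subset]
    exact (place_subset x).trans (Finset.Ico_subset_Ico le_rfl (by omega))
  simp only [this, empty_union, smul_sum, sum_smul, smul_smul]
  rw [sum_comm]

theorem sqNorm_loadAt {a k : ℕ} (φ : Bits k → ℂ) :
    sqNorm (loadAt a φ) = ∑ x, Complex.normSq (φ x) := by
  have hlow : loadAt a φ ∈ low (a + k) := by
    refine Submodule.sum_mem _ fun x _ => Submodule.smul_mem _ _ (ket_mem_low ?_)
    intro u hu
    have := mem_Ico.1 (place_subset x hu)
    exact Finset.mem_range.2 this.2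
  have hinj : ∀ x y : Bits k, place a x = place a y → x = y := by
    intro x y h
    funext i
    have := mem_place_add (a := a) (x := x) i
    rw [h, mem_place_add] at this
    exact Bool.eq_iff_iff.2 this.symm
  have happ : ∀ x, loadAt a φ (place a x) = φ x := by
    intro x
    rw [loadAt, Finsupp.finsetSum_apply, sum_eq_single x]
    · simp [ket_apply]
    · intro y _ hy
      rw [Finsupp.smul_apply, ket_apply, if_neg fun h => hy (hinj _ _ h), smul_zero]
    · simp
  have hsupp : (loadAt a φ).support ⊆ univ.image (fun x : Bits k => place a x) := by
    intro s hs
    by_contra hn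
    rw [Finsupp.mem_support_iff] at hs
    apply hs
    rw [loadAt, Finsupp.finsetSum_apply]
    refine sum_eq_zero fun y _ => ?_
    rw [Finsupp.smul_apply, ket_apply, if_neg fun h => hn ?_, smul_zero]
    exact mem_image.2 ⟨y, mem_univ _, h⟩
  rw [sqNorm_eq_sum hsupp, Finset.sum_image fun x _ y _ h => hinj x y h]
  simp only [happ]

theorem swapKraus_snoc_false {n : ℕ} {κ : ℝ} {flag : Bool} {ψ : Fin n → PureState n}
    {e : Bits n × (Fin n → Bits n) × (Fin n → Bits n)} {y : Bits 1} {x : Bits (n * n)}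
    (h : swapKraus κ flag ψ e y (Fin.snoc (α := fun _ => Bool) x false) ≠ 0) :
    y 0 = (flag && open scoped Classical in
      decide (κ * n ≤ ((univ.filter fun j => e.1 j = true).card : ℝ))) := by
  by_contra hne
  apply h
  rw [swapKraus, if_neg, mul_zero]
  simpa using hne

theorem acceptProb_query_notMem {κ : ℝ} {L : Set ℕ} {ψ : ∀ n, Fin n → PureState n} {n : ℕ}
    (hn : n ∉ L) (φ : Bits (n * n) → ℂ) :
    acceptProb (swapOracle κ L ψ) [.query n 1, .gate (.cnot 1 0)] (loadAt 1 φ) = 0 := by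
  classical
  rw [swapOracle_accept_const false]
  · simp
  intro e
  right
  intro s hs
  rw [window_loadAt, Finsupp.finsetSum_apply] at hs
  obtain ⟨y, _, hy⟩ := exists_ne_zero_of_sum_ne_zero hs
  rw [Finsupp.smul_apply, ket_apply] at hy
  split_ifs at hy with hsy
  · obtain ⟨x, _, hx⟩ := exists_ne_zero_of_sum_ne_zero (left_ne_zero_of_mul hy)
    have := swapKraus_snoc_false (right_ne_zero_of_mul hx)
    simp only [hn, decide_false, Bool.false_and] at this
    subst hsy
    refine ⟨notMem_place (Or.inl one_pos), ?_⟩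
    have h1 := mem_place_add (a := 1) (x := y) 0
    simp only [Fin.val_zero, add_zero] at h1
    rw [h1, this]
  · simp at hy

theorem sum_prod_block {R : Type} [CommSemiring R] {n : ℕ} (f : Fin n → Bits n → R) :
    ∑ x : Bits (n * n), ∏ j, f j (block x j) = ∏ j, ∑ z, f j z := by
  rw [prod_univ_sum, Fintype.piFinset_univ, ← (flatEquiv n).sum_comp]
  simp

theorem acceptProb_query_mem {κ : ℝ} (hκ : κ < 1) {L : Set ℕ} {ψ : ∀ n, Fin n → PureState n} {n : ℕ}
    (hn : n ∈ L) :
    acceptProb (swapOracle κ L ψ) [.query n 1, .gate (.cnot 1 0)]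
      (loadAt 1 (jointState (ψ n))) = 1 := by
  classical
  rw [swapOracle_accept_const true]
  · rw [if_pos rfl, sqNorm_loadAt]
    have h : ∑ x : Bits (n * n), (∏ j, (Complex.normSq ((ψ n j).1 (block x j)) : ℂ)) =
        ∏ j, ∑ z, (Complex.normSq ((ψ n j).1 z) : ℂ) :=
      sum_prod_block fun j z => (Complex.normSq ((ψ n j).1 z) : ℂ)
    have h2 : ∀ j, ∑ z, Complex.normSq ((ψ n j).1 z) = 1 := fun j => (ψ n j).2
    apply Complex.ofReal_injective
    simp only [jointState, map_prod, Complex.ofReal_sum, Complex.ofReal_prod, Complex.ofReal_one, h]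
    simp only [← Complex.ofReal_sum, h2]
    simp
  intro e
  by_cases he : ∀ j, e.1 j = true
  · right
    intro s hs
    rw [window_loadAt, Finsupp.finsetSum_apply] at hs
    obtain ⟨y, _, hy⟩ := exists_ne_zero_of_sum_ne_zero hs
    rw [Finsupp.smul_apply, ket_apply] at hy
    split_ifs at hy with hsy
    · obtain ⟨x, _, hx⟩ := exists_ne_zero_of_sum_ne_zero (left_ne_zero_of_mul hy)
      have := swapKraus_snoc_false (right_ne_zero_of_mul hx)
      have hle : κ * n ≤ n := by
        have : (0 : ℝ) ≤ n := Nat.cast_nonneg n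
        nlinarith
      simp only [hn, decide_true, Bool.true_and, he, Finset.filter_true, Finset.card_univ,
        Fintype.card_fin, hle] at this
      subst hsy
      refine ⟨notMem_place (Or.inl one_pos), ?_⟩
      have h1 := mem_place_add (a := 1) (x := y) 0
      simp only [Fin.val_zero, add_zero] at h1
      rw [h1, this]
    · simp at hy
  · left
    push Not at he
    obtain ⟨j, hj⟩ := he
    rw [window_loadAt]
    refine sum_eq_zero fun y _ => ?_
    have : ∑ x : Bits (n * n), jointState (ψ n) x * (swapChannel κ (decide (n ∈ L)) (ψ n)).kraus e y
        (Fin.snoc (α := fun _ => Bool) x false) = 0 := by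
      simp only [swapChannel, swapKraus, jointState, Fin.snoc_castSucc, Fin.snoc_last, ← mul_assoc,
        ← sum_mul, ← prod_mul_distrib]
      rw [sum_prod_block (fun j z => (ψ n j).1 z *
        swapAmp (ψ n j).1 (e.1 j) (e.2.1 j) (e.2.2 j) z), prod_eq_zero (mem_univ j),
        zero_mul]
      have hf : e.1 j = false := by simpa using hj
      have : ∀ z, (ψ n j).1 z * swapAmp (ψ n j).1 (e.1 j) (e.2.1 j) (e.2.2 j) z =
          ((if e.2.1 j = z then (ψ n j).1 z * (ψ n j).1 (e.2.2 j) else 0) -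
            (if e.2.2 j = z then (ψ n j).1 z * (ψ n j).1 (e.2.1 j) else 0)) / 2 := by
        intro z
        simp only [swapAmp, hf, Bool.false_eq_true, if_false]
        split_ifs <;> ring
      simp only [this, ← sum_div, sum_sub_distrib, sum_ite_eq,
        mem_univ, if_true]
      ring
    rw [this, zero_smul]

/-! ### Circuits for X, Toffoli, controlled swaps and multiply controlled X -/

theorem had_ket (i : ℕ) (s : Finset ℕ) : (Gate.had i).op (ket s) = ((Real.sqrt 2 : ℝ) : ℂ)⁻¹ •
    (ket (s.erase i) + (if i ∈ s then (-1 : ℂ) else 1) • ket (insert i s)) := by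
  simp [Gate.op]

theorem cnot_ket (i j : ℕ) (s : Finset ℕ) :
    (Gate.cnot i j).op (ket s) = ket (if i ∈ s ∧ i ≠ j then symmDiff s {j} else s) := by
  simp only [Gate.op, ofBasis_ket]
  split_ifs <;> rfl

/-- The eighth root of unity that defines the gate `T`. -/
def omega8 : ℂ := Complex.exp (Real.pi / 4 * Complex.I)

theorem omega8_pow_four : omega8 ^ 4 = -1 := by
  rw [omega8, ← Complex.exp_nat_mul, ← Complex.exp_pi_mul_I]
  congr 1
  push_cast
  ring

theorem omega8_pow_eight : omega8 ^ 8 = 1 := by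
  rw [show omega8 ^ 8 = (omega8 ^ 4) ^ 2 by ring, omega8_pow_four]; norm_num

theorem tee_pow_ket (i k : ℕ) (s : Finset ℕ) :
    gatesOp (List.replicate k (.tee i)) (ket s) = (if i ∈ s then omega8 ^ k else 1) • ket s := by
  induction k with
  | zero => simp
  | succ k ih =>
    rw [List.replicate_succ, gatesOp_cons]
    have : (Gate.tee i).op (ket s) = (if i ∈ s then omega8 else 1) • ket s := by
      simp [Gate.op, omega8]
    rw [this, map_smul, ih, smul_smul]
    congr 1
    split_ifs
    · rw [pow_succ, mul_comm]
    · simp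

theorem inv_sqrt_two_mul_self : ((Real.sqrt 2 : ℝ) : ℂ)⁻¹ * ((Real.sqrt 2 : ℝ) : ℂ)⁻¹ = 1 / 2 := by
  rw [← mul_inv, ← Complex.ofReal_mul, Real.mul_self_sqrt (by norm_num)]
  norm_num

theorem had_had_ket (i : ℕ) (s : Finset ℕ) : (Gate.had i).op ((Gate.had i).op (ket s)) = ket s := by
  have hr := inv_sqrt_two_mul_self
  rw [had_ket, map_smul, map_add, map_smul, had_ket, had_ket]
  generalize ((Real.sqrt 2 : ℝ) : ℂ)⁻¹ = r at *
  by_cases h : i ∈ s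
  · simp only [h, if_true, Finset.erase_idem, Finset.notMem_erase, if_false,
      insert_erase h, Finset.insert_eq_of_mem h]
    match_scalars <;> first | ring1 | linear_combination 2 * hr
  · simp only [h, if_false, Finset.erase_eq_of_notMem h, mem_insert_self, if_true,
      erase_insert h, Finset.insert_idem]
    match_scalars <;> first | ring1 | linear_combination 2 * hr

theorem had_flip_ket (i : ℕ) (s : Finset ℕ) : (Gate.had i).op (((Real.sqrt 2 : ℝ) : ℂ)⁻¹ •
    (ket (s.erase i) - (if i ∈ s then (-1 : ℂ) else 1) • ket (insert i s))) =
      ket (symmDiff s {i}) := by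
  have key : (Gate.had i).op (ket (symmDiff s {i})) = (((Real.sqrt 2 : ℝ) : ℂ)⁻¹ •
    (ket (s.erase i) - (if i ∈ s then (-1 : ℂ) else 1) • ket (insert i s))) := by
    rw [had_ket]
    by_cases h : i ∈ s
    · have h1 : symmDiff s {i} = s.erase i := by
        ext u; simp only [mem_symmDiff, mem_singleton, mem_erase]
        constructor
        · rintro (⟨a, b⟩ | ⟨rfl, b⟩)
          · exact ⟨b, a⟩
          · exact absurd h b
        · exact fun ⟨a, b⟩ => Or.inl ⟨b, a⟩
      simp [h1, h]
    · have h1 : symmDiff s {i} = insert i s := by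
        ext u; simp only [mem_symmDiff, mem_singleton, mem_insert]
        constructor
        · rintro (⟨a, b⟩ | ⟨rfl, b⟩)
          · exact Or.inr a
          · exact Or.inl rfl
        · rintro (rfl | a)
          · exact Or.inr ⟨rfl, h⟩
          · exact Or.inl ⟨a, fun hu => h (hu ▸ a)⟩
      simp [h1, h, sub_eq_add_neg]
  rw [← key, had_had_ket]

/-- The Pauli gate `X`. -/
def xGate (i : ℕ) : List Gate := .had i :: (List.replicate 4 (.tee i) ++ [.had i])

theorem xGate_ket (i : ℕ) (s : Finset ℕ) : gatesOp (xGate i) (ket s) = ket (symmDiff s {i}) := by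
  rw [← had_flip_ket, xGate, gatesOp_cons, gatesOp_append_apply, had_ket]
  simp only [map_smul, map_add, map_sub, tee_pow_ket, Finset.notMem_erase, if_false,
    mem_insert_self, if_true, omega8_pow_four, gatesOp_cons, gatesOp_nil, one_smul]
  module

/-- The doubly controlled phase gate. -/
def cczGate (a b c : ℕ) : List Gate :=
  List.replicate 1 (.tee a) ++ (List.replicate 1 (.tee b) ++ (List.replicate 1 (.tee c) ++
  ([.cnot a b] ++ (List.replicate 7 (.tee b) ++ ([.cnot a b] ++
  ([.cnot b c] ++ (List.replicate 7 (.tee c) ++ ([.cnot a c] ++ (List.replicate 1 (.tee c) ++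
  ([.cnot b c] ++ (List.replicate 7 (.tee c) ++ [.cnot a c])))))))))))

theorem gatesOp_cnot_ket (i j : ℕ) (s : Finset ℕ) :
    gatesOp [.cnot i j] (ket s) = ket (if i ∈ s ∧ i ≠ j then symmDiff s {j} else s) := by
  rw [gatesOp_cons, gatesOp_nil, cnot_ket]

theorem cczGate_ket {a b c : ℕ} (hab : a ≠ b) (hac : a ≠ c) (hbc : b ≠ c) (s : Finset ℕ) :
    gatesOp (cczGate a b c) (ket s) = (if a ∈ s ∧ b ∈ s ∧ c ∈ s then (-1 : ℂ) else 1) • ket s := by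
  have hw8 := omega8_pow_eight
  have h4 := omega8_pow_four
  have h16 : omega8 ^ 16 = 1 := by rw [show omega8 ^ 16 = (omega8 ^ 8) ^ 2 by ring, hw8]; norm_num
  simp only [cczGate, gatesOp_append_apply]
  have hm : ∀ (i j : ℕ) (u : Finset ℕ), i ≠ j → (i ∈ symmDiff u {j} ↔ i ∈ u) := by
    intro i j u hij; simp [mem_symmDiff, hij]
  have hs : ∀ (i : ℕ) (u : Finset ℕ), (i ∈ symmDiff u {i} ↔ i ∉ u) := by
    intro i u; simp [mem_symmDiff]
  by_cases ha : a ∈ s <;> by_cases hb : b ∈ s <;> by_cases hc : c ∈ s <;>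
    simp only [tee_pow_ket, gatesOp_cnot_ket, map_smul, ha, hb, hc, hm _ _ _ hab, hm _ _ _ hac,
      hm _ _ _ hbc, hm _ _ _ hab.symm, hm _ _ _ hac.symm, hm _ _ _ hbc.symm, hs, hab, hac, hbc,
      ne_eq, not_true_eq_false, not_false_eq_true, and_true, and_false, true_and, false_and,
      if_true, if_false, smul_smul, one_smul, mul_one, symmDiff_assoc, symmDiff_self,
      symmDiff_bot] <;>
    first
    | rfl
    | (congr 1; ring_nf; simp only [hw8, h4, h16]; done)
    | (ring_nf; simp only [hw8, h4, h16, one_smul])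

/-- The Toffoli gate with controls `a`, `b`. -/
def ccxGate (a b c : ℕ) : List Gate := .had c :: (cczGate a b c ++ [.had c])

theorem ccxGate_ket {a b c : ℕ} (hab : a ≠ b) (hac : a ≠ c) (hbc : b ≠ c) (s : Finset ℕ) :
    gatesOp (ccxGate a b c) (ket s) = ket (if a ∈ s ∧ b ∈ s then symmDiff s {c} else s) := by
  rw [ccxGate, gatesOp_cons, gatesOp_append_apply]
  by_cases h : a ∈ s ∧ b ∈ s
  · rw [if_pos h, ← had_flip_ket, had_ket, gatesOp_cons, gatesOp_nil]
    simp only [map_smul, map_add, map_sub, cczGate_ket hab hac hbc, mem_erase,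
      mem_insert, hac, hbc, ne_eq, not_true_eq_false, false_and, and_false, if_false,
      one_smul, false_or, true_or, and_true, h, if_true, neg_smul, map_neg]
    module
  · rw [if_neg h]
    conv_rhs => rw [← had_had_ket c]
    rw [had_ket, gatesOp_cons, gatesOp_nil]
    simp only [map_smul, map_add, cczGate_ket hab hac hbc, mem_erase,
      mem_insert, hac, hbc, ne_eq, not_true_eq_false, false_and, and_false, if_false,
      one_smul, false_or, true_or, and_true, not_false_eq_true, true_and, if_neg h]

/-- Exchange two wires in a set of wires. -/
def swapSet (x y : ℕ) (s : Finset ℕ) : Finset ℕ := s.image (Equiv.swap x y)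

theorem mem_swapSet {x y u : ℕ} {s : Finset ℕ} : u ∈ swapSet x y s ↔ Equiv.swap x y u ∈ s := by
  rw [swapSet, mem_image]
  constructor
  · rintro ⟨w, hw, rfl⟩; simpa using hw
  · exact fun h => ⟨_, h, by simp⟩

/-- The controlled swap gate. -/
def cswapGate (c x y : ℕ) : List Gate := .cnot y x :: (ccxGate c x y ++ [.cnot y x])

theorem cswapGate_ket {c x y : ℕ} (hcx : c ≠ x) (hcy : c ≠ y) (hxy : x ≠ y) (s : Finset ℕ) :
    gatesOp (cswapGate c x y) (ket s) = ket (if c ∈ s then swapSet x y s else s) := by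
  rw [cswapGate, gatesOp_cons, gatesOp_append_apply, cnot_ket, ccxGate_ket hcx hcy hxy,
    gatesOp_cons, gatesOp_nil, cnot_ket]
  congr 1
  ext u
  by_cases hc : c ∈ s <;> by_cases hx : x ∈ s <;> by_cases hy : y ∈ s <;>
    by_cases hux : u = x <;> by_cases huy : u = y <;>
    simp_all [mem_symmDiff, mem_swapSet, Equiv.swap_apply_of_ne_of_ne, hxy.symm, eq_comm]

/-- Swap the `m` wires from `x` on with those from `y` on, controlled by `c`. -/
def cswapBlock (c x y m : ℕ) : List Gate := (List.range m).flatMap fun i => cswapGate c (x + i) (y + i)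

/-- The permutation of wires that exchanges two blocks. -/
def blockSwap (x y m u : ℕ) : ℕ :=
  if x ≤ u ∧ u < x + m then y + (u - x) else if y ≤ u ∧ u < y + m then x + (u - y) else u

theorem cswapBlock_ket {c x y m : ℕ} (hcx : c < x ∨ x + m ≤ c) (hcy : c < y ∨ y + m ≤ c)
    (hxy : x + m ≤ y ∨ y + m ≤ x) (s : Finset ℕ) :
    ∃ s', gatesOp (cswapBlock c x y m) (ket s) = ket s' ∧
      ∀ u, u ∈ s' ↔ (if c ∈ s then blockSwap x y m u else u) ∈ s := by
  induction m with
  | zero =>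
    refine ⟨s, by simp [cswapBlock], fun u => ?_⟩
    have : blockSwap x y 0 u = u := by
      rw [blockSwap, if_neg (by omega), if_neg (by omega)]
    simp [this]
  | succ m ih =>
    obtain ⟨s', h1, h2⟩ := ih (by omega) (by omega) (by omega)
    have hcs : c ∈ s' ↔ c ∈ s := by
      rw [h2]
      split_ifs with h
      · rw [show blockSwap x y m c = c by
          rw [blockSwap, if_neg (by omega), if_neg (by omega)]]
      · rfl
    refine ⟨if c ∈ s' then swapSet (x + m) (y + m) s' else s', ?_, fun u => ?_⟩
    · have e : cswapBlock c x y (m + 1) = cswapBlock c x y m ++ cswapGate c (x + m) (y + m) := by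
        simp [cswapBlock, List.range_succ]
      rw [e, gatesOp_append_apply, h1, cswapGate_ket (by omega) (by omega) (by omega)]
    · by_cases hc : c ∈ s
      · rw [if_pos (hcs.2 hc), if_pos hc, mem_swapSet, h2, if_pos hc]
        have : blockSwap x y m (Equiv.swap (x + m) (y + m) u) = blockSwap x y (m + 1) u := by
          by_cases h3 : u = x + m
          · subst h3
            rw [Equiv.swap_apply_left, blockSwap, blockSwap, if_neg (by omega), if_neg (by omega),
              if_pos (by omega)]
            omega
          · by_cases h4 : u = y + m
            · subst h4
              rw [Equiv.swap_apply_right, blockSwap, blockSwap, if_neg (by omega),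
                if_neg (by omega), if_neg (by omega), if_pos (by omega)]
              omega
            · rw [Equiv.swap_apply_of_ne_of_ne h3 h4, blockSwap, blockSwap]
              split_ifs <;> omega
        rw [this]
      · rw [if_neg fun h => hc (hcs.1 h), if_neg hc, h2, if_neg hc]

theorem xGate_length (i : ℕ) : (xGate i).length = 6 := rfl
theorem ccxGate_length (a b c : ℕ) : (ccxGate a b c).length = 33 := rfl
theorem cswapGate_length (a b c : ℕ) : (cswapGate a b c).length = 35 := rfl

theorem cswapBlock_length (c x y m : ℕ) : (cswapBlock c x y m).length = 35 * m := by
  simp [cswapBlock, List.length_flatMap, cswapGate_length, mul_comm]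

theorem xGate_below {i N : ℕ} (h : i < N) : ∀ g ∈ xGate i, g.Below N := by
  intro g hg
  simp only [xGate, List.mem_cons, List.mem_append, List.mem_replicate, List.not_mem_nil,
    or_false] at hg
  rcases hg with rfl | ⟨_, rfl⟩ | rfl <;> exact h

theorem ccxGate_below {a b c N : ℕ} (ha : a < N) (hb : b < N) (hc : c < N) :
    ∀ g ∈ ccxGate a b c, g.Below N := by
  intro g hg
  simp only [ccxGate, cczGate, List.mem_cons, List.mem_append, List.mem_replicate,
    List.not_mem_nil, or_false] at hg
  rcases hg with rfl | h
  · exact hc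
  rcases h with h | rfl
  · rcases h with ⟨_, rfl⟩ | ⟨_, rfl⟩ | ⟨_, rfl⟩ | rfl | ⟨_, rfl⟩ | rfl | rfl | ⟨_, rfl⟩ | rfl |
      ⟨_, rfl⟩ | rfl | ⟨_, rfl⟩ | rfl <;> simp only [Gate.Below] <;> omega
  · exact hc

theorem cswapGate_below {a b c N : ℕ} (ha : a < N) (hb : b < N) (hc : c < N) :
    ∀ g ∈ cswapGate a b c, g.Below N := by
  intro g hg
  simp only [cswapGate, List.mem_cons, List.mem_append, List.not_mem_nil, or_false] at hg
  rcases hg with rfl | h | rfl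
  · exact ⟨hc, hb⟩
  · exact ccxGate_below ha hb hc g h
  · exact ⟨hc, hb⟩

theorem cswapBlock_below {c x y m N : ℕ} (hc : c < N) (hx : x + m ≤ N) (hy : y + m ≤ N) :
    ∀ g ∈ cswapBlock c x y m, g.Below N := by
  intro g hg
  obtain ⟨i, hi, hg⟩ := List.mem_flatMap.1 hg
  have := List.mem_range.1 hi
  exact cswapGate_below hc (by omega) (by omega) g hg

/-- Flip `tgt` if all the wires in the list are set; the wires `t, t + 1, …` are scratch space. -/
def mcx : List ℕ → ℕ → ℕ → List Gate
  | [], tgt, _ => xGate tgt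
  | [w], tgt, _ => [.cnot w tgt]
  | w₁ :: w₂ :: ws, tgt, t => ccxGate w₁ w₂ t ++ (mcx (t :: ws) tgt (t + 1) ++ ccxGate w₁ w₂ t)
termination_by ws => ws.length

theorem mcx_ket (ws : List ℕ) (tgt t : ℕ) (hnd : ws.Nodup) (htgt : tgt ∉ ws) (hlt : ∀ w ∈ ws, w < t)
    (htt : tgt < t) (s : Finset ℕ) (hs : ∀ u, t ≤ u → u ∉ s) :
    gatesOp (mcx ws tgt t) (ket s) = ket (if ∀ w ∈ ws, w ∈ s then symmDiff s {tgt} else s) := by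
  induction h : ws.length using Nat.strong_induction_on generalizing ws t s with
  | _ k ih =>
    match ws, h with
    | [], _ => simp [mcx, xGate_ket]
    | [w], _ =>
      have : w ≠ tgt := fun h => htgt (by simp [h])
      simp [mcx, cnot_ket, this]
    | w₁ :: w₂ :: ws, h =>
      have h1 := hlt w₁ (by simp)
      have h2 := hlt w₂ (by simp)
      have h12 : w₁ ≠ w₂ := by
        rintro rfl; simp at hnd
      have hts : t ∉ s := hs t le_rfl
      simp only [List.nodup_cons, List.mem_cons, not_or] at hnd htgt
      have htws : t ∉ ws := fun h => by
        have := hlt t (by simp [h]); omega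
      rw [mcx, gatesOp_append_apply, gatesOp_append_apply, ccxGate_ket h12 (by omega) (by omega)]
      have hd : ∀ u w : ℕ, u ≠ w → ∀ s : Finset ℕ, (u ∈ symmDiff s {w} ↔ u ∈ s) := by
        intro u w huw s; simp [mem_symmDiff, huw]
      rw [ih (ws.length + 1) (by simp only [List.length_cons] at h; omega) (t :: ws) (t + 1)
        (by simp [htws, hnd.2.2]) (by simp [htgt.2.2]; omega)
        (by
          intro w hw
          rcases List.mem_cons.1 hw with rfl | hw
          · omega
          · have := hlt w (by simp [hw]); omega) (by omega) _
        (by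
          intro u hu
          split_ifs
          · rw [hd u t (by omega)]; exact hs u (by omega)
          · exact hs u (by omega)) rfl]
      rw [ccxGate_ket h12 (by omega) (by omega)]
      congr 1
      by_cases hA : w₁ ∈ s ∧ w₂ ∈ s
      · simp only [hA, and_self, if_true, List.forall_mem_cons, true_and]
        have e : t ∈ symmDiff s {t} := by simp [mem_symmDiff, hts]
        simp only [e, true_and]
        have e2 : (∀ w ∈ ws, w ∈ symmDiff s {t}) ↔ ∀ w ∈ ws, w ∈ s :=
          forall₂_congr fun w hw => hd w t (fun h => htws (h ▸ hw)) s
        simp only [e2]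
        have hw1 : w₁ ≠ t := by omega
        have hw2 : w₂ ≠ t := by omega
        have hg1 : w₁ ≠ tgt := fun h => htgt.1 h.symm
        have hg2 : w₂ ≠ tgt := fun h => htgt.2.1 h.symm
        by_cases h3 : ∀ w ∈ ws, w ∈ s
        · simp only [if_pos h3, hd w₁ tgt hg1, hd w₂ tgt hg2, hd w₁ t hw1, hd w₂ t hw2, hA,
            and_self, if_true]
          rw [symmDiff_right_comm, symmDiff_assoc s, symmDiff_self, symmDiff_bot]
        · simp only [if_neg h3, hd w₁ t hw1, hd w₂ t hw2, hA, and_self, if_true]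
          rw [symmDiff_assoc, symmDiff_self, symmDiff_bot]
      · have e : ¬ ∀ w ∈ t :: ws, w ∈ s := fun h => hts (h t (by simp))
        have e2 : ¬ ∀ w ∈ w₁ :: w₂ :: ws, w ∈ s := fun h => hA ⟨h _ (by simp), h _ (by simp)⟩
        simp only [hA, if_false, e, e2]

theorem mcx_length (ws : List ℕ) (tgt t : ℕ) : (mcx ws tgt t).length ≤ 66 * ws.length + 6 := by
  induction h : ws.length using Nat.strong_induction_on generalizing ws t with
  | _ k ih =>
    match ws, h with
    | [], h => simp [mcx, xGate_length]
    | [w], h => simp [mcx]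
    | w₁ :: w₂ :: ws, h =>
      have := ih (ws.length + 1) (by simp only [List.length_cons] at h; omega) (t :: ws) (t + 1) rfl
      simp only [List.length_cons] at h
      rw [mcx]
      simp only [List.length_append, ccxGate_length]
      omega

theorem mcx_below (ws : List ℕ) (tgt t N : ℕ) (hlt : ∀ w ∈ ws, w < t) (htt : tgt < t)
    (hN : t + ws.length ≤ N) : ∀ g ∈ mcx ws tgt t, g.Below N := by
  induction h : ws.length using Nat.strong_induction_on generalizing ws t with
  | _ k ih =>
    match ws, h with
    | [], h => rw [mcx]; exact xGate_below (by omega)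
    | [w], h =>
      have := hlt w (by simp)
      intro g hg
      simp only [mcx, List.mem_singleton] at hg
      subst hg
      exact ⟨by omega, by omega⟩
    | w₁ :: w₂ :: ws, h =>
      have h1 := hlt w₁ (by simp)
      have h2 := hlt w₂ (by simp)
      simp only [List.length_cons] at h hN
      have hb := ccxGate_below (a := w₁) (b := w₂) (c := t) (N := N) (by omega) (by omega) (by omega)
      intro g hg
      rw [mcx, List.mem_append, List.mem_append] at hg
      rcases hg with hg | hg | hg
      · exact hb g hg
      · refine ih (ws.length + 1) (by omega) (t :: ws) (t + 1) ?_ (by omega)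
          (by simp only [List.length_cons]; omega) rfl g hg
        intro w hw
        rcases List.mem_cons.1 hw with rfl | hw
        · omega
        · have := hlt w (by simp [hw]); omega
      · exact hb g hg

/-- `X` gates on the wires of a window at which the string `x` has the entry `false`. -/
def maskGates (a : ℕ) {k : ℕ} (x : Bits k) : List Gate :=
  (List.finRange k).flatMap fun i => if x i then [] else xGate (a + i)

/-- Flip `tgt` if the string found on the wires `a, a + 1, …` is `x`. -/
def patternGate (a : ℕ) {k : ℕ} (x : Bits k) (tgt t : ℕ) : List Gate :=
  maskGates a x ++ (mcx ((List.range k).map (a + ·)) tgt t ++ maskGates a x)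

theorem flatMap_xGate_ket {α : Type*} (l : List α) (f : α → ℕ) (p : α → Bool) (hf : (l.map f).Nodup)
    (s : Finset ℕ) :
    ∃ s', gatesOp (l.flatMap fun i => if p i then [] else xGate (f i)) (ket s) = ket s' ∧
      ∀ u, u ∈ s' ↔ (u ∈ s ↔ ¬ ∃ i ∈ l, p i = false ∧ f i = u) := by
  induction l generalizing s with
  | nil => exact ⟨s, by simp, by simp⟩
  | cons i l ih =>
    simp only [List.map_cons, List.nodup_cons] at hf
    simp only [List.flatMap_cons, gatesOp_append_apply]
    cases hp : p i with
    | true =>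
      obtain ⟨s', h1, h2⟩ := ih hf.2 s
      refine ⟨s', by simpa using h1, fun u => ?_⟩
      simp [h2, hp]
    | false =>
      obtain ⟨s', h1, h2⟩ := ih hf.2 (symmDiff s {f i})
      refine ⟨s', by simpa [xGate_ket] using h1, fun u => ?_⟩
      rw [h2]
      simp only [mem_symmDiff, mem_singleton, List.mem_cons, exists_eq_or_imp, hp,
        true_and]
      by_cases hu : u = f i
      · subst hu
        have : ¬ ∃ j ∈ l, p j = false ∧ f j = f i := by
          rintro ⟨j, hj, _, he⟩
          exact hf.1 (List.mem_map.2 ⟨j, hj, he⟩)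
        simp [this]
      · have hu' : f i ≠ u := fun h => hu h.symm
        simp [hu, hu']

theorem maskGates_ket {a k : ℕ} (x : Bits k) (s : Finset ℕ) :
    ∃ s', gatesOp (maskGates a x) (ket s) = ket s' ∧
      ∀ u, u ∈ s' ↔ (u ∈ s ↔ ¬ ∃ i : Fin k, x i = false ∧ a + (i : ℕ) = u) := by
  obtain ⟨s', h1, h2⟩ := flatMap_xGate_ket (List.finRange k) (fun i => a + (i : ℕ)) x
    ((List.nodup_finRange k).map fun i j h => Fin.ext (by simpa using h)) s
  exact ⟨s', h1, fun u => by rw [h2]; simp⟩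

theorem patternGate_ket {a k tgt t : ℕ} (x : Bits k) (htgt : tgt < a ∨ a + k ≤ tgt) (hk : a + k ≤ t)
    (htt : tgt < t) {s : Finset ℕ} (hs : ∀ u, t ≤ u → u ∉ s) :
    gatesOp (patternGate a x tgt t) (ket s) =
      ket (if readAt a k s = x then symmDiff s {tgt} else s) := by
  obtain ⟨s₁, h1, h2⟩ := maskGates_ket (a := a) x s
  rw [patternGate, gatesOp_append_apply, gatesOp_append_apply, h1, mcx_ket]
  · have hiff : (∀ w ∈ (List.range k).map (a + ·), w ∈ s₁) ↔ readAt a k s = x := by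
      rw [readAt_eq]
      simp only [List.mem_map, List.mem_range, forall_exists_index, and_imp,
        forall_apply_eq_imp_iff₂, h2]
      constructor
      · intro h i
        rw [h i i.2]
        constructor
        · intro h3
          by_contra h4
          exact h3 ⟨i, by simpa using h4, rfl⟩
        · rintro h3 ⟨j, hj, he⟩
          rw [show j = i from Fin.ext (by omega), h3] at hj
          simp at hj
      · intro h i hi
        rw [h ⟨i, hi⟩]
        constructor
        · rintro h3 ⟨j, hj, he⟩
          rw [show j = ⟨i, hi⟩ from Fin.ext (by simpa using he), h3] at hj
          simp at hj
        · intro h3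
          by_contra h4
          exact h3 ⟨⟨i, hi⟩, by simpa using h4, rfl⟩
    simp only [hiff]
    split_ifs
    · obtain ⟨s₂, h3, h4⟩ := maskGates_ket (a := a) x (symmDiff s₁ {tgt})
      rw [h3]
      congr 1
      ext u
      rw [h4, mem_symmDiff, h2, mem_symmDiff, mem_singleton]
      by_cases hu : u = tgt
      · subst hu
        have : ¬ ∃ i : Fin k, x i = false ∧ a + (i : ℕ) = u := by
          rintro ⟨i, _, he⟩; have := i.2; omega
        simp [this]
      · simp only [hu, not_false_eq_true, and_true, false_and, or_false]
        by_cases h5 : ∃ i : Fin k, x i = false ∧ a + (i : ℕ) = u <;> simp [h5]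
    · obtain ⟨s₂, h3, h4⟩ := maskGates_ket (a := a) x s₁
      rw [h3]
      congr 1
      ext u
      rw [h4, h2]
      by_cases h5 : ∃ i : Fin k, x i = false ∧ a + (i : ℕ) = u <;> simp [h5]
  · refine (List.nodup_range).map fun i j h => ?_
    simpa using h
  · simp only [List.mem_map, List.mem_range, not_exists, not_and]
    intro i hi; omega
  · intro w hw
    obtain ⟨i, hi, rfl⟩ := List.mem_map.1 hw
    have := List.mem_range.1 hi
    omega
  · exact htt
  · intro u hu
    rw [h2]
    have : ¬ ∃ i : Fin k, x i = false ∧ a + (i : ℕ) = u := by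
      rintro ⟨i, _, he⟩; have := i.2; omega
    simp [this, hs u hu]

theorem maskGates_length (a : ℕ) {k : ℕ} (x : Bits k) : (maskGates a x).length ≤ 6 * k := by
  have : (maskGates a x).length ≤ ((List.finRange k).map fun _ => 6).sum := by
    rw [maskGates, List.length_flatMap]
    refine List.sum_le_sum fun i _ => ?_
    split_ifs <;> simp [xGate_length]
  simpa [mul_comm] using this

theorem patternGate_length (a : ℕ) {k : ℕ} (x : Bits k) (tgt t : ℕ) :
    (patternGate a x tgt t).length ≤ 78 * k + 6 := by
  have h1 := maskGates_length a x
  have h2 := mcx_length ((List.range k).map (a + ·)) tgt t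
  simp only [patternGate, List.length_append, List.length_map, List.length_range] at h2 ⊢
  omega

theorem maskGates_below {a k N : ℕ} (x : Bits k) (hN : a + k ≤ N) :
    ∀ g ∈ maskGates a x, g.Below N := by
  intro g hg
  obtain ⟨i, _, hg⟩ := List.mem_flatMap.1 hg
  split_ifs at hg
  · simp at hg
  · exact xGate_below (by have := i.2; omega) g hg

theorem patternGate_below {a k tgt t N : ℕ} (x : Bits k) (hk : a + k ≤ t) (htt : tgt < t)
    (hN : t + k ≤ N) : ∀ g ∈ patternGate a x tgt t, g.Below N := by
  intro g hg
  rw [patternGate, List.mem_append, List.mem_append] at hg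
  rcases hg with hg | hg | hg
  · exact maskGates_below x (by omega) g hg
  · refine mcx_below _ tgt t N ?_ htt (by simpa using hN) g hg
    intro w hw
    obtain ⟨i, hi, rfl⟩ := List.mem_map.1 hw
    have := List.mem_range.1 hi
    omega
  · exact maskGates_below x (by omega) g hg

/-! ### Renaming wires -/

/-- The wires on which a gate acts. -/
def Gate.wires : Gate → List ℕ
  | .had i => [i]
  | .tee i => [i]
  | .cnot i j => [i, j]

/-- Rename the wires of a gate. -/
def Gate.map (f : ℕ → ℕ) : Gate → Gate
  | .had i => .had (f i)
  | .tee i => .tee (f i)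
  | .cnot i j => .cnot (f i) (f j)

/-- Rename the wires of a state by `f`, and set the wires in `g`. -/
def embed (f : ℕ → ℕ) (g : Finset ℕ) : Workspace →ₗ[ℂ] Workspace :=
  ofBasis fun s => ket (g ∪ s.image f)

theorem embed_ket (f : ℕ → ℕ) (g s : Finset ℕ) : embed f g (ket s) = ket (g ∪ s.image f) :=
  ofBasis_ket _ _

theorem Gate.op_embed {f : ℕ → ℕ} (hf : Function.Injective f) {t : Finset ℕ} (g : Gate)
    (h : ∀ i ∈ g.wires, f i ∉ t) (v : Workspace) :
    (g.map f).op (embed f t v) = embed f t (g.op v) := by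
  suffices H : (g.map f).op ∘ₗ embed f t = embed f t ∘ₗ g.op from LinearMap.congr_fun H v
  refine linearMap_ext_ket fun s => ?_
  simp only [LinearMap.comp_apply, embed_ket]
  have hmem : ∀ i, f i ∉ t → (f i ∈ t ∪ s.image f ↔ i ∈ s) := by
    intro i hi
    simp only [mem_union, hi, false_or, mem_image]
    exact ⟨fun ⟨j, hj, he⟩ => hf he ▸ hj, fun hj => ⟨i, hj, rfl⟩⟩
  cases g with
  | had i =>
    have hi : f i ∉ t := h i (by simp [Gate.wires])
    have e1 : (t ∪ s.image f).erase (f i) = t ∪ (s.erase i).image f := by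
      rw [Finset.erase_union_distrib, Finset.erase_eq_of_notMem hi, Finset.image_erase hf]
    have e2 : insert (f i) (t ∪ s.image f) = t ∪ (insert i s).image f := by
      rw [Finset.image_insert, Finset.union_insert]
    simp only [Gate.map, had_ket, e1, e2, hmem i hi, map_smul, map_add, embed_ket]
  | tee i =>
    have hi : f i ∉ t := h i (by simp [Gate.wires])
    simp only [Gate.map, Gate.op, ofBasis_ket, hmem i hi, map_smul, embed_ket]
  | cnot i j =>
    have hi : f i ∉ t := h i (by simp [Gate.wires])
    have hj : f j ∉ t := h j (by simp [Gate.wires])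
    have e : symmDiff (t ∪ s.image f) {f j} = t ∪ (symmDiff s {j}).image f := by
      rw [Finset.image_symmDiff _ _ hf, Finset.image_singleton]
      ext x
      simp only [mem_symmDiff, mem_union, mem_singleton]
      by_cases hx : x = f j
      · subst hx; simp [hj]
      · simp [hx]
    simp only [Gate.map, cnot_ket, hmem i hi, hf.ne_iff, embed_ket]
    split_ifs
    · rw [e]
    · rfl

theorem gatesOp_embed {f : ℕ → ℕ} (hf : Function.Injective f) {t : Finset ℕ} (c : List Gate)
    (h : ∀ g ∈ c, ∀ i ∈ g.wires, f i ∉ t) (v : Workspace) :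
    gatesOp (c.map (Gate.map f)) (embed f t v) = embed f t (gatesOp c v) := by
  induction c generalizing v with
  | nil => simp
  | cons g c ih =>
    rw [List.map_cons, gatesOp_cons, gatesOp_cons, Gate.op_embed hf g (h g (by simp)),
      ih fun g' hg' => h g' (by simp [hg'])]

theorem Gate.map_id (g : Gate) : g.map id = g := by cases g <;> rfl

theorem Gate.below_iff {N : ℕ} {g : Gate} : g.Below N ↔ ∀ i ∈ g.wires, i < N := by
  cases g <;> simp [Gate.Below, Gate.wires]

theorem Gate.wires_map (f : ℕ → ℕ) (g : Gate) : (g.map f).wires = g.wires.map f := by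
  cases g <;> rfl

/-- Set the wires in `g`. -/
def attach (g : Finset ℕ) : Workspace →ₗ[ℂ] Workspace := embed id g

theorem attach_ket (g s : Finset ℕ) : attach g (ket s) = ket (g ∪ s) := by
  rw [attach, embed_ket, Finset.image_id]

theorem attach_empty (v : Workspace) : attach ∅ v = v := by
  suffices H : attach ∅ = LinearMap.id from LinearMap.congr_fun H v
  exact linearMap_ext_ket fun s => by simp [attach_ket]

theorem attach_attach (g h : Finset ℕ) (v : Workspace) : attach g (attach h v) = attach (g ∪ h) v := by
  suffices H : attach g ∘ₗ attach h = attach (g ∪ h) from LinearMap.congr_fun H v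
  exact linearMap_ext_ket fun s => by simp [attach_ket, union_assoc]

theorem gatesOp_attach {N : ℕ} {c : List Gate} (hc : ∀ g ∈ c, g.Below N) {t : Finset ℕ}
    (ht : ∀ x ∈ t, N ≤ x) (v : Workspace) : gatesOp c (attach t v) = attach t (gatesOp c v) := by
  have := gatesOp_embed Function.injective_id (t := t) c
    (fun g hg i hi hit => by
      have := Gate.below_iff.1 (hc g hg) i hi
      have := ht _ hit
      simp only [id] at this
      omega) v
  rwa [show c.map (Gate.map id) = c from by
    rw [List.map_congr_left fun g _ => Gate.map_id g, List.map_id']] at this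

theorem attach_mem_low {N M : ℕ} {t : Finset ℕ} (ht : t ⊆ range M) (hNM : N ≤ M) {v : Workspace}
    (hv : v ∈ low N) : attach t v ∈ low M := by
  refine map_mem_of_low (fun s hs => ?_) hv
  rw [attach_ket]
  exact ket_mem_low (Finset.union_subset ht (hs.trans (Finset.range_mono hNM)))

theorem window_attach {k l a : ℕ} (K : Matrix (Bits l) (Bits k) ℂ) {t : Finset ℕ}
    (ht : ∀ x ∈ t, a + k ≤ x) (v : Workspace) :
    window K a (attach t v) = attach t (window K a v) := by
  suffices H : window K a ∘ₗ attach t = attach t ∘ₗ window K a from LinearMap.congr_fun H v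
  refine linearMap_ext_ket fun s => ?_
  simp only [LinearMap.comp_apply, attach_ket, window_ket, map_sum, map_smul]
  have e1 : readAt a k (t ∪ s) = readAt a k s := by
    funext i
    simp only [readAt, mem_union]
    have : a + (i : ℕ) ∉ t := fun h => by have := ht _ h; have := i.2; omega
    simp [this]
  have e2 : clearAt a k (t ∪ s) = t ∪ clearAt a k s := by
    ext x
    simp only [mem_clearAt, mem_union]
    constructor
    · rintro ⟨h | h, h'⟩
      · exact Or.inl h
      · exact Or.inr ⟨h, h'⟩
    · rintro (h | ⟨h, h'⟩)
      · exact ⟨Or.inl h, Or.inr (ht _ h)⟩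
      · exact ⟨Or.inr h, h'⟩
  simp only [e1, e2, union_assoc]

/-! ### Functionals that ignore fresh wires -/

/-- The functional `F` does not look at the wires `M, M + 1, …`, so that fresh wires can be used
to store garbage. -/
def Local (M : ℕ) (F : Workspace → ℝ) : Prop :=
  ∀ w, M ≤ w → ∀ u₀ ∈ low w, ∀ u₁ ∈ low w, F (u₀ + attach {w} u₁) = F u₀ + F u₁

theorem Local.mono {M M' : ℕ} (h : M ≤ M') {F : Workspace → ℝ} (hF : Local M F) : Local M' F :=
  fun w hw => hF w (h.trans hw)

theorem Local.comp {M : ℕ} {F : Workspace → ℝ} (hF : Local M F) {c : List Gate}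
    (hc : ∀ g ∈ c, g.Below M) : Local M fun v => F (gatesOp c v) := by
  intro w hw u₀ h₀ u₁ h₁
  have hc' : ∀ g ∈ c, g.Below w := fun g hg => (hc g hg).mono hw
  simp only [map_add]
  rw [gatesOp_attach hc' (by simp)]
  exact hF w hw _ (gatesOp_low hc' h₀) _ (gatesOp_low hc' h₁)

theorem local_sqNorm : Local 0 sqNorm := by
  intro w _ u₀ h₀ u₁ h₁
  have hs : {w} ⊆ range (w + 1) := by simp
  have hsum : u₀ + attach {w} u₁ ∈ low (w + 1) :=
    Submodule.add_mem _ (low_mono (Nat.le_succ w) h₀) (attach_mem_low hs (Nat.le_succ w) h₁)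
  rw [sqNorm_low hsum, sqNorm_low h₀, sqNorm_low h₁, Finset.range_add_one,
    sum_powerset_insert Finset.notMem_range_self]
  have hatt : ∀ s, attach {w} u₁ s = if w ∈ s then u₁ (s.erase w) else 0 := by
    intro s
    have e := eq_sum_ket u₁ (mem_low_iff_support.1 h₁)
    conv_lhs => rw [e]
    simp only [map_sum, map_smul, attach_ket, Finsupp.finsetSum_apply, Finsupp.smul_apply,
      ket_apply, smul_eq_mul, mul_ite, mul_one, mul_zero]
    split_ifs with hw
    · by_cases hsub : s.erase w ∈ (range w).powerset
      · rw [sum_eq_single_of_mem (s.erase w) hsub]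
        · rw [if_pos]
          rw [← Finset.insert_eq, insert_erase hw]
        · intro b hb hne
          rw [if_neg]
          rintro rfl
          apply hne
          rw [← Finset.insert_eq, erase_insert]
          exact fun h => by simpa using mem_powerset.1 hb h
      · have : u₁ (s.erase w) = 0 := by
          by_contra h
          exact hsub (mem_powerset.2 (mem_low.1 h₁ _ h))
        rw [this]
        refine sum_eq_zero fun b hb => if_neg ?_
        rintro rfl
        apply hsub
        rw [← Finset.insert_eq, erase_insert]
        · exact hb
        · exact fun h => by simpa using mem_powerset.1 hb h
    · refine sum_eq_zero fun b hb => if_neg ?_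
      rintro rfl
      simp at hw
  have hnot : ∀ s ∈ (range w).powerset, w ∉ s := fun s hs h => by
    simpa using mem_powerset.1 hs h
  congr 1 <;> refine sum_congr rfl fun s hs => ?_
  · rw [Finsupp.add_apply, hatt, if_neg (hnot s hs), add_zero]
  · have : u₀ (insert w s) = 0 := by
      by_contra h
      simpa using mem_low.1 h₀ _ h (mem_insert_self w s)
    rw [Finsupp.add_apply, hatt, if_pos (mem_insert_self w s), this, zero_add,
      erase_insert (hnot s hs)]

theorem local_fidAt {n : ℕ} (ψ : PureState n) (b : ℕ) : Local (b + n) (fidAt ψ b) := by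
  intro w hw u₀ h₀ u₁ h₁
  simp only [fidAt, map_add]
  refine (congrArg (fun z => sqNorm (_ + z)) (window_attach
    (fun (_ : Bits 0) (x : Bits n) => (starRingEnd ℂ) (ψ.1 x)) (by simpa using hw) u₁)).trans ?_
  exact local_sqNorm w (Nat.zero_le _) _ (window_low (Nat.zero_le n) hw _ h₀) _
    (window_low (Nat.zero_le n) hw _ h₁)

theorem Local.sum {M : ℕ} {F : Workspace → ℝ} (hF : Local M F) (hq : IsSumSq F) {ι : Type*}
    (S : Finset ι) (g : ι → Finset ℕ) (hg : Set.InjOn g S) (hd : ∀ i ∈ S, ∀ x ∈ g i, M ≤ x)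
    (u : ι → Workspace) (hu : ∀ i ∈ S, u i ∈ low M) :
    F (∑ i ∈ S, attach (g i) (u i)) = ∑ i ∈ S, F (u i) := by
  classical
  have key : ∀ (W : ℕ) (S : Finset ι) (g : ι → Finset ℕ), Set.InjOn g S →
      (∀ i ∈ S, ∀ x ∈ g i, M ≤ x ∧ x < M + W) → (∀ i ∈ S, u i ∈ low M) →
      F (∑ i ∈ S, attach (g i) (u i)) = ∑ i ∈ S, F (u i) := by
    intro W
    induction W with
    | zero =>
      intro S g hg hd hu
      have he : ∀ i ∈ S, g i = ∅ := fun i hi => Finset.eq_empty_of_forall_notMem fun x hx => by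
        have := hd i hi x hx; omega
      have hcard : S.card ≤ 1 := Finset.card_le_one.2 fun i hi j hj =>
        hg hi hj ((he i hi).trans (he j hj).symm)
      rcases Nat.le_one_iff_eq_zero_or_eq_one.1 hcard with h | h
      · rw [Finset.card_eq_zero] at h
        subst h
        simp [hq.zero]
      · obtain ⟨i, rfl⟩ := Finset.card_eq_one.1 h
        simp [he i (by simp), attach_empty]
    | succ W ih =>
      intro S g hg hd hu
      have hlow : ∀ (S : Finset ι) (g : ι → Finset ℕ), (∀ i ∈ S, ∀ x ∈ g i, x < M + W) →
          (∀ i ∈ S, u i ∈ low M) → ∑ i ∈ S, attach (g i) (u i) ∈ low (M + W) := by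
        intro S g hd hu
        refine Submodule.sum_mem _ fun i hi => attach_mem_low ?_ (Nat.le_add_right M W) (hu i hi)
        exact fun x hx => Finset.mem_range.2 (hd i hi x hx)
      set S₀ := S.filter fun i => M + W ∉ g i
      set S₁ := S.filter fun i => ¬ M + W ∉ g i
      have e1 : ∑ i ∈ S₁, attach (g i) (u i) =
          attach {M + W} (∑ i ∈ S₁, attach ((g i).erase (M + W)) (u i)) := by
        rw [map_sum]
        refine sum_congr rfl fun i hi => ?_
        have : M + W ∈ g i := not_not.1 (mem_filter.1 hi).2
        rw [attach_attach, ← Finset.insert_eq, insert_erase this]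
      have h0 : ∀ i ∈ S₀, i ∈ S := fun i hi => (mem_filter.1 hi).1
      have h1 : ∀ i ∈ S₁, i ∈ S := fun i hi => (mem_filter.1 hi).1
      have b0 : ∀ i ∈ S₀, ∀ x ∈ g i, M ≤ x ∧ x < M + W := by
        intro i hi x hx
        have := hd i (h0 i hi) x hx
        have h2 : x ≠ M + W := fun h => (mem_filter.1 hi).2 (h ▸ hx)
        omega
      have b1 : ∀ i ∈ S₁, ∀ x ∈ (g i).erase (M + W), M ≤ x ∧ x < M + W := by
        intro i hi x hx
        have := hd i (h1 i hi) x (Finset.mem_of_mem_erase hx)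
        have h2 : x ≠ M + W := Finset.ne_of_mem_erase hx
        omega
      rw [← sum_filter_add_sum_filter_not S (fun i => M + W ∉ g i),
        ← sum_filter_add_sum_filter_not S (fun i => M + W ∉ g i), e1,
        hF (M + W) (Nat.le_add_right M W) _ (hlow _ _ (fun i hi x hx => (b0 i hi x hx).2)
          fun i hi => hu i (h0 i hi)) _ (hlow _ _ (fun i hi x hx => (b1 i hi x hx).2)
          fun i hi => hu i (h1 i hi)),
        ih S₀ g (fun i hi j hj h => hg (h0 i hi) (h0 j hj) h) b0 fun i hi => hu i (h0 i hi),
        ih S₁ (fun i => (g i).erase (M + W)) (fun i hi j hj h => hg (h1 i hi) (h1 j hj) ?_) b1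
          fun i hi => hu i (h1 i hi)]
      have hi' : M + W ∈ g i := not_not.1 (mem_filter.1 hi).2
      have hj' : M + W ∈ g j := not_not.1 (mem_filter.1 hj).2
      rw [← insert_erase hi', ← insert_erase hj']
      exact congrArg _ h
  obtain ⟨B, hB⟩ := ((S.biUnion g).exists_nat_subset_range)
  refine key B S g hg (fun i hi x hx => ⟨hd i hi x hx, ?_⟩) hu
  have := Finset.mem_range.1 (hB (mem_biUnion.2 ⟨i, hi, hx⟩))
  omega

theorem IsSumSq.gatesOp {F : Workspace → ℝ} (h : IsSumSq F) (c : List Gate) :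
    IsSumSq fun v => F (ChannelOracles.gatesOp c v) := h.comp _

/-! ### Loading a state that a circuit with measurement prepares with some probability -/

theorem mem_place_iff {a k u : ℕ} {x : Bits k} :
    u ∈ place a x ↔ ∃ h : a ≤ u ∧ u < a + k, x ⟨u - a, by omega⟩ = true := by
  rw [mem_place]
  constructor
  · rintro ⟨i, hi, rfl⟩
    refine ⟨⟨Nat.le_add_right _ _, by have := i.2; omega⟩, ?_⟩
    rw [← hi]
    congr 1
    exact Fin.ext (Nat.add_sub_cancel_left _ _)
  · rintro ⟨h, hx⟩
    exact ⟨_, hx, by simp only; omega⟩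

theorem image_place (a b : ℕ) {k : ℕ} (x : Bits k) : (place a x).image (· + b) = place (a + b) x := by
  ext u
  simp only [mem_image, mem_place]
  constructor
  · rintro ⟨_, ⟨i, hi, rfl⟩, rfl⟩; exact ⟨i, hi, by omega⟩
  · rintro ⟨i, hi, rfl⟩; exact ⟨_, ⟨i, hi, rfl⟩, by omega⟩

theorem sum_powerset_two_windows {E : Type*} [AddCommMonoid E] (m : ℕ) (f : Finset ℕ → E) :
    ∑ s ∈ (range (2 * m)).powerset, f s = ∑ x : Bits m, ∑ y : Bits m, f (place 0 x ∪ place m y) := by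
  rw [sum_powerset_window (a := m) (k := m) (by omega)]
  have e : range (2 * m) \ Ico m (m + m) = range m := by
    ext u; simp only [mem_sdiff, Finset.mem_range, mem_Ico]; omega
  rw [e, sum_powerset_window (a := 0) (k := m) (by omega)]
  have e : range m \ Ico 0 (0 + m) = ∅ := by
    ext u; simp
  rw [e]
  simp

/-- Add the state `φ` on the (empty) wires `Y, Y + 1, …`. -/
def loadOp (Y : ℕ) {k : ℕ} (φ : Bits k → ℂ) : Workspace →ₗ[ℂ] Workspace :=
  ∑ x, φ x • attach (place Y x)

theorem loadOp_apply (Y : ℕ) {k : ℕ} (φ : Bits k → ℂ) (v : Workspace) :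
    loadOp Y φ v = ∑ x, φ x • attach (place Y x) v := by
  simp [loadOp]

theorem place_subset_range {a k N : ℕ} (h : a + k ≤ N) (x : Bits k) : place a x ⊆ range N := by
  intro u hu
  obtain ⟨h', _⟩ := mem_place_iff.1 hu
  exact Finset.mem_range.2 (by omega)

theorem loadOp_low {Y k M : ℕ} (h : Y + k ≤ M) (φ : Bits k → ℂ) {v : Workspace} (hv : v ∈ low M) :
    loadOp Y φ v ∈ low M := by
  rw [loadOp_apply]
  exact Submodule.sum_mem _ fun x _ => Submodule.smul_mem _ _
    (attach_mem_low (place_subset_range h x) le_rfl hv)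

/-- The part of the state that has the string `z` on the wires `Y, Y + 1, …`, which are reset. -/
def pick (Y : ℕ) {k : ℕ} (z : Bits k) : Workspace →ₗ[ℂ] Workspace :=
  ofBasis fun s => if readAt Y k s = z then ket (clearAt Y k s) else 0

theorem pick_ket (Y : ℕ) {k : ℕ} (z : Bits k) (s : Finset ℕ) :
    pick Y z (ket s) = if readAt Y k s = z then ket (clearAt Y k s) else 0 :=
  ofBasis_ket _ _

theorem pick_low {Y k M : ℕ} (z : Bits k) {v : Workspace} (hv : v ∈ low M) : pick Y z v ∈ low M := by
  refine map_mem_of_low (fun s hs => ?_) hv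
  rw [pick_ket]
  split_ifs
  · exact ket_mem_low (Finset.sdiff_subset.trans hs)
  · exact Submodule.zero_mem _

theorem readAt_place_union {Y k : ℕ} {s : Finset ℕ} (hs : ∀ u ∈ s, u < Y ∨ Y + k ≤ u) (x : Bits k) :
    readAt Y k (place Y x ∪ s) = x := by
  rw [readAt_eq]
  intro i
  rw [mem_union, mem_place_add]
  have : Y + (i : ℕ) ∉ s := fun h => by
    have := hs _ h
    have := i.2
    omega
  simp [this]

theorem clearAt_place_union {Y k : ℕ} {s : Finset ℕ} (hs : ∀ u ∈ s, u < Y ∨ Y + k ≤ u) (x : Bits k) :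
    clearAt Y k (place Y x ∪ s) = s := by
  ext u
  rw [mem_clearAt, mem_union]
  constructor
  · rintro ⟨h | h, h'⟩
    · obtain ⟨_, _⟩ := mem_place_iff.1 h; omega
    · exact h
  · exact fun h => ⟨Or.inr h, hs u h⟩

theorem pick_attach_place {Y k : ℕ} (z x : Bits k) {v : Workspace} (hv : v ∈ low Y) :
    pick Y z (attach (place Y x) v) = if x = z then v else 0 := by
  have : (pick Y z ∘ₗ attach (place Y x)) v = (if x = z then LinearMap.id else (0 : Workspace →ₗ[ℂ] Workspace)) v := by
    refine eq_on_low (fun s hs => ?_) hv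
    have hs' : ∀ u ∈ s, u < Y ∨ Y + k ≤ u := fun u hu => Or.inl (Finset.mem_range.1 (hs hu))
    rw [LinearMap.comp_apply, attach_ket, pick_ket, readAt_place_union hs', clearAt_place_union hs']
    split_ifs <;> rfl
  rw [LinearMap.comp_apply] at this
  rw [this]
  split_ifs <;> rfl

theorem pick_loadOp {Y k : ℕ} (z : Bits k) (φ : Bits k → ℂ) {v : Workspace} (hv : v ∈ low Y) :
    pick Y z (loadOp Y φ v) = φ z • v := by
  rw [loadOp_apply, map_sum]
  simp only [map_smul, pick_attach_place z _ hv]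
  simp

theorem place_false (Y k : ℕ) : place Y (fun _ : Fin k => false) = ∅ := by
  simp [place]

theorem pick_of_low {Y k : ℕ} (z : Bits k) {v : Workspace} (hv : v ∈ low Y) :
    pick Y z v = if (fun _ => false) = z then v else 0 := by
  have := pick_attach_place z (fun _ => false) hv
  rwa [place_false, attach_empty] at this

/-- One attempt at loading a state on the wires from `Y` on: run the circuit on fresh wires, and
if the first half of its output is `o`, exchange the second half with the wires from `Y` on. -/
def trial (c : List Gate) {m : ℕ} (o : Bits m) (Y M : ℕ) : List Gate :=
  c.map (Gate.map (· + (M + 1))) ++ (patternGate (M + 1) o M (M + 1 + 2 * m) ++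
    cswapBlock M Y (M + 1 + m) m)

theorem gatesOp_shift_ket {c : List Gate} {m : ℕ} (hc : ∀ g ∈ c, g.Below (2 * m)) {Q : ℕ}
    {s : Finset ℕ} (hs : ∀ u ∈ s, u < Q) : gatesOp (c.map (Gate.map (· + Q))) (ket s) =
      ∑ x : Bits m, ∑ y : Bits m, gatesOp c (ket ∅) (place 0 x ∪ place m y) •
        ket (s ∪ (place Q x ∪ place (Q + m) y)) := by
  have e : ket s = embed (· + Q) s (ket ∅) := by simp [embed_ket]
  rw [e, gatesOp_embed (add_left_injective _)]
  · have hlow : gatesOp c (ket ∅) ∈ low (2 * m) := gatesOp_low hc (ket_mem_low (by simp))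
    conv_lhs => rw [eq_sum_ket _ (mem_low_iff_support.1 hlow), sum_powerset_two_windows]
    simp only [map_sum, map_smul, embed_ket, Finset.image_union, image_place, zero_add]
    rw [Nat.add_comm m Q]
  · intro g _ i _ hi
    have := hs _ hi
    omega

theorem trial_ket {c : List Gate} {m : ℕ} (hc : ∀ g ∈ c, g.Below (2 * m)) (o : Bits m) {Y M : ℕ}
    (hY : Y + m ≤ M) {s : Finset ℕ} (hs : s ⊆ range M) :
    gatesOp (trial c o Y M) (ket s) =
      ∑ x : Bits m, ∑ y : Bits m, gatesOp c (ket ∅) (place 0 x ∪ place m y) •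
        (if x = o then ket (insert M (place (M + 1) o ∪ place (M + 1 + m) (readAt Y m s)) ∪
          (place Y y ∪ clearAt Y m s))
        else ket (place (M + 1) x ∪ place (M + 1 + m) y ∪ s)) := by
  have hsM : ∀ u ∈ s, u < M := fun u hu => Finset.mem_range.1 (hs hu)
  rw [trial, gatesOp_append_apply, gatesOp_append_apply,
    gatesOp_shift_ket hc fun u hu => Nat.lt_succ_of_lt (hsM u hu)]
  simp only [map_sum, map_smul]
  refine sum_congr rfl fun x _ => sum_congr rfl fun y _ => ?_
  congr 1
  have hr : readAt (M + 1) m (s ∪ (place (M + 1) x ∪ place (M + 1 + m) y)) = x := by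
    rw [← union_assoc, union_comm s, union_assoc]
    refine readAt_place_union (fun u hu => ?_) x
    rcases mem_union.1 hu with hu | hu
    · have := hsM u hu; omega
    · obtain ⟨_, _⟩ := mem_place_iff.1 hu; omega
  rw [patternGate_ket o (by omega) (by omega) (by omega) (fun u hu h => ?_), hr]
  · split_ifs with hx
    · subst hx
      obtain ⟨s', h1, h2⟩ := cswapBlock_ket (c := M) (x := Y) (y := M + 1 + m) (m := m) (by omega)
        (by omega) (by omega) (symmDiff (s ∪ (place (M + 1) x ∪ place (M + 1 + m) y)) {M})
      rw [h1]
      congr 1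
      have hM : M ∈ symmDiff (s ∪ (place (M + 1) x ∪ place (M + 1 + m) y)) {M} := by
        rw [mem_symmDiff]
        refine Or.inr ⟨by simp, fun h => ?_⟩
        simp only [mem_union, mem_place_iff] at h
        rcases h with h | ⟨h, _⟩ | ⟨h, _⟩
        · exact absurd (hsM _ h) (by omega)
        · omega
        · omega
      ext u
      rw [h2, if_pos hM]
      simp only [mem_symmDiff, mem_singleton, mem_union, mem_insert,
        mem_clearAt]
      have nm : ∀ a, M ≤ a → a ∉ s := fun a ha h => absurd (hsM a h) (by omega)
      by_cases hu1 : Y ≤ u ∧ u < Y + m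
      · rw [blockSwap, if_pos hu1]
        have a1 : M + 1 + m + (u - Y) ∉ s := nm _ (by omega)
        have a2 : M + 1 + m + (u - Y) ∉ place (M + 1) x := notMem_place (by omega)
        have a3 : M + 1 + m + (u - Y) ≠ M := by omega
        have a4 : u ∉ place (M + 1) x := notMem_place (by omega)
        have a5 : u ∉ place (M + 1 + m) (readAt Y m s) := notMem_place (by omega)
        have a6 : u ≠ M := by omega
        have a7 : ¬ (u < Y ∨ Y + m ≤ u) := by omega
        have a8 : M + 1 + m + (u - Y) ∈ place (M + 1 + m) y ↔ u ∈ place Y y := by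
          have e1 := mem_place_add (a := M + 1 + m) (x := y) ⟨u - Y, by omega⟩
          have e2 := mem_place_add (a := Y) (x := y) ⟨u - Y, by omega⟩
          simp only [show Y + (u - Y) = u by omega] at e2
          rw [e2, ← e1]
        simp [a1, a2, a3, a4, a5, a6, a7, a8]
      · by_cases hu2 : M + 1 + m ≤ u ∧ u < M + 1 + m + m
        · rw [blockSwap, if_neg hu1, if_pos hu2]
          have b1 : u ∉ s := nm _ (by omega)
          have b2 : u ∉ place (M + 1) x := notMem_place (by omega)
          have b3 : u ≠ M := by omega
          have b4 : Y + (u - (M + 1 + m)) ≠ M := by omega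
          have b5 : Y + (u - (M + 1 + m)) ∉ place (M + 1) x := notMem_place (by omega)
          have b6 : Y + (u - (M + 1 + m)) ∉ place (M + 1 + m) y := notMem_place (by omega)
          have b7 : u ∉ place Y y := notMem_place (by omega)
          have b8 : u ∈ place (M + 1 + m) (readAt Y m s) ↔ Y + (u - (M + 1 + m)) ∈ s := by
            have e1 := mem_place_add (a := M + 1 + m) (x := readAt Y m s) ⟨u - (M + 1 + m), by omega⟩
            simp only [show M + 1 + m + (u - (M + 1 + m)) = u by omega] at e1
            rw [e1]
            simp [readAt]
          simp [b1, b2, b3, b4, b5, b6, b7, b8]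
        · rw [blockSwap, if_neg hu1, if_neg hu2]
          have c1 : u ∉ place (M + 1 + m) y := notMem_place (by omega)
          have c2 : u ∉ place (M + 1 + m) (readAt Y m s) := notMem_place (by omega)
          have c3 : u ∉ place Y y := notMem_place (by omega)
          have c4 : u < Y ∨ Y + m ≤ u := by omega
          by_cases huM : u = M
          · subst huM
            have : u ∉ place (u + 1) x := notMem_place (by omega)
            have : u ∉ s := nm _ le_rfl
            simp_all
          · simp only [huM, c1, c2, c3, c4, not_false_eq_true, and_true, false_and, or_false,
              false_or]
            exact or_comm
    · obtain ⟨s', h1, h2⟩ := cswapBlock_ket (c := M) (x := Y) (y := M + 1 + m) (m := m) (by omega)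
        (by omega) (by omega) (s ∪ (place (M + 1) x ∪ place (M + 1 + m) y))
      have hM : M ∉ s ∪ (place (M + 1) x ∪ place (M + 1 + m) y) := by
        intro h
        simp only [mem_union, mem_place_iff] at h
        rcases h with h | ⟨h, _⟩ | ⟨h, _⟩
        · exact absurd (hsM _ h) (by omega)
        · omega
        · omega
      rw [h1, union_comm _ s]
      congr 1
      ext u
      rw [h2, if_neg hM]
  · simp only [mem_union, mem_place_iff] at h
    rcases h with h | ⟨h, _⟩ | ⟨h, _⟩
    · exact absurd (hsM _ h) (by omega)
    · omega
    · omega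

theorem trial_length (c : List Gate) {m : ℕ} (o : Bits m) (Y M : ℕ) :
    (trial c o Y M).length ≤ c.length + 113 * m + 6 := by
  have := patternGate_length (M + 1) o M (M + 1 + 2 * m)
  simp only [trial, List.length_append, List.length_map, cswapBlock_length]
  omega

theorem trial_below {c : List Gate} {m : ℕ} (hc : ∀ g ∈ c, g.Below (2 * m)) (o : Bits m) {Y M : ℕ}
    (hY : Y + m ≤ M) : ∀ g ∈ trial c o Y M, g.Below (M + 1 + 3 * m) := by
  intro g hg
  rw [trial, List.mem_append, List.mem_append] at hg
  rcases hg with hg | hg | hg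
  · obtain ⟨g', hg', rfl⟩ := List.mem_map.1 hg
    rw [Gate.below_iff, Gate.wires_map]
    intro i hi
    obtain ⟨i', hi', rfl⟩ := List.mem_map.1 hi
    have := Gate.below_iff.1 (hc g' hg') i' hi'
    omega
  · exact patternGate_below o (by omega) (by omega) (by omega) g hg
  · exact cswapBlock_below (by omega) (by omega) (by omega) g hg

/-- The total weight of the outcomes of a circuit. -/
theorem sum_normSq_output {c : List Gate} {m : ℕ} (hc : ∀ g ∈ c, g.Below (2 * m)) :
    ∑ x : Bits m, ∑ y : Bits m, Complex.normSq (gatesOp c (ket ∅) (place 0 x ∪ place m y)) = 1 := by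
  rw [← sum_powerset_two_windows m fun s => Complex.normSq (gatesOp c (ket ∅) s),
    ← sqNorm_low (gatesOp_low hc (ket_mem_low (by simp))), sqNorm_gatesOp, sqNorm_ket]

theorem trial_value {c : List Gate} {m : ℕ} (hc : ∀ g ∈ c, g.Below (2 * m)) {o : Bits m} {Y M : ℕ}
    (hY : Y + m ≤ M) {ψ : PureState m} {r : ℂ}
    (hr : ∀ y, gatesOp c (ket ∅) (place 0 o ∪ place m y) = r * ψ.1 y) {F : Workspace → ℝ}
    (hF : Local M F) (hq : IsSumSq F) {v : Workspace} (hv : v ∈ low M) :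
    F (gatesOp (trial c o Y M) v) = (1 - Complex.normSq r) * F v +
      Complex.normSq r * ∑ z : Bits m, F (loadOp Y ψ.1 (pick Y z v)) := by
  classical
  set out : Bits m → Bits m → ℂ := fun x y => gatesOp c (ket ∅) (place 0 x ∪ place m y) with hout
  set S : Finset ((Bits m × Bits m) ⊕ Bits m) :=
    (univ.filter fun p : Bits m × Bits m => p.1 ≠ o).disjSum univ with hS
  set g : (Bits m × Bits m) ⊕ Bits m → Finset ℕ :=
    Sum.elim (fun p => place (M + 1) p.1 ∪ place (M + 1 + m) p.2)
      (fun z => insert M (place (M + 1) o ∪ place (M + 1 + m) z)) with hg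
  set u : (Bits m × Bits m) ⊕ Bits m → (Workspace →ₗ[ℂ] Workspace) :=
    Sum.elim (fun p => out p.1 p.2 • LinearMap.id) (fun z => r • (loadOp Y ψ.1 ∘ₗ pick Y z)) with hu
  have hval : gatesOp (trial c o Y M) v = ∑ i ∈ S, attach (g i) (u i v) := by
    have : gatesOp (trial c o Y M) v = (∑ i ∈ S, attach (g i) ∘ₗ u i) v := by
      refine eq_on_low (fun s hs => ?_) hv
      rw [trial_ket hc o hY hs, LinearMap.sum_apply, hS, Finset.sum_disjSum, sum_filter,
        Fintype.sum_prod_type]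
      have hsplit : ∀ x : Bits m, ∑ y : Bits m, out x y •
          (if x = o then ket (insert M (place (M + 1) o ∪ place (M + 1 + m) (readAt Y m s)) ∪
            (place Y y ∪ clearAt Y m s))
          else ket (place (M + 1) x ∪ place (M + 1 + m) y ∪ s)) =
          (∑ y : Bits m, if x ≠ o then out x y • ket (place (M + 1) x ∪ place (M + 1 + m) y ∪ s)
            else 0) +
          (if x = o then ∑ y : Bits m, (r * ψ.1 y) •
            ket (insert M (place (M + 1) o ∪ place (M + 1 + m) (readAt Y m s)) ∪
            (place Y y ∪ clearAt Y m s)) else 0) := by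
        intro x
        by_cases hx : x = o
        · subst hx
          simp only [if_true, ne_eq, not_true_eq_false, if_false, sum_const_zero, zero_add,
            hout, hr]
        · simp [hx]
      refine (sum_congr rfl fun x _ => hsplit x).trans ?_
      rw [sum_add_distrib]
      congr 1
      · refine sum_congr rfl fun x _ => sum_congr rfl fun y _ => ?_
        simp [hu, hg, attach_ket]
      · rw [Finset.sum_ite_eq' univ o, if_pos (mem_univ _)]
        refine Eq.trans ?_ (sum_eq_single (readAt Y m s) ?_ ?_).symm
        · simp only [hu, hg, Sum.elim_inr, LinearMap.comp_apply, LinearMap.smul_apply, pick_ket,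
            if_true, loadOp_apply, attach_ket, map_smul, map_sum, smul_sum, smul_smul]
        · intro z _ hz
          simp [hu, pick_ket, hz.symm]
        · simp
    rw [this, LinearMap.sum_apply]
    rfl
  have hinj : Set.InjOn g S := by
    have r1 : ∀ x y : Bits m, readAt (M + 1) m (place (M + 1) x ∪ place (M + 1 + m) y) = x :=
      fun x y => readAt_place_union (fun u hu => by
        obtain ⟨_, _⟩ := mem_place_iff.1 hu; omega) x
    have r2 : ∀ x y : Bits m, readAt (M + 1 + m) m (place (M + 1) x ∪ place (M + 1 + m) y) = y := by
      intro x y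
      rw [union_comm]
      exact readAt_place_union (fun u hu => by
        obtain ⟨_, _⟩ := mem_place_iff.1 hu; omega) y
    have hM : ∀ x y : Bits m, M ∉ place (M + 1) x ∪ place (M + 1 + m) y := by
      intro x y h
      rcases mem_union.1 h with h | h <;> obtain ⟨_, _⟩ := mem_place_iff.1 h <;> omega
    rintro (⟨x, y⟩ | z) _ (⟨x', y'⟩ | z') _ h
    · simp only [hg, Sum.elim_inl] at h
      have e1 := congrArg (readAt (M + 1) m) h
      have e2 := congrArg (readAt (M + 1 + m) m) h
      rw [r1, r1] at e1
      rw [r2, r2] at e2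
      rw [e1, e2]
    · simp only [hg, Sum.elim_inl, Sum.elim_inr] at h
      exact absurd (h ▸ mem_insert_self _ _) (hM x y)
    · simp only [hg, Sum.elim_inl, Sum.elim_inr] at h
      exact absurd (h.symm ▸ mem_insert_self _ _) (hM x' y')
    · simp only [hg, Sum.elim_inr] at h
      have h' := congrArg (fun s => s.erase M) h
      simp only [erase_insert (hM _ _)] at h'
      rw [← r2 o z, h', r2]
  rw [hval, hF.sum hq S g hinj, hS, Finset.sum_disjSum, sum_filter, Fintype.sum_prod_type]
  · congr 1
    · have htot : ∑ x : Bits m, ∑ y : Bits m, Complex.normSq (out x y) = 1 := sum_normSq_output hc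
      have ho : ∑ y : Bits m, Complex.normSq (out o y) = Complex.normSq r := by
        simp only [hout, hr, map_mul, ← mul_sum]
        rw [ψ.2, mul_one]
      have : ∑ x : Bits m, (if x ≠ o then ∑ y : Bits m, Complex.normSq (out x y) else 0) =
          1 - Complex.normSq r := by
        rw [← htot, ← ho, ← Finset.add_sum_erase univ _ (mem_univ o),
          ← Finset.add_sum_erase univ (fun x => ∑ y : Bits m, Complex.normSq (out x y))
            (mem_univ o)]
        simp only [ne_eq, not_true_eq_false, if_false, zero_add, add_sub_cancel_left]
        exact sum_congr rfl fun x hx => if_pos (Finset.ne_of_mem_erase hx)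
      rw [← this, sum_mul]
      refine sum_congr rfl fun x _ => ?_
      by_cases hx : x = o
      · simp [hx]
      · simp only [ne_eq, hx, not_false_eq_true, if_true, hu, Sum.elim_inl, LinearMap.smul_apply,
          LinearMap.id_apply, hq.smul, sum_mul]
    · rw [mul_sum]
      refine sum_congr rfl fun z _ => ?_
      simp only [hu, Sum.elim_inr, LinearMap.smul_apply, LinearMap.comp_apply, hq.smul]
  · rintro (⟨x, y⟩ | z) _ a ha
    · simp only [hg, Sum.elim_inl] at ha
      rcases mem_union.1 ha with h | h <;> obtain ⟨_, _⟩ := mem_place_iff.1 h <;> omega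
    · simp only [hg, Sum.elim_inr] at ha
      rcases mem_insert.1 ha with rfl | ha
      · exact le_rfl
      rcases mem_union.1 ha with h | h <;> obtain ⟨_, _⟩ := mem_place_iff.1 h <;> omega
  · rintro (⟨x, y⟩ | z) _
    · exact Submodule.smul_mem _ _ hv
    · exact Submodule.smul_mem _ _ (loadOp_low hY _ (pick_low z hv))

theorem normSq_branch_le {c : List Gate} {m : ℕ} (hc : ∀ g ∈ c, g.Below (2 * m)) {o : Bits m}
    {ψ : PureState m} {r : ℂ}
    (hr : ∀ y, gatesOp c (ket ∅) (place 0 o ∪ place m y) = r * ψ.1 y) : Complex.normSq r ≤ 1 := by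
  have h1 : ∑ y : Bits m, Complex.normSq (gatesOp c (ket ∅) (place 0 o ∪ place m y)) =
      Complex.normSq r := by
    simp only [hr, map_mul, ← mul_sum]
    rw [ψ.2, mul_one]
  rw [← h1, ← sum_normSq_output hc]
  exact single_le_sum (f := fun x => ∑ y : Bits m,
    Complex.normSq (gatesOp c (ket ∅) (place 0 x ∪ place m y)))
    (fun x _ => sum_nonneg fun _ _ => Complex.normSq_nonneg _) (mem_univ o)

/-- Repeated attempts: with `K` attempts the state is loaded except with probability `(1 - p) ^ K`. -/
theorem exists_load {c : List Gate} {m : ℕ} (hc : ∀ g ∈ c, g.Below (2 * m)) {o : Bits m}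
    {ψ : PureState m} {r : ℂ}
    (hr : ∀ y, gatesOp c (ket ∅) (place 0 o ∪ place m y) = r * ψ.1 y) {Y M : ℕ} (hY : Y + m ≤ M)
    (K : ℕ) :
    ∃ (U : List Gate) (M' : ℕ), M ≤ M' ∧ (∀ g ∈ U, g.Below M') ∧
      U.length ≤ K * (c.length + 113 * m + 6) ∧
      ∀ F, Local M F → IsSumSq F → ∀ v ∈ low Y,
        (1 - (1 - Complex.normSq r) ^ K) * F (loadOp Y ψ.1 v) ≤ F (gatesOp U v) ∧
        F (loadOp Y ψ.1 v) ≤ F (gatesOp U (loadOp Y ψ.1 v)) := by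
  have hp := normSq_branch_le hc hr
  have hp0 := Complex.normSq_nonneg r
  generalize hpd : Complex.normSq r = p at *
  induction K with
  | zero => exact ⟨[], M, le_rfl, by simp, by simp, fun F _ hq v _ => by simpa using hq.nonneg v⟩
  | succ K ih =>
    obtain ⟨U, M', hM, hb, hl, hU⟩ := ih
    refine ⟨trial c o Y M' ++ U, M' + 1 + 3 * m, by omega, ?_, ?_, ?_⟩
    · intro g hg
      rcases List.mem_append.1 hg with hg | hg
      · exact trial_below hc o (Y := Y) (M := M') (by omega) g hg
      · exact (hb g hg).mono (by omega)
    · have := trial_length c o Y M'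
      rw [List.length_append]
      linarith
    · intro F hF hq v hv
      have hF' : Local M' fun v => F (gatesOp U v) := (hF.mono hM).comp hb
      have hq' := hq.gatesOp U
      obtain ⟨h1, h2⟩ := hU F hF hq v hv
      have hvM : v ∈ low M' := low_mono (by omega) hv
      simp only [gatesOp_append_apply]
      have hps : ∑ z : Bits m, Complex.normSq (ψ.1 z) = 1 := ψ.2
      constructor
      · have := trial_value hc (o := o) (Y := Y) (M := M') (by omega) hr hF' hq' hvM
        simp only [hpd, pick_of_low _ hv] at this
        rw [this, sum_eq_single (fun _ => false) (fun z _ hz => by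
          rw [if_neg (fun h => hz h.symm), map_zero]; exact hq'.zero) (by simp), if_pos rfl]
        rw [pow_succ]
        nlinarith
      · have := trial_value hc (o := o) (Y := Y) (M := M') (by omega) hr hF' hq'
          (loadOp_low (show Y + m ≤ M' by omega) ψ.1 hvM)
        simp only [hpd, pick_loadOp _ _ hv, map_smul, hq.smul, ← sum_mul] at this
        rw [this]
        have e : ∀ t : ℝ, (1 - p) * t + p * (1 * t) = t := fun t => by ring
        rw [hps, e]
        exact h2

/-! ### Simultaneous gates on blocks of wires -/

theorem place_snoc (C : ℕ) {m : ℕ} (t : Bits m) (b : Bool) :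
    place C (Fin.snoc (α := fun _ => Bool) t b) = place C t ∪ (if b then {C + m} else ∅) := by
  ext u
  rw [mem_union, mem_place, mem_place]
  constructor
  · rintro ⟨i, hi, rfl⟩
    induction i using Fin.lastCases with
    | last => right; simp at hi; simp [hi]
    | cast i => left; exact ⟨i, by simpa using hi, rfl⟩
  · rintro (⟨i, hi, rfl⟩ | h)
    · exact ⟨i.castSucc, by simpa using hi, rfl⟩
    · split_ifs at h with hb
      · exact ⟨Fin.last m, by simp [hb], by simpa using (mem_singleton.1 h).symm⟩
      · simp at h

/-- The sign `(-1) ^ (p q)`. -/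
def bitSign (p q : Bool) : ℂ := if p && q then -1 else 1

/-- Hadamard gates on the wires `C, …, C + m - 1`. -/
def hadBlock (C m : ℕ) : List Gate := (List.range m).map fun j => .had (C + j)

theorem hadBlock_ket (C m : ℕ) (s : Finset ℕ) : gatesOp (hadBlock C m) (ket s) =
    ∑ t : Bits m, (∏ j, ((Real.sqrt 2 : ℝ) : ℂ)⁻¹ * bitSign (t j) (readAt C m s j)) •
      ket (clearAt C m s ∪ place C t) := by
  induction m with
  | zero =>
    have e : clearAt C 0 s = s := by simp [clearAt]
    have e2 : ∀ t : Bits 0, place C t = ∅ := fun t => by simp [place]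
    simp [hadBlock, e, e2]
  | succ m ih =>
    have e : hadBlock C (m + 1) = hadBlock C m ++ [.had (C + m)] := by
      simp [hadBlock, List.range_succ]
    rw [e, gatesOp_append_apply, ih, map_sum, ← (Fin.snocEquiv fun _ => Bool).sum_comp,
      Fintype.sum_prod_type_right]
    refine sum_congr rfl fun t _ => ?_
    have h1 : C + m ∈ clearAt C m s ∪ place C t ↔ C + m ∈ s := by
      rw [mem_union, mem_clearAt]
      have : C + m ∉ place C t := notMem_place (by omega)
      simp [this]
    have h2 : (clearAt C m s ∪ place C t).erase (C + m) =
        clearAt C (m + 1) s ∪ place C t := by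
      ext u
      simp only [mem_erase, mem_union, mem_clearAt]
      have : u ∈ place C t → u ≠ C + m := by
        rintro h rfl; exact notMem_place (by omega) h
      constructor
      · rintro ⟨hu, ⟨h3, h4⟩ | h3⟩
        · exact Or.inl ⟨h3, by omega⟩
        · exact Or.inr h3
      · rintro (⟨h3, h4⟩ | h3)
        · exact ⟨by omega, Or.inl ⟨h3, by omega⟩⟩
        · exact ⟨this h3, Or.inr h3⟩
    have h3 : insert (C + m) (clearAt C m s ∪ place C t) =
        clearAt C (m + 1) s ∪ (place C t ∪ {C + m}) := by
      rw [← union_assoc, ← h2]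
      ext u
      by_cases hu : u = C + m <;> simp [hu]
    have h5 : ∀ b, Fin.snocEquiv (fun _ : Fin (m + 1) => Bool) (b, t) =
        Fin.snoc (α := fun _ => Bool) t b := fun _ => rfl
    have h4 : readAt C (m + 1) s = Fin.snoc (α := fun _ => Bool) (readAt C m s)
        (decide (C + m ∈ s)) := by
      funext i
      induction i using Fin.lastCases with
      | last => simp [readAt]
      | cast i => simp [readAt]
    rw [map_smul, gatesOp_cons, gatesOp_nil, had_ket, h2, h3]
    simp only [h1, Fintype.sum_bool, h5, place_snoc, Fin.prod_univ_castSucc,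
      Fin.snoc_castSucc, Fin.snoc_last, h4, if_true, Bool.false_eq_true, if_false,
      union_empty, bitSign, Bool.true_and, Bool.false_and, decide_eq_true_eq, mul_one]
    rw [smul_smul, smul_add, smul_smul, add_comm]
    congr 2
    ring

theorem gatesOp_cswaps {ι : Type*} (l : List ι) (hl : l.Nodup) (c f g : ι → ℕ)
    (hf : Function.Injective f) (hg : Function.Injective g) (hfg : ∀ p q, f p ≠ g q)
    (hcf : ∀ p q, c p ≠ f q) (hcg : ∀ p q, c p ≠ g q) (s : Finset ℕ) :
    ∃ s', gatesOp (l.flatMap fun p => cswapGate (c p) (f p) (g p)) (ket s) = ket s' ∧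
      (∀ p ∈ l, (f p ∈ s' ↔ if c p ∈ s then g p ∈ s else f p ∈ s) ∧
        (g p ∈ s' ↔ if c p ∈ s then f p ∈ s else g p ∈ s)) ∧
      ∀ u, (∀ p ∈ l, u ≠ f p ∧ u ≠ g p) → (u ∈ s' ↔ u ∈ s) := by
  induction l generalizing s with
  | nil => exact ⟨s, by simp, by simp, by simp⟩
  | cons p l ih =>
    simp only [List.nodup_cons] at hl
    have hne : ∀ q ∈ l, q ≠ p := fun q hq h => hl.1 (h ▸ hq)
    set s₁ := if c p ∈ s then swapSet (f p) (g p) s else s with hs₁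
    obtain ⟨s', h1, h2, h3⟩ := ih hl.2 s₁
    have hother : ∀ u, u ≠ f p → u ≠ g p → (u ∈ s₁ ↔ u ∈ s) := by
      intro u h4 h5
      rw [hs₁]
      split_ifs
      · rw [mem_swapSet, Equiv.swap_apply_of_ne_of_ne h4 h5]
      · rfl
    have hfp : f p ∈ s₁ ↔ if c p ∈ s then g p ∈ s else f p ∈ s := by
      rw [hs₁]
      split_ifs
      · rw [mem_swapSet, Equiv.swap_apply_left]
      · rfl
    have hgp : g p ∈ s₁ ↔ if c p ∈ s then f p ∈ s else g p ∈ s := by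
      rw [hs₁]
      split_ifs
      · rw [mem_swapSet, Equiv.swap_apply_right]
      · rfl
    refine ⟨s', ?_, ?_, ?_⟩
    · rw [List.flatMap_cons, gatesOp_append_apply, cswapGate_ket (hcf p p) (hcg p p) (hfg p p), h1]
    · intro q hq
      rcases List.mem_cons.1 hq with rfl | hq
      · have h4 := h3 (f q) fun p' hp' => ⟨hf.ne (hne p' hp').symm, hfg q p'⟩
        have h5 := h3 (g q) fun p' hp' => ⟨(hfg p' q).symm, hg.ne (hne p' hp').symm⟩
        exact ⟨h4.trans hfp, h5.trans hgp⟩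
      · obtain ⟨h4, h5⟩ := h2 q hq
        have e1 := hother (f q) (hf.ne (hne q hq)) (hfg q p)
        have e2 := hother (g q) (hfg p q).symm (hg.ne (hne q hq))
        have e3 := hother (c q) (hcf q p) (hcg q p)
        simp only [e1, e2, e3] at h4 h5
        exact ⟨h4, h5⟩
    · intro u hu
      rw [h3 u fun q hq => hu q (by simp [hq])]
      exact hother u (hu p (by simp)).1 (hu p (by simp)).2

/-- Move the contents of the wires `a, …, a + k - 1` to the empty wires `Z, …, Z + k - 1`. -/
def moveBlock (a Z k : ℕ) : List Gate :=
  (List.range k).flatMap fun i => [.cnot (a + i) (Z + i), .cnot (Z + i) (a + i)]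

theorem move_ket {x z : ℕ} (hxz : x ≠ z) {s : Finset ℕ} (hz : z ∉ s) :
    gatesOp [.cnot x z, .cnot z x] (ket s) = ket (if x ∈ s then insert z (s.erase x) else s) := by
  rw [gatesOp_cons, cnot_ket, gatesOp_cons, cnot_ket, gatesOp_nil]
  congr 1
  ext u
  by_cases hx : x ∈ s <;> by_cases hu : u = x <;> by_cases hu' : u = z <;>
    simp_all [mem_symmDiff, hxz.symm]

theorem moveBlock_ket {a Z k : ℕ} (h : a + k ≤ Z ∨ Z + k ≤ a) {s : Finset ℕ}
    (hs : ∀ u ∈ s, u < Z ∨ Z + k ≤ u) :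
    gatesOp (moveBlock a Z k) (ket s) = ket (clearAt a k s ∪ place Z (readAt a k s)) := by
  have key : ∀ j ≤ k, ∃ s', gatesOp (moveBlock a Z j) (ket s) = ket s' ∧ ∀ u, u ∈ s' ↔
      if a ≤ u ∧ u < a + j then False else if Z ≤ u ∧ u < Z + j then a + (u - Z) ∈ s else u ∈ s := by
    intro j hj
    induction j with
    | zero =>
      refine ⟨s, by simp [moveBlock], fun u => ?_⟩
      rw [if_neg (by omega), if_neg (by omega)]
    | succ j ih =>
      obtain ⟨s', h1, h2⟩ := ih (by omega)
      have e : moveBlock a Z (j + 1) = moveBlock a Z j ++ [.cnot (a + j) (Z + j), .cnot (Z + j) (a + j)] := by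
        simp [moveBlock, List.range_succ]
      have hz : Z + j ∉ s' := by
        rw [h2, if_neg (by omega), if_neg (by omega)]
        intro hh
        have := hs _ hh
        omega
      have ha : a + j ∈ s' ↔ a + j ∈ s := by
        rw [h2, if_neg (by omega), if_neg (by omega)]
      refine ⟨_, by rw [e, gatesOp_append_apply, h1, move_ket (by omega) hz], fun u => ?_⟩
      have hu : u ∈ (if a + j ∈ s' then insert (Z + j) (s'.erase (a + j)) else s') ↔
          if u = a + j then False else if u = Z + j then a + j ∈ s else u ∈ s' := by
        split_ifs with h3 h4 h5 h5
        · subst h4; simp; omega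
        · subst h5; simp [ha.1 h3]
        · simp [h4, h5]
        · subst h5; simp [h3]
        · rename_i h5; subst h5; simp [hz, mt ha.2 h3]
        · rfl
      rw [hu, h2]
      by_cases h3 : u = a + j
      · rw [if_pos h3, if_pos (by omega)]
      · rw [if_neg h3]
        by_cases h4 : u = Z + j
        · rw [if_pos h4, if_neg (by omega), if_pos (by omega), show a + (u - Z) = a + j by omega]
        · rw [if_neg h4]
          by_cases h5 : a ≤ u ∧ u < a + j
          · have n5 : a ≤ u ∧ u < a + (j + 1) := by omega
            simp only [if_pos h5, if_pos n5]
          · have n5 : ¬ (a ≤ u ∧ u < a + (j + 1)) := by omega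
            simp only [if_neg h5, if_neg n5]
            by_cases h6 : Z ≤ u ∧ u < Z + j
            · have n6 : Z ≤ u ∧ u < Z + (j + 1) := by omega
              simp only [if_pos h6, if_pos n6]
            · have n6 : ¬ (Z ≤ u ∧ u < Z + (j + 1)) := by omega
              simp only [if_neg h6, if_neg n6]
  obtain ⟨s', h1, h2⟩ := key k le_rfl
  rw [h1]
  congr 1
  ext u
  rw [h2, mem_union, mem_clearAt, mem_place_iff]
  by_cases h3 : a ≤ u ∧ u < a + k
  · rw [if_pos h3]
    have : ¬ (Z ≤ u ∧ u < Z + k) := by omega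
    simp [this]; omega
  · rw [if_neg h3]
    by_cases h4 : Z ≤ u ∧ u < Z + k
    · rw [if_pos h4]
      have : u ∉ s := fun hh => by have := hs u hh; omega
      simp [this, readAt, h4]
    · rw [if_neg h4]
      have : u < a ∨ a + k ≤ u := by omega
      simp [h4, this]

theorem gatesOp_patterns {a k tgt t : ℕ} (l : List (Bits k)) (hl : l.Nodup)
    (htgt : tgt < a ∨ a + k ≤ tgt) (hk : a + k ≤ t) (htt : tgt < t) {s : Finset ℕ}
    (hs : ∀ u, t ≤ u → u ∉ s) :
    gatesOp (l.flatMap fun x => patternGate a x tgt t) (ket s) =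
      ket (if readAt a k s ∈ l then symmDiff s {tgt} else s) := by
  induction l generalizing s with
  | nil => simp
  | cons x l ih =>
    simp only [List.nodup_cons] at hl
    rw [List.flatMap_cons, gatesOp_append_apply, patternGate_ket x htgt hk htt hs]
    have hr : readAt a k (symmDiff s {tgt}) = readAt a k s := by
      funext i
      have : a + (i : ℕ) ≠ tgt := by have := i.2; omega
      simp [readAt, mem_symmDiff, this]
    by_cases hx : readAt a k s = x
    · rw [if_pos hx, ih hl.2, hr, hx, if_neg hl.1, if_pos (by simp)]
      intro u hu h
      rcases mem_symmDiff.1 h with ⟨h, _⟩ | ⟨h, _⟩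
      · exact hs u hu h
      · rw [mem_singleton] at h; omega
    · rw [if_neg hx, ih hl.2 hs]
      simp [hx]

theorem hadBlock_length (C m : ℕ) : (hadBlock C m).length = m := by simp [hadBlock]

theorem moveBlock_length (a Z k : ℕ) : (moveBlock a Z k).length = 2 * k := by
  simp [moveBlock, List.length_flatMap, mul_comm]

theorem hadBlock_below {C m N : ℕ} (h : C + m ≤ N) : ∀ g ∈ hadBlock C m, g.Below N := by
  intro g hg
  obtain ⟨i, hi, rfl⟩ := List.mem_map.1 hg
  have := List.mem_range.1 hi
  simp only [Gate.Below]
  omega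

theorem moveBlock_below {a Z k N : ℕ} (ha : a + k ≤ N) (hZ : Z + k ≤ N) :
    ∀ g ∈ moveBlock a Z k, g.Below N := by
  intro g hg
  obtain ⟨i, hi, hg⟩ := List.mem_flatMap.1 hg
  have := List.mem_range.1 hi
  simp only [List.mem_cons, List.not_mem_nil, or_false] at hg
  rcases hg with rfl | rfl <;> simp only [Gate.Below] <;> omega

/-! ### A gate circuit for the swap-test channel -/

theorem place_one_mem {a u : ℕ} {l : Bool} :
    u ∈ place a (fun _ : Fin 1 => l) ↔ u = a ∧ l = true := by
  rw [mem_place_iff]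
  constructor
  · rintro ⟨h, h'⟩; exact ⟨by omega, h'⟩
  · rintro ⟨rfl, h⟩; exact ⟨by omega, h⟩

/-- Move the last qubit of the window of a channel to its first wire, when the others are empty. -/
theorem moveLast_ket {a k : ℕ} {R : Finset ℕ} (hR : ∀ u ∈ R, u < a ∨ a + k < u) (l : Bool) :
    gatesOp [.cnot (a + k) a, .cnot a (a + k)] (ket (R ∪ place (a + k) fun _ : Fin 1 => l)) =
      ket (R ∪ place a fun _ : Fin 1 => l) := by
  rcases Nat.eq_zero_or_pos k with rfl | hk
  · simp [cnot_ket]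
  · have hR1 : a ∉ R := fun h => by have := hR _ h; omega
    have hR2 : a + k ∉ R := fun h => by have := hR _ h; omega
    rw [move_ket (by omega) (by simp [place_one_mem, hR1]; omega)]
    congr 1
    ext u
    simp only [mem_union, place_one_mem]
    by_cases h1 : u = a <;> by_cases h2 : u = a + k <;> cases l <;>
      simp_all [place_one_mem]

/-- A set of wires given by the contents of the window of a channel (`x`, `l`), of the slots for
the marked states (`y`), of the coins (`t`) and of the wires for discarded registers (`z`). -/
def cfgSet (a m Y : ℕ) (r : Finset ℕ) (x : Bits (m * m)) (l : Bool) (y : Bits (m * m)) (t : Bits m)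
    (z : Bits (m * m)) : Finset ℕ :=
  place a x ∪ (place (a + m * m) (fun _ : Fin 1 => l) ∪ (place Y y ∪ (place (Y + m * m) t ∪
    (place (Y + m * m + m) z ∪ r))))

/-- Wires outside the window of the channel and below the scratch wires. -/
def Outside (a m Y : ℕ) (r : Finset ℕ) : Prop := ∀ u ∈ r, (u < a ∨ a + m * m < u) ∧ u < Y

section

variable {a m Y : ℕ} {r : Finset ℕ} {x y z : Bits (m * m)} {l : Bool} {t : Bits m}

theorem mem_cfgSet {u : ℕ} : u ∈ cfgSet a m Y r x l y t z ↔ u ∈ place a x ∨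
    (u = a + m * m ∧ l = true) ∨ u ∈ place Y y ∨ u ∈ place (Y + m * m) t ∨
      u ∈ place (Y + m * m + m) z ∨ u ∈ r := by
  simp only [cfgSet, mem_union, place_one_mem]

theorem cfgSet_input (haY : a + m * m < Y) (hr : Outside a m Y r) (i : Fin (m * m)) :
    a + (i : ℕ) ∈ cfgSet a m Y r x l y t z ↔ x i = true := by
  have hi := i.2
  rw [mem_cfgSet, mem_place_add]
  have h1 : a + (i : ℕ) ∉ r := fun h => by have := hr _ h; omega
  have h2 : a + (i : ℕ) ∉ place Y y := notMem_place (by omega)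
  have h3 : a + (i : ℕ) ∉ place (Y + m * m) t := notMem_place (by omega)
  have h4 : a + (i : ℕ) ∉ place (Y + m * m + m) z := notMem_place (by omega)
  have h5 : (i : ℕ) ≠ m * m := by omega
  simp [h1, h2, h3, h4, h5]

theorem cfgSet_slot (haY : a + m * m < Y) (hr : Outside a m Y r) (i : Fin (m * m)) :
    Y + (i : ℕ) ∈ cfgSet a m Y r x l y t z ↔ y i = true := by
  have hi := i.2
  rw [mem_cfgSet, mem_place_add]
  have h1 : Y + (i : ℕ) ∉ r := fun h => by have := hr _ h; omega
  have h2 : Y + (i : ℕ) ∉ place a x := notMem_place (by omega)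
  have h3 : Y + (i : ℕ) ∉ place (Y + m * m) t := notMem_place (by omega)
  have h4 : Y + (i : ℕ) ∉ place (Y + m * m + m) z := notMem_place (by omega)
  have h5 : Y + (i : ℕ) ≠ a + m * m := by omega
  simp [h1, h2, h3, h4, h5]

theorem cfgSet_coin (haY : a + m * m < Y) (hr : Outside a m Y r) (j : Fin m) :
    Y + m * m + (j : ℕ) ∈ cfgSet a m Y r x l y t z ↔ t j = true := by
  have hi := j.2
  rw [mem_cfgSet, mem_place_add]
  have h1 : Y + m * m + (j : ℕ) ∉ r := fun h => by have := hr _ h; omega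
  have h2 : Y + m * m + (j : ℕ) ∉ place a x := notMem_place (by omega)
  have h3 : Y + m * m + (j : ℕ) ∉ place Y y := notMem_place (by omega)
  have h4 : Y + m * m + (j : ℕ) ∉ place (Y + m * m + m) z := notMem_place (by omega)
  have h5 : Y + m * m + (j : ℕ) ≠ a + m * m := by omega
  simp [h1, h2, h3, h4, h5]

theorem cfgSet_rest {u : ℕ} (h1 : u < a ∨ a + m * m ≤ u) (h2 : u < Y ∨ Y + m * m ≤ u) :
    u ∈ cfgSet a m Y r x l y t z ↔ (u = a + m * m ∧ l = true) ∨ u ∈ place (Y + m * m) t ∨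
      u ∈ place (Y + m * m + m) z ∨ u ∈ r := by
  have h3 : u ∉ place a x := notMem_place h1
  have h4 : u ∉ place Y y := notMem_place h2
  rw [mem_cfgSet]
  simp [h3, h4]

theorem cfgSet_lt (haY : a + m * m < Y) (hr : Outside a m Y r) :
    ∀ u, Y + m * m + m + m * m ≤ u → u ∉ cfgSet a m Y r x l y t z := by
  intro u hu h
  rw [mem_cfgSet] at h
  simp only [mem_place_iff] at h
  rcases h with ⟨h, _⟩ | h | ⟨h, _⟩ | ⟨h, _⟩ | ⟨h, _⟩ | h
  · omega
  · omega
  · omega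
  · omega
  · omega
  · have := hr _ h; omega

theorem cfgSet_flip (haY : a + m * m < Y) (hr : Outside a m Y r) :
    symmDiff (cfgSet a m Y r x l y t z) {a + m * m} = cfgSet a m Y r x (!l) y t z := by
  ext u
  rw [mem_symmDiff, mem_singleton, mem_cfgSet, mem_cfgSet]
  by_cases hu : u = a + m * m
  · subst hu
    have h1 : a + m * m ∉ place a x := notMem_place (by omega)
    have h2 : a + m * m ∉ place Y y := notMem_place (by omega)
    have h3 : a + m * m ∉ place (Y + m * m) t := notMem_place (by omega)
    have h4 : a + m * m ∉ place (Y + m * m + m) z := notMem_place (by omega)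
    have h5 : a + m * m ∉ r := fun h => by have := hr _ h; omega
    simp [h1, h2, h3, h4, h5]
  · simp [hu]

theorem readAt_coin (haY : a + m * m < Y) (hr : Outside a m Y r) :
    readAt (Y + m * m) m (cfgSet a m Y r x l y t z) = t := by
  rw [readAt_eq]
  exact cfgSet_coin haY hr

theorem clearAt_coin (haY : a + m * m < Y) (hr : Outside a m Y r) (t' : Bits m) :
    clearAt (Y + m * m) m (cfgSet a m Y r x l y t z) ∪ place (Y + m * m) t' =
      cfgSet a m Y r x l y t' z := by
  have e : ∀ t : Bits m, cfgSet a m Y r x l y t z = place (Y + m * m) t ∪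
      (place a x ∪ (place (a + m * m) (fun _ : Fin 1 => l) ∪ (place Y y ∪
        (place (Y + m * m + m) z ∪ r)))) := fun t => by
    unfold cfgSet; ac_rfl
  rw [e, clearAt_place_union, e, union_comm]
  intro u h
  simp only [mem_union, place_one_mem] at h
  simp only [mem_place_iff] at h
  rcases h with ⟨h, _⟩ | h | ⟨h, _⟩ | ⟨h, _⟩ | h
  · omega
  · omega
  · omega
  · omega
  · have := hr _ h; omega

theorem hadBlock_cfg (haY : a + m * m < Y) (hr : Outside a m Y r) :
    gatesOp (hadBlock (Y + m * m) m) (ket (cfgSet a m Y r x l y t z)) =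
      ∑ t' : Bits m, (∏ j, ((Real.sqrt 2 : ℝ) : ℂ)⁻¹ * bitSign (t' j) (t j)) •
        ket (cfgSet a m Y r x l y t' z) := by
  rw [hadBlock_ket]
  simp only [readAt_coin haY hr, clearAt_coin haY hr]

end

/-- The controlled swaps of the swap tests. -/
def swapLayer (a m Y : ℕ) : List Gate :=
  (List.finRange m ×ˢ List.finRange m).flatMap fun p =>
    cswapGate (Y + m * m + p.1) (a + (finProdFinEquiv p : ℕ)) (Y + (finProdFinEquiv p : ℕ))

/-- Take the blocks of `y` where `t` is set, and those of `x` elsewhere. -/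
def selBlocks {m : ℕ} (t : Bits m) (x y : Fin m → Bits m) : Fin m → Bits m :=
  fun j => if t j then y j else x j

theorem flatEquiv_apply {m : ℕ} (x : Fin m → Bits m) (p : Fin m × Fin m) :
    flatEquiv m x (finProdFinEquiv p) = x p.1 p.2 := by
  simp only [flatEquiv, Equiv.coe_fn_mk, Equiv.symm_apply_apply]

theorem swapLayer_ket {a m Y : ℕ} {r : Finset ℕ} (haY : a + m * m < Y) (hr : Outside a m Y r)
    (x y : Fin m → Bits m) (l : Bool) (t : Bits m) (z : Bits (m * m)) :
    gatesOp (swapLayer a m Y) (ket (cfgSet a m Y r (flatEquiv m x) l (flatEquiv m y) t z)) =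
      ket (cfgSet a m Y r (flatEquiv m (selBlocks t x y)) l (flatEquiv m (selBlocks t y x)) t z) := by
  have hinj : Function.Injective fun p : Fin m × Fin m => ((finProdFinEquiv p : Fin (m * m)) : ℕ) :=
    fun p q h => finProdFinEquiv.injective (Fin.ext h)
  obtain ⟨s', h1, h2, h3⟩ := gatesOp_cswaps (List.finRange m ×ˢ List.finRange m)
    ((List.nodup_finRange m).product (List.nodup_finRange m)) (fun p => Y + m * m + p.1) (fun p => a + (finProdFinEquiv p : ℕ))
    (fun p => Y + (finProdFinEquiv p : ℕ)) (fun p q h => hinj (by simpa using h))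
    (fun p q h => hinj (by simpa using h))
    (fun p q h => by have := (finProdFinEquiv p).2; omega)
    (fun p q h => by have := (finProdFinEquiv q).2; omega)
    (fun p q h => by have := (finProdFinEquiv q).2; omega)
    (cfgSet a m Y r (flatEquiv m x) l (flatEquiv m y) t z)
  rw [swapLayer, h1]
  congr 1
  ext u
  by_cases hu1 : a ≤ u ∧ u < a + m * m
  · set p := finProdFinEquiv.symm (⟨u - a, by omega⟩ : Fin (m * m)) with hp
    have e : u = a + (finProdFinEquiv p : ℕ) := by rw [hp, Equiv.apply_symm_apply]; simp only; omega
    rw [e, (h2 p (List.mem_product.2 ⟨List.mem_finRange _, List.mem_finRange _⟩)).1]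
    simp only [cfgSet_coin haY hr, cfgSet_slot haY hr, cfgSet_input haY hr, flatEquiv_apply,
      selBlocks]
    split_ifs <;> rfl
  · by_cases hu2 : Y ≤ u ∧ u < Y + m * m
    · set p := finProdFinEquiv.symm (⟨u - Y, by omega⟩ : Fin (m * m)) with hp
      have e : u = Y + (finProdFinEquiv p : ℕ) := by
        rw [hp, Equiv.apply_symm_apply]; simp only; omega
      rw [e, (h2 p (List.mem_product.2 ⟨List.mem_finRange _, List.mem_finRange _⟩)).2]
      simp only [cfgSet_coin haY hr, cfgSet_slot haY hr, cfgSet_input haY hr, flatEquiv_apply,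
        selBlocks]
      split_ifs <;> rfl
    · rw [h3 u fun p _ => ⟨fun h => by have := (finProdFinEquiv p).2; omega,
        fun h => by have := (finProdFinEquiv p).2; omega⟩,
        cfgSet_rest (by omega) (by omega), cfgSet_rest (by omega) (by omega)]

/-- The coin tosses and controlled swaps of the swap tests. -/
def testGates (a m Y : ℕ) : List Gate :=
  hadBlock (Y + m * m) m ++ (swapLayer a m Y ++ hadBlock (Y + m * m) m)

theorem testGates_ket {a m Y : ℕ} {r : Finset ℕ} (haY : a + m * m < Y) (hr : Outside a m Y r)
    (x y : Fin m → Bits m) (l : Bool) (z : Bits (m * m)) :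
    gatesOp (testGates a m Y)
        (ket (cfgSet a m Y r (flatEquiv m x) l (flatEquiv m y) (fun _ => false) z)) =
      ∑ t : Bits m, ∑ t' : Bits m, (∏ j, bitSign (t' j) (t j) / 2) •
        ket (cfgSet a m Y r (flatEquiv m (selBlocks t x y)) l (flatEquiv m (selBlocks t y x)) t' z) := by
  rw [testGates, gatesOp_append_apply, gatesOp_append_apply, hadBlock_cfg haY hr]
  simp only [map_sum, map_smul, swapLayer_ket haY hr, hadBlock_cfg haY hr, smul_sum,
    smul_smul]
  refine sum_congr rfl fun t _ => sum_congr rfl fun t' _ => ?_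
  rw [← prod_mul_distrib]
  congr 1
  refine prod_congr rfl fun j _ => ?_
  have h : bitSign (t j) false = 1 := by simp [bitSign]
  rw [h, mul_one, ← mul_assoc, inv_sqrt_two_mul_self]
  ring

theorem swapAmp_eq_sum {m : ℕ} (ψ : Bits m → ℂ) (τ : Bool) (a b x : Bits m) :
    swapAmp ψ τ a b x = ∑ q : Bits m × Bool, ψ q.1 * (bitSign (!τ) q.2 / 2) *
      (if a = (if q.2 then q.1 else x) ∧ b = (if q.2 then x else q.1) then 1 else 0) := by
  rw [Fintype.sum_prod_type_right]
  simp only [Fintype.sum_bool, if_true, Bool.false_eq_true, if_false, bitSign, Bool.and_true,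
    Bool.and_false, ite_and, mul_ite, mul_one, mul_zero]
  have e1 : ∀ c : Bits m → ℂ, (∑ y, if a = y then if b = x then c y else 0 else 0) =
      if b = x then c a else 0 := by
    intro c
    rw [sum_ite_eq]
    simp
  have e2 : ∀ c : Bits m → ℂ, (∑ y, if a = x then if b = y then c y else 0 else 0) =
      if a = x then c b else 0 := by
    intro c
    split_ifs
    · rw [sum_ite_eq]; simp
    · simp
  rw [e1, e2, swapAmp]
  cases τ <;> simp <;> split_ifs <;> ring

/-- Testing the marked states against the window of the channel. -/
theorem sum_testGates {m : ℕ} (ψ : Fin m → PureState m) (x : Fin m → Bits m)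
    (G : (Fin m → Bits m) → (Fin m → Bits m) → Bits m → Workspace) :
    ∑ y : Fin m → Bits m, (∏ j, (ψ j).1 (y j)) • ∑ t : Bits m, ∑ t' : Bits m,
      (∏ j, bitSign (t' j) (t j) / 2) • G (selBlocks t x y) (selBlocks t y x) t' =
    ∑ e : Bits m × (Fin m → Bits m) × (Fin m → Bits m),
      (∏ j, swapAmp (ψ j).1 (e.1 j) (e.2.1 j) (e.2.2 j) (x j)) •
        G e.2.1 e.2.2 (fun j => !e.1 j) := by
  classical
  have hexp : ∀ e : Bits m × (Fin m → Bits m) × (Fin m → Bits m),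
      (∏ j, swapAmp (ψ j).1 (e.1 j) (e.2.1 j) (e.2.2 j) (x j)) •
        G e.2.1 e.2.2 (fun j => !e.1 j) =
      ∑ y : Fin m → Bits m, ∑ t : Bits m, if e.2.1 = selBlocks t x y ∧ e.2.2 = selBlocks t y x then
        ((∏ j, (ψ j).1 (y j)) * ∏ j, bitSign (!e.1 j) (t j) / 2) •
          G e.2.1 e.2.2 (fun j => !e.1 j) else 0 := by
    intro e
    simp only [swapAmp_eq_sum]
    rw [prod_univ_sum, Fintype.piFinset_univ, sum_smul,
      ← (Equiv.arrowProdEquivProdArrow (Fin m) (fun _ => Bits m) fun _ => Bool).symm.sum_comp,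
      Fintype.sum_prod_type]
    refine sum_congr rfl fun y _ => sum_congr rfl fun t _ => ?_
    change (∏ j, (ψ j).1 (y j) * (bitSign (!e.1 j) (t j) / 2) *
      (if e.2.1 j = (if t j then y j else x j) ∧ e.2.2 j = (if t j then x j else y j)
        then 1 else 0)) • _ = _
    simp only [prod_mul_distrib, prod_boole, mem_univ, true_imp_iff]
    have hiff : (∀ j, (e.2.1 j = if t j = true then y j else x j) ∧
        e.2.2 j = if t j = true then x j else y j) ↔
        e.2.1 = selBlocks t x y ∧ e.2.2 = selBlocks t y x := by
      simp only [funext_iff, selBlocks, forall_and]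
    simp only [hiff, mul_ite, mul_one, mul_zero, ite_smul, zero_smul]
  rw [sum_congr rfl fun e _ => hexp e]
  refine Eq.trans (sum_congr rfl fun y _ => ?_) sum_comm
  rw [smul_sum]
  refine Eq.trans ?_ sum_comm
  refine sum_congr rfl fun t _ => ?_
  rw [Fintype.sum_prod_type, smul_sum]
  have hnot : Function.Involutive fun (τ : Bits m) (j : Fin m) => !τ j := fun τ => by simp
  rw [← Equiv.sum_comp hnot.toPerm]
  refine sum_congr rfl fun τ _ => ?_
  rw [sum_eq_single (selBlocks t x y, selBlocks t y x)]
  · simp [Function.Involutive.toPerm, smul_smul]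
  · rintro ⟨a, b⟩ _ hne
    rw [if_neg]
    rintro ⟨rfl, rfl⟩
    exact hne rfl
  · simp

/-- Discard the input registers of a channel (their contents are moved to the wires from `Z` on)
and move its last input qubit to the first wire. -/
def outputGates (a m Z : ℕ) : List Gate :=
  moveBlock a Z (m * m) ++ [.cnot (a + m * m) a, .cnot a (a + m * m)]

theorem outputGates_ket {a m Z : ℕ} (haZ : a + m * m < Z) {s : Finset ℕ}
    (hs : ∀ u ∈ s, u < Z ∨ Z + m * m ≤ u) :
    gatesOp (outputGates a m Z) (ket s) =
      ket (place Z (readAt a (m * m) s) ∪ (clearAt a (m * m + 1) s ∪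
        place a fun _ : Fin 1 => decide (a + m * m ∈ s))) := by
  rw [outputGates, gatesOp_append_apply, moveBlock_ket (by omega) hs]
  have e : clearAt a (m * m) s ∪ place Z (readAt a (m * m) s) =
      (place Z (readAt a (m * m) s) ∪ clearAt a (m * m + 1) s) ∪
        place (a + m * m) fun _ : Fin 1 => decide (a + m * m ∈ s) := by
    ext u
    simp only [mem_union, mem_clearAt, place_one_mem, decide_eq_true_eq]
    by_cases hu : u = a + m * m
    · subst hu; simp; tauto
    · have : (u < a ∨ a + m * m ≤ u) ↔ (u < a ∨ a + (m * m + 1) ≤ u) := by omega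
      simp only [this, hu, false_and, or_false]
      exact or_comm
  rw [e, moveLast_ket, union_assoc]
  intro u hu
  rcases mem_union.1 hu with hu | hu
  · obtain ⟨_, _⟩ := mem_place_iff.1 hu; omega
  · have := (mem_clearAt.1 hu).2; omega

theorem outputGates_length (a m Z : ℕ) : (outputGates a m Z).length = 2 * (m * m) + 2 := by
  simp [outputGates, moveBlock_length]

theorem outputGates_below {a m Z N : ℕ} (haZ : a + m * m < Z) (hZ : Z + m * m ≤ N) :
    ∀ g ∈ outputGates a m Z, g.Below N := by
  intro g hg
  rw [outputGates, List.mem_append] at hg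
  rcases hg with hg | hg
  · exact moveBlock_below (by omega) hZ g hg
  · simp only [List.mem_cons, List.not_mem_nil, or_false] at hg
    rcases hg with rfl | rfl <;> simp only [Gate.Below] <;> omega

theorem window_discardKraus_ket {m : ℕ} (x : Bits (m * m)) (a : ℕ) (s : Finset ℕ) :
    window (discardKraus x) a (ket s) = if readAt a (m * m) s = x then
      ket (clearAt a (m * m + 1) s ∪ place a fun _ : Fin 1 => decide (a + m * m ∈ s)) else 0 := by
  rw [window_ket, ← (Equiv.funUnique (Fin 1) Bool).symm.sum_comp, Fintype.sum_bool]
  have e : ∀ b : Bool, (Equiv.funUnique (Fin 1) Bool).symm b = fun _ => b := fun b => rfl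
  have e2 : (fun i : Fin (m * m) => readAt a (m * m + 1) s i.castSucc) = readAt a (m * m) s := rfl
  have e3 : readAt a (m * m + 1) s (Fin.last _) = decide (a + m * m ∈ s) := rfl
  simp only [discardKraus, e, e2, e3]
  by_cases h : readAt a (m * m) s = x
  · by_cases h2 : a + m * m ∈ s <;> simp [h, h2]
  · simp [h]

theorem discard_value {a m M : ℕ} (haM : a + m * m < M) {F : Workspace → ℝ} (hF : Local M F)
    (hq : IsSumSq F) {v : Workspace} (hv : v ∈ low M) :
    F (gatesOp (outputGates a m M) v) = ∑ x : Bits (m * m), F (window (discardKraus x) a v) := by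
  have h : gatesOp (outputGates a m M) v =
      (∑ x : Bits (m * m), attach (place M x) ∘ₗ window (discardKraus x) a) v := by
    refine eq_on_low (fun s hs => ?_) hv
    rw [outputGates_ket haM fun u hu => Or.inl (Finset.mem_range.1 (hs hu)), LinearMap.sum_apply,
      sum_eq_single (readAt a (m * m) s)]
    · rw [LinearMap.comp_apply, window_discardKraus_ket, if_pos rfl, attach_ket]
    · intro x _ hx
      rw [LinearMap.comp_apply, window_discardKraus_ket, if_neg hx.symm, map_zero]
    · simp
  rw [h, LinearMap.sum_apply]
  refine hF.sum hq univ (fun x => place M x) ?_ ?_ _ ?_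
  · intro x _ y _ h
    have e : ∀ x : Bits (m * m), readAt M (m * m) (place M x) = x := fun x => by
      have := readAt_place_union (Y := M) (s := ∅) (by simp) x
      rwa [union_empty] at this
    have := congrArg (readAt M (m * m)) h
    rwa [e, e] at this
  · intro x _ u hu
    obtain ⟨h, _⟩ := mem_place_iff.1 hu
    exact h.1
  · exact fun x _ => window_low (by omega) (by omega) _ hv

/-- The outcomes of the coins for which enough swap tests are passed (a coin shows `false` if the
test is passed). -/
def passPatterns (κ : ℝ) (m : ℕ) : Finset (Bits m) :=
  open scoped Classical in
  univ.filter fun t => κ * m ≤ ((univ.filter fun j => t j = false).card : ℝ)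

/-- The swap tests against the marked states found on the wires from `Y` on, followed by the
conditional flip. -/
def channelGates (κ : ℝ) (a m Y : ℕ) : List Gate :=
  testGates a m Y ++ ((passPatterns κ m).toList.flatMap (fun t =>
    patternGate (Y + m * m) t (a + m * m) (Y + m * m + m + m * m)) ++
    outputGates a m (Y + m * m + m))

theorem channelGates_below {κ : ℝ} {a m Y N : ℕ} (haY : a + m * m < Y)
    (hN : Y + m * m + m + m * m + m ≤ N) : ∀ g ∈ channelGates κ a m Y, g.Below N := by
  intro g hg
  simp only [channelGates, testGates, List.mem_append] at hg
  rcases hg with (hg | hg | hg) | hg | hg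
  · exact hadBlock_below (by omega) g hg
  · obtain ⟨p, _, hg⟩ := List.mem_flatMap.1 hg
    have := (finProdFinEquiv p).2
    have := p.1.2
    exact cswapGate_below (by omega) (by omega) (by omega) g hg
  · exact hadBlock_below (by omega) g hg
  · obtain ⟨t, _, hg⟩ := List.mem_flatMap.1 hg
    exact patternGate_below t (by omega) (by omega) (by omega) g hg
  · exact outputGates_below (by omega) (by omega) g hg

theorem channelGates_length (κ : ℝ) (a m Y : ℕ) :
    (channelGates κ a m Y).length ≤ 2 * m + 37 * (m * m) + 2 + 2 ^ m * (78 * m + 6) := by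
  have h1 : (swapLayer a m Y).length = 35 * (m * m) := by
    simp [swapLayer, List.length_flatMap, cswapGate_length, List.length_product, mul_comm]
  have h2 : ∀ l : List (Bits m), (l.flatMap (fun t =>
      patternGate (Y + m * m) t (a + m * m) (Y + m * m + m + m * m))).length ≤
      l.length * (78 * m + 6) := by
    intro l
    rw [List.length_flatMap]
    have := List.sum_le_card_nsmul (l.map fun t => (patternGate (Y + m * m) t (a + m * m)
      (Y + m * m + m + m * m)).length) (78 * m + 6) (by
        intro n hn
        obtain ⟨t, _, rfl⟩ := List.mem_map.1 hn
        exact patternGate_length _ _ _ _)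
    simpa using this
  have h3 : (passPatterns κ m).toList.length ≤ 2 ^ m := by
    rw [Finset.length_toList]
    exact (Finset.card_le_univ _).trans (by simp)
  have h4 := (h2 (passPatterns κ m).toList).trans (Nat.mul_le_mul_right _ h3)
  simp only [channelGates, testGates, List.length_append, hadBlock_length, h1,
    outputGates_length]
  omega

/-- The state in which the slots from `Y` on hold the first `i` marked states. -/
def loadSlots (Y : ℕ) {m : ℕ} : ∀ i, (Fin i → PureState m) → Workspace → Workspace
  | 0, _, v => v
  | i + 1, ψ, v => loadOp (Y + m * i) (ψ (Fin.last i)).1 (loadSlots Y i (fun j => ψ j.castSucc) v)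

theorem loadSlots_low {Y m : ℕ} {i : ℕ} (ψ : Fin i → PureState m) {v : Workspace} (hv : v ∈ low Y) :
    loadSlots Y i ψ v ∈ low (Y + m * i) := by
  induction i with
  | zero => exact low_mono (by omega) hv
  | succ i ih =>
    exact loadOp_low (by rw [Nat.mul_succ]; omega) _
      (low_mono (by rw [Nat.mul_succ]; omega) (ih fun j => ψ j.castSucc))

theorem loadSlots_eq {Y m : ℕ} {i : ℕ} (ψ : Fin i → PureState m) (v : Workspace) :
    loadSlots Y i ψ v = ∑ y : Fin i → Bits m, (∏ j, (ψ j).1 (y j)) •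
      attach (univ.biUnion fun j : Fin i => place (Y + m * j) (y j)) v := by
  induction i with
  | zero => simp [loadSlots, attach_empty]
  | succ i ih =>
    rw [loadSlots, ih, loadOp_apply, ← Equiv.sum_comp (Fin.snocEquiv fun _ => Bits m),
      Fintype.sum_prod_type]
    refine sum_congr rfl fun x _ => ?_
    rw [map_sum, smul_sum]
    refine sum_congr rfl fun y _ => ?_
    have e : Fin.snocEquiv (fun _ : Fin (i + 1) => Bits m) (x, y) =
      Fin.snoc (α := fun _ => Bits m) y x := rfl
    rw [e, map_smul, smul_smul, attach_attach, Fin.prod_univ_castSucc, mul_comm]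
    have hset : (univ.biUnion fun j : Fin (i + 1) => place (Y + m * j)
        (Fin.snoc (α := fun _ => Bits m) y x j)) = place (Y + m * i) x ∪
          univ.biUnion fun j : Fin i => place (Y + m * j) (y j) := by
      ext u
      simp only [mem_union, mem_biUnion, mem_univ, true_and,
        Fin.exists_fin_succ', Fin.snoc_castSucc, Fin.snoc_last, Fin.val_last, Fin.val_castSucc]
      exact or_comm
    rw [hset]
    simp only [Fin.snoc_castSucc, Fin.snoc_last]

theorem biUnion_place {Y m : ℕ} (y : Fin m → Bits m) :
    (univ.biUnion fun j : Fin m => place (Y + m * j) (y j)) = place Y (flatEquiv m y) := by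
  ext u
  simp only [mem_biUnion, mem_univ, true_and, mem_place]
  constructor
  · rintro ⟨j, i, hi, rfl⟩
    refine ⟨finProdFinEquiv (j, i), by rw [flatEquiv_apply]; exact hi, ?_⟩
    simp [finProdFinEquiv]; ring
  · rintro ⟨q, hq, rfl⟩
    refine ⟨(finProdFinEquiv.symm q).1, (finProdFinEquiv.symm q).2, ?_, ?_⟩
    · rw [← flatEquiv_apply (m := m) y, Equiv.apply_symm_apply]
      exact hq
    · have : ((finProdFinEquiv (finProdFinEquiv.symm q) : Fin (m * m)) : ℕ) = q := by
        rw [Equiv.apply_symm_apply]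
      rw [← this]
      generalize finProdFinEquiv.symm q = p
      simp [finProdFinEquiv]; ring

theorem window_swapKraus_ket {κ : ℝ} {m : ℕ} (ψ : Fin m → PureState m)
    (e : Bits m × (Fin m → Bits m) × (Fin m → Bits m)) (a : ℕ) (s : Finset ℕ) :
    open scoped Classical in
    window (swapKraus κ true ψ e) a (ket s) =
      (∏ j, swapAmp (ψ j).1 (e.1 j) (e.2.1 j) (e.2.2 j) (block (readAt a (m * m) s) j)) •
        ket (clearAt a (m * m + 1) s ∪ place a fun _ : Fin 1 => xor (decide (a + m * m ∈ s))
          (decide (κ * m ≤ ((univ.filter fun j => e.1 j = true).card : ℝ)))) := by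
  classical
  rw [window_ket, ← (Equiv.funUnique (Fin 1) Bool).symm.sum_comp, Fintype.sum_bool]
  have e1 : ∀ b : Bool, (Equiv.funUnique (Fin 1) Bool).symm b = fun _ => b := fun b => rfl
  have e2 : (fun i : Fin (m * m) => readAt a (m * m + 1) s i.castSucc) = readAt a (m * m) s := rfl
  have e3 : readAt a (m * m + 1) s (Fin.last _) = decide (a + m * m ∈ s) := rfl
  simp only [swapKraus, e1, e2, e3, Bool.true_and]
  generalize decide (a + m * m ∈ s) = l
  have : ∀ p : Prop, ∀ [Decidable p], ∀ c : ℂ, ∀ f : Bool → Workspace,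
      (c * if true = xor l (decide p) then 1 else 0) • f true +
      (c * if false = xor l (decide p) then 1 else 0) • f false = c • f (xor l (decide p)) := by
    intro p _ c f
    by_cases hp : p <;> cases l <;> simp [hp]
  exact this _ _ fun b => ket (clearAt a (m * m + 1) s ∪ place a fun _ => b)

theorem channelGates_loadSlots {κ : ℝ} {a m Y : ℕ} (haY : a + m * m < Y) (ψ : Fin m → PureState m)
    {v : Workspace} (hv : v ∈ low Y) :
    gatesOp (channelGates κ a m Y) (loadSlots Y m ψ v) =
      ∑ e : Bits m × (Fin m → Bits m) × (Fin m → Bits m),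
        attach (place (Y + m * m) (fun j => !e.1 j) ∪ (place Y (flatEquiv m e.2.2) ∪
          place (Y + m * m + m) (flatEquiv m e.2.1))) (window (swapKraus κ true ψ e) a v) := by
  classical
  simp only [loadSlots_eq, biUnion_place]
  have : (gatesOp (channelGates κ a m Y) ∘ₗ ∑ y : Fin m → Bits m, (∏ j, (ψ j).1 (y j)) •
      attach (place Y (flatEquiv m y))) v =
      (∑ e : Bits m × (Fin m → Bits m) × (Fin m → Bits m),
        attach (place (Y + m * m) (fun j => !e.1 j) ∪ (place Y (flatEquiv m e.2.2) ∪
          place (Y + m * m + m) (flatEquiv m e.2.1))) ∘ₗ window (swapKraus κ true ψ e) a) v := by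
    refine eq_on_low (fun s hs => ?_) hv
    set r := clearAt a (m * m + 1) s with hr
    set x : Fin m → Bits m := (flatEquiv m).symm (readAt a (m * m) s) with hx
    set l := decide (a + m * m ∈ s) with hl
    have hout : Outside a m Y r := by
      intro u hu
      have h := mem_clearAt.1 hu
      have := Finset.mem_range.1 (hs h.1)
      omega
    have hs1 : ∀ y : Fin m → Bits m, place Y (flatEquiv m y) ∪ s =
        cfgSet a m Y r (flatEquiv m x) l (flatEquiv m y) (fun _ => false) (fun _ => false) := by
      intro y
      ext u
      rw [mem_cfgSet, place_false, place_false, mem_union, hx, Equiv.apply_symm_apply, hl,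
        hr, mem_clearAt, mem_place_iff (x := readAt a (m * m) s)]
      simp only [notMem_empty, false_or, decide_eq_true_eq, readAt]
      by_cases h1 : a ≤ u ∧ u < a + m * m
      · have h2 : ¬ (u = a + m * m) := by omega
        have h3 : ¬ (u < a ∨ a + (m * m + 1) ≤ u) := by omega
        have h4 : u ∉ place Y (flatEquiv m y) := notMem_place (by omega)
        have h5 : a + (u - a) = u := by omega
        simp [h1, h2, h3, h4, h5]
      · by_cases h2 : u = a + m * m
        · subst h2
          have h3 : ¬ (a + m * m < a ∨ a + (m * m + 1) ≤ a + m * m) := by omega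
          have h4 : a + m * m ∉ place Y (flatEquiv m y) := notMem_place (by omega)
          simp [h3, h4]
        · have h3 : u < a ∨ a + (m * m + 1) ≤ u := by omega
          simp [h1, h2, h3]
    have hB : ∀ (x' y' : Fin m → Bits m) (t : Bits m),
        gatesOp ((passPatterns κ m).toList.flatMap (fun t =>
          patternGate (Y + m * m) t (a + m * m) (Y + m * m + m + m * m)) ++
          outputGates a m (Y + m * m + m))
          (ket (cfgSet a m Y r (flatEquiv m x') l (flatEquiv m y') t (fun _ => false))) =
        ket (place (Y + m * m) t ∪ (place Y (flatEquiv m y') ∪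
          place (Y + m * m + m) (flatEquiv m x')) ∪ (r ∪ place a fun _ : Fin 1 =>
            xor l (decide (t ∈ passPatterns κ m)))) := by
      intro x' y' t
      rw [gatesOp_append_apply, gatesOp_patterns _ (Finset.nodup_toList _) (by omega) (by omega)
        (by omega) (cfgSet_lt haY hout), readAt_coin haY hout]
      have hflip : (if t ∈ (passPatterns κ m).toList then symmDiff (cfgSet a m Y r (flatEquiv m x') l
          (flatEquiv m y') t (fun _ => false)) {a + m * m} else cfgSet a m Y r (flatEquiv m x') l
          (flatEquiv m y') t (fun _ => false)) =
          cfgSet a m Y r (flatEquiv m x') (xor l (decide (t ∈ passPatterns κ m)))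
            (flatEquiv m y') t (fun _ => false) := by
        simp only [Finset.mem_toList]
        split_ifs with ht
        · rw [cfgSet_flip haY hout]; simp [ht]
        · simp [ht]
      rw [hflip]
      generalize xor l (decide (t ∈ passPatterns κ m)) = l'
      rw [outputGates_ket (by omega)]
      · congr 1
        have e1 : readAt a (m * m) (cfgSet a m Y r (flatEquiv m x') l' (flatEquiv m y') t
            (fun _ => false)) = flatEquiv m x' := by
          rw [readAt_eq]
          exact cfgSet_input haY hout
        have e2 : decide (a + m * m ∈ cfgSet a m Y r (flatEquiv m x') l' (flatEquiv m y') t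
            (fun _ => false)) = l' := by
          rw [Bool.eq_iff_iff, decide_eq_true_iff, cfgSet_rest (by omega) (by omega)]
          have h3 : a + m * m ∉ place (Y + m * m) t := notMem_place (by omega)
          have h4 : a + m * m ∉ place (Y + m * m + m) (fun _ : Fin (m * m) => false) :=
              notMem_place (by omega)
          have h5 : a + m * m ∉ r := fun h => by have := hout _ h; omega
          simp [h3, h4, h5]
        have e3 : clearAt a (m * m + 1) (cfgSet a m Y r (flatEquiv m x') l' (flatEquiv m y') t
            (fun _ => false)) = place (Y + m * m) t ∪ (place Y (flatEquiv m y') ∪ r) := by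
          ext u
          rw [mem_clearAt, mem_cfgSet, place_false]
          simp only [mem_union, notMem_empty, false_or]
          by_cases h1 : a ≤ u ∧ u ≤ a + m * m
          · have h2 : ¬ (u < a ∨ a + (m * m + 1) ≤ u) := by omega
            have h3 : u ∉ place (Y + m * m) t := notMem_place (by omega)
            have h4 : u ∉ place Y (flatEquiv m y') := notMem_place (by omega)
            have h5 : u ∉ r := fun h => by have := hout _ h; omega
            simp [h2, h3, h4, h5]
          · have h2 : u < a ∨ a + (m * m + 1) ≤ u := by omega
            have h3 : u ∉ place a (flatEquiv m x') := notMem_place (by omega)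
            have h4 : u ≠ a + m * m := by omega
            simp only [h2, h3, h4, and_true, false_and, false_or]
            tauto
        rw [e1, e2, e3]
        ac_rfl
      · intro u hu
        rw [mem_cfgSet, place_false] at hu
        simp only [mem_place_iff, notMem_empty, false_or] at hu
        rcases hu with ⟨h, _⟩ | h | ⟨h, _⟩ | ⟨h, _⟩ | h
        · omega
        · omega
        · omega
        · omega
        · have := hout _ h; omega
    rw [LinearMap.comp_apply, LinearMap.sum_apply, map_sum, LinearMap.sum_apply]
    simp only [LinearMap.smul_apply, map_smul, attach_ket, hs1, LinearMap.comp_apply,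
      window_swapKraus_ket]
    set G : (Fin m → Bits m) → (Fin m → Bits m) → Bits m → Workspace := fun x' y' t' =>
      ket (place (Y + m * m) t' ∪
        (place Y (flatEquiv m y') ∪ place (Y + m * m + m) (flatEquiv m x')) ∪
          (r ∪ place a fun _ : Fin 1 => xor l (decide (t' ∈ passPatterns κ m)))) with hG
    have hA : ∀ y : Fin m → Bits m, gatesOp (channelGates κ a m Y) (ket (cfgSet a m Y r
        (flatEquiv m x) l (flatEquiv m y) (fun _ => false) (fun _ => false))) =
        ∑ t : Bits m, ∑ t' : Bits m, (∏ j, bitSign (t' j) (t j) / 2) •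
          G (selBlocks t x y) (selBlocks t y x) t' := by
      intro y
      rw [channelGates, gatesOp_append_apply, testGates_ket haY hout]
      simp only [map_sum, map_smul, hB, hG]
    simp only [hA]
    rw [sum_testGates]
    refine sum_congr rfl fun e _ => ?_
    have hp : (fun j => !e.1 j) ∈ passPatterns κ m ↔
        κ * m ≤ ((univ.filter fun j => e.1 j = true).card : ℝ) := by
      simp [passPatterns]
    have hx' : ∀ j, block (readAt a (m * m) s) j = x j := fun j => rfl
    simp only [hG, hp, hx', map_smul, attach_ket]
    congr!
  rw [LinearMap.comp_apply, LinearMap.sum_apply, LinearMap.sum_apply] at this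
  simpa only [LinearMap.smul_apply, LinearMap.comp_apply] using this

theorem channelGates_value {κ : ℝ} {a m Y : ℕ} (haY : a + m * m < Y) (ψ : Fin m → PureState m)
    {F : Workspace → ℝ} (hF : Local Y F) (hq : IsSumSq F) {v : Workspace} (hv : v ∈ low Y) :
    F (gatesOp (channelGates κ a m Y) (loadSlots Y m ψ v)) =
      ∑ e, F (window (swapKraus κ true ψ e) a v) := by
  rw [channelGates_loadSlots haY ψ hv]
  refine hF.sum hq univ _ ?_ ?_ _ ?_
  · rintro ⟨t, x, y⟩ _ ⟨t', x', y'⟩ _ h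
    simp only at h
    have hY : ∀ (t : Bits m) (x y : Fin m → Bits m), readAt Y (m * m) (place (Y + m * m) t ∪
        (place Y (flatEquiv m y) ∪ place (Y + m * m + m) (flatEquiv m x))) = flatEquiv m y := by
      intro t x y
      rw [Finset.union_left_comm]
      refine readAt_place_union (fun u hu => ?_) _
      simp only [mem_union, mem_place_iff] at hu
      rcases hu with ⟨h, _⟩ | ⟨h, _⟩ <;> omega
    have hC : ∀ (t : Bits m) (x y : Fin m → Bits m), readAt (Y + m * m) m (place (Y + m * m) t ∪
        (place Y (flatEquiv m y) ∪ place (Y + m * m + m) (flatEquiv m x))) = t := by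
      intro t x y
      refine readAt_place_union (fun u hu => ?_) _
      simp only [mem_union, mem_place_iff] at hu
      rcases hu with ⟨h, _⟩ | ⟨h, _⟩ <;> omega
    have hZ : ∀ (t : Bits m) (x y : Fin m → Bits m), readAt (Y + m * m + m) (m * m)
        (place (Y + m * m) t ∪ (place Y (flatEquiv m y) ∪ place (Y + m * m + m) (flatEquiv m x))) =
          flatEquiv m x := by
      intro t x y
      rw [← union_assoc, union_comm]
      refine readAt_place_union (fun u hu => ?_) _
      simp only [mem_union, mem_place_iff] at hu
      rcases hu with ⟨h, _⟩ | ⟨h, _⟩ <;> omega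
    have e1 := congrArg (readAt Y (m * m)) h
    have e2 := congrArg (readAt (Y + m * m) m) h
    have e3 := congrArg (readAt (Y + m * m + m) (m * m)) h
    rw [hY, hY] at e1
    rw [hC, hC] at e2
    rw [hZ, hZ] at e3
    have e4 : t = t' := by
      funext j
      have := congrFun e2 j
      simpa using this
    rw [(flatEquiv m).injective e1, (flatEquiv m).injective e3, e4]
  · rintro ⟨t, x, y⟩ _ u hu
    simp only [mem_union, mem_place_iff] at hu
    rcases hu with ⟨h, _⟩ | ⟨h, _⟩ | ⟨h, _⟩ <;> omega
  · exact fun e _ => window_low (by omega) (by omega) _ hv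

/-! ### Simulating an oracle circuit by gates -/

/-- A circuit of at most `ℓ` gates with measurement prepares `ψ` with probability at least `p`. -/
def Preparable (ℓ : ℕ) (p : ℝ) {m : ℕ} (ψ : PureState m) : Prop :=
  ∃ (c : List Gate) (o : Bits m) (r : ℂ), c.length ≤ ℓ ∧ (∀ g ∈ c, g.Below (2 * m)) ∧
    (∀ y, gatesOp c (ket ∅) (place 0 o ∪ place m y) = r * ψ.1 y) ∧ p ≤ Complex.normSq r

theorem exists_loadSlots {ℓ m i : ℕ} {p : ℝ} (hp : 0 ≤ p) (hp1 : p ≤ 1) {ψ : Fin i → PureState m}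
    (hψ : ∀ j, Preparable ℓ p (ψ j)) (K : ℕ) {Y M : ℕ} (hY : Y + m * i ≤ M) :
    ∃ (U : List Gate) (M' : ℕ), M ≤ M' ∧ (∀ g ∈ U, g.Below M') ∧
      U.length ≤ i * (K * (ℓ + 113 * m + 6)) ∧
      ∀ F, Local M F → IsSumSq F → ∀ v ∈ low Y,
        (1 - (1 - p) ^ K) ^ i * F (loadSlots Y i ψ v) ≤ F (gatesOp U v) := by
  have hs0 : 0 ≤ 1 - (1 - p) ^ K := sub_nonneg.2 (pow_le_one₀ (by linarith) (by linarith))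
  induction i generalizing M with
  | zero => exact ⟨[], M, le_rfl, by simp, by simp, fun F _ _ v _ => by simp [loadSlots]⟩
  | succ i ih =>
    rw [Nat.mul_succ] at hY
    obtain ⟨c, o, r, hcl, hcb, hr, hpr⟩ := hψ (Fin.last i)
    obtain ⟨U₁, M₁, hM₁, hb₁, hl₁, hU₁⟩ := exists_load hcb hr (Y := Y + m * i) (M := M) (by omega) K
    obtain ⟨U, M', hM', hb, hl, hU⟩ := ih (ψ := fun j => ψ j.castSucc) (fun j => hψ _)
      (M := M₁) (by omega)
    refine ⟨U ++ U₁, M', hM₁.trans hM', ?_, ?_, ?_⟩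
    · intro g hg
      rcases List.mem_append.1 hg with hg | hg
      · exact hb g hg
      · exact (hb₁ g hg).mono hM'
    · have := Nat.mul_le_mul_left K (show c.length + 113 * m + 6 ≤ ℓ + 113 * m + 6 by omega)
      rw [List.length_append, Nat.succ_mul]
      omega
    · intro F hF hq v hv
      have h1 := hU _ ((hF.mono hM₁).comp hb₁) (hq.gatesOp U₁) v hv
      have h2 := (hU₁ F hF hq _ (loadSlots_low (fun j => ψ j.castSucc) hv)).1
      rw [gatesOp_append_apply]
      refine le_trans ?_ h1
      have hr1 := normSq_branch_le hcb hr
      have h3 : (1 - (1 - p) ^ K) ≤ 1 - (1 - Complex.normSq r) ^ K :=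
        sub_le_sub_left (pow_le_pow_left₀ (by linarith) (by linarith) _) _
      rw [pow_succ, mul_assoc]
      refine mul_le_mul_of_nonneg_left (le_trans ?_ h2) (pow_nonneg hs0 _)
      exact mul_le_mul_of_nonneg_right h3 (hq.nonneg _)

/-- The number of gates that replace a query. -/
def queryCost (ℓ K m : ℕ) : ℕ :=
  m * (K * (ℓ + 113 * m + 6)) + (2 * m + 37 * (m * m) + 2 + 2 ^ m * (78 * m + 6))

theorem exists_query {ℓ m : ℕ} {p κ : ℝ} (hp : 0 ≤ p) (hp1 : p ≤ 1) {ψ : Fin m → PureState m}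
    (hψ : ∀ j, Preparable ℓ p (ψ j)) (K : ℕ) {a M : ℕ} (haM : a + m * m < M) :
    ∃ (U : List Gate) (M' : ℕ), M ≤ M' ∧ (∀ g ∈ U, g.Below M') ∧ U.length ≤ queryCost ℓ K m ∧
      ∀ F, Local M F → IsSumSq F → ∀ v ∈ low M,
        (1 - (1 - p) ^ K) ^ m * ∑ e, F (window (swapKraus κ true ψ e) a v) ≤ F (gatesOp U v) := by
  obtain ⟨U, M', hM', hb, hl, hU⟩ := exists_loadSlots hp hp1 hψ K (Y := M)
    (M := M + m * m + m + m * m + m) (by omega)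
  have hcb := channelGates_below (κ := κ) haM (le_refl (M + m * m + m + m * m + m))
  refine ⟨U ++ channelGates κ a m M, M', by omega, ?_, ?_, ?_⟩
  · intro g hg
    rcases List.mem_append.1 hg with hg | hg
    · exact hb g hg
    · exact (hcb g hg).mono hM'
  · have := channelGates_length κ a m M
    rw [List.length_append, queryCost]
    omega
  · intro F hF hq v hv
    rw [← channelGates_value haM ψ hF hq hv, gatesOp_append_apply]
    exact hU _ ((hF.mono (by omega)).comp hcb) (hq.gatesOp _) v hv

/-- All wires used by an instruction are below `M`. -/
def Instr.Below (M : ℕ) : Instr → Prop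
  | .gate g => g.Below M
  | .query m a => a + m * m < M

theorem Instr.Below.mono {M M' : ℕ} (h : M ≤ M') {i : Instr} (hi : i.Below M) : i.Below M' := by
  cases i with
  | gate g => exact Gate.Below.mono h hi
  | query m a => exact lt_of_lt_of_le hi h

theorem exists_circuit_below (c : Circuit) : ∃ M, ∀ i ∈ c, i.Below M := by
  induction c with
  | nil => exact ⟨0, by simp⟩
  | cons i c ih =>
    obtain ⟨M, hM⟩ := ih
    obtain ⟨N, hN⟩ : ∃ N, i.Below N := by
      cases i with
      | gate g => exact g.exists_below
      | query m a => exact ⟨a + m * m + 1, Nat.lt_succ_self _⟩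
    refine ⟨max M N, fun j hj => ?_⟩
    rcases List.mem_cons.1 hj with rfl | hj
    · exact hN.mono (le_max_right _ _)
    · exact (hM j hj).mono (le_max_left _ _)

theorem exists_simulation {κ : ℝ} {L : Set ℕ} {ψ : ∀ n, Fin n → PureState n} {σ : ℝ} (hσ : 0 ≤ σ)
    (hσ1 : σ ≤ 1) {Q K : ℕ} (hQ : 1 ≤ Q) (c : Circuit)
    (hL : ∀ m ∈ queries c, m ∈ L → ∃ (ℓ : ℕ) (p : ℝ), 0 ≤ p ∧ p ≤ 1 ∧
      (∀ j, Preparable ℓ p (ψ m j)) ∧ queryCost ℓ K m ≤ Q ∧ σ ≤ (1 - (1 - p) ^ K) ^ m)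
    (hm : ∀ m ∈ queries c, m ∉ L → 2 * (m * m) + 2 ≤ Q) {M : ℕ} (hM : ∀ i ∈ c, i.Below M) :
    ∃ (U : List Gate) (M' : ℕ), M ≤ M' ∧ (∀ g ∈ U, g.Below M') ∧ U.length ≤ c.length * Q ∧
      ∀ F, Local M F → IsSumSq F → ∀ v ∈ low M,
        σ ^ c.length * expect (truncOracle κ L ψ) c F v ≤ F (gatesOp U v) := by
  induction c with
  | nil => exact ⟨[], M, le_rfl, by simp, by simp, fun F _ _ v _ => by simp [expect]⟩
  | cons i c ih =>
    have hMc : ∀ j ∈ c, j.Below M := fun j hj => hM j (by simp [hj])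
    cases i with
    | gate g =>
      obtain ⟨U, M', hM', hb, hl, hU⟩ := ih hL hm hMc
      have hg : g.Below M := hM (.gate g) (by simp)
      refine ⟨g :: U, M', hM', ?_, ?_, ?_⟩
      · intro g' hg'
        rcases List.mem_cons.1 hg' with rfl | hg'
        · exact hg.mono hM'
        · exact hb g' hg'
      · rw [List.length_cons, List.length_cons, Nat.succ_mul]; omega
      · intro F hF hq v hv
        have hgv : g.op v ∈ low M := by
          have := gatesOp_low (c := [g]) (by simpa using hg) hv
          simpa using this
        have h1 := hU F hF hq _ hgv
        rw [gatesOp_cons, List.length_cons, pow_succ]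
        refine le_trans ?_ h1
        have h0 : 0 ≤ expect (truncOracle κ L ψ) c F (g.op v) := (hq.expect _ _).nonneg _
        have : expect (truncOracle κ L ψ) (.gate g :: c) F v =
          expect (truncOracle κ L ψ) c F (g.op v) := rfl
        rw [this]
        refine mul_le_mul_of_nonneg_right ?_ h0
        exact mul_le_of_le_one_right (pow_nonneg hσ _) hσ1
    | query m a =>
      obtain ⟨U, M', hM', hb, hl, hU⟩ := ih (fun m' h' => hL m' (by simp [queries, h']))
        (fun m' h' => hm m' (by simp [queries, h'])) hMc
      have ha : a + m * m < M := hM (.query m a) (by simp)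
      have hexp : ∀ F v, expect (truncOracle κ L ψ) (.query m a :: c) F v =
          ∑ e, expect (truncOracle κ L ψ) c F
            (window (((truncOracle κ L ψ).chan m).kraus e) a v) := fun _ _ => rfl
      obtain ⟨U₁, M₁, hM₁, hb₁, hl₁, hU₁⟩ : ∃ (U₁ : List Gate) (M₁ : ℕ), M' ≤ M₁ ∧
          (∀ g ∈ U₁, g.Below M₁) ∧ U₁.length ≤ Q ∧ ∀ F, Local M' F → IsSumSq F → ∀ v ∈ low M,
          ∀ G : Workspace → ℝ, (∀ u ∈ low M, σ ^ c.length * G u ≤ F u) → (∀ u, 0 ≤ G u) →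
          σ ^ (c.length + 1) * ∑ e, G (window (((truncOracle κ L ψ).chan m).kraus e) a v) ≤
            F (gatesOp U₁ v) := by
        by_cases hmL : m ∈ L
        · obtain ⟨ℓ, p, hp, hp1, hprep, hcost, hσp⟩ := hL m (by simp [queries]) hmL
          obtain ⟨U₁, M₁, hM₁, hb₁, hl₁, hU₁⟩ := exists_query (κ := κ) hp hp1 hprep K
            (a := a) (M := M') (by omega)
          refine ⟨U₁, M₁, hM₁, hb₁, hl₁.trans hcost, ?_⟩
          intro F hF hq v hv G hG hG0
          refine le_trans ?_ (hU₁ F hF hq v (low_mono hM' hv))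
          rw [expect_trunc_of_mem hmL, pow_succ, mul_comm (σ ^ c.length), mul_assoc, mul_sum]
          refine mul_le_mul hσp (sum_le_sum fun e _ => hG _ ?_)
            (sum_nonneg fun e _ => mul_nonneg (pow_nonneg hσ _) (hG0 _))
            (hσ.trans hσp)
          exact window_low (by omega) (by omega) _ hv
        · refine ⟨outputGates a m M', M' + m * m, by omega,
            outputGates_below (by omega) le_rfl, ?_, ?_⟩
          · rw [outputGates_length]
            exact hm m (by simp [queries]) hmL
          · intro F hF hq v hv G hG hG0
            rw [discard_value (by omega) hF hq (low_mono hM' hv), expect_trunc_of_notMem hmL,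
              pow_succ, mul_sum]
            refine sum_le_sum fun e _ => le_trans ?_ (hG _ (window_low (by omega)
              (by omega) _ hv))
            exact mul_le_mul_of_nonneg_right (mul_le_of_le_one_right (pow_nonneg hσ _) hσ1) (hG0 _)
      refine ⟨U₁ ++ U, M₁, hM'.trans hM₁, ?_, ?_, ?_⟩
      · intro g hg
        rcases List.mem_append.1 hg with hg | hg
        · exact hb₁ g hg
        · exact (hb g hg).mono hM₁
      · rw [List.length_append, List.length_cons, Nat.succ_mul]; omega
      · intro F hF hq v hv
        rw [gatesOp_append_apply, hexp, List.length_cons]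
        exact hU₁ _ ((hF.mono hM').comp hb) (hq.gatesOp U) v hv _ (fun u hu => hU F hF hq u hu)
          fun u => (hq.expect _ _).nonneg u

/-! ### From windows to the first wires -/

/-- Rotate the first `b + n` wires, so that the wires `b, …, b + n - 1` become the first ones. -/
def rotateWire (b n u : ℕ) : ℕ := if u < b then u + n else if u < b + n then u - b else u

theorem rotateWire_injective (b n : ℕ) : Function.Injective (rotateWire b n) := by
  intro u w h
  simp only [rotateWire] at h
  split_ifs at h <;> omega

theorem sqNorm_embed {f : ℕ → ℕ} (hf : Function.Injective f) (v : Workspace) :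
    sqNorm (embed f ∅ v) = sqNorm v := by
  have hinj : Function.Injective (Finset.image f) := Finset.image_injective hf
  have e : embed f ∅ v = Finsupp.mapDomain (Finset.image f) v := by
    have : embed f ∅ = Finsupp.lmapDomain ℂ ℂ (Finset.image f) :=
      linearMap_ext_ket fun s => by
        rw [embed_ket, empty_union, Finsupp.lmapDomain_apply]
        exact Finsupp.mapDomain_single.symm
    rw [this]; rfl
  rw [e, sqNorm, Finsupp.mapDomain_support_of_injective hinj,
    Finset.sum_image fun _ _ _ _ h => hinj h, sqNorm]
  exact sum_congr rfl fun s _ => by rw [Finsupp.mapDomain_apply hinj]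

theorem fidelity_rotate {n : ℕ} (ψ : PureState n) (b : ℕ) (v : Workspace) :
    fidelity ψ (embed (rotateWire b n) ∅ v) = fidAt ψ b v := by
  have hf := rotateWire_injective b n
  refine Eq.trans (congrArg sqNorm ?_) (sqNorm_embed hf _)
  have : (window (fun (_ : Bits 0) (x : Bits n) => (starRingEnd ℂ) (ψ.1 x)) 0 ∘ₗ
      embed (rotateWire b n) ∅) = embed (rotateWire b n) ∅ ∘ₗ
        window (fun (_ : Bits 0) (x : Bits n) => (starRingEnd ℂ) (ψ.1 x)) b := by
    refine linearMap_ext_ket fun s => ?_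
    rw [LinearMap.comp_apply, LinearMap.comp_apply, embed_ket]
    refine (window_ket _ 0 _).trans (Eq.trans ?_ (congrArg (embed (rotateWire b n) ∅)
      (window_ket _ b s).symm))
    rw [map_sum]
    refine sum_congr rfl fun y _ => ?_
    rw [map_smul, embed_ket]
    have e0 : ∀ a, place a y = ∅ := fun a => by simp [place]
    have hmem : ∀ i, i < n → (i ∈ s.image (rotateWire b n) ↔ b + i ∈ s) := by
      intro i hi
      have : rotateWire b n (b + i) = i := by
        rw [rotateWire, if_neg (by omega), if_pos (by omega)]; omega
      rw [mem_image]
      constructor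
      · rintro ⟨u, hu, he⟩
        rwa [← hf (he.trans this.symm)]
      · exact fun h => ⟨_, h, this⟩
    have e1 : readAt 0 n (∅ ∪ s.image (rotateWire b n)) = readAt b n s := by
      funext i
      rw [empty_union, readAt, readAt]
      simp only [zero_add, hmem i i.2]
    have e2 : clearAt 0 n (∅ ∪ s.image (rotateWire b n)) =
        (clearAt b n s).image (rotateWire b n) := by
      ext u
      rw [mem_clearAt, empty_union]
      simp only [mem_image, mem_clearAt]
      constructor
      · rintro ⟨⟨w, hw, rfl⟩, h⟩
        refine ⟨w, ⟨hw, ?_⟩, rfl⟩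
        simp only [rotateWire] at h
        split_ifs at h <;> omega
      · rintro ⟨w, ⟨hw, h⟩, rfl⟩
        refine ⟨⟨w, hw, rfl⟩, ?_⟩
        simp only [rotateWire]
        split_ifs <;> omega
    rw [e0, e0, e1, e2]
    simp
  exact LinearMap.congr_fun this v

/-- Gates that write a string. -/
def writeGates (a : ℕ) {k : ℕ} (y : Bits k) : List Gate := maskGates a fun i => !y i

theorem writeGates_ket (a : ℕ) {k : ℕ} (y : Bits k) :
    gatesOp (writeGates a y) (ket ∅) = ket (place a y) := by
  obtain ⟨s', h1, h2⟩ := maskGates_ket (a := a) (fun i => !y i) ∅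
  rw [writeGates, h1]
  congr 1
  ext u
  rw [h2, mem_place]
  simp

theorem writeGates_length (a : ℕ) {k : ℕ} (y : Bits k) : (writeGates a y).length ≤ 6 * k :=
  maskGates_length a _

theorem expect_le_of_not_easy {κ : ℝ} {L : Set ℕ} {ψ : ∀ n, Fin n → PureState n} {σ : ℝ}
    (hσ : 0 ≤ σ) (hσ1 : σ ≤ 1) {Q K : ℕ} (hQ : 1 ≤ Q) (c : Circuit)
    (hL : ∀ m ∈ queries c, m ∈ L → ∃ (ℓ : ℕ) (p : ℝ), 0 ≤ p ∧ p ≤ 1 ∧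
      (∀ j, Preparable ℓ p (ψ m j)) ∧ queryCost ℓ K m ≤ Q ∧ σ ≤ (1 - (1 - p) ^ K) ^ m)
    (hm : ∀ m ∈ queries c, m ∉ L → 2 * (m * m) + 2 ≤ Q) {n k w : ℕ} {φ : PureState n}
    (hφ : ¬ Easy k φ) (hlen : c.length * Q + 6 * w ≤ n ^ k) (b : ℕ) (y : Bits w) :
    σ ^ c.length * expect (truncOracle κ L ψ) c (fidAt φ b) (ket (place 1 y)) ≤
      ((n : ℝ) ^ k)⁻¹ := by
  obtain ⟨M, hM⟩ := exists_circuit_below c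
  obtain ⟨U, M', _, _, hl, hU⟩ := exists_simulation (κ := κ) hσ hσ1 hQ c hL hm
    (M := max M (max (b + n) (1 + w))) fun i hi => (hM i hi).mono (le_max_left _ _)
  refine le_trans (hU _ ((local_fidAt φ b).mono (by omega)) (isSumSq_fidAt φ b) _
    (ket_mem_low (place_subset_range (by omega) y))) ?_
  have h1 : ¬ _ := fun h => hφ ⟨(writeGates 1 y ++ U).map (Gate.map (rotateWire b n)), ?_, h⟩
  · rw [not_le, runGates_eq] at h1
    have e : (ket ∅ : Workspace) = embed (rotateWire b n) ∅ (ket ∅) := by simp [embed_ket]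
    rw [e, gatesOp_embed (rotateWire_injective b n) _ (by simp), fidelity_rotate,
      gatesOp_append_apply, writeGates_ket] at h1
    exact h1.le
  · have := writeGates_length 1 y
    rw [List.length_map, List.length_append]
    omega

/-! ### Polynomial-time machines -/

section Machines

open Turing Turing.TM2

variable {K K' : Type} [DecidableEq K] [DecidableEq K'] {Γ : K → Type} {Λ Λ' σ σ' G : Type}

/-- The letters that a statement may push. -/
def letters : Stmt Γ Λ σ → Set (Σ k, Γ k)
  | .push k f q => Set.range (fun v => ⟨k, f v⟩) ∪ letters q
  | .peek _ _ q => letters q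
  | .pop _ _ q => letters q
  | .load _ q => letters q
  | .branch _ q₁ q₂ => letters q₁ ∪ letters q₂
  | .goto _ => ∅
  | .halt => ∅

theorem letters_finite [Finite σ] (q : Stmt Γ Λ σ) : (letters q).Finite := by
  induction q with
  | push k f q ih => exact (Set.finite_range _).union ih
  | peek k f q ih => exact ih
  | pop k f q ih => exact ih
  | load f q ih => exact ih
  | branch f q₁ q₂ ih₁ ih₂ => exact ih₁.union ih₂
  | goto f => exact Set.finite_empty
  | halt => exact Set.finite_empty

/-- Rename stacks, letters, labels and states of a statement. -/
def translate (eK : K ≃ K') (eΛ : Λ ≃ Λ') (eσ : σ ≃ σ') (r : (Σ k, Γ k) → G)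
    (i : ∀ k, G → Option (Γ k)) : Stmt Γ Λ σ → Stmt (fun _ : K' => G) Λ' σ'
  | .push k f q => .push (eK k) (fun v => r ⟨k, f (eσ.symm v)⟩) (translate eK eΛ eσ r i q)
  | .peek k f q => .peek (eK k) (fun v o => eσ (f (eσ.symm v) (o.bind (i k))))
      (translate eK eΛ eσ r i q)
  | .pop k f q => .pop (eK k) (fun v o => eσ (f (eσ.symm v) (o.bind (i k))))
      (translate eK eΛ eσ r i q)
  | .load f q => .load (fun v => eσ (f (eσ.symm v))) (translate eK eΛ eσ r i q)
  | .branch f q₁ q₂ => .branch (fun v => f (eσ.symm v)) (translate eK eΛ eσ r i q₁)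
      (translate eK eΛ eσ r i q₂)
  | .goto f => .goto fun v => eΛ (f (eσ.symm v))
  | .halt => .halt

/-- The stacks `S` over letters in `U` correspond to the stacks `S'`. -/
def StacksCorrespond (eK : K ≃ K') (r : (Σ k, Γ k) → G) (U : Set (Σ k, Γ k))
    (S : ∀ k, List (Γ k)) (S' : K' → List G) : Prop :=
  ∀ k, S' (eK k) = (S k).map (fun a => r ⟨k, a⟩) ∧ ∀ a ∈ S k, (⟨k, a⟩ : Σ k, Γ k) ∈ U

theorem StacksCorrespond.update {eK : K ≃ K'} {r : (Σ k, Γ k) → G} {U : Set (Σ k, Γ k)}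
    {S : ∀ k, List (Γ k)} {S' : K' → List G} (h : StacksCorrespond eK r U S S') (k : K)
    (l : List (Γ k)) (hl : ∀ a ∈ l, (⟨k, a⟩ : Σ k, Γ k) ∈ U) :
    StacksCorrespond eK r U (Function.update S k l)
      (Function.update S' (eK k) (l.map fun a => r ⟨k, a⟩)) := by
  intro k'
  by_cases hk : k' = k
  · subst hk
    simpa using hl
  · rw [Function.update_of_ne hk, Function.update_of_ne (by simpa using hk)]
    exact h k'

/-- Corresponding configurations. -/
def CfgCorrespond (eK : K ≃ K') (eΛ : Λ ≃ Λ') (eσ : σ ≃ σ') (r : (Σ k, Γ k) → G)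
    (U : Set (Σ k, Γ k)) (C : Cfg Γ Λ σ) (C' : Cfg (fun _ : K' => G) Λ' σ') : Prop :=
  C'.l = C.l.map eΛ ∧ C'.var = eσ C.var ∧ StacksCorrespond eK r U C.stk C'.stk

theorem translate_stepAux {eK : K ≃ K'} {eΛ : Λ ≃ Λ'} {eσ : σ ≃ σ'} {r : (Σ k, Γ k) → G}
    {i : ∀ k, G → Option (Γ k)} {U : Set (Σ k, Γ k)}
    (hi : ∀ k a, (⟨k, a⟩ : Σ k, Γ k) ∈ U → i k (r ⟨k, a⟩) = some a) (q : Stmt Γ Λ σ)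
    (hq : letters q ⊆ U) (v : σ) {S : ∀ k, List (Γ k)} {S' : K' → List G}
    (h : StacksCorrespond eK r U S S') :
    CfgCorrespond eK eΛ eσ r U (stepAux q v S)
      (stepAux (translate eK eΛ eσ r i q) (eσ v) S') := by
  have hhead : ∀ k, ((S' (eK k)).head?).bind (i k) = (S k).head? := by
    intro k
    rw [(h k).1]
    have := (h k).2
    cases hS : S k with
    | nil => rfl
    | cons a l =>
      simp only [List.map_cons, List.head?_cons, Option.bind_some]
      exact hi k a (this a (by simp [hS]))
  induction q generalizing v S S' with
  | push k f q ih =>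
    simp only [letters, Set.union_subset_iff] at hq
    simp only [translate, stepAux, Equiv.symm_apply_apply]
    have hc : StacksCorrespond eK r U (Function.update S k (f v :: S k))
        (Function.update S' (eK k) (r ⟨k, f v⟩ :: S' (eK k))) := by
      rw [(h k).1]
      refine h.update k (f v :: S k) ?_
      intro a ha
      rcases List.mem_cons.1 ha with rfl | ha
      · exact hq.1 ⟨v, rfl⟩
      · exact (h k).2 a ha
    refine ih hq.2 v hc ?_
    intro k'
    rw [(hc k').1]
    have := (hc k').2
    cases hS : Function.update S k (f v :: S k) k' with
    | nil => rfl
    | cons a l =>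
      simp only [List.map_cons, List.head?_cons, Option.bind_some]
      exact hi k' a (this a (by simp [hS]))
  | peek k f q ih =>
    simp only [translate, stepAux, Equiv.symm_apply_apply, hhead]
    exact ih hq _ h hhead
  | pop k f q ih =>
    simp only [translate, stepAux, Equiv.symm_apply_apply, hhead]
    have hc : StacksCorrespond eK r U (Function.update S k (S k).tail)
        (Function.update S' (eK k) (S' (eK k)).tail) := by
      rw [(h k).1, ← List.map_tail]
      exact h.update k _ fun a ha => (h k).2 a (List.mem_of_mem_tail ha)
    refine ih hq _ hc ?_
    intro k'
    rw [(hc k').1]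
    have := (hc k').2
    cases hS : Function.update S k (S k).tail k' with
    | nil => rfl
    | cons a l =>
      simp only [List.map_cons, List.head?_cons, Option.bind_some]
      exact hi k' a (this a (by simp [hS]))
  | load f q ih =>
    simp only [translate, stepAux, Equiv.symm_apply_apply]
    exact ih hq _ h hhead
  | branch f q₁ q₂ ih₁ ih₂ =>
    simp only [letters, Set.union_subset_iff] at hq
    simp only [translate, stepAux, Equiv.symm_apply_apply]
    cases f v
    · exact ih₂ hq.2 _ h hhead
    · exact ih₁ hq.1 _ h hhead
  | goto f => exact ⟨by simp [translate], rfl, h⟩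
  | halt => exact ⟨by simp [translate], rfl, h⟩

/-- Iterate a partial function. -/
theorem iterate_bind_succ {α : Type} (f : α → Option α) (t : ℕ) (a b : α)
    (h : (flip bind f)^[t + 1] (some a) = some b) :
    ∃ c, f a = some c ∧ (flip bind f)^[t] (some c) = some b := by
  rw [Function.iterate_succ_apply] at h
  have h1 : flip bind f (some a) = f a := rfl
  rw [h1] at h
  cases hf : f a with
  | none =>
    exfalso
    rw [hf] at h
    have : ∀ t, (flip bind f)^[t] none = none := by
      intro t
      induction t with
      | zero => rfl
      | succ t ih => rw [Function.iterate_succ_apply]; exact ih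
    rw [this] at h
    cases h
  | some c => exact ⟨c, rfl, by rwa [hf] at h⟩

theorem translate_iterate {eK : K ≃ K'} {eΛ : Λ ≃ Λ'} {eσ : σ ≃ σ'} {r : (Σ k, Γ k) → G}
    {i : ∀ k, G → Option (Γ k)} {U : Set (Σ k, Γ k)}
    (hi : ∀ k a, (⟨k, a⟩ : Σ k, Γ k) ∈ U → i k (r ⟨k, a⟩) = some a) {M : Λ → Stmt Γ Λ σ}
    (hM : ∀ l, letters (M l) ⊆ U) (t : ℕ) {C C₁ : Cfg Γ Λ σ} {C' : Cfg (fun _ : K' => G) Λ' σ'}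
    (h : CfgCorrespond eK eΛ eσ r U C C') (hC : (flip bind (step M))^[t] (some C) = some C₁) :
    ∃ C₁', (flip bind (step fun l => translate eK eΛ eσ r i (M (eΛ.symm l))))^[t] (some C') =
      some C₁' ∧ CfgCorrespond eK eΛ eσ r U C₁ C₁' := by
  induction t generalizing C C' with
  | zero =>
    obtain rfl : C = C₁ := by simpa using hC
    exact ⟨C', rfl, h⟩
  | succ t ih =>
    obtain ⟨C₂, h1, h2⟩ := iterate_bind_succ _ _ _ _ hC
    obtain ⟨l, v, S⟩ := C
    obtain ⟨l', v', S'⟩ := C'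
    obtain ⟨hl, hv, hS⟩ := h
    simp only at hl hv hS
    cases l with
    | none => simp [step] at h1
    | some l =>
      simp only [step, Option.some.injEq] at h1
      subst h1 hl hv
      obtain ⟨C₁', h3, h4⟩ := ih (translate_stepAux (eΛ := eΛ) (eσ := eσ) hi (M l) (hM l) v hS) h2
      refine ⟨C₁', ?_, h4⟩
      rw [Function.iterate_succ_apply, ← h3]
      congr 1
      simp [flip, step]


/-- Statements of height at most `n`. -/
def stmtStage (Γ : K → Type) (Λ σ : Type) : ℕ → Set (Stmt Γ Λ σ)
  | 0 => ∅
  | n + 1 =>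
    (⋃ k, Set.image2 (Stmt.push k) Set.univ (stmtStage Γ Λ σ n)) ∪
    (⋃ k, Set.image2 (Stmt.peek k) Set.univ (stmtStage Γ Λ σ n)) ∪
    (⋃ k, Set.image2 (Stmt.pop k) Set.univ (stmtStage Γ Λ σ n)) ∪
    Set.image2 Stmt.load Set.univ (stmtStage Γ Λ σ n) ∪
    (⋃ f, Set.image2 (Stmt.branch f) (stmtStage Γ Λ σ n) (stmtStage Γ Λ σ n)) ∪
    Set.range Stmt.goto ∪ {Stmt.halt} ∪ stmtStage Γ Λ σ n

theorem stmtStage_mono {Γ : K → Type} {Λ σ : Type} : Monotone (stmtStage Γ Λ σ) :=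
  monotone_nat_of_le_succ fun _ _ h => Or.inr h

theorem countable_stmt [Countable K] [∀ k, Countable (Γ k)] [∀ k, Finite (Γ k)] [Countable Λ]
    [Finite σ] : Countable (Stmt Γ Λ σ) := by
  have : Countable σ := Finite.to_countable
  have h1 : ∀ n, (stmtStage Γ Λ σ n).Countable := by
    intro n
    induction n with
    | zero => exact Set.countable_empty
    | succ n ih =>
      refine ((((((Set.Countable.union ?_ ?_).union ?_).union ?_).union ?_).union
        ?_).union ?_).union ih
      · exact Set.countable_iUnion fun k => Set.Countable.image2 Set.countable_univ ih _
      · exact Set.countable_iUnion fun k => Set.Countable.image2 Set.countable_univ ih _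
      · exact Set.countable_iUnion fun k => Set.Countable.image2 Set.countable_univ ih _
      · exact Set.Countable.image2 Set.countable_univ ih _
      · exact Set.countable_iUnion fun f => Set.Countable.image2 ih ih _
      · exact Set.countable_range _
      · exact Set.countable_singleton _
  have h2 : ∀ q : Stmt Γ Λ σ, ∃ n, q ∈ stmtStage Γ Λ σ n := by
    intro q
    induction q with
    | push k f q ih =>
      obtain ⟨n, h⟩ := ih
      exact ⟨n + 1, by
        simp only [stmtStage, Set.mem_union, Set.mem_iUnion]
        exact .inl (.inl (.inl (.inl (.inl (.inl (.inl ⟨k, f, trivial, q, h, rfl⟩))))))⟩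
    | peek k f q ih =>
      obtain ⟨n, h⟩ := ih
      exact ⟨n + 1, by
        simp only [stmtStage, Set.mem_union, Set.mem_iUnion]
        exact .inl (.inl (.inl (.inl (.inl (.inl (.inr ⟨k, f, trivial, q, h, rfl⟩))))))⟩
    | pop k f q ih =>
      obtain ⟨n, h⟩ := ih
      exact ⟨n + 1, by
        simp only [stmtStage, Set.mem_union, Set.mem_iUnion]
        exact .inl (.inl (.inl (.inl (.inl (.inr ⟨k, f, trivial, q, h, rfl⟩)))))⟩
    | load f q ih =>
      obtain ⟨n, h⟩ := ih
      exact ⟨n + 1, .inl (.inl (.inl (.inl (.inr ⟨f, trivial, q, h, rfl⟩))))⟩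
    | branch f q₁ q₂ ih₁ ih₂ =>
      obtain ⟨n, h⟩ := ih₁
      obtain ⟨n', h'⟩ := ih₂
      refine ⟨max n n' + 1, ?_⟩
      simp only [stmtStage, Set.mem_union, Set.mem_iUnion]
      exact .inl (.inl (.inl (.inr ⟨f, q₁, stmtStage_mono (le_max_left _ _) h, q₂,
        stmtStage_mono (le_max_right _ _) h', rfl⟩)))
    | goto f => exact ⟨1, .inl (.inl (.inr ⟨f, rfl⟩))⟩
    | halt => exact ⟨1, .inl (.inr rfl)⟩
  rw [← Set.countable_univ_iff]
  refine (Set.countable_iUnion h1).mono fun q _ => ?_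
  obtain ⟨n, h⟩ := h2 q
  exact Set.mem_iUnion.2 ⟨n, h⟩

/-- Machines with standard stacks, letters, labels and states: the sizes of these sets, the
program, the initial label and state, the input and output stacks, and the input and output
alphabets. -/
abbrev MachineCode : Type :=
  Σ z : ℕ × ℕ × ℕ × ℕ,
    (Fin z.2.1 → Stmt (fun _ : Fin z.1 => Fin z.2.2.2) (Fin z.2.1) (Fin z.2.2.1)) ×
      (Fin z.2.1 × Fin z.2.2.1) × (Fin z.1 × Fin z.1) ×
      (Option Bool → Fin z.2.2.2) × (Fin z.2.2.2 → Fin 6)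

/-- The machine with the given code computes `V`. -/
def MachineCode.Computes (D : MachineCode) (V : List (Option Bool) → Circuit) : Prop :=
  ∀ x, ∃ (t : ℕ) (C : Cfg (fun _ : Fin D.1.1 => Fin D.1.2.2.2) (Fin D.1.2.1) (Fin D.1.2.2.1)),
    (flip bind (step D.2.1))^[t] (some ⟨some D.2.2.1.1, D.2.2.1.2,
      fun k => if k = D.2.2.2.1.1 then x.map D.2.2.2.2.1 else []⟩) = some C ∧ C.l = none ∧
      (C.stk D.2.2.2.1.2).map D.2.2.2.2.2 = encodeCircuit (V x)

theorem iterate_halt_unique {α : Type} {f : α → Option α} {t t' : ℕ} {a b b' : α}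
    (h : (flip bind f)^[t] (some a) = some b) (hb : f b = none)
    (h' : (flip bind f)^[t'] (some a) = some b') (hb' : f b' = none) : b = b' := by
  induction t generalizing a t' with
  | zero =>
    obtain rfl : a = b := by simpa using h
    cases t' with
    | zero => simpa using h'
    | succ t' =>
      obtain ⟨c, hc, -⟩ := iterate_bind_succ _ _ _ _ h'
      rw [hb] at hc; cases hc
  | succ t ih =>
    obtain ⟨c, hc, h1⟩ := iterate_bind_succ _ _ _ _ h
    cases t' with
    | zero =>
      obtain rfl : a = b' := by simpa using h'
      rw [hb'] at hc; cases hc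
    | succ t' =>
      obtain ⟨c', hc', h2⟩ := iterate_bind_succ _ _ _ _ h'
      rw [hc] at hc'
      cases hc'
      exact ih h1 h2

theorem MachineCode.Computes.unique {D : MachineCode} {V V' : List (Option Bool) → Circuit}
    (h : D.Computes V) (h' : D.Computes V') : V = V' := by
  funext x
  obtain ⟨t, C, h1, h2, h3⟩ := h x
  obtain ⟨t', C', h1', h2', h3'⟩ := h' x
  have hn : ∀ C : Cfg (fun _ : Fin D.1.1 => Fin D.1.2.2.2) (Fin D.1.2.1) (Fin D.1.2.2.1),
      C.l = none → step D.2.1 C = none := by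
    rintro ⟨l, v, S⟩ h
    simp only at h
    subst h
    rfl
  have := iterate_halt_unique h1 (hn _ h2) h1' (hn _ h2')
  subst this
  exact encodeCircuit_injective (h3.symm.trans h3')

theorem initList_stk_self (tm : FinTM2) (s : List (tm.Γ tm.k₀)) :
    (initList tm s).stk tm.k₀ = s := by
  simp [initList]

theorem initList_stk_of_ne (tm : FinTM2) (s : List (tm.Γ tm.k₀)) {k : tm.K} (h : k ≠ tm.k₀) :
    (initList tm s).stk k = [] := by
  simp [initList, h]

theorem haltList_stk_self (tm : FinTM2) (s : List (tm.Γ tm.k₁)) :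
    (haltList tm s).stk tm.k₁ = s := by
  simp [haltList]

theorem PolyTime.exists_code {V : List (Option Bool) → Circuit} (hV : PolyTime V) :
    ∃ D : MachineCode, D.Computes V := by
  classical
  obtain ⟨⟨⟨tm, α, β⟩, T, hT⟩⟩ := hV
  have := tm.kFin
  have := tm.ΛFin
  have := tm.σFin
  have := tm.Γk₀Fin
  set U : Set (Σ k, tm.Γ k) := (⋃ l, letters (tm.m l)) ∪ Set.range (fun a => ⟨tm.k₀, a⟩) with hU
  have hUf : U.Finite := (Set.finite_iUnion fun l => letters_finite _).union (Set.finite_range _)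
  have : Fintype U := hUf.fintype
  let e := Fintype.equivFin (Option U)
  let r : (Σ k, tm.Γ k) → Fin (Fintype.card (Option U)) := fun a =>
    e (if h : a ∈ U then some ⟨a, h⟩ else none)
  have hr : ∀ a ∈ U, ∀ b ∈ U, r a = r b → a = b := by
    intro a ha b hb h
    have := e.injective h
    simpa [ha, hb] using this
  let i : ∀ k, Fin (Fintype.card (Option U)) → Option (tm.Γ k) := fun k y =>
    if h : ∃ a, (⟨k, a⟩ : Σ k, tm.Γ k) ∈ U ∧ r ⟨k, a⟩ = y then some h.choose else none
  have hi : ∀ k a, (⟨k, a⟩ : Σ k, tm.Γ k) ∈ U → i k (r ⟨k, a⟩) = some a := by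
    intro k a ha
    have h : ∃ a', (⟨k, a'⟩ : Σ k, tm.Γ k) ∈ U ∧ r ⟨k, a'⟩ = r ⟨k, a⟩ := ⟨a, ha, rfl⟩
    simp only [i, dif_pos h, Option.some.injEq]
    have := hr _ h.choose_spec.1 _ ha h.choose_spec.2
    simpa using this
  let eK := Fintype.equivFin tm.K
  let eΛ := Fintype.equivFin tm.Λ
  let eσ := Fintype.equivFin tm.σ
  refine ⟨⟨⟨Fintype.card tm.K, Fintype.card tm.Λ, Fintype.card tm.σ, Fintype.card (Option U)⟩,
    fun l => translate eK eΛ eσ r i (tm.m (eΛ.symm l)), (eΛ tm.main, eσ tm.initialState),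
    (eK tm.k₀, eK tm.k₁), fun a => r ⟨tm.k₀, α.symm a⟩, fun y => ((i tm.k₁ y).map β).getD 0⟩, ?_⟩
  intro x
  obtain ⟨⟨t, ht⟩, -⟩ := hT x
  have hstart : CfgCorrespond eK eΛ eσ r U (initList tm (x.map α.symm))
      ⟨some (eΛ tm.main), eσ tm.initialState, fun k => if k = eK tm.k₀ then
        x.map (fun a => r ⟨tm.k₀, α.symm a⟩) else []⟩ := by
    refine ⟨rfl, rfl, fun k => ?_⟩
    by_cases hk : k = tm.k₀
    · subst hk
      rw [initList_stk_self]
      refine ⟨by simp, ?_⟩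
      intro a _
      exact Or.inr ⟨a, rfl⟩
    · rw [initList_stk_of_ne tm _ hk]
      simp [hk]
  obtain ⟨C, h1, h2, h3, h4⟩ := translate_iterate hi
    (fun l => (Set.subset_iUnion (fun l => letters (tm.m l)) l).trans Set.subset_union_left)
    t hstart ht
  refine ⟨t, C, h1, h2, ?_⟩
  obtain ⟨h5, h6⟩ := h4 tm.k₁
  simp only [h5, List.map_map]
  rw [haltList_stk_self] at h6 ⊢
  rw [List.map_map]
  conv_rhs => rw [← List.map_id (encodeCircuit (V x))]
  refine List.map_congr_left fun a ha => ?_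
  have := hi tm.k₁ (β.symm a) (h6 _ (List.mem_map_of_mem ha))
  simp only [Function.comp_apply]
  erw [this]
  simp

/-- There are only countably many polynomial-time verifiers. -/
theorem countable_polyTime : {V | PolyTime V}.Countable := by
  have : ∀ a b c g : ℕ, Countable (Stmt (fun _ : Fin a => Fin g) (Fin b) (Fin c)) :=
    fun a b c g => countable_stmt
  have hcode : Countable MachineCode := by
    have : ∀ z : ℕ × ℕ × ℕ × ℕ, Countable ((Fin z.2.1 →
      Stmt (fun _ : Fin z.1 => Fin z.2.2.2) (Fin z.2.1) (Fin z.2.2.1)) ×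
      (Fin z.2.1 × Fin z.2.2.1) × (Fin z.1 × Fin z.1) ×
      (Option Bool → Fin z.2.2.2) × (Fin z.2.2.2 → Fin 6)) := fun z => inferInstance
    infer_instance
  choose f hf using fun V : {V | PolyTime V} => PolyTime.exists_code V.2
  refine Set.countable_coe_iff.1 (Function.Injective.countable (f := f) fun V V' h => ?_)
  have h1 := hf V
  rw [h] at h1
  exact Subtype.ext (h1.unique (hf V'))

/-! ### The length of the output -/

/-- A bound for the number of letters pushed by a statement. -/
def pushCount : Stmt Γ Λ σ → ℕ
  | .push _ _ q => pushCount q + 1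
  | .peek _ _ q => pushCount q
  | .pop _ _ q => pushCount q
  | .load _ q => pushCount q
  | .branch _ q₁ q₂ => pushCount q₁ + pushCount q₂
  | .goto _ => 0
  | .halt => 0

theorem stepAux_length (q : Stmt Γ Λ σ) (v : σ) (S : ∀ k, List (Γ k)) (k : K) :
    ((stepAux q v S).stk k).length ≤ (S k).length + pushCount q := by
  induction q generalizing v S with
  | push k' f q ih =>
    refine (ih _ _).trans ?_
    by_cases h : k = k'
    · subst h
      simp only [Function.update_self, List.length_cons, pushCount]
      omega
    · simp only [Function.update_of_ne h, pushCount]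
      omega
  | peek k' f q ih => exact ih _ _
  | pop k' f q ih =>
    refine (ih _ _).trans ?_
    by_cases h : k = k'
    · subst h
      simp only [Function.update_self, List.length_tail, pushCount]
      omega
    · simp only [Function.update_of_ne h, pushCount]
      omega
  | load f q ih => exact ih _ _
  | branch f q₁ q₂ ih₁ ih₂ =>
    have h1 := ih₁ v S
    have h2 := ih₂ v S
    simp only [stepAux, pushCount]
    cases f v <;> simp only [cond_true, cond_false] <;> omega
  | goto f => simp [stepAux]
  | halt => simp [stepAux]

theorem iterate_length {M : Λ → Stmt Γ Λ σ} {B : ℕ} (hB : ∀ l, pushCount (M l) ≤ B) (t : ℕ)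
    {C C' : Cfg Γ Λ σ} (h : (flip bind (step M))^[t] (some C) = some C') (k : K) :
    (C'.stk k).length ≤ (C.stk k).length + B * t := by
  induction t generalizing C with
  | zero =>
    obtain rfl : C = C' := by simpa using h
    simp
  | succ t ih =>
    obtain ⟨C₂, h1, h2⟩ := iterate_bind_succ _ _ _ _ h
    refine (ih h2).trans ?_
    obtain ⟨l, v, S⟩ := C
    cases l with
    | none => simp [step] at h1
    | some l =>
      simp only [step, Option.some.injEq] at h1
      have := stepAux_length (M l) v S k
      rw [h1] at this
      have h3 := hB l
      rw [Nat.mul_succ]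
      simp only at *
      omega

/-- The circuits set up in polynomial time have polynomial size. -/
theorem PolyTime.exists_length_le {V : List (Option Bool) → Circuit} (hV : PolyTime V) :
    ∃ P : Polynomial ℕ, ∀ x, (encodeCircuit (V x)).length ≤ P.eval x.length := by
  classical
  obtain ⟨⟨⟨tm, α, β⟩, T, hT⟩⟩ := hV
  have := tm.ΛFin
  obtain ⟨B, hB⟩ : ∃ B, ∀ l, pushCount (tm.m l) ≤ B :=
    ⟨∑ l, pushCount (tm.m l), fun l =>
      single_le_sum (f := fun l => pushCount (tm.m l)) (fun _ _ => Nat.zero_le _)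
        (mem_univ l)⟩
  refine ⟨Polynomial.X + Polynomial.C B * T, fun x => ?_⟩
  obtain ⟨⟨t, ht⟩, htT⟩ := hT x
  have h1 := iterate_length hB t ht tm.k₁
  rw [haltList_stk_self, List.length_map] at h1
  have h2 : ((initList tm (x.map α.invFun)).stk tm.k₁).length ≤ x.length := by
    by_cases hk : tm.k₁ = tm.k₀
    · have : ∀ k (hk : k = tm.k₀), ((initList tm (x.map α.invFun)).stk k).length ≤ x.length := by
        rintro k rfl
        rw [initList_stk_self, List.length_map]
      exact this _ hk
    · rw [initList_stk_of_ne tm _ hk]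
      simp
  have h3 := Nat.mul_le_mul_left B htT
  simp only [id] at h3
  simp only [Polynomial.eval_add, Polynomial.eval_X, Polynomial.eval_mul, Polynomial.eval_C]
  exact h1.trans (Nat.add_le_add h2 h3)

end Machines

/-! ### The verifier with a quantum witness -/

theorem length_le_encodeCircuit (c : Circuit) : c.length ≤ (encodeCircuit c).length := by
  induction c with
  | nil => simp
  | cons i c ih =>
    simp only [encodeCircuit, List.flatMap_cons, List.length_append, List.length_cons] at ih ⊢
    have : 1 ≤ (encodeInstr i).length := by
      rcases i with (i | i | ⟨i, j⟩) | ⟨i, j⟩ <;> simp [encodeInstr]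
    omega

theorem query_le_encodeCircuit {c : Circuit} {m : ℕ} (hm : m ∈ queries c) :
    m ≤ (encodeCircuit c).length := by
  induction c with
  | nil => simp [queries] at hm
  | cons i c ih =>
    simp only [encodeCircuit, List.flatMap_cons, List.length_append] at ih ⊢
    cases i with
    | gate g =>
      have := ih hm
      omega
    | query m' a =>
      rcases List.mem_cons.1 hm with rfl | hm
      · simp only [encodeInstr, List.length_cons, List.length_append, List.length_replicate]
        omega
      · have := ih hm
        omega

/-- On the input `1 ^ n`: query the channel of length `n` on the wires `1, 2, …` and copy the
output to wire `0`. -/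
def oneQuery (x : List (Option Bool)) : Circuit :=
  if ∀ a ∈ x, a = some true then [.query x.length 1, .gate (.cnot 1 0)] else []

section

open Turing Turing.TM2

/-- The stacks of the machine for `oneQuery`: input (`false`) and output (`true`). -/
abbrev OneQueryStack : Bool → Type := fun b => cond b (Fin 6) (Option Bool)

/-- The result of reading an input letter: `0` at the end, `1` for the letter `1`, `2` for other
letters. -/
def readLetter : Option (Option Bool) → Fin 3
  | none => 0
  | some (some true) => 1
  | _ => 2

/-- The program of the machine for `oneQuery`. -/
def oneQueryProgram : Fin 3 → Stmt OneQueryStack (Fin 3) (Fin 3)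
  | 0 => .push true (fun _ => (5 : Fin 6)) <| .push true (fun _ => (5 : Fin 6)) <|
      .push true (fun _ => (4 : Fin 6)) <| .push true (fun _ => (2 : Fin 6)) <|
      .push true (fun _ => (5 : Fin 6)) <| .push true (fun _ => (4 : Fin 6)) <|
      .push true (fun _ => (5 : Fin 6)) <| .goto fun _ => 1
  | 1 => .pop false (fun _ o => readLetter o) <|
      .branch (fun v => decide (v = 1))
        (.push true (fun _ => (4 : Fin 6)) <| .goto fun _ => 1) <|
        .branch (fun v => decide (v = 0)) (.push true (fun _ => (3 : Fin 6)) .halt)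
          (.goto fun _ => 2)
  | 2 => .pop true (fun _ o => if o.isSome then 1 else 0) <|
      .pop false (fun v o => if o.isSome then 1 else v) <|
      .branch (fun v => decide (v = 1)) (.goto fun _ => 2) .halt

/-- The stacks with given contents. -/
def stackPair (a : List (Option Bool)) (b : List (Fin 6)) : ∀ k, List (OneQueryStack k)
  | false => a
  | true => b

theorem update_stackPair_true (a : List (Option Bool)) (b b' : List (Fin 6)) :
    Function.update (stackPair a b) true b' = stackPair a b' := by
  funext k; cases k <;> rfl

theorem update_stackPair_false (a a' : List (Option Bool)) (b : List (Fin 6)) :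
    Function.update (stackPair a b) false a' = stackPair a' b := by
  funext k; cases k <;> rfl

theorem oneQuery_clear (a : List (Option Bool)) (b : List (Fin 6)) (v : Fin 3) :
    ∃ t, t ≤ a.length + b.length + 1 ∧ (flip bind (step oneQueryProgram))^[t]
      (some ⟨some 2, v, stackPair a b⟩) = some ⟨none, 0, stackPair [] []⟩ := by
  induction h : a.length + b.length using Nat.strong_induction_on generalizing a b v with
  | _ N ih =>
    by_cases h0 : a = [] ∧ b = []
    · obtain ⟨rfl, rfl⟩ := h0
      refine ⟨1, by omega, ?_⟩
      simp only [Function.iterate_one, flip, Option.bind_eq_bind, Option.bind_some, step,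
        oneQueryProgram, stepAux, update_stackPair_true, update_stackPair_false]
      rfl
    · have hs : flip bind (step oneQueryProgram) (some ⟨some 2, v, stackPair a b⟩) =
          some ⟨some 2, 1, stackPair a.tail b.tail⟩ := by
        simp only [flip, Option.bind_eq_bind, Option.bind_some, step,
          oneQueryProgram, stepAux, update_stackPair_true, update_stackPair_false]
        cases a <;> cases b
        · simp at h0
        all_goals rfl
      obtain ⟨t, ht, h1⟩ := ih (a.tail.length + b.tail.length) (by
        cases a <;> cases b
        · simp at h0
        all_goals simp at h ⊢ <;> omega) a.tail b.tail 1 rfl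
      refine ⟨t + 1, ?_, ?_⟩
      · simp only [List.length_tail] at ht
        cases a <;> cases b
        · simp at h0
        all_goals simp at h ht ⊢ <;> omega
      · rw [Function.iterate_succ_apply, hs, h1]

theorem oneQuery_scan (a : List (Option Bool)) (b : List (Fin 6)) (v : Fin 3) :
    ∃ t, t ≤ 3 * a.length + b.length + 3 ∧ (flip bind (step oneQueryProgram))^[t]
      (some ⟨some 1, v, stackPair a b⟩) = some ⟨none, 0, stackPair []
        (if ∀ x ∈ a, x = some true then 3 :: (List.replicate a.length 4 ++ b) else [])⟩ := by
  induction a generalizing b v with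
  | nil =>
    refine ⟨1, by omega, ?_⟩
    simp only [Function.iterate_one, flip, Option.bind_eq_bind, Option.bind_some, step,
        oneQueryProgram, stepAux, update_stackPair_false, List.not_mem_nil,
        IsEmpty.forall_iff, implies_true, if_true, List.length_nil, List.replicate_zero,
        List.nil_append]
    show some (⟨none, 0, Function.update (stackPair [] b) true ((3 : Fin 6) :: b)⟩ :
      Cfg OneQueryStack (Fin 3) (Fin 3)) = _
    rw [update_stackPair_true]
  | cons x a ih =>
    by_cases hx : x = some true
    · subst hx
      obtain ⟨t, ht, h1⟩ := ih (4 :: b) 1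
      refine ⟨t + 1, by simp at ht ⊢; omega, ?_⟩
      rw [Function.iterate_succ_apply]
      have hs : flip bind (step oneQueryProgram) (some ⟨some 1, v, stackPair (some true :: a) b⟩) =
          some ⟨some 1, 1, stackPair a (4 :: b)⟩ := by
        simp only [flip, Option.bind_eq_bind, Option.bind_some, step,
          oneQueryProgram, stepAux, update_stackPair_false]
        show some (⟨some 1, 1, Function.update (stackPair a b) true ((4 : Fin 6) :: b)⟩ :
          Cfg OneQueryStack (Fin 3) (Fin 3)) = _
        rw [update_stackPair_true]
      rw [hs, h1]
      have h2 : List.replicate a.length (4 : Fin 6) ++ 4 :: b =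
          List.replicate (a.length + 1) 4 ++ b := by
        rw [List.replicate_succ']; simp
      simp [h2]
    · obtain ⟨t, ht, h1⟩ := oneQuery_clear a b 2
      refine ⟨t + 1, by simp only [List.length_cons]; omega, ?_⟩
      rw [Function.iterate_succ_apply]
      have hr : readLetter (some x) = 2 := by
        rcases x with _ | _ | _
        · rfl
        · rfl
        · exact absurd rfl hx
      have hs : flip bind (step oneQueryProgram) (some ⟨some 1, v, stackPair (x :: a) b⟩) =
          some ⟨some 2, 2, stackPair a b⟩ := by
        simp only [flip, Option.bind_eq_bind, Option.bind_some, step,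
          oneQueryProgram, stepAux, update_stackPair_false]
        have : (stackPair (x :: a) b false).head? = some x := rfl
        rw [this, hr]
        rfl
      rw [hs, h1, if_neg]
      intro h
      exact hx (h x (by simp))

/-- The machine for `oneQuery`. -/
def oneQueryMachine : FinTM2 where
  K := Bool
  k₀ := false
  k₁ := true
  Γ := OneQueryStack
  Λ := Fin 3
  main := 0
  σ := Fin 3
  initialState := 0
  Γk₀Fin := inferInstanceAs (Fintype (Option Bool))
  m := oneQueryProgram

theorem polyTime_oneQuery : PolyTime oneQuery := by
  refine ⟨{ tm := oneQueryMachine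
            inputAlphabet := Equiv.refl (Option Bool)
            outputAlphabet := Equiv.refl (Fin 6)
            time := 3 * Polynomial.X + 11
            outputsFun := fun x => ?_ }⟩
  have h : ∃ t, t ≤ 3 * x.length + 11 ∧ (flip bind (step oneQueryProgram))^[t]
      (some ⟨some 0, 0, stackPair x []⟩) = some ⟨none, 0, stackPair []
        (encodeCircuit (oneQuery x))⟩ := by
    obtain ⟨t, ht, h1⟩ := oneQuery_scan x [5, 4, 5, 2, 4, 5, 5] 0
    refine ⟨t + 1, by simp at ht ⊢; omega, ?_⟩
    rw [Function.iterate_succ_apply]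
    have hs : flip bind (step oneQueryProgram) (some ⟨some 0, 0, stackPair x []⟩) =
        some ⟨some 1, 0, stackPair x [5, 4, 5, 2, 4, 5, 5]⟩ := by
      simp only [flip, Option.bind_eq_bind, Option.bind_some, step, oneQueryProgram, stepAux,
        update_stackPair_true]
      rfl
    rw [hs, h1, oneQuery]
    split_ifs
    · simp [encodeCircuit, encodeInstr]
    · simp [encodeCircuit]
  choose t ht h1 using h
  refine ⟨⟨t, ?_⟩, ?_⟩
  · have hi : initList oneQueryMachine ((id x : List (Option Bool)).map (Equiv.refl (Option Bool)).invFun)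
        = (⟨some 0, 0, stackPair x []⟩ : Cfg OneQueryStack (Fin 3) (Fin 3)) := by
      refine (congrArg (initList oneQueryMachine) (List.map_id x)).trans ?_
      unfold initList
      congr 1
      funext k
      cases k <;> rfl
    have ho : haltList oneQueryMachine ((encodeCircuit (oneQuery x)).map
        (Equiv.refl (Fin 6)).invFun) =
        (⟨none, 0, stackPair [] (encodeCircuit (oneQuery x))⟩ :
          Cfg OneQueryStack (Fin 3) (Fin 3)) := by
      refine (congrArg (haltList oneQueryMachine) (List.map_id (encodeCircuit (oneQuery x)))).trans
        ?_
      unfold haltList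
      congr 1
      funext k
      cases k <;> rfl
    refine (congrArg _ (congrArg some hi)).trans ?_
    exact h1.trans (congrArg some ho.symm)
  · simpa using ht

end

/-! ### Languages that separate -/

theorem Legal.mono {q q' : ℕ∞} {acc acc' : Access} {n : ℕ} {c : Circuit} (hq : q ≤ q')
    (hacc : ∀ m, acc n m → acc' n m) (h : Legal q acc n c) : Legal q' acc' n c :=
  ⟨h.1.trans hq, fun m hm => hacc m (h.2 m hm)⟩

theorem verifierInput_zero (x : List Bool) (D : ℕ → List Bool) :
    verifierInput x D 0 = x.map some := by
  simp [verifierInput]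

theorem loadAt_one_of_mem {k : ℕ} (φ : Bits k → ℂ) {s : Finset ℕ} (hs : 0 ∈ s) :
    loadAt 1 φ s = 0 := by
  rw [loadAt, Finsupp.finsetSum_apply]
  refine sum_eq_zero fun x _ => ?_
  rw [Finsupp.smul_apply, ket, Finsupp.single_apply, if_neg, smul_zero]
  rintro rfl
  simp [place] at hs

theorem acceptProb_nil_loadAt (Φ : ChannelOracle) {k : ℕ} (φ : Bits k → ℂ) :
    acceptProb Φ [] (loadAt 1 φ) = 0 := by
  refine sum_eq_zero fun s hs => ?_
  rw [loadAt_one_of_mem φ (mem_filter.1 hs).2, map_zero]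

theorem map_some_all_true {x : List Bool} :
    (∀ a ∈ x.map some, a = some true) ↔ x = List.replicate x.length true := by
  rw [List.eq_replicate_iff]
  simp only [List.mem_map, forall_exists_index, and_imp, forall_apply_eq_imp_iff₂,
    Option.some.injEq, true_and]

theorem unary_mem_QMA {κ : ℝ} (hκ : κ < 1) (L : Set ℕ) (ψ : ∀ n, Fin n → PureState n) {q : ℕ∞}
    (hq : 1 ≤ q) {acc : Access} (hacc : ∀ n, acc n n) (D : ℕ → List Bool) :
    unary L ∈ QMA q acc (swapOracle κ L ψ) D := by
  refine ⟨oneQuery, 0, Polynomial.X * Polynomial.X, polyTime_oneQuery, fun x => ?_⟩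
  have hw : (Polynomial.X * Polynomial.X : Polynomial ℕ).eval x.length = x.length * x.length := by
    simp
  simp only [Polynomial.eval_zero, verifierInput_zero]
  rw [hw, oneQuery]
  by_cases hx : x = List.replicate x.length true
  · rw [if_pos (map_some_all_true.2 hx), List.length_map]
    refine ⟨⟨by simpa [queries] using hq, by simp [queries, hacc]⟩, ?_, ?_⟩
    · rintro ⟨n, hn, h⟩
      have hn' : x.length ∈ L := by rw [h]; simpa using hn
      refine ⟨⟨jointState (ψ x.length), ?_⟩, ?_⟩
      · have := sum_prod_block (n := x.length)
          fun j y => Complex.normSq ((ψ x.length j).1 y)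
        simp only [jointState, map_prod]
        rw [this]
        exact prod_eq_one fun j _ => (ψ _ j).2
      · rw [acceptProb_query_mem hκ hn']
        norm_num
    · intro hn φ
      have hn' : x.length ∉ L := fun h => hn ⟨_, h, hx⟩
      rw [acceptProb_query_notMem hn']
      norm_num
  · rw [if_neg (mt map_some_all_true.1 hx)]
    refine ⟨⟨by simp [queries], by simp [queries]⟩, ?_, ?_⟩
    · rintro ⟨n, -, rfl⟩
      simp at hx
    · intro _ φ
      rw [acceptProb_nil_loadAt]
      norm_num

theorem QCMA_mono {q q' : ℕ∞} (hq : q ≤ q') (acc : Access) (Φ : ChannelOracle)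
    (D : ℕ → List Bool) : QCMA q acc Φ D ⊆ QCMA q' acc Φ D := by
  rintro A ⟨V, d, w, hV, h⟩
  exact ⟨V, d, w, hV, fun x => ⟨(h x).1.mono hq fun _ h => h, (h x).2⟩⟩

/-- The circuit for the input `1 ^ n`. -/
def verifierCircuit (V : List (Option Bool) → Circuit) (D : ℕ → List Bool) (d : Polynomial ℕ)
    (n : ℕ) : Circuit :=
  V (verifierInput (List.replicate n true) D (d.eval n))

/-- The answer for the input `1 ^ n` of the verifier with classical witness given by `V`, `d` and
`w` is right. -/
def DecidesAt (acc : Access) (Φ : ChannelOracle) (D : ℕ → List Bool) (L : Set ℕ)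
    (V : List (Option Bool) → Circuit) (d w : Polynomial ℕ) (n : ℕ) : Prop :=
  (∀ m ∈ queries (verifierCircuit V D d n), acc n m) ∧
  (n ∈ L → ∃ y : Bits (w.eval n),
    2 / 3 ≤ acceptProb Φ (verifierCircuit V D d n) (ket (place 1 y))) ∧
  (n ∉ L → ∀ y : Bits (w.eval n),
    acceptProb Φ (verifierCircuit V D d n) (ket (place 1 y)) ≤ 1 / 3)

theorem separates_of_not_decides {κ : ℝ} (hκ : κ < 1) {L : Set ℕ} {ψ : ∀ n, Fin n → PureState n}
    {acc : Access} (hacc : ∀ n, acc n n) {D : ℕ → List Bool}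
    (h : ∀ V, PolyTime V → ∀ d w : Polynomial ℕ,
      ∃ n, ¬ DecidesAt acc (swapOracle κ L ψ) D L V d w n) :
    Separates acc (swapOracle κ L ψ) D L := by
  have h1 : unary L ∉ QCMA ⊤ acc (swapOracle κ L ψ) D := by
    rintro ⟨V, d, w, hV, hx⟩
    obtain ⟨n, hn⟩ := h V hV d w
    apply hn
    have := hx (List.replicate n true)
    rw [List.length_replicate] at this
    have hL : List.replicate n true ∈ unary L ↔ n ∈ L := by
      constructor
      · rintro ⟨m, hm, h⟩
        have := congrArg List.length h
        simp only [List.length_replicate] at this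
        rwa [this]
      · exact fun h => ⟨n, h, rfl⟩
    rw [hL] at this
    exact ⟨this.1.2, this.2⟩
  refine ⟨unary_mem_QMA (acc := ownLength) hκ L ψ le_rfl (fun _ => rfl) noInfo, h1, fun q hq heq => h1 ?_⟩
  have := unary_mem_QMA hκ L ψ hq hacc D
  rw [heq] at this
  exact QCMA_mono le_top _ _ _ this

/-! ### Polynomial bounds -/

theorem exists_pow_bound (P : Polynomial ℕ) : ∃ k, ∀ n, 2 ≤ n → P.eval n ≤ n ^ k := by
  induction P using Polynomial.induction_on' with
  | add p q hp hq =>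
    obtain ⟨a, ha⟩ := hp
    obtain ⟨b, hb⟩ := hq
    refine ⟨max a b + 1, fun n hn => ?_⟩
    rw [Polynomial.eval_add, pow_succ]
    have h1 := (ha n hn).trans (Nat.pow_le_pow_right (by omega) (le_max_left a b))
    have h2 := (hb n hn).trans (Nat.pow_le_pow_right (by omega) (le_max_right a b))
    have := Nat.mul_le_mul_left (n ^ max a b) hn
    omega
  | monomial j a =>
    refine ⟨a + j, fun n hn => ?_⟩
    rw [Polynomial.eval_monomial, pow_add]
    exact Nat.mul_le_mul_right _ ((Nat.lt_pow_self (by omega)).le)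

theorem eval_le_eval (P : Polynomial ℕ) {a b : ℕ} (h : a ≤ b) : P.eval a ≤ P.eval b := by
  rw [Polynomial.eval_eq_sum, Polynomial.eval_eq_sum]
  exact sum_le_sum fun i _ => Nat.mul_le_mul_left _ (Nat.pow_le_pow_left h i)

theorem verifierInput_length_le (x : List Bool) {D : ℕ → List Bool} {T : Polynomial ℕ}
    (hD : ∀ m, (D m).length ≤ T.eval m) (k : ℕ) :
    (verifierInput x D k).length ≤ x.length + k * (T.eval k + 1) := by
  simp only [verifierInput, List.length_append, List.length_map, List.length_flatMap,
    List.length_cons]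
  refine Nat.add_le_add_left ?_ _
  have := List.sum_le_card_nsmul ((List.range k).map fun m => (D m).length + 1)
    (T.eval k + 1) (by
      intro a ha
      obtain ⟨m, hm, rfl⟩ := List.mem_map.1 ha
      have := (hD m).trans (eval_le_eval T (List.mem_range.1 hm).le)
      omega)
  simpa using this

theorem PolyTime.exists_circuit_bound {V : List (Option Bool) → Circuit} (hV : PolyTime V)
    (d T : Polynomial ℕ) : ∃ k, ∀ D : ℕ → List Bool, (∀ m, (D m).length ≤ T.eval m) →
      ∀ n, 2 ≤ n → (verifierCircuit V D d n).length ≤ n ^ k ∧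
        ∀ m ∈ queries (verifierCircuit V D d n), m ≤ n ^ k := by
  obtain ⟨P, hP⟩ := hV.exists_length_le
  obtain ⟨k, hk⟩ := exists_pow_bound (P.comp (Polynomial.X + d * (T.comp d + 1)))
  refine ⟨k, fun D hD n hn => ?_⟩
  have h1 : (encodeCircuit (verifierCircuit V D d n)).length ≤ n ^ k := by
    refine (hP _).trans (le_trans ?_ (hk n hn))
    rw [Polynomial.eval_comp]
    refine eval_le_eval P ?_
    refine (verifierInput_length_le _ hD _).trans ?_
    simp [Polynomial.eval_comp]
  exact ⟨(length_le_encodeCircuit _).trans h1, fun m hm => (query_le_encodeCircuit hm).trans h1⟩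

/-! ### States with random signs -/

section Signs

variable {X : Type} [Fintype X] [DecidableEq X]

/-- The sign given by a bit. -/
def sign (b : Bool) : ℝ := if b then -1 else 1

theorem sign_mul_self (b : Bool) : sign b * sign b = 1 := by cases b <;> simp [sign]

theorem sum_exp_sign (a : X → ℝ) (l : ℝ) :
    ∑ ε : X → Bool, Real.exp (l * ∑ x, sign (ε x) * a x) ≤
      Fintype.card (X → Bool) * Real.exp (l ^ 2 * (∑ x, a x ^ 2) / 2) := by
  have h1 : ∀ ε : X → Bool, Real.exp (l * ∑ x, sign (ε x) * a x) =
      ∏ x, Real.exp (l * (sign (ε x) * a x)) := by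
    intro ε
    rw [mul_sum, Real.exp_sum]
  simp only [h1]
  have h2 := prod_univ_sum (fun _ : X => (Finset.univ : Finset Bool))
    (fun x b => Real.exp (l * (sign b * a x)))
  rw [Fintype.piFinset_univ] at h2
  rw [← h2]
  have h3 : ∀ x, ∑ b, Real.exp (l * (sign b * a x)) ≤ 2 * Real.exp ((l * a x) ^ 2 / 2) := by
    intro x
    have := Real.cosh_le_exp_half_sq (l * a x)
    rw [Real.cosh_eq] at this
    rw [Fintype.sum_bool]
    simp only [sign, if_true, Bool.false_eq_true, if_false]
    have e1 : l * (-1 * a x) = -(l * a x) := by ring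
    have e2 : l * (1 * a x) = l * a x := by ring
    rw [e1, e2]
    linarith
  refine (prod_le_prod (fun x _ => sum_nonneg fun _ _ => (Real.exp_pos _).le)
    fun x _ => h3 x).trans (le_of_eq ?_)
  rw [prod_mul_distrib, ← Real.exp_sum]
  simp only [prod_const, Finset.card_univ, Fintype.card_pi, Fintype.card_bool]
  push_cast
  congr 2
  rw [mul_sum, sum_div]
  exact sum_congr rfl fun x _ => by ring

theorem card_sign_sum_gt (a : X → ℝ) {τ : ℝ} (hτ : 0 ≤ τ) :
    ((univ.filter fun ε : X → Bool => τ * ∑ x, a x ^ 2 < (∑ x, sign (ε x) * a x) ^ 2).card : ℝ) ≤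
      2 * Real.exp (-(τ / 2)) * Fintype.card (X → Bool) := by
  have hS : 0 ≤ ∑ x, a x ^ 2 := sum_nonneg fun _ _ => sq_nonneg _
  rcases hS.eq_or_lt with hS0 | hS0
  · have ha : ∀ x, a x = 0 := by
      intro x
      have := (sum_eq_zero_iff_of_nonneg fun x _ => sq_nonneg (a x)).1 hS0.symm x
        (mem_univ x)
      simpa using this
    rw [Finset.filter_false_of_mem]
    · simp only [Finset.card_empty, Nat.cast_zero]; positivity
    · intro ε _
      simp [ha]
  set S := ∑ x, a x ^ 2
  set l := Real.sqrt (τ / S) with hl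
  have hl0 : 0 ≤ l := Real.sqrt_nonneg _
  have hl2 : l ^ 2 * S = τ := by
    rw [hl, Real.sq_sqrt (by positivity), div_mul_cancel₀ _ hS0.ne']
  have key : ∀ ε : X → Bool, τ * S < (∑ x, sign (ε x) * a x) ^ 2 →
      Real.exp τ ≤ Real.exp (l * ∑ x, sign (ε x) * a x) +
        Real.exp ((-l) * ∑ x, sign (ε x) * a x) := by
    intro ε h
    set t := ∑ x, sign (ε x) * a x
    have h1 : τ ≤ |l * t| := by
      refine abs_le_of_sq_le_sq' ?_ (abs_nonneg _) |>.2
      rw [sq_abs, mul_pow]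
      nlinarith [sq_nonneg l]
    rcases le_total 0 (l * t) with h2 | h2
    · rw [abs_of_nonneg h2] at h1
      have := Real.exp_le_exp.2 h1
      have := (Real.exp_pos (-l * t)).le
      linarith
    · rw [abs_of_nonpos h2] at h1
      have h3 : τ ≤ -l * t := by linarith
      have := Real.exp_le_exp.2 h3
      have := (Real.exp_pos (l * t)).le
      linarith
  have h1 : ((univ.filter fun ε : X → Bool => τ * S < (∑ x, sign (ε x) * a x) ^ 2).card : ℝ) *
      Real.exp τ ≤ ∑ ε : X → Bool, (Real.exp (l * ∑ x, sign (ε x) * a x) +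
        Real.exp ((-l) * ∑ x, sign (ε x) * a x)) := by
    rw [← nsmul_eq_mul, ← sum_const]
    refine (sum_le_sum fun ε hε => key ε (mem_filter.1 hε).2).trans ?_
    exact sum_le_univ_sum_of_nonneg fun ε => by positivity
  rw [sum_add_distrib] at h1
  have h2 := sum_exp_sign a l
  have h3 := sum_exp_sign a (-l)
  rw [neg_sq] at h3
  rw [show (∑ x, a x ^ 2) = S from rfl, hl2] at h2 h3
  have h4 : Real.exp τ = Real.exp (τ / 2) * Real.exp (τ / 2) := by
    rw [← Real.exp_add]; congr 1; ring
  rw [Real.exp_neg]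
  have h5 := Real.exp_pos (τ / 2)
  rw [h4] at h1
  have h6 := h1.trans (add_le_add h2 h3)
  rw [← mul_assoc] at h6
  have h7 : ((univ.filter fun ε : X → Bool => τ * S < (∑ x, sign (ε x) * a x) ^ 2).card : ℝ) *
      Real.exp (τ / 2) ≤ 2 * Fintype.card (X → Bool) := by
    refine le_of_mul_le_mul_right (h6.trans (le_of_eq ?_)) h5
    ring
  rw [mul_right_comm, ← div_eq_mul_inv, le_div_iff₀ h5]
  exact h7

theorem card_sign_normSq_gt (u : X → ℂ) {τ : ℝ} (hτ : 0 ≤ τ) :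
    ((univ.filter fun ε : X → Bool => τ * ∑ x, Complex.normSq (u x) <
      Complex.normSq (∑ x, (sign (ε x) : ℂ) * u x)).card : ℝ) ≤
      4 * Real.exp (-(τ / 2)) * Fintype.card (X → Bool) := by
  have h1 := card_sign_sum_gt (fun x => (u x).re) hτ
  have h2 := card_sign_sum_gt (fun x => (u x).im) hτ
  have h3 : (univ.filter fun ε : X → Bool => τ * ∑ x, Complex.normSq (u x) <
      Complex.normSq (∑ x, (sign (ε x) : ℂ) * u x)) ⊆
      (univ.filter fun ε : X → Bool => τ * ∑ x, (u x).re ^ 2 <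
        (∑ x, sign (ε x) * (u x).re) ^ 2) ∪
      (univ.filter fun ε : X → Bool => τ * ∑ x, (u x).im ^ 2 <
        (∑ x, sign (ε x) * (u x).im) ^ 2) := by
    intro ε hε
    simp only [mem_filter, mem_univ, true_and, mem_union] at hε ⊢
    by_contra! h
    refine absurd hε (not_lt.2 ?_)
    have e1 : (∑ x, (sign (ε x) : ℂ) * u x).re = ∑ x, sign (ε x) * (u x).re := by
      simp [Complex.re_sum]
    have e2 : (∑ x, (sign (ε x) : ℂ) * u x).im = ∑ x, sign (ε x) * (u x).im := by
      simp [Complex.im_sum]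
    rw [Complex.normSq_apply, e1, e2]
    have e3 : ∑ x, Complex.normSq (u x) = ∑ x, (u x).re ^ 2 + ∑ x, (u x).im ^ 2 := by
      rw [← sum_add_distrib]
      exact sum_congr rfl fun x _ => by rw [Complex.normSq_apply]; ring
    rw [e3]
    nlinarith [h.1, h.2]
  have h4 := (Finset.card_le_card h3).trans (Finset.card_union_le _ _)
  have h5 : (((univ.filter fun ε : X → Bool => τ * ∑ x, Complex.normSq (u x) <
      Complex.normSq (∑ x, (sign (ε x) : ℂ) * u x)).card : ℕ) : ℝ) ≤ _ := Nat.cast_le.2 h4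
  push_cast at h5
  linarith

theorem normSq_sign_sum_le (u : X → ℂ) (ε : X → Bool) :
    Complex.normSq (∑ x, (sign (ε x) : ℂ) * u x) ≤ Fintype.card X * ∑ x, Complex.normSq (u x) := by
  have h1 : ‖∑ x, (sign (ε x) : ℂ) * u x‖ ≤ ∑ x, ‖u x‖ := by
    refine (norm_sum_le _ _).trans (sum_le_sum fun x _ => ?_)
    rw [norm_mul]
    cases ε x <;> simp [sign]
  have h2 := sq_sum_le_card_mul_sum_sq (s := (univ : Finset X)) (f := fun x => ‖u x‖)
  simp only [Complex.normSq_eq_norm_sq]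
  exact (pow_le_pow_left₀ (norm_nonneg _) h1 2).trans h2

end Signs

/-- The state with equal weights and the given signs. -/
def signState {n : ℕ} (ε : Bits n → Bool) : PureState n :=
  ⟨fun x => (Real.sqrt (Fintype.card (Bits n)) : ℂ)⁻¹ * (sign (ε x) : ℂ), by
    have h : ∀ x, Complex.normSq ((Real.sqrt (Fintype.card (Bits n)) : ℂ)⁻¹ * (sign (ε x) : ℂ)) =
        (Fintype.card (Bits n) : ℝ)⁻¹ := by
      intro x
      rw [map_mul, map_inv₀, Complex.normSq_ofReal, Complex.normSq_ofReal, sign_mul_self,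
        Real.mul_self_sqrt (Nat.cast_nonneg _), mul_one]
    rw [sum_congr rfl fun x _ => h x, sum_const, Finset.card_univ, nsmul_eq_mul]
    exact mul_inv_cancel₀ (Nat.cast_ne_zero.2 Fintype.card_ne_zero)⟩

theorem sum_max_sign_le {n : ℕ} (u : Bits n → ℂ) {δ : ℝ} (hδ : 0 ≤ δ) :
    ∑ ε : Bits n → Bool, max 0 (Complex.normSq (∑ x, (starRingEnd ℂ) ((signState ε).1 x) * u x) -
      δ * ∑ x, Complex.normSq (u x)) ≤
    4 * Real.exp (-(δ * 2 ^ n / 2)) * Fintype.card (Bits n → Bool) *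
      ∑ x, Complex.normSq (u x) := by
  have hN : (Fintype.card (Bits n) : ℝ) = 2 ^ n := by simp
  have h0 : ∀ ε : Bits n → Bool,
      Complex.normSq (∑ x, (starRingEnd ℂ) ((signState ε).1 x) * u x) =
      (2 ^ n)⁻¹ * Complex.normSq (∑ x, (sign (ε x) : ℂ) * u x) := by
    intro ε
    have : ∑ x, (starRingEnd ℂ) ((signState ε).1 x) * u x =
        (Real.sqrt (Fintype.card (Bits n)) : ℂ)⁻¹ * ∑ x, (sign (ε x) : ℂ) * u x := by
      rw [mul_sum]
      refine sum_congr rfl fun x _ => ?_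
      simp only [signState, map_mul, map_inv₀, Complex.conj_ofReal, mul_assoc]
    rw [this, map_mul, map_inv₀, Complex.normSq_ofReal, Real.mul_self_sqrt (Nat.cast_nonneg _), hN]
  set T := ∑ x, Complex.normSq (u x) with hT
  have hT0 : 0 ≤ T := sum_nonneg fun _ _ => Complex.normSq_nonneg _
  have hp : (0 : ℝ) < 2 ^ n := by positivity
  have h1 : ∀ ε : Bits n → Bool,
      max 0 (Complex.normSq (∑ x, (starRingEnd ℂ) ((signState ε).1 x) * u x) - δ * T) ≤
      if δ * 2 ^ n * T < Complex.normSq (∑ x, (sign (ε x) : ℂ) * u x) then T else 0 := by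
    intro ε
    rw [h0]
    split_ifs with h
    · refine max_le hT0 ?_
      have := normSq_sign_sum_le u ε
      rw [hN, ← hT] at this
      have h2 : (2 ^ n)⁻¹ * Complex.normSq (∑ x, (sign (ε x) : ℂ) * u x) ≤ T := by
        rw [inv_mul_le_iff₀ hp]; exact this
      nlinarith [mul_nonneg hδ hT0]
    · refine max_le le_rfl ?_
      rw [not_lt] at h
      have : (2 ^ n)⁻¹ * Complex.normSq (∑ x, (sign (ε x) : ℂ) * u x) ≤ δ * T := by
        rw [inv_mul_le_iff₀ hp]; linarith
      linarith
  refine (sum_le_sum fun ε _ => h1 ε).trans ?_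
  rw [← sum_filter, sum_const, nsmul_eq_mul]
  exact mul_le_mul_of_nonneg_right (card_sign_normSq_gt u (by positivity)) hT0

theorem sum_max_fidAt_le {n b : ℕ} {δ : ℝ} (hδ : 0 ≤ δ) (v : Workspace) :
    ∑ ε : Bits n → Bool, max 0 (fidAt (signState ε) b v - δ * sqNorm v) ≤
    4 * Real.exp (-(δ * 2 ^ n / 2)) * Fintype.card (Bits n → Bool) * sqNorm v := by
  obtain ⟨N₀, hN₀⟩ := exists_mem_low v
  have hv : v ∈ low (max N₀ (b + n)) := low_mono (le_max_left _ _) hN₀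
  have hN : b + n ≤ max N₀ (b + n) := le_max_right _ _
  simp only [fidAt_eq _ hN hv, sqNorm_eq_window hN hv]
  rw [mul_sum]
  have h1 : ∀ ε : Bits n → Bool,
      max 0 (∑ r ∈ (range (max N₀ (b + n)) \ Ico b (b + n)).powerset,
        Complex.normSq (∑ x, (starRingEnd ℂ) ((signState ε).1 x) * v (r ∪ place b x)) -
        ∑ r ∈ (range (max N₀ (b + n)) \ Ico b (b + n)).powerset, δ *
          ∑ x : Bits n, Complex.normSq (v (r ∪ place b x))) ≤
      ∑ r ∈ (range (max N₀ (b + n)) \ Ico b (b + n)).powerset,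
        max 0 (Complex.normSq (∑ x, (starRingEnd ℂ) ((signState ε).1 x) * v (r ∪ place b x)) -
          δ * ∑ x : Bits n, Complex.normSq (v (r ∪ place b x))) := by
    intro ε
    rw [← sum_sub_distrib]
    exact max_le (sum_nonneg fun _ _ => le_max_left _ _)
      (sum_le_sum fun _ _ => le_max_right _ _)
  refine (sum_le_sum fun ε _ => h1 ε).trans ?_
  rw [sum_comm, mul_sum]
  exact sum_le_sum fun r _ => sum_max_sign_le _ hδ

theorem card_fidAt_gt {n b : ℕ} {δ : ℝ} (hδ : 0 < δ) (Φ : ChannelOracle) (p : Circuit)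
    {v : Workspace} (hv : sqNorm v = 1) :
    ((univ.filter fun ε : Bits n → Bool =>
      2 * δ < expect Φ p (fidAt (signState ε) b) v).card : ℝ) * δ ≤
    4 * Real.exp (-(δ * 2 ^ n / 2)) * Fintype.card (Bits n → Bool) := by
  have h1 : ∀ ε : Bits n → Bool, expect Φ p (fidAt (signState ε) b) v - δ ≤
      expect Φ p (fun v => max 0 (fidAt (signState ε) b v - δ * sqNorm v)) v := by
    intro ε
    have h2 : expect Φ p (fidAt (signState ε) b) v ≤ expect Φ p
        (fun v => max 0 (fidAt (signState ε) b v - δ * sqNorm v) + δ * sqNorm v) v :=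
      expect_mono Φ p (fun v => by linarith [le_max_right 0 (fidAt (signState ε) b v -
        δ * sqNorm v)]) v
    rw [expect_add, expect_const_mul, expect_sqNorm, hv] at h2
    linarith
  have h0 : ∀ ε : Bits n → Bool,
      0 ≤ expect Φ p (fun v => max 0 (fidAt (signState ε) b v - δ * sqNorm v)) v := by
    intro ε
    have := expect_mono Φ p (F := fun v => 0 * sqNorm v)
      (G := fun v => max 0 (fidAt (signState ε) b v - δ * sqNorm v))
      (fun v => by simp) v
    rw [expect_const_mul, zero_mul] at this
    exact this
  rw [← nsmul_eq_mul, ← sum_const]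
  refine (sum_le_sum fun ε hε => (show δ ≤
    expect Φ p (fun v => max 0 (fidAt (signState ε) b v - δ * sqNorm v)) v from ?_)).trans ?_
  · have := (mem_filter.1 hε).2
    linarith [h1 ε]
  refine (sum_le_univ_sum_of_nonneg h0).trans ?_
  rw [← expect_sum]
  refine (expect_mono Φ p (fun v => sum_max_fidAt_le hδ.le v) v).trans ?_
  rw [expect_const_mul, expect_sqNorm, hv, mul_one]

/-! ### A verifier with a classical witness errs -/

theorem not_decidesAt {κ : ℝ} {L : Set ℕ} {ψ : ∀ n, Fin n → PureState n} {acc : Access}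
    {D : ℕ → List Bool} {V : List (Option Bool) → Circuit} {d w : Polynomial ℕ} {n : ℕ} {δ : ℝ}
    (hq : (∀ m ∈ queries (verifierCircuit V D d n), acc n m) →
      ∀ m ∈ queries (verifierCircuit V D d n), m ∈ L → m ≤ n)
    (hδ : 0 ≤ δ)
    (h : (∀ m ∈ queries (verifierCircuit V D d n), acc n m) → ∀ y : Bits (w.eval n), ∀ p a r,
      verifierCircuit V D d n = p ++ .query n a :: r → ∀ j : Fin n,
      expect (truncOracle κ {m | m < n ∧ m ∈ L} ψ) p (fidAt (ψ n j) (a + n * j))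
        (ket (place 1 y)) ≤ δ)
    (hsmall : ((verifierCircuit V D d n).length : ℝ) * (coinTail κ n + n * δ) ≤ 1 / 12)
    (hL : n ∈ L ↔ ¬ ∃ y : Bits (w.eval n), 1 / 2 < acceptProb
      (truncOracle κ {m | m < n ∧ m ∈ L} ψ) (verifierCircuit V D d n) (ket (place 1 y))) :
    ¬ DecidesAt acc (swapOracle κ L ψ) D L V d w n := by
  rintro ⟨h1, h2, h3⟩
  specialize hq h1
  by_cases hn : n ∈ L
  · obtain ⟨y, hy⟩ := h2 hn
    have h4 := acceptProb_le_trunc_add (κ := κ) (L := L) (L' := {m | m < n ∧ m ∈ L}) (ψ := ψ)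
      (n := n) (by simp) (fun m hm => hm.2) (verifierCircuit V D d n)
      (fun m hm hmL => (hq m hm hmL).lt_or_eq.imp (fun h => ⟨h, hmL⟩) id)
      (sqNorm_ket (place 1 y)) hδ (h h1 y)
    have h5 := hL.1 hn
    push Not at h5
    have := h5 y
    linarith
  · have h5 := not_not.1 (mt hL.2 hn)
    obtain ⟨y, hy⟩ := h5
    have h4 := h3 hn y
    rw [acceptProb_eq_trunc (L' := {m | m < n ∧ m ∈ L}) (fun m hm => hm.2) _ (fun m hm hmL =>
      ⟨(hq m hm hmL).lt_of_ne (by rintro rfl; exact hn hmL), hmL⟩)] at h4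
    linarith

theorem truncOracle_congr {κ : ℝ} {L L' : Set ℕ} {ψ ψ' : ∀ n, Fin n → PureState n} (hL : L = L')
    (h : ∀ n ∈ L, ψ n = ψ' n) : truncOracle κ L ψ = truncOracle κ L' ψ' := by
  subst hL
  unfold truncOracle
  congr 1
  funext n
  by_cases hn : n ∈ L
  · simp [hn, h n hn]
  · simp [hn]

/-! ### Marked states that a given circuit cannot use -/

theorem exp_bound {n k : ℕ} (hn : 1 ≤ n)
    (hbig : 96 * (n : ℝ) ^ (k + 1) * (n ^ k + 2 * n ^ (k + 1) + 192) < 2 ^ n) :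
    (2 : ℝ) ^ (n ^ k) * n ^ (k + 1) * (4 * Real.exp (-((48 * (n : ℝ) ^ (k + 1))⁻¹ * 2 ^ n / 2))) <
      (48 * (n : ℝ) ^ (k + 1))⁻¹ := by
  set a : ℝ := (n : ℝ) ^ (k + 1) with ha
  have ha1 : 1 ≤ a := one_le_pow₀ (by exact_mod_cast hn)
  have h1 : (n : ℝ) ^ k + 2 * a + 192 < (48 * a)⁻¹ * 2 ^ n / 2 := by
    rw [lt_div_iff₀ (by norm_num), lt_inv_mul_iff₀ (by positivity)]
    linarith
  have h2 : Real.exp (-((48 * a)⁻¹ * 2 ^ n / 2)) < Real.exp (-((n : ℝ) ^ k + 2 * a + 192)) :=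
    Real.exp_lt_exp.2 (by linarith)
  have h3 : (2 : ℝ) ^ (n ^ k) ≤ Real.exp ((n : ℝ) ^ k) := by
    have : (2 : ℝ) ≤ Real.exp 1 := by linarith [Real.add_one_le_exp 1]
    calc (2 : ℝ) ^ (n ^ k) ≤ Real.exp 1 ^ (n ^ k) := pow_le_pow_left₀ (by norm_num) this _
      _ = Real.exp ((n : ℝ) ^ k) := by rw [← Real.exp_nat_mul]; simp
  have h4 : a ≤ Real.exp a := by linarith [Real.add_one_le_exp a]
  have h5 : (192 : ℝ) ≤ Real.exp 192 := by linarith [Real.add_one_le_exp 192]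
  have h6 : (2 : ℝ) ^ (n ^ k) * a * (4 * Real.exp (-((48 * a)⁻¹ * 2 ^ n / 2))) * (48 * a) < 1 := by
    calc (2 : ℝ) ^ (n ^ k) * a * (4 * Real.exp (-((48 * a)⁻¹ * 2 ^ n / 2))) * (48 * a)
        = 192 * (2 : ℝ) ^ (n ^ k) * a * a * Real.exp (-((48 * a)⁻¹ * 2 ^ n / 2)) := by ring
      _ < 192 * (2 : ℝ) ^ (n ^ k) * a * a * Real.exp (-((n : ℝ) ^ k + 2 * a + 192)) :=
          mul_lt_mul_of_pos_left h2 (by positivity)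
      _ ≤ Real.exp 192 * Real.exp ((n : ℝ) ^ k) * Real.exp a * Real.exp a *
          Real.exp (-((n : ℝ) ^ k + 2 * a + 192)) := by gcongr
      _ = 1 := by
          rw [← Real.exp_add, ← Real.exp_add, ← Real.exp_add, ← Real.exp_add]
          rw [Real.exp_eq_one_iff]; ring
  have h7 := (lt_div_iff₀ (by positivity)).2 h6
  rwa [one_div] at h7

theorem exists_marked {n k w : ℕ} (hn : 1 ≤ n)
    (hbig : 96 * (n : ℝ) ^ (k + 1) * (n ^ k + 2 * n ^ (k + 1) + 192) < 2 ^ n) (Φ : ChannelOracle)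
    (c : Circuit) (hc : c.length ≤ n ^ k) (hw : w ≤ n ^ k) :
    ∃ ψ : Fin n → PureState n, ∀ (y : Bits w) p a r, c = p ++ .query n a :: r → ∀ j : Fin n,
      expect Φ p (fidAt (ψ j) (a + n * j)) (ket (place 1 y)) ≤ 2 * (48 * (n : ℝ) ^ (k + 1))⁻¹ := by
  classical
  set δ : ℝ := (48 * (n : ℝ) ^ (k + 1))⁻¹ with hδ
  have hn0 : (0 : ℝ) < n := by exact_mod_cast hn
  have hδ0 : 0 < δ := by positivity
  let pos : ℕ → ℕ := fun t => match (c.drop t).head? with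
    | some (.query _ a) => a
    | _ => 0
  let bad : Bits w × Fin c.length × Fin n → Finset (Bits n → Bool) := fun z =>
    univ.filter fun ε => 2 * δ <
      expect Φ (c.take z.2.1) (fidAt (signState ε) (pos z.2.1 + n * z.2.2)) (ket (place 1 z.1))
  have hbad : ∀ z, ((bad z).card : ℝ) ≤
      δ⁻¹ * (4 * Real.exp (-(δ * 2 ^ n / 2)) * Fintype.card (Bits n → Bool)) := by
    intro z
    rw [le_inv_mul_iff₀ hδ0, mul_comm]
    exact card_fidAt_gt hδ0 Φ _ (sqNorm_ket _)
  have hE : (0 : ℝ) < Fintype.card (Bits n → Bool) := by exact_mod_cast Fintype.card_pos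
  have hcard : ((univ.biUnion bad).card : ℝ) < Fintype.card (Bits n → Bool) := by
    calc ((univ.biUnion bad).card : ℝ) ≤ ∑ z, ((bad z).card : ℝ) := by
          exact_mod_cast Finset.card_biUnion_le
      _ ≤ ∑ z : Bits w × Fin c.length × Fin n,
          δ⁻¹ * (4 * Real.exp (-(δ * 2 ^ n / 2)) * Fintype.card (Bits n → Bool)) :=
          sum_le_sum fun z _ => hbad z
      _ = (2 ^ w * (c.length * n)) *
          (δ⁻¹ * (4 * Real.exp (-(δ * 2 ^ n / 2)) * Fintype.card (Bits n → Bool))) := by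
          simp [Finset.card_univ]
      _ ≤ ((2 : ℝ) ^ (n ^ k) * (n ^ k * n)) *
          (δ⁻¹ * (4 * Real.exp (-(δ * 2 ^ n / 2)) * Fintype.card (Bits n → Bool))) := by
          gcongr
          · norm_num
          · exact_mod_cast hc
      _ = ((2 : ℝ) ^ (n ^ k) * n ^ (k + 1) * (4 * Real.exp (-(δ * 2 ^ n / 2)))) * δ⁻¹ *
          Fintype.card (Bits n → Bool) := by ring
      _ < δ * δ⁻¹ * Fintype.card (Bits n → Bool) := by
          gcongr
          exact exp_bound hn hbig
      _ = Fintype.card (Bits n → Bool) := by rw [mul_inv_cancel₀ hδ0.ne', one_mul]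
  obtain ⟨ε, hε⟩ : ∃ ε, ε ∉ univ.biUnion bad := by
    by_contra! h
    have : univ.biUnion bad = univ := Finset.eq_univ_iff_forall.2 h
    rw [this, Finset.card_univ] at hcard
    exact lt_irrefl _ hcard
  refine ⟨fun _ => signState ε, fun y p a r hp j => ?_⟩
  have hlt : p.length < c.length := by rw [hp]; simp
  by_contra! h
  refine hε (mem_biUnion.2 ⟨(y, ⟨p.length, hlt⟩, j), mem_univ _, ?_⟩)
  have h1 : c.take p.length = p := by rw [hp]; simp
  have h2 : pos p.length = a := by
    have : (c.drop p.length).head? = some (.query n a) := by rw [hp]; simp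
    simp only [pos, this]
  simp only [bad, mem_filter, mem_univ, true_and, h1, h2]
  exact h

theorem eventually_pow_lt_two_pow (C : ℝ) (k : ℕ) :
    ∀ᶠ n : ℕ in Filter.atTop, C * (n : ℝ) ^ k < 2 ^ n := by
  have h := (tendsto_pow_const_div_const_pow_of_one_lt k (r := (2 : ℝ)) (by norm_num)).const_mul C
  rw [mul_zero] at h
  filter_upwards [h.eventually (gt_mem_nhds (show (0 : ℝ) < 1 by norm_num))] with n hn
  rwa [← mul_div_assoc, div_lt_one (by positivity)] at hn

theorem eventually_big (k : ℕ) : ∀ᶠ n : ℕ in Filter.atTop,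
    96 * (n : ℝ) ^ (k + 1) * (n ^ k + 2 * n ^ (k + 1) + 192) < 2 ^ n := by
  filter_upwards [eventually_pow_lt_two_pow (96 * 195) (2 * k + 2), Filter.eventually_ge_atTop 1]
    with n hn h1
  refine lt_of_le_of_lt ?_ hn
  have h2 : (1 : ℝ) ≤ n := by exact_mod_cast h1
  have h3 : (n : ℝ) ^ k ≤ n ^ (k + 1) := pow_le_pow_right₀ h2 (Nat.le_succ k)
  have h4 : (1 : ℝ) ≤ n ^ (k + 1) := one_le_pow₀ h2
  have h5 : (n : ℝ) ^ (2 * k + 2) = n ^ (k + 1) * n ^ (k + 1) := by ring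
  rw [h5]
  nlinarith

theorem eventually_coinTail {κ : ℝ} (hκ : 1 / 2 < κ) (k : ℕ) {ε : ℝ} (hε : 0 < ε) :
    ∀ᶠ n : ℕ in Filter.atTop, (n : ℝ) ^ k * coinTail κ n < ε := by
  have h := tendsto_pow_const_mul_const_pow_of_abs_lt_one k
    (r := Real.exp (-((2 * κ - 1) ^ 2 / 2))) (by
      rw [abs_of_pos (Real.exp_pos _), Real.exp_lt_one_iff]
      have : 0 < (2 * κ - 1) ^ 2 := by
        have : 0 < 2 * κ - 1 := by linarith
        positivity
      linarith)
  filter_upwards [h.eventually (gt_mem_nhds hε)] with n hn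
  exact lt_of_le_of_lt (mul_le_mul_of_nonneg_left (coinTail_le hκ n) (by positivity)) hn

/-- Dependent choice along the natural numbers. -/
theorem exists_strong_choice {β : ℕ → Type} [∀ n, Nonempty (β n)]
    (P : ∀ n, (∀ m, β m) → β n → Prop) (h : ∀ n f, ∃ b, P n f b)
    (hP : ∀ n f f' b, (∀ m < n, f m = f' m) → P n f b → P n f' b) :
    ∃ f : ∀ n, β n, ∀ n, P n f (f n) := by
  classical
  choose g hg using h
  let F : ∀ n, β n := fun n => Nat.strongRec (motive := β) (fun n r =>
    g n fun m => if hm : m < n then r m hm else Classical.arbitrary _) n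
  have hF : ∀ n, F n = g n fun m => if m < n then F m else Classical.arbitrary _ := by
    intro n
    simp only [F]
    rw [Nat.strongRec_eq]
    simp
  refine ⟨F, fun n => ?_⟩
  have := hg n fun m => if m < n then F m else Classical.arbitrary _
  rw [← hF] at this
  exact hP n _ _ _ (fun m hm => by simp [hm]) this

instance (n : ℕ) : Nonempty (PureState n) := ⟨signState fun _ => false⟩

theorem countable_polynomial : Countable (Polynomial ℕ) := by
  refine Function.Injective.countable (f := fun p : Polynomial ℕ =>
    (List.range (p.natDegree + 1)).map p.coeff) fun p q h => ?_
  have hd : p.natDegree = q.natDegree := by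
    have := congrArg List.length h
    simpa using this
  ext i
  by_cases hi : i ≤ p.natDegree
  · have := congrArg (fun l : List ℕ => l.getD i 0) h
    simpa [List.getD_eq_getElem?_getD, ← hd, Nat.lt_succ_of_le hi] using this
  · rw [Polynomial.coeff_eq_zero_of_natDegree_lt (by omega),
      Polynomial.coeff_eq_zero_of_natDegree_lt (by omega)]

theorem exists_separating {κ : ℝ} (hκ : 1 / 2 < κ) (hκ1 : κ < 1) :
    ∃ (L : Set ℕ) (ψ : ∀ n, Fin n → PureState n),
      Separates anyLength (swapOracle κ L ψ) noInfo L := by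
  classical
  have hcount : Countable ({V | PolyTime V} × Polynomial ℕ × Polynomial ℕ) := by
    have := countable_polyTime.to_subtype
    have := countable_polynomial
    infer_instance
  have hne : Nonempty ({V | PolyTime V} × Polynomial ℕ × Polynomial ℕ) :=
    ⟨⟨⟨oneQuery, polyTime_oneQuery⟩, 0, 0⟩⟩
  obtain ⟨req, hreq⟩ := exists_surjective_nat ({V | PolyTime V} × Polynomial ℕ × Polynomial ℕ)
  have hbound : ∀ i, ∃ k N : ℕ, ∀ n, N ≤ n → 2 ≤ n ∧
      (verifierCircuit (req i).1.1 noInfo (req i).2.1 n).length ≤ n ^ k ∧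
      (∀ m ∈ queries (verifierCircuit (req i).1.1 noInfo (req i).2.1 n), m ≤ n ^ k) ∧
      (req i).2.2.eval n ≤ n ^ k ∧
      96 * (n : ℝ) ^ (k + 1) * (n ^ k + 2 * n ^ (k + 1) + 192) < 2 ^ n ∧
      (n : ℝ) ^ k * coinTail κ n < 1 / 24 := by
    intro i
    obtain ⟨k₁, h1⟩ := PolyTime.exists_circuit_bound (req i).1.2 (req i).2.1 0
    obtain ⟨k₂, h2⟩ := exists_pow_bound (req i).2.2
    have := ((eventually_big (max k₁ k₂)).and (eventually_coinTail hκ (max k₁ k₂)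
      (show (0 : ℝ) < 1 / 24 by norm_num))).and (Filter.eventually_ge_atTop 2)
    obtain ⟨N, hN⟩ := Filter.eventually_atTop.1 this
    refine ⟨max k₁ k₂, N, fun n hn => ?_⟩
    obtain ⟨⟨h3, h4⟩, h5⟩ := hN n hn
    obtain ⟨h6, h7⟩ := h1 noInfo (by simp [noInfo]) n h5
    have h8 := Nat.pow_le_pow_right (show 0 < n by omega) (le_max_left k₁ k₂)
    have h9 := Nat.pow_le_pow_right (show 0 < n by omega) (le_max_right k₁ k₂)
    exact ⟨h5, h6.trans h8, fun m hm => (h7 m hm).trans h8, (h2 n h5).trans h9, h3, h4⟩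
  choose k N hkN using hbound
  let len : ℕ → ℕ := fun i => Nat.rec (N 0) (fun i l => max (N (i + 1)) (max (l ^ k i) l + 1)) i
  have hlen_succ : ∀ i, len (i + 1) = max (N (i + 1)) (max (len i ^ k i) (len i) + 1) :=
    fun i => rfl
  have hlenN : ∀ i, N i ≤ len i := by
    intro i
    cases i with
    | zero => exact le_rfl
    | succ i => rw [hlen_succ]; exact le_max_left _ _
  have hmono : StrictMono len := strictMono_nat_of_lt_succ fun i => by
    rw [hlen_succ]
    exact lt_of_lt_of_le (Nat.lt_succ_of_le (le_max_right _ _)) (le_max_right _ _)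
  have hquery : ∀ i, len i ^ k i < len (i + 1) := fun i => by
    rw [hlen_succ]
    exact lt_of_lt_of_le (Nat.lt_succ_of_le (le_max_left _ _)) (le_max_right _ _)
  clear_value len
  let circ : ℕ → Circuit := fun i => verifierCircuit (req i).1.1 noInfo (req i).2.1 (len i)
  let Φ : ℕ → (∀ m, Bool × (Fin m → PureState m)) → ChannelOracle := fun n f =>
    truncOracle κ {m | m < n ∧ (f m).1 = true} fun m => (f m).2
  obtain ⟨f, hf⟩ := exists_strong_choice (β := fun m => Bool × (Fin m → PureState m))
    (fun n f b =>
      (∀ i, n = len i →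
        (∀ (y : Bits ((req i).2.2.eval n)) p a r, circ i = p ++ .query n a :: r →
          ∀ j : Fin n, expect (Φ n f) p (fidAt (b.2 j) (a + n * j)) (ket (place 1 y)) ≤
            2 * (48 * (n : ℝ) ^ (k i + 1))⁻¹) ∧
        (b.1 = true ↔ ¬ ∃ y : Bits ((req i).2.2.eval n), 1 / 2 < acceptProb (Φ n f) (circ i)
          (ket (place 1 y)))) ∧
      ((∀ i, n ≠ len i) → b.1 = false))
    (by
      intro n f
      by_cases hn : ∃ i, n = len i
      · obtain ⟨i, rfl⟩ := hn
        obtain ⟨h1, h2, h3, h4, h5, h6⟩ := hkN i (len i) (hlenN i)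
        obtain ⟨ψ, hψ⟩ := exists_marked (by omega) h5 (Φ (len i) f) (circ i) h2 h4
        refine ⟨⟨decide (¬ ∃ y : Bits ((req i).2.2.eval (len i)), 1 / 2 < acceptProb
          (Φ (len i) f) (circ i) (ket (place 1 y))), ψ⟩, ?_, fun h => absurd rfl (h i)⟩
        intro i' hi'
        obtain rfl := hmono.injective hi'
        exact ⟨hψ, decide_eq_true_iff⟩
      · exact ⟨⟨false, Classical.arbitrary _⟩, fun i h => absurd ⟨i, h⟩ hn, fun _ => rfl⟩)
    (by
      intro n f f' b hff h
      have : Φ n f = Φ n f' := by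
        refine truncOracle_congr ?_ ?_
        · ext m
          simp only [Set.mem_setOf_eq]
          exact and_congr_right fun hm => by rw [hff m hm]
        · intro m hm
          exact congrArg Prod.snd (hff m hm.1)
      simpa only [this] using h)
  refine ⟨{m | (f m).1 = true}, fun m => (f m).2, ?_⟩
  refine separates_of_not_decides hκ1 (fun _ => trivial) fun V hV d w => ?_
  obtain ⟨i, hi⟩ := hreq ⟨⟨V, hV⟩, d, w⟩
  obtain rfl : (req i).1.1 = V := by rw [hi]
  obtain rfl : (req i).2.1 = d := by rw [hi]
  obtain rfl : (req i).2.2 = w := by rw [hi]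
  obtain ⟨h1, h2, h3, h4, h5, h6⟩ := hkN i (len i) (hlenN i)
  obtain ⟨h7, h8⟩ := (hf (len i)).1 i rfl
  have hn0 := (Nat.cast_pos (α := ℝ)).2 (lt_of_lt_of_le two_pos h1)
  refine ⟨len i, not_decidesAt (δ := 2 * (48 * (len i : ℝ) ^ (k i + 1))⁻¹) ?_ (by positivity)
    (fun _ => h7) ?_ h8⟩
  · intro _ m hm hmL
    show m ≤ len i
    by_contra! hlt
    obtain ⟨i', rfl⟩ : ∃ i', m = len i' := by
      by_contra! h
      have := (hf m).2 h
      exact Bool.false_ne_true (this.symm.trans hmL)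
    have h9 : i < i' := hmono.lt_iff_lt.1 hlt
    have h10 := hmono.monotone (Nat.succ_le_of_lt h9)
    have := h3 _ hm
    have := hquery i
    simp only [Nat.succ_eq_add_one] at h10
    omega
  · have h9 : ((circ i).length : ℝ) ≤ (len i : ℝ) ^ k i := by
      exact_mod_cast h2
    have h10 : (0 : ℝ) ≤ coinTail κ (len i) + (len i : ℝ) * (2 * (48 * (len i : ℝ) ^ (k i + 1))⁻¹) :=
      add_nonneg (coinTail_nonneg _ _) (by positivity)
    refine (mul_le_mul_of_nonneg_right h9 h10).trans ?_
    rw [mul_add]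
    have : (len i : ℝ) ^ k i * ((len i : ℝ) * (2 * (48 * (len i : ℝ) ^ (k i + 1))⁻¹)) = 1 / 24 := by
      rw [pow_succ]
      field_simp
      norm_num
    rw [this]
    linarith

/-! ### Probabilities of events about the generated data -/

open MeasureTheory

variable {s : Polynomial ℕ}

instance (n : ℕ) : IsProbabilityMeasure (samplePMF s n).toMeasure :=
  PMF.toMeasure.isProbabilityMeasure _

theorem samplePMF_toMeasure {n : ℕ} (A : Set (Sample s n)) [DecidablePred (· ∈ A)] :
    (samplePMF s n).toMeasure A = ENNReal.ofReal (∑ x, if x ∈ A then x.prob else 0) := by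
  rw [PMF.toMeasure_apply_fintype, ENNReal.ofReal_sum_of_nonneg]
  · refine sum_congr rfl fun x _ => ?_
    by_cases hx : x ∈ A
    · rw [Set.indicator_of_mem hx, if_pos hx]; rfl
    · rw [Set.indicator_of_notMem hx, if_neg hx, ENNReal.ofReal_zero]
  · intro x _
    split_ifs
    exacts [x.prob_nonneg, le_rfl]

theorem oracleLaw_eval (n : ℕ) (A : Set (Sample s n)) :
    oracleLaw s {ω | ω n ∈ A} = (samplePMF s n).toMeasure A :=
  (measurePreserving_eval_infinitePi (fun n => (samplePMF s n).toMeasure) n).measure_preimage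
    (MeasurableSet.of_discrete (s := A)).nullMeasurableSet

open scoped Classical in
theorem sum_sample_descr {n : ℕ} (P : Descr s n → Prop) (j : Fin n) :
    ∑ x : Sample s n, (if P (x.2 j) then x.prob else 0) =
      ∑ d : Descr s n, if P d then d.prob else 0 := by
  have h1 : ∀ f : Fin n → Descr s n, (if P (f j) then ∏ i, (f i).prob else 0) =
      ∏ i, if i = j then (if P (f i) then (f i).prob else 0) else (f i).prob := by
    intro f
    by_cases h : P (f j)
    · rw [if_pos h]
      refine prod_congr rfl fun i _ => ?_
      by_cases hi : i = j
      · subst hi; rw [if_pos rfl, if_pos h]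
      · rw [if_neg hi]
    · rw [if_neg h]
      exact (prod_eq_zero (mem_univ j) (by rw [if_pos rfl, if_neg h])).symm
  have h2 : ∑ f : Fin n → Descr s n, (if P (f j) then ∏ i, (f i).prob else 0) =
      ∑ d : Descr s n, if P d then d.prob else 0 := by
    simp only [h1]
    have := prod_univ_sum (fun _ : Fin n => (Finset.univ : Finset (Descr s n)))
      (fun i d => if i = j then (if P d then d.prob else 0) else d.prob)
    rw [Fintype.piFinset_univ] at this
    rw [← this, prod_eq_single j]
    · simp only [if_true]
    · intro i _ hi
      simp only [if_neg hi]
      exact Descr.sum_prob s (Fin.pos j).ne'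
    · intro h; exact absurd (mem_univ j) h
  rw [Fintype.sum_prod_type, Fintype.sum_bool]
  have h3 : ∀ b : Bool, ∑ f : Fin n → Descr s n,
      (if P (f j) then Sample.prob (b, f) else 0) =
      1 / 2 * ∑ d : Descr s n, if P d then d.prob else 0 := by
    intro b
    rw [← h2, mul_sum]
    refine sum_congr rfl fun f _ => ?_
    simp only [Sample.prob, mul_ite, mul_zero]
  rw [h3, h3]
  ring

open scoped Classical in
theorem oracleLaw_exists_le (n : ℕ) (P : Descr s n → Prop) :
    oracleLaw s {ω | ∃ j, P ((ω n).2 j)} ≤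
      ENNReal.ofReal (n * ∑ d : Descr s n, if P d then d.prob else 0) := by
  refine (oracleLaw_eval n {x : Sample s n | ∃ j, P (x.2 j)}).trans_le ?_
  rw [samplePMF_toMeasure]
  refine ENNReal.ofReal_le_ofReal ?_
  calc ∑ x : Sample s n, (if x ∈ {x : Sample s n | ∃ j, P (x.2 j)} then x.prob else 0)
      ≤ ∑ x : Sample s n, ∑ j, if P (x.2 j) then x.prob else 0 := by
        refine sum_le_sum fun x _ => ?_
        have h0 : ∀ j ∈ (Finset.univ : Finset (Fin n)),
            0 ≤ if P (x.2 j) then x.prob else 0 := by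
          intro j _
          split_ifs
          exacts [x.prob_nonneg, le_rfl]
        by_cases h : ∃ j, P (x.2 j)
        · obtain ⟨j, hj⟩ := h
          rw [if_pos (show x ∈ {x : Sample s n | ∃ j, P (x.2 j)} from ⟨j, hj⟩)]
          refine le_trans ?_ (single_le_sum h0 (mem_univ j))
          rw [if_pos hj]
        · rw [if_neg (show x ∉ {x : Sample s n | ∃ j, P (x.2 j)} from h)]
          exact sum_nonneg h0
    _ = n * ∑ d : Descr s n, if P d then d.prob else 0 := by
        rw [sum_comm]
        simp only [sum_sample_descr]
        simp

theorem ae_eventually_not_exists {P : ∀ n, Descr s n → Prop}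
    (h : Summable fun n : ℕ => open scoped Classical in
      (n : ℝ) * ∑ d : Descr s n, if P n d then d.prob else 0) :
    ∀ᵐ ω ∂(oracleLaw s), ∀ᶠ n in Filter.atTop, ∀ j, ¬ P n ((ω n).2 j) := by
  classical
  have h1 : (∑' n, oracleLaw s {ω | ∃ j, P n ((ω n).2 j)}) ≠ ⊤ := by
    refine ne_top_of_le_ne_top ?_ (ENNReal.tsum_le_tsum fun n => oracleLaw_exists_le n (P n))
    exact h.tsum_ofReal_ne_top
  filter_upwards [ae_eventually_notMem h1] with ω hω
  filter_upwards [hω] with n hn j hj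
  exact hn ⟨j, hj⟩

theorem ae_not_easy (hs : GeneratesComplexStates s) : ∀ᵐ ω ∂(oracleLaw s), ∀ k,
    ∀ᶠ n in Filter.atTop, ∀ j, ¬ Easy k ((ω n).2 j).state := by
  classical
  rw [ae_all_iff]
  intro k
  refine ae_eventually_not_exists (P := fun n d => Easy k d.state) ?_
  have h1 := (hs k) 3
  have h2 : ∀ᶠ n : ℕ in Filter.atTop, (n : ℝ) ^ 3 *
      (∑ d : Descr s n, if Easy k d.state then d.prob else 0) < 1 :=
    h1.eventually (gt_mem_nhds (by norm_num))
  refine summable_of_isBigO_nat (g := fun n : ℕ => 1 / (n : ℝ) ^ 2)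
    (Real.summable_one_div_nat_pow.2 (by norm_num)) ?_
  refine Asymptotics.IsBigO.of_bound 1 ?_
  filter_upwards [h2, Filter.eventually_ge_atTop 1] with n hn h1
  have hn0 : (0 : ℝ) < n := by exact_mod_cast h1
  have h0 : 0 ≤ ∑ d : Descr s n, if Easy k d.state then d.prob else 0 :=
    sum_nonneg fun d _ => by
      split_ifs
      exacts [d.prob_nonneg, le_rfl]
  rw [Real.norm_of_nonneg (mul_nonneg hn0.le h0), Real.norm_of_nonneg (by positivity), one_mul,
    le_div_iff₀ (by positivity)]
  refine le_trans (le_of_eq ?_) hn.le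
  ring

/-- The probability of the measurement result in a description. -/
def Descr.weight {n : ℕ} (d : Descr s n) : ℝ := ∑ y, Complex.normSq (d.branch y)

theorem Descr.weight_nonneg {n : ℕ} (d : Descr s n) : 0 ≤ d.weight :=
  sum_nonneg fun _ _ => Complex.normSq_nonneg _

open scoped Classical in
theorem sum_prob_weight_le {n : ℕ} {t : ℝ} (ht : 0 ≤ t) :
    ∑ d : Descr s n, (if d.weight ≤ t then d.prob else 0) ≤ 2 ^ n * t := by
  calc ∑ d : Descr s n, (if d.weight ≤ t then d.prob else 0)
      ≤ ∑ _d : Descr s n, (Fintype.card (RandomCircuit s n) : ℝ)⁻¹ * t := by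
        refine sum_le_sum fun d _ => ?_
        split_ifs with h
        · exact mul_le_mul_of_nonneg_left h (by positivity)
        · positivity
    _ = ((Fintype.card (RandomCircuit s n) : ℝ) * (Fintype.card (RandomCircuit s n) : ℝ)⁻¹) *
        (2 ^ n * t) := by
        rw [sum_const, Finset.card_univ, Fintype.card_prod, nsmul_eq_mul]
        simp only [Fintype.card_fun, Fintype.card_bool, Fintype.card_fin]
        push_cast
        ring
    _ ≤ 1 * (2 ^ n * t) :=
        mul_le_mul_of_nonneg_right mul_inv_le_one (by positivity)
    _ = 2 ^ n * t := one_mul _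

theorem ae_weight_pos : ∀ᵐ ω ∂(oracleLaw s), ∀ n j, 0 < ((ω n).2 j).weight := by
  classical
  rw [ae_all_iff]
  intro n
  have h1 := oracleLaw_exists_le n fun d : Descr s n => d.weight ≤ 0
  have h2 : ∑ d : Descr s n, (if d.weight ≤ 0 then d.prob else 0) ≤ 0 := by
    simpa using sum_prob_weight_le (s := s) (n := n) le_rfl
  rw [ENNReal.ofReal_of_nonpos (mul_nonpos_of_nonneg_of_nonpos (Nat.cast_nonneg n) h2)] at h1
  have h3 := nonpos_iff_eq_zero.1 h1
  rw [ae_iff]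
  refine measure_mono_null (fun ω hω => ?_) h3
  simpa using hω

theorem ae_weight_eventually : ∀ᵐ ω ∂(oracleLaw s), ∀ᶠ n in Filter.atTop, ∀ j,
    ¬ ((ω n).2 j).weight ≤ ((4 : ℝ) ^ n)⁻¹ := by
  classical
  refine ae_eventually_not_exists (P := fun n d => d.weight ≤ ((4 : ℝ) ^ n)⁻¹) ?_
  have h : Summable fun n : ℕ => (n : ℝ) ^ 1 * (1 / 2 : ℝ) ^ n :=
    summable_pow_mul_geometric_of_norm_lt_one 1 (by norm_num)
  refine Summable.of_nonneg_of_le (fun n => ?_) (fun n => ?_) h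
  · refine mul_nonneg (Nat.cast_nonneg n) (sum_nonneg fun d _ => ?_)
    split_ifs
    exacts [d.prob_nonneg, le_rfl]
  · rw [pow_one]
    refine mul_le_mul_of_nonneg_left ?_ (Nat.cast_nonneg n)
    refine (sum_prob_weight_le (by positivity)).trans (le_of_eq ?_)
    rw [show (4 : ℝ) = 2 * 2 by norm_num, mul_pow, mul_inv, ← mul_assoc,
      mul_inv_cancel₀ (by positivity), one_mul, one_div, inv_pow]

theorem exists_weight_bound {ω : ∀ n, Sample s n} (h0 : ∀ n j, 0 < ((ω n).2 j).weight)
    (h1 : ∀ᶠ n in Filter.atTop, ∀ j, ¬ ((ω n).2 j).weight ≤ ((4 : ℝ) ^ n)⁻¹) :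
    ∃ B : ℕ, 1 ≤ B ∧ ∀ n j, ((B : ℝ) * 4 ^ n)⁻¹ ≤ ((ω n).2 j).weight := by
  obtain ⟨N, hN⟩ := Filter.eventually_atTop.1 h1
  obtain ⟨B, hB⟩ := exists_nat_ge (∑ n ∈ range N, ∑ j, (((ω n).2 j).weight)⁻¹)
  refine ⟨B + 1, by omega, fun n j => ?_⟩
  push_cast
  by_cases hn : N ≤ n
  · refine le_trans ?_ (not_le.1 (hN n hn j)).le
    refine inv_anti₀ (by positivity) (le_mul_of_one_le_left (by positivity) ?_)
    linarith [Nat.cast_nonneg (α := ℝ) B]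
  · have hi : ∀ n j, 0 ≤ (((ω n).2 j).weight)⁻¹ := fun n j => (inv_pos.2 (h0 n j)).le
    have h2 : (((ω n).2 j).weight)⁻¹ ≤ B := by
      refine le_trans ?_ hB
      refine le_trans ?_ (single_le_sum (f := fun n => ∑ j, (((ω n).2 j).weight)⁻¹)
        (fun n _ => sum_nonneg fun j _ => hi n j) (Finset.mem_range.2 (not_le.1 hn)))
      exact single_le_sum (f := fun j => (((ω n).2 j).weight)⁻¹)
        (fun j _ => hi n j) (mem_univ j)
    refine inv_le_of_inv_le₀ (h0 n j) (h2.trans ?_)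
    have : (1 : ℝ) ≤ 4 ^ n := one_le_pow₀ (by norm_num)
    nlinarith [Nat.cast_nonneg (α := ℝ) B]

theorem Descr.preparable {n : ℕ} (d : Descr s n) {p : ℝ} (h0 : 0 < d.weight) (hp : p ≤ d.weight) :
    Preparable (s.eval n) p d.state := by
  refine ⟨List.ofFn fun t => (d.1 t).toGate, d.2, (Real.sqrt d.weight : ℝ), by simp, ?_, ?_, ?_⟩
  · intro g hg
    rw [List.mem_ofFn] at hg
    obtain ⟨t, rfl⟩ := hg
    simp only [GateChoice.toGate]
    split_ifs <;> simp [Gate.Below]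
  · intro y
    have h1 : (Real.sqrt d.weight : ℂ) ≠ 0 := by
      rw [Complex.ofReal_ne_zero]; exact (Real.sqrt_pos.2 h0).ne'
    have h2 : d.state.1 y = d.branch y / (Real.sqrt d.weight : ℝ) := by
      rw [Descr.state, dif_neg (show ¬ ∑ y, Complex.normSq (d.branch y) = 0 from h0.ne')]
      rfl
    rw [h2, mul_div_cancel₀ _ h1, ← runGates_eq]
    rfl
  · rw [Complex.normSq_ofReal, Real.mul_self_sqrt h0.le]
    exact hp

/-! ### Guessing the private bits -/

/-- Flip the private bit of length `n`. -/
def flipBit (n : ℕ) (ω : ∀ n, Sample s n) : ∀ n, Sample s n := fun m =>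
  if m = n then (!(ω m).1, (ω m).2) else ω m

theorem flipBit_of_ne {m n : ℕ} (h : m ≠ n) (ω : ∀ n, Sample s n) : flipBit n ω m = ω m :=
  if_neg h

theorem flipBit_self (n : ℕ) (ω : ∀ n, Sample s n) : flipBit n ω n = (!(ω n).1, (ω n).2) :=
  if_pos rfl

theorem measurePreserving_flipBit (n : ℕ) :
    MeasurePreserving (flipBit n) (oracleLaw s) (oracleLaw s) := by
  classical
  let f : ∀ m, Sample s m → Sample s m := fun m x => if m = n then (!x.1, x.2) else x
  have hf : ∀ m, Measurable (f m) := fun m => Measurable.of_discrete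
  have h1 : (flipBit n : (∀ n, Sample s n) → ∀ n, Sample s n) = fun ω m => f m (ω m) := rfl
  refine ⟨?_, ?_⟩
  · rw [h1]
    exact measurable_pi_lambda _ fun m => (hf m).comp (measurable_pi_apply m)
  · rw [h1]
    refine (Measure.infinitePi_map_pi (fun n => (samplePMF s n).toMeasure) hf).trans ?_
    congr 1
    funext m
    refine Measure.ext fun A _ => ?_
    rw [Measure.map_apply (hf m) MeasurableSet.of_discrete, samplePMF_toMeasure,
      samplePMF_toMeasure]
    congr 1
    by_cases hm : m = n
    · have hinv : Function.Involutive (f m) := fun x => by simp [f, hm]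
      refine Fintype.sum_equiv hinv.toPerm _ _ fun x => ?_
      have : (f m x).prob = x.prob := by simp [f, hm, Sample.prob]
      simp only [Function.Involutive.coe_toPerm, Set.mem_preimage, this]
    · simp [f, hm]

theorem measurableSet_of_depends {A : Set (∀ n, Sample s n)} (M : ℕ)
    (h : ∀ ω ω', (∀ m < M, ω m = ω' m) → ω ∈ A → ω' ∈ A) : MeasurableSet A := by
  let r : (∀ n, Sample s n) → ∀ m : Fin M, Sample s m := fun ω m => ω m
  have hr : Measurable r := measurable_pi_lambda _ fun m => measurable_pi_apply (m : ℕ)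
  have : A = r ⁻¹' (r '' A) := by
    refine Set.Subset.antisymm (Set.subset_preimage_image _ _) ?_
    rintro ω ⟨ω', h1, h2⟩
    exact h ω' ω (fun m hm => congrFun h2 ⟨m, hm⟩) h1
  rw [this]
  exact hr MeasurableSet.of_discrete

theorem ae_guess_wrong {S : Set ℕ} (hS : S.Infinite) {g : ℕ → (∀ n, Sample s n) → Prop}
    (hg : ∀ n, ∃ M, ∀ ω ω', (∀ m < M, ω m = ω' m) → (g n ω ↔ g n ω'))
    (hflip : ∀ n m ω, n ≤ m → (g n (flipBit m ω) ↔ g n ω)) :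
    ∀ᵐ ω ∂(oracleLaw s), ∀ N, ∃ n, N ≤ n ∧ n ∈ S ∧ ((ω n).1 = true ↔ ¬ g n ω) := by
  classical
  have : IsProbabilityMeasure (oracleLaw s) := by unfold oracleLaw; infer_instance
  rw [ae_all_iff]
  intro N
  obtain ⟨e, he, heS⟩ := Filter.extraction_of_frequently_atTop
    ((Nat.frequently_atTop_iff_infinite.2 hS).and_eventually (Filter.eventually_ge_atTop N))
  choose M hM using hg
  let E : ℕ → Set (∀ n, Sample s n) := fun r =>
    {ω | ∀ i < r, ((ω (e i)).1 = true ↔ g (e i) ω)}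
  have hmeas : ∀ r, MeasurableSet (E r) := by
    intro r
    refine measurableSet_of_depends (∑ i ∈ range r, (M (e i) + e i + 1)) ?_
    intro ω ω' h hω i hi
    have h1 := single_le_sum (f := fun i => M (e i) + e i + 1) (fun _ _ => Nat.zero_le _)
      (Finset.mem_range.2 hi)
    rw [← h (e i) (by omega), ← hM (e i) ω ω' fun m hm => h m (by omega)]
    exact hω i hi
  have hstep : ∀ r, oracleLaw s (E (r + 1)) = oracleLaw s (E r) / 2 := by
    intro r
    have h1 : flipBit (e r) ⁻¹' (E (r + 1)) = E r \ E (r + 1) := by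
      ext ω
      have h2 : flipBit (e r) ω ∈ E r ↔ ω ∈ E r := by
        refine forall_congr' fun i => forall_congr' fun hi => ?_
        rw [flipBit_of_ne (he hi).ne, hflip _ _ _ (he hi).le]
      have h3 : ∀ ω, ω ∈ E (r + 1) ↔ ω ∈ E r ∧ ((ω (e r)).1 = true ↔ g (e r) ω) := by
        intro ω
        constructor
        · exact fun h => ⟨fun i hi => h i (by omega), h r (by omega)⟩
        · rintro ⟨h, h'⟩ i hi
          rcases Nat.lt_succ_iff_lt_or_eq.1 hi with hi | rfl
          exacts [h i hi, h']
      rw [Set.mem_preimage, Set.mem_diff, h3, h3, h2, flipBit_self, hflip _ _ _ le_rfl]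
      cases (ω (e r)).1 <;> simp <;> tauto
    have h2 := (measurePreserving_flipBit (s := s) (e r)).measure_preimage
      (hmeas (r + 1)).nullMeasurableSet
    rw [h1] at h2
    have h3 := measure_inter_add_diff (μ := oracleLaw s) (E r) (hmeas (r + 1))
    have h4 : E r ∩ E (r + 1) = E (r + 1) :=
      Set.inter_eq_right.2 fun ω h i hi => h i (by omega)
    rw [h4, h2, ← two_mul] at h3
    rw [← h3, mul_comm, ENNReal.mul_div_cancel_right two_ne_zero ENNReal.ofNat_ne_top]
  have hpow : ∀ r, oracleLaw s (E r) ≤ 2⁻¹ ^ r := by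
    intro r
    induction r with
    | zero => simpa using prob_le_one
    | succ r ih =>
      rw [hstep, pow_succ, ENNReal.div_eq_inv_mul, mul_comm]
      exact mul_le_mul_left ih _
  rw [ae_iff]
  have h0 : ∀ r, oracleLaw s {ω | ¬ ∃ n, N ≤ n ∧ n ∈ S ∧ ((ω n).1 = true ↔ ¬ g n ω)} ≤ 2⁻¹ ^ r := by
    intro r
    refine (measure_mono fun ω hω i hi => ?_).trans (hpow r)
    by_contra hc
    refine hω ⟨e i, (heS i).2, (heS i).1, ?_⟩
    tauto
  refine le_antisymm ?_ zero_le
  refine ge_of_tendsto' (ENNReal.tendsto_pow_atTop_nhds_zero_of_lt_one ?_) h0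
  exact ENNReal.inv_lt_one.2 (by norm_num)

/-! ### Verifiers with a classical witness fail on complex marked states -/

theorem mem_queries_append {m : ℕ} (c c' : Circuit) (h : m ∈ queries c) : m ∈ queries (c ++ c') := by
  induction c with
  | nil => simp [queries] at h
  | cons i c ih =>
    cases i with
    | gate g => exact ih h
    | query m' a =>
      rcases List.mem_cons.1 h with rfl | h
      · exact List.mem_cons_self
      · exact List.mem_cons_of_mem _ (ih h)

/-- Repeated trials succeed often enough. -/
theorem le_trials {p ε : ℝ} (hp : 0 < p) (hp1 : p ≤ 1) (hε : 0 ≤ ε) {K m : ℕ} (hm : m ≤ ε * (p * K)) :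
    1 - ε ≤ (1 - (1 - p) ^ K) ^ m := by
  have h0 : 0 ≤ (1 - p) ^ K := pow_nonneg (by linarith) _
  have h1 : (1 - p) ^ K ≤ 1 := pow_le_one₀ (by linarith) (by linarith)
  have h2 := one_add_mul_le_pow (a := -(1 - p) ^ K) (by linarith) m
  rw [← sub_eq_add_neg] at h2
  refine le_trans ?_ h2
  have h3 : (1 - p) ^ K * (1 + p * K) ≤ 1 := by
    have h4 : (1 - p) ^ K ≤ Real.exp (-(p * K)) := by
      rw [show -(p * K) = K * (-p) by ring, Real.exp_nat_mul]
      exact pow_le_pow_left₀ (by linarith) (by linarith [Real.add_one_le_exp (-p)]) _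
    have h5 : 1 + p * K ≤ Real.exp (p * K) := by linarith [Real.add_one_le_exp (p * K)]
    calc (1 - p) ^ K * (1 + p * K) ≤ Real.exp (-(p * K)) * Real.exp (p * K) :=
          mul_le_mul h4 h5 (by positivity) (Real.exp_pos _).le
      _ = 1 := by rw [← Real.exp_add, neg_add_cancel, Real.exp_zero]
  have h6 : 0 ≤ p * K := by positivity
  have hmx : m * (1 - p) ^ K ≤ ε := by
    nlinarith [mul_le_mul_of_nonneg_right hm h0]
  linarith

theorem exists_not_decidesAt (s : Polynomial ℕ) {κ : ℝ} (hκ : 1 / 2 < κ)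
    {V : List (Option Bool) → Circuit} (hV : PolyTime V) (d w T : Polynomial ℕ) {B : ℕ}
    (hB : 1 ≤ B) :
    ∃ k N : ℕ, ∀ (L : Set ℕ) (ψ : ∀ n, Fin n → PureState n) (acc : Access) (D : ℕ → List Bool)
      (n : ℕ), N ≤ n → (∀ m, (D m).length ≤ T.eval m) →
      (∀ m j, Preparable (s.eval m) ((B : ℝ) * 4 ^ m)⁻¹ (ψ m j)) → (∀ j, ¬ Easy k (ψ n j)) →
      (∀ m ∈ L, acc n m → (m < n → 2 ^ m ≤ n) ∧ (n < m → 2 ^ n ≤ m)) →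
      (n ∈ L ↔ ¬ ∃ y : Bits (w.eval n), 1 / 2 < acceptProb
        (truncOracle κ {m | m < n ∧ m ∈ L} ψ) (verifierCircuit V D d n) (ket (place 1 y))) →
      ¬ DecidesAt acc (swapOracle κ L ψ) D L V d w n := by
  obtain ⟨a, ha⟩ := hV.exists_circuit_bound d T
  let KP : Polynomial ℕ := 2 * (Polynomial.X ^ a + 1) * (Polynomial.X * Polynomial.C B *
    Polynomial.X ^ 2)
  let QP : Polynomial ℕ := Polynomial.X * (KP * (s + 113 * Polynomial.X + 6)) +
    (2 * Polynomial.X + 37 * (Polynomial.X * Polynomial.X) + 2 +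
      Polynomial.X * (78 * Polynomial.X + 6)) +
    (2 * (Polynomial.X ^ a * Polynomial.X ^ a) + 2)
  have hKP : ∀ n, KP.eval n = 2 * (n ^ a + 1) * (n * B * n ^ 2) := fun n => by simp [KP]
  have hQP : ∀ n, QP.eval n = n * (KP.eval n * (s.eval n + 113 * n + 6)) +
      (2 * n + 37 * (n * n) + 2 + n * (78 * n + 6)) + (2 * (n ^ a * n ^ a) + 2) :=
    fun n => by simp [QP]
  obtain ⟨k₀, hk₀⟩ := exists_pow_bound (Polynomial.X ^ a * QP + 6 * w)
  obtain ⟨N, hN⟩ := Filter.eventually_atTop.1 (((eventually_pow_lt_two_pow 1 a).and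
    (eventually_coinTail hκ a (show (0 : ℝ) < 1 / 24 by norm_num))).and
    (Filter.eventually_ge_atTop 48))
  refine ⟨max k₀ (a + 2), N, fun L ψ acc D n hn hD hprep heasy hgap hL => ?_⟩
  obtain ⟨⟨hn1, hn2⟩, hn3⟩ := hN n hn
  rw [one_mul] at hn1
  obtain ⟨hc, hq⟩ := ha D hD n (by omega)
  set k := max k₀ (a + 2)
  set c := verifierCircuit V D d n with hcdef
  have hn0 : (0 : ℝ) < n := by exact_mod_cast (show 0 < n by omega)
  have hk : ((n : ℝ) ^ k)⁻¹ ≤ ((n : ℝ) ^ (a + 2))⁻¹ :=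
    inv_anti₀ (by positivity) (pow_le_pow_right₀ (by exact_mod_cast (show 1 ≤ n by omega))
      (le_max_right _ _))
  refine not_decidesAt (δ := 2 * ((n : ℝ) ^ k)⁻¹) ?_ (by positivity) ?_ ?_ hL
  · intro hacc m hm hmL
    by_contra! hlt
    have h1 := (hgap m hmL (hacc m hm)).2 hlt
    have h2 := hq m hm
    have h3 : n ^ a < 2 ^ n := by exact_mod_cast hn1
    omega
  · intro hacc y p b r hp j
    rw [← hcdef] at hp
    have hpc : ∀ m ∈ queries p, m ∈ queries c := fun m hm => by
      rw [hp]; exact mem_queries_append _ _ hm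
    have hplen : p.length ≤ n ^ a := by
      refine le_trans ?_ hc
      rw [hp]; simp
    set ε : ℝ := (2 * ((n : ℝ) ^ a + 1))⁻¹ with hε
    have hε0 : 0 < ε := by positivity
    have hε1 : ε ≤ 1 / 2 := by
      rw [hε, one_div]
      refine inv_anti₀ (by norm_num) ?_
      nlinarith [show (0 : ℝ) ≤ (n : ℝ) ^ a by positivity]
    have key := expect_le_of_not_easy (κ := κ) (L := {m | m < n ∧ m ∈ L}) (ψ := ψ) (σ := 1 - ε)
      (by linarith) (by linarith) (Q := QP.eval n) (K := KP.eval n)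
      (by rw [hQP]; omega) p ?_ ?_ (k := k) (w := w.eval n) (heasy j) ?_ (b + n * j) y
    · have h1 : (1 : ℝ) / 2 ≤ (1 - ε) ^ p.length := by
        have h2 := one_add_mul_le_pow (a := -ε) (by linarith) p.length
        rw [← sub_eq_add_neg] at h2
        refine le_trans ?_ h2
        have h3 : (p.length : ℝ) ≤ (n : ℝ) ^ a := by exact_mod_cast hplen
        have h4 : ((n : ℝ) ^ a + 1) * ε = 1 / 2 := by rw [hε]; field_simp
        nlinarith
      have h0 : 0 ≤ expect (truncOracle κ {m | m < n ∧ m ∈ L} ψ) p (fidAt (ψ n j) (b + n * j))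
          (ket (place 1 y)) := ((isSumSq_fidAt _ _).expect _ _).nonneg _
      nlinarith [mul_le_mul_of_nonneg_right h1 h0]
    · intro m hm hmL
      have h2m := (hgap m hmL.2 (hacc m (hpc m hm))).1 hmL.1
      have hmn := hmL.1.le
      have hB0 : (0 : ℝ) < B := by exact_mod_cast hB
      refine ⟨s.eval m, ((B : ℝ) * 4 ^ m)⁻¹, by positivity, ?_, hprep m, ?_, ?_⟩
      · refine inv_le_one_of_one_le₀ ?_
        have h1 : (1 : ℝ) ≤ 4 ^ m := one_le_pow₀ (by norm_num)
        have h2 : (1 : ℝ) ≤ B := by exact_mod_cast hB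
        nlinarith
      · rw [hQP, queryCost]
        have h1 := Nat.mul_le_mul hmn (Nat.mul_le_mul_left (KP.eval n)
          (show s.eval m + 113 * m + 6 ≤ s.eval n + 113 * n + 6 by
            have := eval_le_eval s hmn; omega))
        have h2 := Nat.mul_le_mul hmn hmn
        have h3 := Nat.mul_le_mul h2m (show 78 * m + 6 ≤ 78 * n + 6 by omega)
        omega
      · refine le_trials (by positivity) ?_ hε0.le ?_
        · refine inv_le_one_of_one_le₀ ?_
          have h1 : (1 : ℝ) ≤ 4 ^ m := one_le_pow₀ (by norm_num)
          have h2 : (1 : ℝ) ≤ B := by exact_mod_cast hB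
          nlinarith
        · have h1 : (4 : ℝ) ^ m ≤ (n : ℝ) ^ 2 := by
            have : ((2 : ℝ) ^ m) ≤ n := by exact_mod_cast h2m
            calc (4 : ℝ) ^ m = (2 ^ m) ^ 2 := by rw [← pow_mul, mul_comm, pow_mul]; norm_num
              _ ≤ (n : ℝ) ^ 2 := pow_le_pow_left₀ (by positivity) this 2
          have h2 : (m : ℝ) ≤ n := by exact_mod_cast hmn
          have h3 : ε * (((B : ℝ) * 4 ^ m)⁻¹ * (KP.eval n : ℕ)) = n * (n ^ 2 / 4 ^ m) := by
            rw [hKP, hε]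
            push_cast
            field_simp
          rw [h3]
          refine h2.trans (le_mul_of_one_le_right hn0.le ?_)
          rw [one_le_div (by positivity)]
          exact h1
    · intro m hm _
      have h1 := hq m (hpc m hm)
      have h2 := Nat.mul_le_mul h1 h1
      rw [hQP]
      omega
    · have h1 := hk₀ n (by omega)
      have h2 := Nat.mul_le_mul_right (QP.eval n) hplen
      have h3 := Nat.pow_le_pow_right (show 0 < n by omega) (le_max_left k₀ (a + 2))
      simp only [Polynomial.eval_add, Polynomial.eval_mul, Polynomial.eval_pow, Polynomial.eval_X,
        Polynomial.eval_ofNat] at h1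
      change _ ≤ n ^ max k₀ (a + 2)
      omega
  · have h1 : (c.length : ℝ) ≤ (n : ℝ) ^ a := by exact_mod_cast hc
    have h2 : coinTail κ n + n * (2 * ((n : ℝ) ^ k)⁻¹) ≤
        coinTail κ n + n * (2 * ((n : ℝ) ^ (a + 2))⁻¹) := by gcongr
    refine (mul_le_mul h1 h2 (add_nonneg (coinTail_nonneg _ _) (by positivity))
      (by positivity)).trans ?_
    have h3 : (n : ℝ) ^ a * (n * (2 * ((n : ℝ) ^ (a + 2))⁻¹)) = 2 / n := by
      rw [pow_add]; field_simp
    rw [mul_add, h3]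
    have h4 : (2 : ℝ) / n ≤ 1 / 24 := by
      rw [div_le_div_iff₀ hn0 (by norm_num)]
      have : (48 : ℝ) ≤ n := by exact_mod_cast hn3
      linarith
    linarith

/-! ### The public information -/

theorem encodeChoice_length_le {n : ℕ} (x : GateChoice n) :
    (encodeChoice x).length ≤ 4 * n + 6 := by
  obtain ⟨a, b, c⟩ := x
  simp only [encodeChoice, List.length_append, List.length_cons, List.length_replicate,
    List.length_nil]
  omega

theorem length_flatMap_ofFn_le {α : Type} {N b : ℕ} (f : Fin N → α) (g : α → List Bool)
    (h : ∀ x, (g x).length ≤ b) : ((List.ofFn f).flatMap g).length ≤ N * b := by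
  rw [List.length_flatMap]
  have := List.sum_le_card_nsmul ((List.ofFn f).map fun x => (g x).length) b (by
    intro l hl
    obtain ⟨x, -, rfl⟩ := List.mem_map.1 hl
    exact h x)
  simpa using this

/-- A bound for the length of the public information. -/
def infoBound (s : Polynomial ℕ) : Polynomial ℕ :=
  Polynomial.X * (s * (4 * Polynomial.X + 6) + Polynomial.X)

theorem publicInfo_length_le {s : Polynomial ℕ} {n : ℕ} (d : Fin n → Descr s n) :
    (publicInfo d).length ≤ (infoBound s).eval n := by
  refine (length_flatMap_ofFn_le d encodeDescr (b := s.eval n * (4 * n + 6) + n) fun x => ?_).trans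
    (le_of_eq (by simp [infoBound]))
  rw [encodeDescr, List.length_append, List.length_ofFn]
  exact Nat.add_le_add_right (length_flatMap_ofFn_le _ _ encodeChoice_length_le) _

theorem flatMap_ofFn_inj {α : Type} {g : α → List Bool}
    (hg : ∀ a b u v, g a ++ u = g b ++ v → a = b ∧ u = v) {N : ℕ} (f f' : Fin N → α)
    (u v : List Bool) (h : (List.ofFn f).flatMap g ++ u = (List.ofFn f').flatMap g ++ v) :
    f = f' ∧ u = v := by
  induction N with
  | zero => exact ⟨Subsingleton.elim _ _, by simpa using h⟩
  | succ N ih =>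
    rw [List.ofFn_succ, List.ofFn_succ, List.flatMap_cons, List.flatMap_cons, List.append_assoc,
      List.append_assoc] at h
    obtain ⟨h1, h2⟩ := hg _ _ _ _ h
    obtain ⟨h3, h4⟩ := ih _ _ h2
    refine ⟨funext fun i => Fin.cases h1 (fun i => congrFun h3 i) i, h4⟩

theorem replicate_true_inj {i j : ℕ} {u v : List Bool}
    (h : List.replicate i true ++ false :: u = List.replicate j true ++ false :: v) :
    i = j ∧ u = v := by
  induction i generalizing j with
  | zero => cases j <;> simp_all [List.replicate_succ]
  | succ i ih =>
    cases j with
    | zero => simp [List.replicate_succ] at h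
    | succ j =>
      simp only [List.replicate_succ, List.cons_append, List.cons.injEq, true_and] at h
      exact ⟨congrArg _ (ih h).1, (ih h).2⟩

theorem encodeChoice_inj {n : ℕ} (a b : GateChoice n) (u v : List Bool)
    (h : encodeChoice a ++ u = encodeChoice b ++ v) : a = b ∧ u = v := by
  simp only [encodeChoice, List.append_assoc, List.cons_append, List.nil_append] at h
  obtain ⟨h1, h⟩ := replicate_true_inj h
  obtain ⟨h2, h⟩ := replicate_true_inj h
  obtain ⟨h3, h⟩ := replicate_true_inj h
  exact ⟨Prod.ext (Fin.ext h1) (Prod.ext (Fin.ext h2) (Fin.ext h3)), h⟩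

theorem encodeDescr_inj {s : Polynomial ℕ} {n : ℕ} (a b : Descr s n) (u v : List Bool)
    (h : encodeDescr a ++ u = encodeDescr b ++ v) : a = b ∧ u = v := by
  rw [encodeDescr, encodeDescr, List.append_assoc, List.append_assoc] at h
  obtain ⟨h1, h⟩ := flatMap_ofFn_inj encodeChoice_inj _ _ _ _ h
  obtain ⟨h2, h⟩ := List.append_inj h (by simp)
  exact ⟨Prod.ext h1 (List.ofFn_injective h2), h⟩

theorem publicInfo_injective (s : Polynomial ℕ) (n : ℕ) :
    Function.Injective (publicInfo : (Fin n → Descr s n) → List Bool) := by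
  intro d d' h
  exact (flatMap_ofFn_inj encodeDescr_inj d d' [] [] (by simpa [publicInfo] using h)).1

/-! ### The random oracle separates -/

open MeasureTheory in
theorem ae_separates {s : Polynomial ℕ} (hs : GeneratesComplexStates s) {κ : ℝ} (hκ : 1 / 2 < κ)
    (hκ1 : κ < 1) {S : Set ℕ} (hS : S.Infinite) {acc : Access} (hacc : ∀ n, acc n n)
    (hgap : ∀ m ∈ S, ∀ n ∈ S, acc n m → (m < n → 2 ^ m ≤ n) ∧ (n < m → 2 ^ n ≤ m))
    {D : (∀ n, Sample s n) → ℕ → List Bool} (hDT : ∀ ω m, (D ω m).length ≤ (infoBound s).eval m)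
    (hD : ∀ ω ω' m, (ω m).2 = (ω' m).2 → D ω m = D ω' m) :
    ∀ᵐ ω ∂(oracleLaw s), Separates acc (oracleOf κ S ω) (D ω) (langOf S ω) := by
  have hcount : Countable {V | PolyTime V} := countable_polyTime.to_subtype
  have hpoly := countable_polynomial
  let trunc : ℕ → (∀ n, Sample s n) → ChannelOracle := fun n ω =>
    truncOracle κ {m | m < n ∧ m ∈ langOf S ω} fun n j => ((ω n).2 j).state
  have htrunc : ∀ n ω ω', (∀ m < n, ω m = ω' m) → trunc n ω = trunc n ω' := by
    intro n ω ω' h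
    refine truncOracle_congr ?_ fun m hm => ?_
    · ext m
      simp only [Set.mem_setOf_eq, langOf]
      exact and_congr_right fun hm => by rw [h m hm]
    · rw [h m hm.1]
  have hcirc : ∀ V d n ω ω', (∀ m < d.eval n, (ω m).2 = (ω' m).2) →
      verifierCircuit V (D ω) d n = verifierCircuit V (D ω') d n := by
    intro V d n ω ω' h
    unfold verifierCircuit verifierInput
    congr 2
    rw [List.flatMap_congr]
    intro m hm
    rw [hD ω ω' m (h m (List.mem_range.1 hm))]
  have hguess : ∀ (V : {V | PolyTime V}) (d w : Polynomial ℕ), ∀ᵐ ω ∂(oracleLaw s), ∀ N, ∃ n,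
      N ≤ n ∧ n ∈ S ∧ ((ω n).1 = true ↔ ¬ ∃ y : Bits (w.eval n), 1 / 2 <
        acceptProb (trunc n ω) (verifierCircuit V (D ω) d n) (ket (place 1 y))) := by
    intro V d w
    refine ae_guess_wrong hS (g := fun n ω => ∃ y : Bits (w.eval n), 1 / 2 <
        acceptProb (trunc n ω) (verifierCircuit V (D ω) d n) (ket (place 1 y))) ?_ ?_
    · intro n
      refine ⟨n + d.eval n, fun ω ω' h => ?_⟩
      beta_reduce
      rw [htrunc n ω ω' fun m hm => h m (by omega),
        hcirc V d n ω ω' fun m hm => by rw [h m (by omega)]]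
    · intro n m ω hnm
      beta_reduce
      rw [htrunc n (flipBit m ω) ω fun m' hm' => flipBit_of_ne (by omega) ω,
        hcirc V d n (flipBit m ω) ω fun m' _ => ?_]
      by_cases h : m' = m
      · subst h; rw [flipBit_self]
      · rw [flipBit_of_ne h]
  have hguess' := (ae_all_iff.2 fun V => ae_all_iff.2 fun d => ae_all_iff.2 fun w =>
    hguess V d w)
  filter_upwards [hguess', ae_not_easy hs, ae_weight_pos, ae_weight_eventually]
    with ω h1 h2 h3 h4
  obtain ⟨B, hB, hw⟩ := exists_weight_bound h3 h4
  refine separates_of_not_decides hκ1 hacc fun V hV d w => ?_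
  obtain ⟨k, N, hkN⟩ := exists_not_decidesAt s hκ hV d w (infoBound s) hB
  obtain ⟨N', hN'⟩ := Filter.eventually_atTop.1 (h2 k)
  obtain ⟨n, hn, hnS, hb⟩ := h1 ⟨V, hV⟩ d w (max N N')
  refine ⟨n, hkN _ _ acc (D ω) n (le_of_max_le_left hn) (hDT ω)
    (fun m j => ((ω m).2 j).preparable (h3 m j) (hw m j)) (hN' n (le_of_max_le_right hn))
    (fun m hm => hgap m hm.1 n hnS) ?_⟩
  rw [← hb]
  exact ⟨fun h => h.2, fun h => ⟨hnS, h⟩⟩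

theorem ae_separates_both {s : Polynomial ℕ} (hs : GeneratesComplexStates s) {κ : ℝ}
    (hκ : 1 / 2 < κ) (hκ1 : κ < 1) {S : Set ℕ} (hS : S.Infinite) {acc : Access}
    (hacc : ∀ n, acc n n)
    (hgap : ∀ m ∈ S, ∀ n ∈ S, acc n m → (m < n → 2 ^ m ≤ n) ∧ (n < m → 2 ^ n ≤ m)) :
    ∀ᵐ ω ∂(oracleLaw s), Separates acc (oracleOf κ S ω) noInfo (langOf S ω) ∧
      Separates acc (oracleOf κ S ω) (infoOf ω) (langOf S ω) :=
  (ae_separates hs hκ hκ1 hS hacc hgap (D := fun _ => noInfo) (by simp [noInfo])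
    (fun _ _ _ _ => rfl)).and
  (ae_separates hs hκ hκ1 hS hacc hgap (D := infoOf) (fun _ _ => publicInfo_length_le _)
    (fun _ _ m h => congrArg publicInfo h))

/-- Registers, quantum state and public tape of a configuration. -/
abbrev Core : Type := (ℕ → ℕ) × Workspace × List Bool

def Config.core (β : Config) : Core := (β.regs, β.vec, β.tape)

/-- Started with the core `s`, the branching process `R` ends with the ensemble `f`, within `C`
steps and on wires up to `M`. -/
structure Spec (R : Config → List Config) (C M : ℕ) (s : Core) {ι : Type} [Fintype ι]
    (f : ι → Core) : Prop where
  sum : ∀ β : Config, β.core = s → ∀ F : Core → ℂ,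
    ((R β).map fun β' => F β'.core).sum = ∑ x, F (f x)
  bound : ∀ β : Config, β.core = s → ∀ β' ∈ R β,
    (∃ x, β'.core = f x) ∧ β'.time ≤ β.time + C ∧ β'.space ≤ max β.space (M + 1)

section
variable {R R' : Config → List Config} {C C' M : ℕ} {s : Core} {ι κ : Type} [Fintype ι] [Fintype κ]

theorem Spec.bind {f : ι → Core} {g : ι → κ → Core} (h : Spec R C M s f)
    (h' : ∀ x, Spec R' C' M (f x) (g x)) :
    Spec (fun β => (R β).flatMap R') (C + C') M s fun p : ι × κ => g p.1 p.2 where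
  sum β hβ F := by
    let F' : Core → ℂ := fun t => ((R' ⟨t.1, t.2.1, t.2.2, 0, 0⟩).map fun β' => F β'.core).sum
    have h1 : ∀ x, F' (f x) = ∑ y, F (g x y) := fun x => (h' x).sum _ rfl F
    rw [Fintype.sum_prod_type]
    simp only [← h1]
    rw [← h.sum β hβ F', List.map_flatMap, List.flatMap_def, List.sum_flatten, List.map_map]
    congr 1
    refine List.map_congr_left fun β' hβ' => ?_
    obtain ⟨x, hx⟩ := (h.bound β hβ β' hβ').1
    exact ((h' x).sum β' hx F).trans (by rw [hx, h1])
  bound β hβ β' hβ' := by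
    obtain ⟨γ, hγ, hβ'⟩ := List.mem_flatMap.1 hβ'
    obtain ⟨⟨x, hx⟩, h2, h3⟩ := h.bound β hβ γ hγ
    obtain ⟨⟨y, hy⟩, h4, h5⟩ := (h' x).bound γ hx β' hβ'
    exact ⟨⟨(x, y), hy⟩, by omega, by omega⟩

theorem Spec.mono {f : ι → Core} (h : Spec R C M s f) (hC : C ≤ C') : Spec R C' M s f where
  sum := h.sum
  bound β hβ β' hβ' := by
    obtain ⟨h1, h2, h3⟩ := h.bound β hβ β' hβ'
    exact ⟨h1, by omega, h3⟩

theorem Spec.equiv {f : ι → Core} {g : κ → Core} (h : Spec R C M s f) (e : κ ≃ ι)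
    (hg : ∀ y, g y = f (e y)) : Spec R C M s g where
  sum β hβ F := by
    rw [h.sum β hβ F, ← e.sum_comp]
    simp only [hg]
  bound β hβ β' hβ' := by
    obtain ⟨⟨x, hx⟩, h2⟩ := h.bound β hβ β' hβ'
    exact ⟨⟨e.symm x, by rw [hg, e.apply_symm_apply, hx]⟩, h2⟩

theorem Spec.single {F : Config → Config} {s' : Core}
    (h : ∀ β : Config, β.core = s → (F β).core = s' ∧ (F β).time ≤ β.time + C ∧
      (F β).space ≤ max β.space (M + 1)) :
    Spec (fun β => [F β]) C M s fun _ : Unit => s' where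
  sum β hβ G := by simp [(h β hβ).1]
  bound β hβ β' hβ' := by
    rw [List.mem_singleton.1 hβ']
    exact ⟨⟨(), (h β hβ).1⟩, (h β hβ).2⟩

/-- A process that consumes one step before `R`. -/
theorem Spec.tick {f : ι → Core} (h : Spec R C M s f) :
    Spec (fun β => R β.tick) (C + 1) M s f where
  sum β hβ F := h.sum β.tick hβ F
  bound β hβ β' hβ' := by
    obtain ⟨h1, h2, h3⟩ := h.bound β.tick hβ β' hβ'
    simp only [Config.tick] at h2 h3
    exact ⟨h1, by omega, h3⟩

theorem Spec.congr_fun {f : ι → Core} (h : Spec R C M s f)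
    (hR : ∀ β : Config, β.core = s → R' β = R β) : Spec R' C M s f where
  sum β hβ := by rw [hR β hβ]; exact h.sum β hβ
  bound β hβ := by rw [hR β hβ]; exact h.bound β hβ

end

/-- An upper bound, as a polynomial in `M`, for the running time of a program all of whose loop
counts are at most `M`. -/
def Prog.cost : Prog → Polynomial ℕ
  | .seq p q => p.cost + q.cost
  | .ifZero _ p q => p.cost + q.cost + 1
  | .loop _ p => Polynomial.X * p.cost + 1
  | _ => 1

/-- Started with the core `s`, the program ends with the ensemble `f`; all loop counts and wire
numbers are at most `M`. -/
def Prog.Spec (p : Prog) (M : ℕ) (s : Core) {ι : Type} [Fintype ι] (f : ι → Core) : Prop :=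
  ChannelOracles.Spec p.run (p.cost.eval M) M s f

/-- Started with the core `s`, the program ends with the core `s'`. -/
abbrev Prog.Det (p : Prog) (M : ℕ) (s s' : Core) : Prop := p.Spec M s fun _ : Unit => s'

namespace Prog
variable {M : ℕ} {p q : Prog} {s s' : Core} {ι κ : Type} [Fintype ι] [Fintype κ] {R : ℕ → ℕ}
  {v : Workspace} {o : List Bool} {r r' k : ℕ}

theorem Spec.seq {f : ι → Core} {g : ι → κ → Core} (h : p.Spec M s f)
    (h' : ∀ x, q.Spec M (f x) (g x)) : (p.seq q).Spec M s fun y : ι × κ => g y.1 y.2 := by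
  rw [Prog.Spec, cost, Polynomial.eval_add]
  exact h.bind h'

theorem Spec.equiv {f : ι → Core} {g : κ → Core} (h : p.Spec M s f) (e : κ ≃ ι)
    (hg : ∀ y, g y = f (e y)) : p.Spec M s g :=
  ChannelOracles.Spec.equiv h e hg

theorem Spec.det {f : ι → Core} {g : ι → Core} (h : p.Spec M s f)
    (h' : ∀ x, q.Det M (f x) (g x)) : (p.seq q).Spec M s g :=
  (h.seq h').equiv (Equiv.prodPUnit ι).symm fun _ => rfl

theorem Spec.after {f : ι → Core} (h : p.Det M s s') (h' : q.Spec M s' f) :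
    (p.seq q).Spec M s f :=
  (h.seq fun _ => h').equiv (Equiv.punitProd ι).symm fun _ => rfl

theorem Det.seq {s'' : Core} (h : p.Det M s s') (h' : q.Det M s' s'') : (p.seq q).Det M s s'' :=
  Spec.after h h'

/-- The register contents given by a list; all further registers are `0`. -/
def rg (l : List ℕ) : ℕ → ℕ := fun r => l.getD r 0

theorem update_rg {l : List ℕ} (h : r < l.length) :
    Function.update (rg l) r k = rg (l.set r k) := by
  funext i
  rw [Function.update_apply]
  split_ifs with hi
  · simp [rg, hi, h]
  · simp [rg, List.getElem?_set_ne (Ne.symm hi)]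

theorem det_set {l : List ℕ} (hr : r < l.length) :
    (const r k).Det M (rg l, v, o) (rg (l.set r k), v, o) := by
  rw [← update_rg hr]
  refine Spec.single fun β h => ?_
  obtain ⟨h1, h2⟩ := Prod.mk.inj h
  simp [Config.core, Config.set, cost, h1, Prod.mk.inj h2]

theorem det_inc {l : List ℕ} (hr : r < l.length) :
    (inc r).Det M (rg l, v, o) (rg (l.set r (l.getD r 0 + 1)), v, o) := by
  rw [← update_rg hr]
  refine Spec.single fun β h => ?_
  obtain ⟨h1, h2⟩ := Prod.mk.inj h
  simp [Config.core, Config.set, cost, h1, Prod.mk.inj h2, rg]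

theorem det_dec {l : List ℕ} (hr : r < l.length) :
    (dec r).Det M (rg l, v, o) (rg (l.set r (l.getD r 0 - 1)), v, o) := by
  rw [← update_rg hr]
  refine Spec.single fun β h => ?_
  obtain ⟨h1, h2⟩ := Prod.mk.inj h
  simp [Config.core, Config.set, cost, h1, Prod.mk.inj h2, rg]

theorem det_emit : (emit r).Det M (R, v, o) (R, v, o ++ [decide (R r ≠ 0)]) :=
  Spec.single fun β h => by
    obtain ⟨R', v', o', t, w⟩ := β
    cases h
    simp [Config.core, Config.tick, cost]

theorem spec_rand {l : List ℕ} {K : ℕ} (hr : r < l.length) (hk : l.getD k 0 = K) (hK : 0 < K) :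
    (rand r k).Spec M (rg l, v, o) fun x : Fin K =>
      (rg (l.set r x), ((Real.sqrt K : ℝ) : ℂ)⁻¹ • v, o) := by
  simp only [← update_rg hr]
  replace hk : rg l k = K := hk
  generalize rg l = R at hk
  have h1 : max 1 (R k) = K := by omega
  constructor
  · rintro ⟨R', v', o', t, w⟩ h F
    cases h
    simp only [run, h1, List.map_map]
    rw [← sum_range fun x : ℕ =>
      F (Function.update R' r x, ((Real.sqrt K : ℝ) : ℂ)⁻¹ • v', o')]
    rfl
  · rintro ⟨R', v', o', t, w⟩ h β' h'
    cases h
    simp only [run, h1, List.mem_map, List.mem_range] at h'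
    obtain ⟨x, hx, rfl⟩ := h'
    exact ⟨⟨⟨x, hx⟩, rfl⟩, by simp [Config.set, cost], by simp [Config.set]⟩

theorem spec_meas {l : List ℕ} {a : ℕ} (hr : r < l.length) (ha : l.getD a 0 ≤ M) :
    (meas r a).Spec M (rg l, v, o) fun x : Bool =>
      (rg (l.set r x.toNat), proj (fun s => decide (l.getD a 0 ∈ s) = x) v, o) := by
  simp only [← update_rg hr]
  change (meas r a).Spec M (rg l, v, o) fun x : Bool =>
    (Function.update (rg l) r x.toNat, proj (fun s => decide (rg l a ∈ s) = x) v, o)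
  replace ha : rg l a ≤ M := ha
  generalize rg l = R at ha
  constructor
  · rintro ⟨R', v', o', t, w⟩ h F
    cases h
    simp only [run, Fintype.sum_bool, proj_eq_filter, decide_eq_true_eq,
      decide_eq_false_iff_not, List.map_cons, List.map_nil, List.sum_cons, List.sum_nil, add_zero]
    rw [add_comm]
    rfl
  · rintro ⟨R', v', o', t, w⟩ h β' h'
    cases h
    simp only [run, List.mem_cons, List.not_mem_nil, or_false] at h'
    rcases h' with rfl | rfl
    · refine ⟨⟨false, ?_⟩, by simp [Config.set, cost], by dsimp only at ha ⊢; omega⟩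
      simp only [proj_eq_filter, decide_eq_false_iff_not]
      rfl
    · refine ⟨⟨true, ?_⟩, by simp [Config.set, cost], by dsimp only at ha ⊢; omega⟩
      simp only [proj_eq_filter, decide_eq_true_eq]
      rfl

theorem Spec.ifZero_pos {f : ι → Core} (h : p.Spec M (R, v, o) f) (hr : R r = 0) :
    (ifZero r p q).Spec M (R, v, o) f :=
  ChannelOracles.Spec.congr_fun (h.tick.mono (by simp only [cost, Polynomial.eval_add, Polynomial.eval_one]; omega)) fun β hβ => by
    obtain ⟨R', v', o', t, w⟩ := β
    cases hβ
    exact if_pos hr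

theorem Spec.ifZero_neg {f : ι → Core} (h : q.Spec M (R, v, o) f) (hr : R r ≠ 0) :
    (ifZero r p q).Spec M (R, v, o) f :=
  ChannelOracles.Spec.congr_fun (h.tick.mono (by simp only [cost, Polynomial.eval_add, Polynomial.eval_one]; omega)) fun β hβ => by
    obtain ⟨R', v', o', t, w⟩ := β
    cases hβ
    exact if_neg hr

/-- The program for a gate whose wires are the contents of registers. -/
def gate : Gate → Prog
  | .had r => had r
  | .tee r => tee r
  | .cnot r r' => cnot r r'

theorem det_gate {g : Gate} (h : (g.map R).Below (M + 1)) :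
    (gate g).Det M (R, v, o) (R, (g.map R).op v, o) := by
  cases g <;>
  · simp only [Gate.map, Gate.Below] at h
    refine Spec.single fun β hβ => ?_
    obtain ⟨R', v', o', t, w⟩ := β
    cases hβ
    refine ⟨rfl, by simp [Config.gate, cost, gate], ?_⟩
    simp only [Config.gate] at h ⊢
    omega

/-- A program that does nothing. -/
def skip : Prog := (inc 0).seq (dec 0)

theorem det_skip : skip.Det M s s := by
  have h : ∀ R : ℕ → ℕ, Function.update (Function.update R 0 (R 0 + 1)) 0
      (Function.update R 0 (R 0 + 1) 0 - 1) = R := fun R => by simp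
  refine Spec.single (F := fun β => (β.set 0 (β.regs 0 + 1)).set 0
    ((β.set 0 (β.regs 0 + 1)).regs 0 - 1)) fun β hβ => ?_
  obtain ⟨R', v', o', t, w⟩ := β
  cases hβ
  simp [Config.core, Config.set, skip, cost]

/-- The program for a list of gates whose wires are the contents of registers. -/
def gates : List Gate → Prog
  | [] => skip
  | g :: c => (gate g).seq (gates c)

theorem det_gates {c : List Gate} (h : ∀ g ∈ c.map (Gate.map R), g.Below (M + 1)) :
    (gates c).Det M (R, v, o) (R, gatesOp (c.map (Gate.map R)) v, o) := by
  induction c generalizing v with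
  | nil => exact det_skip
  | cons g c ih =>
    exact (det_gate (h _ List.mem_cons_self)).seq
      (ih fun g' hg' => h g' (List.mem_cons_of_mem _ hg'))

/-- Ensembles indexed by sequences of outcomes: from any of at most `K - N` outcomes, the program
produces `N` further ones. -/
def Reps (p : Prog) (M K N : ℕ) (T : List ι → Core) : Prop :=
  ∀ xs : List ι, xs.length + N ≤ K →
    p.Spec M (T xs) fun y : Fin N → ι => T (xs ++ List.ofFn y)

theorem Reps.one {K : ℕ} {T : List ι → Core}
    (h : ∀ xs : List ι, xs.length < K → p.Spec M (T xs) fun x => T (xs ++ [x])) :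
    p.Reps M K 1 T := fun xs hxs =>
  (h xs (by omega)).equiv (Equiv.funUnique (Fin 1) ι) fun y => by simp

theorem Reps.seq {K N N' : ℕ} {T : List ι → Core} (h : p.Reps M K N T) (h' : q.Reps M K N' T) :
    (p.seq q).Reps M K (N + N') T := fun xs hxs =>
  ((h xs (by omega)).seq fun y => h' (xs ++ List.ofFn y) (by simp; omega)).equiv
    (Fin.appendEquiv N N').symm fun y => by
      obtain ⟨y, rfl⟩ := (Fin.appendEquiv N N').surjective y
      simp [Fin.appendEquiv, List.ofFn_fin_append]

theorem Reps.loop {K N k : ℕ} {T : List ι → Core} (h : p.Reps M K N T)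
    (hk : ∀ xs, xs.length + k * N ≤ K → (T xs).1 r = k) (hkM : k ≤ M) : (loop r p).Reps M K (k * N) T := by
  have key : ∀ i ≤ k, ∀ xs : List ι, xs.length + i * N ≤ K →
      ChannelOracles.Spec (fun β => (fun l : List Config => l.flatMap p.run)^[i] [β])
        (i * p.cost.eval M) M (T xs) fun y : Fin (i * N) → ι => T (xs ++ List.ofFn y) := by
    intro i
    induction i with
    | zero =>
      intro _ xs _
      rw [Nat.zero_mul, Nat.zero_mul]
      exact (Spec.single (F := fun β => β) fun β hβ => ⟨hβ, by omega, by omega⟩).equiv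
        (Equiv.equivPUnit (Fin 0 → ι)) fun y => by simp
    | succ i ih =>
      intro hi xs hxs
      rw [Nat.succ_mul] at hxs
      have h1 := (ih (by omega) xs (by omega)).bind fun y => h (xs ++ List.ofFn y) (by simp; omega)
      rw [Nat.succ_mul, Nat.succ_mul]
      refine (h1.congr_fun fun β hβ => ?_).equiv (Fin.appendEquiv (i * N) N).symm fun y => ?_
      · rw [Function.iterate_succ_apply']
      · obtain ⟨y, rfl⟩ := (Fin.appendEquiv (i * N) N).surjective y
        simp [Fin.appendEquiv, List.ofFn_fin_append]
  intro xs hxs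
  refine ((key k le_rfl xs hxs).tick.mono ?_).congr_fun fun β hβ => ?_
  · simp only [cost, Polynomial.eval_add, Polynomial.eval_mul, Polynomial.eval_X,
      Polynomial.eval_one]
    exact Nat.succ_le_succ (Nat.mul_le_mul_right _ hkM)
  · have : β.regs r = k := by rw [← hk xs hxs, ← hβ]; rfl
    simp [run, this]

theorem det_loop (T : ℕ → Core) (hr : (T 0).1 r = k) (hk : k ≤ M)
    (h : ∀ i < k, p.Det M (T i) (T (i + 1))) : (loop r p).Det M (T 0) (T k) := by
  have h1 : p.Reps M k 1 fun xs : List Unit => T xs.length :=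
    .one fun xs hxs => by simpa using h xs.length hxs
  have h2 := h1.loop (r := r) (k := k) (fun xs hxs => by
    rw [List.eq_nil_of_length_eq_zero (by omega : xs.length = 0)]; exact hr) hk [] (by simp)
  exact h2.equiv (Equiv.ofUnique _ _) fun y => by simp

theorem exists_rep (p : Prog) (s : Polynomial ℕ) : ∃ q : Prog, ∀ (n M K : ℕ) (ι : Type)
    (_ : Fintype ι) (T : List ι → Core), (∀ xs, (T xs).1 0 = n) → n ≤ M → p.Reps M K 1 T →
      q.Reps M K (s.eval n) T := by
  have h0 : ∀ (M K : ℕ) (ι : Type) (_ : Fintype ι) (T : List ι → Core), skip.Reps M K 0 T :=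
    fun M K ι _ T xs _ => det_skip.equiv (Equiv.equivPUnit (Fin 0 → ι)) fun y => by simp
  induction s using Polynomial.induction_on with
  | C a =>
    induction a with
    | zero => exact ⟨skip, fun n M K ι _ T _ _ _ => by simpa using h0 M K ι _ T⟩
    | succ a ih =>
      obtain ⟨q, hq⟩ := ih
      exact ⟨q.seq p, fun n M K ι _ T h1 h2 h3 => by
        simpa using (hq n M K ι _ T h1 h2 h3).seq h3⟩
  | add s t hs ht =>
    obtain ⟨q, hq⟩ := hs
    obtain ⟨q', hq'⟩ := ht
    exact ⟨q.seq q', fun n M K ι _ T h1 h2 h3 => by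
      rw [Polynomial.eval_add]
      exact (hq n M K ι _ T h1 h2 h3).seq (hq' n M K ι _ T h1 h2 h3)⟩
  | monomial d a ih =>
    obtain ⟨q, hq⟩ := ih
    exact ⟨loop 0 q, fun n M K ι _ T h1 h2 h3 => by
      rw [pow_succ, ← mul_assoc, Polynomial.eval_mul, Polynomial.eval_X, mul_comm]
      exact (hq n M K ι _ T h1 h2 h3).loop (fun xs _ => h1 xs) h2⟩

theorem Spec.bounded {β : Config} {f : ι → Core} {Q : Polynomial ℕ} {n : ℕ}
    (h : p.Spec (Q.eval n) β.core f) (h1 : β.time = 0) (h2 : β.space = 0) :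
    p.Bounded β ((p.cost.comp Q + Q + 1).eval n) := fun β' hβ' => by
  have := h.bound β rfl β' hβ'
  simp only [Polynomial.eval_add, Polynomial.eval_comp, Polynomial.eval_one]
  omega

/-- Add register `r` to register `t`. -/
def addTo (t r : ℕ) : Prog := loop r (inc t)

theorem det_addTo {l : List ℕ} {t k : ℕ} (ht : t < l.length) (hr : l.getD r 0 = k) (hk : k ≤ M) :
    (addTo t r).Det M (rg l, v, o) (rg (l.set t (l.getD t 0 + k)), v, o) := by
  have h0 : l = l.set t (l.getD t 0 + 0) := by simp [ht]
  have := det_loop (M := M) (p := inc t) (r := r) (k := k)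
    (fun i => (rg (l.set t (l.getD t 0 + i)), v, o)) (by rw [← h0]; exact hr) hk fun i _ => by
      have h2 : t < (l.set t (l.getD t 0 + i)).length := by rwa [List.length_set]
      have h3 := det_inc (M := M) (v := v) (o := o) h2
      rwa [List.set_set, List.getD_eq_getElem _ 0 h2, List.getElem_set_self, add_assoc] at h3
  rwa [← h0] at this

theorem det_gateLoop (L : ℕ → List ℕ) (f : ℕ → List Gate) (hr : (L 0).getD r 0 = k) (hk : k ≤ M)
    (h : ∀ i < k, ∀ v, p.Det M (rg (L i), v, o) (rg (L (i + 1)), gatesOp (f i) v, o)) :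
    (loop r p).Det M (rg (L 0), v, o)
      (rg (L k), gatesOp ((List.range k).flatMap f) v, o) :=
  det_loop (fun i => (rg (L i), gatesOp ((List.range i).flatMap f) v, o)) hr hk fun i hi => by
    rw [List.range_succ, List.flatMap_append, gatesOp_append_apply, List.flatMap_singleton]
    exact h i hi _

end Prog

/-- Read off and reset the wires from `a` on, with outcomes `xs`. -/
def readOff (a : ℕ) (xs : List Bool) : Workspace →ₗ[ℂ] Workspace :=
  ofBasis fun s => if ∀ i < xs.length, decide (a + i ∈ s) = xs.getD i false then
    ket (s \ Ico a (a + xs.length)) else 0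

theorem readOff_nil (a : ℕ) : readOff a [] = LinearMap.id :=
  linearMap_ext_ket fun s => by simp [readOff, ofBasis_ket]

theorem readOff_ofFn (a : ℕ) {n : ℕ} (m : Bits n) : readOff a (List.ofFn m) = pick a m :=
  linearMap_ext_ket fun s => by
    rw [pick_ket, readOff, ofBasis_ket]
    refine if_congr ?_ (by simp [clearAt]) rfl
    rw [readAt_eq, List.length_ofFn]
    constructor
    · intro h i
      have := h i i.2
      simp only [List.getD_eq_getElem?_getD, List.getElem?_ofFn, i.2, dite_true,
        Option.getD_some] at this
      rw [← this, decide_eq_true_eq]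
    · intro h i hi
      have := h ⟨i, hi⟩
      simp only [List.getD_eq_getElem?_getD, List.getElem?_ofFn, hi, dite_true, Option.getD_some]
      rw [Bool.eq_iff_iff, decide_eq_true_eq]
      exact this

theorem readOff_snoc (a : ℕ) (xs : List Bool) (x : Bool) (v : Workspace) :
    gatesOp (if x then xGate (a + xs.length) else [])
      (proj (fun s => decide (a + xs.length ∈ s) = x) (readOff a xs v)) =
      readOff a (xs ++ [x]) v := by
  suffices h : gatesOp (if x then xGate (a + xs.length) else []) ∘ₗ
      (proj (fun s => decide (a + xs.length ∈ s) = x) ∘ₗ readOff a xs) = readOff a (xs ++ [x]) from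
    LinearMap.congr_fun h v
  refine linearMap_ext_ket fun s => ?_
  have hm : a + xs.length ∈ s \ Ico a (a + xs.length) ↔ a + xs.length ∈ s := by simp
  have hall : (∀ i < (xs ++ [x]).length, decide (a + i ∈ s) = (xs ++ [x]).getD i false) ↔
      (∀ i < xs.length, decide (a + i ∈ s) = xs.getD i false) ∧
        decide (a + xs.length ∈ s) = x := by
    rw [List.length_append, List.length_singleton, Nat.forall_lt_succ_right]
    refine and_congr (forall₂_congr fun i hi => ?_) ?_
    · rw [List.getD_append _ _ _ _ hi]
    · rw [List.getD_append_right _ _ _ _ le_rfl]; simp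
  have hset : s \ Ico a (a + (xs ++ [x]).length) =
      (s \ Ico a (a + xs.length)).erase (a + xs.length) := by
    ext u
    simp only [List.length_append, List.length_singleton, mem_sdiff, mem_Ico, mem_erase]
    by_cases hu : u ∈ s <;> simp only [hu, true_and, false_and, and_false]
    omega
  simp only [LinearMap.comp_apply, readOff, ofBasis_ket, hall, hset]
  by_cases h1 : ∀ i < xs.length, decide (a + i ∈ s) = xs.getD i false
  · rw [if_pos h1, proj, ofBasis_ket]
    simp only [hm]
    by_cases h2 : decide (a + xs.length ∈ s) = x
    · have hc := And.intro h1 h2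
      rw [if_pos h2, if_pos hc]
      cases x
      · rw [erase_eq_of_notMem (by rw [hm]; simpa using h2)]
        rfl
      · rw [if_pos rfl, xGate_ket]
        congr 1
        have h3 := hm.2 (by simpa using h2)
        ext u
        simp only [mem_symmDiff, mem_singleton, mem_erase]
        constructor
        · rintro (⟨h4, h5⟩ | ⟨rfl, h5⟩)
          · exact ⟨h5, h4⟩
          · exact absurd h3 h5
        · exact fun h => Or.inl ⟨h.2, h.1⟩
    · have hc : ¬((∀ i < xs.length, decide (a + i ∈ s) = xs.getD i false) ∧
        decide (a + xs.length ∈ s) = x) := fun h => h2 h.2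
      rw [if_neg h2, if_neg hc, map_zero]
  · have hc : ¬((∀ i < xs.length, decide (a + i ∈ s) = xs.getD i false) ∧
        decide (a + xs.length ∈ s) = x) := fun h => h1 h.1
    rw [if_neg h1, if_neg hc, map_zero, map_zero]

namespace Prog
variable {M : ℕ} {v : Workspace} {o : List Bool} {r : ℕ} {n D : ℕ}

/-- Measure the wire with number `a`, keep the outcome in register `r` and reset the wire. -/
def measReset (r a : ℕ) : Prog := (meas r a).seq (ifZero r skip (gates (xGate a)))

theorem xGate_map (r : ℕ) (f : ℕ → ℕ) : (xGate r).map (Gate.map f) = xGate (f r) := rfl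

theorem spec_measReset {l : List ℕ} {a w : ℕ} {xs : List Bool} (hr : r < l.length) (hra : a ≠ r)
    (ha : l.getD a 0 = w + xs.length) (hw : w + xs.length ≤ M) :
    (measReset r a).Spec M (rg l, readOff w xs v, o) fun x : Bool =>
      (rg (l.set r x.toNat), readOff w (xs ++ [x]) v, o) := by
  refine (spec_meas hr (ha.trans_le hw)).det fun x => ?_
  have h1 : rg (l.set r x.toNat) r = x.toNat := by simp [rg, hr]
  have h2 : rg (l.set r x.toNat) a = w + xs.length := by
    rw [← ha, ← update_rg hr, Function.update_of_ne hra, rg]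
  rw [ha, ← readOff_snoc]
  cases x
  · exact Spec.ifZero_pos det_skip h1
  · refine Spec.ifZero_neg ?_ (h1.trans_ne one_ne_zero)
    rw [if_pos rfl, ← h2, ← xGate_map]
    refine det_gates ?_
    rw [xGate_map, h2]
    exact xGate_below (Nat.lt_succ_of_le hw)

/-- Announce register `r` in unary notation; registers `2` and `12` hold `1` and `0`. -/
def emitUnary (r : ℕ) : Prog := (loop r (emit 2)).seq (emit 12)

theorem det_emitUnary {l : List ℕ} {k : ℕ} (h2 : l.getD 2 0 = 1) (h12 : l.getD 12 0 = 0)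
    (hr : l.getD r 0 = k) (hk : k ≤ M) : (emitUnary r).Det M (rg l, v, o)
      (rg l, v, o ++ (List.replicate k true ++ [false])) := by
  have h := det_loop (M := M) (p := emit 2) (r := r) (k := k)
    (fun i => (rg l, v, o ++ List.replicate i true)) hr hk fun i _ => by
      have h3 := det_emit (M := M) (R := rg l) (v := v) (o := o ++ List.replicate i true) (r := 2)
      rwa [show rg l 2 = 1 from h2, List.append_assoc,
        show [decide (1 ≠ 0)] = List.replicate 1 true from rfl, List.replicate_append_replicate] at h3
  have h3 := det_emit (M := M) (R := rg l) (v := v) (o := o ++ List.replicate k true) (r := 12)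
  rw [show rg l 12 = 0 from h12, List.append_assoc] at h3
  rw [List.replicate_zero, List.append_nil] at h
  exact Det.seq h h3

/-- Apply the gate of the kind in register `7` to the wires in registers `10` and `11`. -/
def kindGate : Prog :=
  (ifZero 7 (gates [.had 10]) ((dec 7).seq (ifZero 7 (gates [.tee 10]) (gates [.cnot 10 11])))).seq
    (const 7 0)

theorem det_kindGate {N B a b a' b' : ℕ} (x : Fin 3) (ha : a' ≤ M) (hb : b' ≤ M) :
    kindGate.Det M (rg [n, 0, 1, 3, N, B, D, x, a, b, a', b', 0], v, o)
      (rg [n, 0, 1, 3, N, B, D, 0, a, b, a', b', 0],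
        (if x = 0 then Gate.had a' else if x = 1 then .tee a' else .cnot a' b').op v, o) := by
  fin_cases x
  · refine Det.seq (Spec.ifZero_pos (det_gates ?_) rfl) (det_set (by simp))
    simpa [Gate.map, Gate.Below, rg, Nat.lt_succ_iff] using ha
  · refine Det.seq (Spec.ifZero_neg (Det.seq (det_dec (by simp))
      (Spec.ifZero_pos (det_gates ?_) rfl)) one_ne_zero) (det_set (by simp))
    simpa [Gate.map, Gate.Below, rg, Nat.lt_succ_iff] using ha
  · refine Det.seq (Spec.ifZero_neg (Det.seq (det_dec (by simp))
      (Spec.ifZero_neg (det_gates ?_) one_ne_zero)) two_ne_zero) (det_set (by simp))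
    simpa [Gate.map, Gate.Below, rg, Nat.lt_succ_iff] using ⟨ha, hb⟩

/-- The registers of the generator between two rounds: constants, and the next free wire `D`. -/
def genRegs (n D : ℕ) : List ℕ := [n, 0, 1, 3, 2 * n, n * n, D, 0, 0, 0, 0, 0, 0]

/-- Choose, announce and apply a random gate. -/
def choice : Prog :=
  (rand 7 3).seq <| (rand 8 4).seq <| (rand 9 4).seq <|
    (emitUnary 7).seq <| (emitUnary 8).seq <| (emitUnary 9).seq <|
    (addTo 10 8).seq <| (addTo 10 5).seq <| (addTo 11 9).seq <| (addTo 11 5).seq <|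
    kindGate.seq <| (const 8 0).seq <| (const 9 0).seq <| (const 10 0).seq (const 11 0)

/-- The amplitude of one random gate. -/
def choiceAmp (n : ℕ) : ℂ :=
  ((Real.sqrt (2 * n : ℕ) : ℝ) : ℂ)⁻¹ * (((Real.sqrt (2 * n : ℕ) : ℝ) : ℂ)⁻¹ *
    ((Real.sqrt (3 : ℕ) : ℝ) : ℂ)⁻¹)

theorem spec_choice (hn : 0 < n) (hM : n * n + 2 * n + 3 ≤ M) :
    choice.Spec M (rg (genRegs n D), v, o) fun x : GateChoice n =>
      (rg (genRegs n D), choiceAmp n • (x.toGate.map (· + n * n)).op v, o ++ encodeChoice x) := by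
  have h2n : 2 * n ≤ M := by omega
  refine Spec.equiv ((spec_rand (l := [n, 0, 1, 3, 2 * n, n * n, D, 0, 0, 0, 0, 0, 0]) (r := 7)
    (k := 3) (K := 3) (by simp) rfl (by norm_num)).seq fun k =>
    (spec_rand (l := [n, 0, 1, 3, 2 * n, n * n, D, k, 0, 0, 0, 0, 0]) (r := 8) (k := 4) (K := 2 * n)
      (by simp) rfl (by omega)).seq fun a =>
    (spec_rand (l := [n, 0, 1, 3, 2 * n, n * n, D, k, a, 0, 0, 0, 0]) (r := 9) (k := 4) (K := 2 * n)
      (by simp) rfl (by omega)).det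
      (g := fun b => (rg (genRegs n D), choiceAmp n • (GateChoice.toGate (k, a, b) |>.map
        (· + n * n)).op v, o ++ encodeChoice (k, a, b))) fun b => ?_)
    (Equiv.refl (GateChoice n)) fun _ => rfl
  have hk : (k : ℕ) ≤ M := by omega
  have ha : (a : ℕ) ≤ M := by omega
  have hb : (b : ℕ) ≤ M := by omega
  have hB : n * n ≤ M := by omega
  have key : ∀ v : Workspace, ∀ o : List Bool, Det _ M
      (rg [n, 0, 1, 3, 2 * n, n * n, D, k, a, b, 0, 0, 0], v, o) _ := fun v o =>
    (det_emitUnary (r := 7) rfl rfl rfl hk).seq <|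
    (det_emitUnary (r := 8) rfl rfl rfl ha).seq <|
    (det_emitUnary (r := 9) rfl rfl rfl hb).seq <|
    (det_addTo (t := 10) (r := 8) (by simp) rfl ha).seq <|
    (det_addTo (t := 10) (r := 5) (by simp) rfl hB).seq <|
    (det_addTo (t := 11) (r := 9) (by simp) rfl hb).seq <|
    (det_addTo (t := 11) (r := 5) (by simp) rfl hB).seq <|
    (det_kindGate k (a' := 0 + a + n * n) (b' := 0 + b + n * n) (by omega) (by omega)).seq <|
    (det_set (r := 8) (k := 0) (by simp)).seq <| (det_set (r := 9) (k := 0) (by simp)).seq <|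
    (det_set (r := 10) (k := 0) (by simp)).seq (det_set (r := 11) (k := 0) (by simp))
  refine (key _ _).equiv (Equiv.refl _) fun _ => ?_
  refine Prod.ext rfl (Prod.ext ?_ ?_)
  · simp only [map_smul, smul_smul, choiceAmp, GateChoice.toGate, zero_add]
    congr 2
    split_ifs <;> rfl
  · simp [encodeChoice]

end Prog

theorem GateChoice.toGate_below {n : ℕ} (x : GateChoice n) : x.toGate.Below (2 * n) := by
  rw [toGate]
  split_ifs <;> simp [Gate.Below]

/-- The circuit, run on the wires from `B` on, the measurement of its first `n` output wires, and
the transport of the other ones to the wires from `D` on. -/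
theorem moveBlock_pick_circuit {s : Polynomial ℕ} {n D B : ℕ} (hD : D + n ≤ B) (d : Descr s n)
    {v : Workspace} (hv : v ∈ low D) :
    gatesOp (moveBlock (B + n) D n) (pick B d.2
      (gatesOp ((List.ofFn d.1).map fun x => x.toGate.map (· + B)) v)) =
      loadOp D d.branch v := by
  have hc : ∀ g ∈ List.ofFn fun t => (d.1 t).toGate, g.Below (2 * n) := by
    intro g hg
    obtain ⟨t, rfl⟩ := List.mem_ofFn.1 hg
    exact GateChoice.toGate_below _
  have e : (List.ofFn d.1).map (fun x => x.toGate.map (· + B)) =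
      (List.ofFn fun t => (d.1 t).toGate).map (Gate.map (· + B)) := by
    simp [List.map_ofFn, Function.comp_def]
  suffices h : ∀ u ⊆ range D, (gatesOp (moveBlock (B + n) D n) ∘ₗ pick B d.2 ∘ₗ
      gatesOp ((List.ofFn d.1).map fun x => x.toGate.map (· + B))) (ket u) =
      loadOp D d.branch (ket u) from eq_on_low h hv
  intro u hu
  have hu' : ∀ w ∈ u, w < D := fun w hw => mem_range.1 (hu hw)
  have h1 : ∀ x y : Bits n, pick B d.2 (ket (u ∪ (place B x ∪ place (B + n) y))) =
      if x = d.2 then ket (place (B + n) y ∪ u) else 0 := by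
    intro x y
    have hw : ∀ w ∈ place (B + n) y ∪ u, w < B ∨ B + n ≤ w := by
      intro w hw
      rcases mem_union.1 hw with hw | hw
      · obtain ⟨h, _⟩ := mem_place_iff.1 hw; omega
      · have := hu' w hw; omega
    rw [show u ∪ (place B x ∪ place (B + n) y) = place B x ∪ (place (B + n) y ∪ u) by ac_rfl,
      pick_ket, readAt_place_union hw, clearAt_place_union hw]
  have h2 : ∀ y : Bits n, gatesOp (moveBlock (B + n) D n) (ket (place (B + n) y ∪ u)) =
      ket (place D y ∪ u) := by
    intro y
    have hw : ∀ w ∈ u, w < B + n ∨ B + n + n ≤ w := fun w hw => by have := hu' w hw; omega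
    rw [moveBlock_ket (by omega), readAt_place_union hw, clearAt_place_union hw, union_comm]
    intro w hw
    rcases mem_union.1 hw with hw | hw
    · obtain ⟨h, _⟩ := mem_place_iff.1 hw; omega
    · exact Or.inl (hu' w hw)
  simp only [LinearMap.comp_apply, e]
  rw [gatesOp_shift_ket hc fun w hw => by have := hu' w hw; omega]
  simp only [map_sum, map_smul, h1, loadOp_apply, attach_ket]
  rw [Fintype.sum_eq_single d.2 fun x hx => by simp [hx]]
  simp only [if_true, h2]
  refine sum_congr rfl fun y _ => ?_
  rw [← runGates_eq]
  rfl

namespace Prog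
variable {M : ℕ} {v : Workspace} {o : List Bool} {n D : ℕ}

/-- Measure and announce the first `n` output wires. -/
def measureRound : Prog := (addTo 10 5).seq
  (loop 0 ((measReset 7 10).seq ((emit 7).seq ((const 7 0).seq (inc 10)))))

theorem spec_measureRound (hM : n * n + 2 * n + 3 ≤ M) :
    measureRound.Spec M (rg (genRegs n D), v, o) fun m : Bits n =>
      (rg [n, 0, 1, 3, 2 * n, n * n, D, 0, 0, 0, n * n + n, 0, 0], pick (n * n) m v,
        o ++ List.ofFn m) := by
  let T : List Bool → Core := fun xs =>
    (rg [n, 0, 1, 3, 2 * n, n * n, D, 0, 0, 0, n * n + xs.length, 0, 0], readOff (n * n) xs v,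
      o ++ xs)
  have hT : T [] = (rg ((genRegs n D).set 10 ((genRegs n D).getD 10 0 + n * n)), v, o) := by
    simp [T, genRegs, readOff_nil]
  have h1 : ((measReset 7 10).seq ((emit 7).seq ((const 7 0).seq (inc 10)))).Reps M n 1 T := by
    refine .one fun xs hxs => ?_
    refine (spec_measReset (l := [n, 0, 1, 3, 2 * n, n * n, D, 0, 0, 0, n * n + xs.length, 0, 0])
      (a := 10) (r := 7) (by simp) (by norm_num) rfl (by omega)).det fun x => ?_
    refine Det.seq (det_emit (r := 7)) ((Det.seq (det_set (r := 7) (by simp))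
      (det_inc (r := 10) (by simp))).equiv (Equiv.refl _) fun _ => ?_)
    refine Prod.ext ?_ (Prod.ext rfl ?_)
    · simp [T, add_assoc]
    · cases x <;> simp [T, rg]
  have h2 := h1.loop (r := 0) (k := n) (fun _ _ => rfl) (by omega) [] (by simp)
  rw [mul_one, hT] at h2
  exact (Spec.after (det_addTo (k := n * n) (by simp [genRegs]) rfl (by omega)) h2).equiv (Equiv.refl _)
    fun m => by simp [T, readOff_ofFn]

/-- Transport the other output wires to the free wires. -/
def moveRound : Prog :=
  (loop 0 ((gates [.cnot 10 6, .cnot 6 10]).seq ((inc 10).seq (inc 6)))).seq (const 10 0)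

theorem det_moveRound (hM : n * n + 2 * n + 3 ≤ M) (hD : D + n ≤ n * n) :
    moveRound.Det M (rg [n, 0, 1, 3, 2 * n, n * n, D, 0, 0, 0, n * n + n, 0, 0], v, o)
      (rg (genRegs n (D + n)), gatesOp (moveBlock (n * n + n) D n) v, o) := by
  refine Det.seq (det_gateLoop (k := n) (fun i => [n, 0, 1, 3, 2 * n, n * n, D + i, 0, 0, 0,
    n * n + n + i, 0, 0]) (fun i => [.cnot (n * n + n + i) (D + i), .cnot (D + i) (n * n + n + i)])
    rfl (by omega) fun i hi v => ?_) (det_set (by simp))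
  refine Det.seq (det_gates ?_) (Det.seq (det_inc (by simp)) (det_inc (by simp)))
  have h1 : D + i ≤ M := by omega
  have h2 : n * n + n + i ≤ M := by omega
  simp [Gate.map, Gate.Below, rg, Nat.lt_succ_iff, h1, h2]

theorem exists_round (s : Polynomial ℕ) : ∃ p : Prog, ∀ (n M D : ℕ) (v : Workspace)
    (o : List Bool), 0 < n → n * n + 2 * n + 3 ≤ M → D + n ≤ n * n → v ∈ low D →
    p.Spec M (rg (genRegs n D), v, o) fun d : Descr s n =>
      (rg (genRegs n (D + n)), choiceAmp n ^ s.eval n • loadOp D d.branch v,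
        o ++ encodeDescr d) := by
  obtain ⟨q, hq⟩ := exists_rep choice s
  refine ⟨q.seq (measureRound.seq moveRound), fun n M D v o hn hM hD hv => ?_⟩
  let T : List (GateChoice n) → Core := fun xs =>
    (rg (genRegs n D), choiceAmp n ^ xs.length •
      gatesOp (xs.map fun x => x.toGate.map (· + n * n)) v, o ++ xs.flatMap encodeChoice)
  have h1 : choice.Reps M (s.eval n) 1 T := .one fun xs _ => by
    refine (spec_choice hn hM).equiv (Equiv.refl _) fun x => ?_
    simp [T, gatesOp_append, smul_smul, pow_succ', gatesOp]
  have h2 := hq n M _ _ _ T (fun _ => rfl) (by omega) h1 [] (by simp)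
  have h3 : T [] = (rg (genRegs n D), v, o) := by simp [T, gatesOp]
  rw [h3] at h2
  refine (h2.seq fun c => (spec_measureRound hM).det fun m => det_moveRound hM hD).equiv
    (Equiv.refl _) fun d => ?_
  refine Prod.ext rfl (Prod.ext ?_ ?_)
  · rw [← moveBlock_pick_circuit hD d hv]
    simp [T]
  · simp [T, encodeDescr]

end Prog

theorem loadSlots_ket_empty {n : ℕ} (ψ : Fin n → PureState n) :
    loadSlots 0 n ψ (ket ∅) = loadAt 0 (jointState ψ) := by
  rw [loadSlots_eq, loadAt, ← (flatEquiv n).sum_comp]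
  refine sum_congr rfl fun y _ => ?_
  rw [biUnion_place, attach_ket, union_empty]
  simp [jointState]

theorem Descr.branch_eq {s : Polynomial ℕ} {n : ℕ} (d : Descr s n) :
    d.branch = ((Real.sqrt d.weight : ℝ) : ℂ) • d.state.1 := by
  funext y
  rw [Pi.smul_apply, smul_eq_mul]
  by_cases h : d.weight = 0
  · have h1 := (sum_eq_zero_iff_of_nonneg fun y _ => Complex.normSq_nonneg _).1 h y (mem_univ y)
    rw [h, Complex.normSq_eq_zero.1 h1]
    simp
  · rw [state, dif_neg (show ¬ ∑ y, Complex.normSq (d.branch y) = 0 from h)]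
    refine (mul_div_cancel₀ _ ?_).symm
    rw [Complex.ofReal_ne_zero]
    exact (Real.sqrt_pos.2 (d.weight_nonneg.lt_of_ne' h)).ne'

theorem loadOp_smul {Y k : ℕ} (z : ℂ) (φ : Bits k → ℂ) : loadOp Y (z • φ) = z • loadOp Y φ := by
  simp [loadOp, smul_sum, smul_smul]

/-- The quantum state after the marked states with the descriptions `ds`, the last one first, have
been generated. -/
def generated {s : Polynomial ℕ} {n : ℕ} : List (Descr s n) → Workspace
  | [] => ket ∅
  | d :: ds => Prog.choiceAmp n ^ s.eval n • loadOp (n * ds.length) d.branch (generated ds)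

theorem generated_low {s : Polynomial ℕ} {n : ℕ} (ds : List (Descr s n)) :
    generated ds ∈ low (n * ds.length) := by
  induction ds with
  | nil => exact ket_mem_low (by simp)
  | cons d ds ih =>
    rw [generated, List.length_cons, Nat.mul_succ]
    exact Submodule.smul_mem _ _ (loadOp_low le_rfl _ (low_mono (Nat.le_add_right _ _) ih))

/-- The amplitude of a description. -/
def Descr.amp {s : Polynomial ℕ} {n : ℕ} (d : Descr s n) : ℂ :=
  Prog.choiceAmp n ^ s.eval n * ((Real.sqrt d.weight : ℝ) : ℂ)

theorem Descr.amp_mul_conj {s : Polynomial ℕ} {n : ℕ} (d : Descr s n) :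
    d.amp * (starRingEnd ℂ) d.amp = d.prob := by
  rw [Complex.mul_conj, amp, map_mul, map_pow, Complex.normSq_ofReal,
    Real.mul_self_sqrt d.weight_nonneg, prob]
  congr 2
  simp only [Prog.choiceAmp, map_mul, map_inv₀, Complex.normSq_ofReal,
    Real.mul_self_sqrt (Nat.cast_nonneg _), Fintype.card_fun, Fintype.card_prod, Fintype.card_fin]
  push_cast
  rw [← inv_pow]
  congr 1
  simp only [mul_inv]
  ring

theorem generated_ofFn {s : Polynomial ℕ} {n i : ℕ} (f : Fin i → Descr s n) :
    generated (List.ofFn f).reverse =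
      (∏ j, (f j).amp) • loadSlots 0 i (fun j => (f j).state) (ket ∅) := by
  induction i with
  | zero => simp [generated, loadSlots]
  | succ i ih =>
    rw [List.ofFn_succ', List.concat_eq_append, List.reverse_append, List.reverse_singleton,
      List.singleton_append, generated, ih, loadSlots, List.length_reverse, List.length_ofFn,
      Descr.branch_eq, loadOp_smul, Fin.prod_univ_castSucc, zero_add]
    simp only [map_smul, LinearMap.smul_apply, smul_smul, Descr.amp]
    congr 1
    ring

namespace Prog

theorem startConfig_regs (n b k : ℕ) (v : Workspace) :
    (startConfig n b v).regs = rg (n :: b :: List.replicate k 0) := by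
  funext r
  match r with
  | 0 => rfl
  | 1 => rfl
  | r + 2 =>
    simp only [startConfig, rg, List.getElem?_cons_succ, List.getD_eq_getElem?_getD,
      List.getElem?_replicate]
    split_ifs <;> simp_all

/-- Set up the constants of the generator. -/
def genInit : Prog := (const 2 1).seq <| (const 3 3).seq <| (addTo 4 0).seq <| (addTo 4 0).seq <|
  loop 0 (addTo 5 0)

theorem det_genInit {M n : ℕ} {v : Workspace} {o : List Bool} (hM : n ≤ M) :
    genInit.Det M (rg (n :: 0 :: List.replicate 11 0), v, o) (rg (genRegs n 0), v, o) := by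
  have h := det_loop (M := M) (p := addTo 5 0) (r := 0) (k := n) (fun i =>
    (rg [n, 0, 1, 3, 2 * n, n * i, 0, 0, 0, 0, 0, 0, 0], v, o)) rfl hM fun i _ =>
      det_addTo (k := n) (by simp) rfl hM
  refine (det_set (by simp)).seq ((det_set (by simp)).seq ((det_addTo (k := n) (by simp) rfl
    hM).seq (Det.seq (s' := (rg [n, 0, 1, 3, 2 * n, n * 0, 0, 0, 0, 0, 0, 0, 0], v, o)) ?_ h)))
  refine (det_addTo (k := n) (by simp) rfl hM).equiv (Equiv.refl _) fun _ => ?_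
  simp [two_mul]

/-- Choose the private bit and clear the registers. -/
def genFinal : Prog := (const 3 2).seq <| (rand 1 3).seq <| (const 2 0).seq <| (const 3 0).seq <|
  (const 4 0).seq <| (const 5 0).seq (const 6 0)

theorem spec_genFinal {M n D : ℕ} {v : Workspace} {o : List Bool} :
    genFinal.Spec M (rg (genRegs n D), v, o) fun b : Fin 2 =>
      (rg (n :: b :: List.replicate 11 0), ((Real.sqrt (2 : ℕ) : ℝ) : ℂ)⁻¹ • v, o) := by
  refine Spec.after (det_set (by simp [genRegs])) ((spec_rand (K := 2) (r := 1) (k := 3)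
    (l := [n, 0, 1, 2, 2 * n, n * n, D, 0, 0, 0, 0, 0, 0]) (by simp) rfl two_pos).det fun b => ?_)
  exact (det_set (by simp)).seq ((det_set (by simp)).seq ((det_set (by simp)).seq
    ((det_set (by simp)).seq (det_set (by simp)))))

theorem exists_generator (s : Polynomial ℕ) :
    ∃ (G : Prog) (T : Polynomial ℕ), GeneratesInstances s G T := by
  obtain ⟨p, hp⟩ := exists_round s
  let Q : Polynomial ℕ := Polynomial.X * Polynomial.X + 2 * Polynomial.X + 3
  have hQ : ∀ n, Q.eval n = n * n + 2 * n + 3 := fun n => by simp [Q]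
  let G := genInit.seq ((loop 0 p).seq genFinal)
  refine ⟨G, G.cost.comp Q + Q + 1, fun n => ?_⟩
  let f : Sample s n → Core := fun x => (rg (n :: x.1.toNat :: List.replicate 11 0),
    (((Real.sqrt (2 : ℕ) : ℝ) : ℂ)⁻¹ * ∏ j, (x.2 j).amp) •
      loadAt 0 (jointState fun j => (x.2 j).state), publicInfo x.2)
  have h : G.Spec (Q.eval n) (startConfig n 0 (ket ∅)).core f := by
    let T : List (Descr s n) → Core := fun ds =>
      (rg (genRegs n (n * ds.length)), generated ds.reverse, ds.flatMap encodeDescr)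
    have h1 : p.Reps (Q.eval n) n 1 T := .one fun xs hxs => by
      refine (hp n _ (n * xs.length) _ _ (by omega) (hQ n).ge ?_ (by
        simpa using generated_low xs.reverse)).equiv (Equiv.refl _) fun d => ?_
      · rw [← Nat.mul_succ]
        exact Nat.mul_le_mul_left _ hxs
      · simp [T, generated, Nat.mul_succ]
    have h2 := h1.loop (r := 0) (k := n) (fun _ _ => rfl) (by rw [hQ]; omega) [] (by simp)
    rw [mul_one] at h2
    have h3 := Spec.after (det_genInit (v := ket ∅) (o := []) (n := n) (M := Q.eval n)
      (by rw [hQ]; omega)) (h2.seq fun y => spec_genFinal)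
    rw [Config.core, startConfig_regs n 0 11]
    refine h3.equiv ((Equiv.prodComm _ _).trans
      (Equiv.prodCongr (Equiv.refl _) finTwoEquiv.symm)) fun x => ?_
    refine Prod.ext ?_ (Prod.ext ?_ ?_)
    · rcases x with ⟨_ | _, d⟩ <;> rfl
    · simp [f, T, generated_ofFn, loadSlots_ket_empty, smul_smul]
    · simp [f, T, publicInfo]
  refine ⟨h.bounded rfl rfl, fun R o u u' => ?_⟩
  classical
  refine (h.sum _ rfl fun c => if c.1 = R ∧ c.2.2 = o then c.2.1 u * (starRingEnd ℂ) (c.2.1 u')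
    else 0).trans (sum_congr rfl fun x _ => ?_)
  have hamp : (x.prob : ℂ) = (((Real.sqrt (2 : ℕ) : ℝ) : ℂ)⁻¹ * ∏ j, (x.2 j).amp) *
      (starRingEnd ℂ) (((Real.sqrt (2 : ℕ) : ℝ) : ℂ)⁻¹ * ∏ j, (x.2 j).amp) := by
    rw [map_mul, map_prod, mul_mul_mul_comm, ← prod_mul_distrib, Complex.mul_conj,
      map_inv₀, Complex.normSq_ofReal, Real.mul_self_sqrt (Nat.cast_nonneg _), Sample.prob]
    simp [Descr.amp_mul_conj]
  simp only [f, startConfig_regs n _ 11, eq_comm (a := R), eq_comm (a := o), hamp,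
    Finsupp.smul_apply, smul_eq_mul, map_mul]
  split_ifs
  · ring
  · rfl

end Prog

theorem place_succ_union {m Y : ℕ} (z : Bits (m * m + 1)) (x : Bits (m * m)) :
    place (m * m) z ∪ place Y x = cfgSet (m * m) m Y ∅ (fun i => z i.castSucc)
      (z (Fin.last _)) x (fun _ => false) (fun _ => false) := by
  have hz : z = Fin.snoc (α := fun _ => Bool) (fun i => z i.castSucc) (z (Fin.last _)) :=
    (Fin.snoc_init_self z).symm
  conv_lhs => rw [hz, place_snoc]
  ext u
  rw [mem_cfgSet, place_false, place_false]
  cases z (Fin.last _) <;> simp [or_assoc, or_left_comm]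

theorem gatesOp_test_input {m : ℕ} (ψ : Fin m → PureState m) (v : Bits (m * m + 1) → ℂ) :
    gatesOp (testGates (m * m) m (2 * (m * m) + 1)) (gatesOp (moveBlock 0 (2 * (m * m) + 1) (m * m))
      (∑ x : Bits (m * m), ∑ z : Bits (m * m + 1),
        (jointState ψ x * v z) • ket (place 0 x ∪ place (m * m) z))) =
    ∑ z, v z • ∑ e : Bits m × (Fin m → Bits m) × (Fin m → Bits m),
      (∏ j, swapAmp (ψ j).1 (e.1 j) (e.2.1 j) (e.2.2 j) (block (fun i => z i.castSucc) j)) •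
        ket (cfgSet (m * m) m (2 * (m * m) + 1) ∅ (flatEquiv m e.2.1) (z (Fin.last _))
          (flatEquiv m e.2.2) (fun j => !e.1 j) (fun _ => false)) := by
  have haY : m * m + m * m < 2 * (m * m) + 1 := by omega
  have hout : Outside (m * m) m (2 * (m * m) + 1) ∅ := fun u hu => absurd hu (notMem_empty u)
  have hmove : ∀ (x : Bits (m * m)) (z : Bits (m * m + 1)),
      gatesOp (moveBlock 0 (2 * (m * m) + 1) (m * m)) (ket (place 0 x ∪ place (m * m) z)) =
        ket (place (m * m) z ∪ place (2 * (m * m) + 1) x) := by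
    intro x z
    have hz : ∀ u ∈ place (m * m) z, u < 0 ∨ 0 + m * m ≤ u := fun u hu => by
      obtain ⟨h, _⟩ := mem_place_iff.1 hu; omega
    rw [moveBlock_ket (by omega), readAt_place_union hz, clearAt_place_union hz]
    intro u hu
    rcases mem_union.1 hu with hu | hu <;> obtain ⟨h, _⟩ := mem_place_iff.1 hu <;> omega
  rw [sum_comm]
  simp only [map_sum, map_smul, hmove, mul_comm _ (v _), ← smul_smul, ← smul_sum]
  refine sum_congr rfl fun z _ => ?_
  congr 1
  rw [← (flatEquiv m).sum_comp, ← sum_testGates ψ (block fun i => z i.castSucc) fun x y t =>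
    ket (cfgSet (m * m) m (2 * (m * m) + 1) ∅ (flatEquiv m x) (z (Fin.last _))
      (flatEquiv m y) t (fun _ => false))]
  refine sum_congr rfl fun y _ => ?_
  rw [← testGates_ket haY hout, show flatEquiv m (block fun i => z i.castSucc) =
    (fun i => z i.castSucc) from (flatEquiv m).right_inv fun i => z i.castSucc, place_succ_union]
  simp only [jointState, block_flatEquiv]

/-- The discarded registers after the swap tests. -/
def discarded {m : ℕ} (i : (Fin m → Bits m) × (Fin m → Bits m)) : Finset ℕ :=
  place (m * m) (flatEquiv m i.1) ∪ place (2 * (m * m) + 1) (flatEquiv m i.2)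

theorem output_test {m : ℕ} (κ : ℝ) (b : Bool) (ψ : Fin m → PureState m)
    (v : Bits (m * m + 1) → ℂ) (t : Bits m) :
    open scoped Classical in
    gatesOp (if b && decide (κ * m ≤ ((univ.filter fun j => t j = false).card : ℝ))
        then xGate (2 * (m * m)) else [])
      (pick (2 * (m * m) + 1 + m * m) t (∑ z, v z •
        ∑ e : Bits m × (Fin m → Bits m) × (Fin m → Bits m),
          (∏ j, swapAmp (ψ j).1 (e.1 j) (e.2.1 j) (e.2.2 j) (block (fun i => z i.castSucc) j)) •
            ket (cfgSet (m * m) m (2 * (m * m) + 1) ∅ (flatEquiv m e.2.1) (z (Fin.last _))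
              (flatEquiv m e.2.2) (fun j => !e.1 j) (fun _ => false)))) =
      ∑ i, ∑ y : Bits 1, (swapKraus κ b ψ (fun j => !t j, i)).mulVec v y •
        ket (discarded i ∪ place (2 * (m * m)) y) := by
  classical
  have haY : m * m + m * m < 2 * (m * m) + 1 := by omega
  have hout : Outside (m * m) m (2 * (m * m) + 1) ∅ := fun u hu => absurd hu (notMem_empty u)
  have hcfg : ∀ (x y : Fin m → Bits m) (l : Bool), cfgSet (m * m) m (2 * (m * m) + 1) ∅
      (flatEquiv m x) l (flatEquiv m y) (fun _ => false) (fun _ => false) =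
      discarded (x, y) ∪ place (2 * (m * m)) fun _ : Fin 1 => l := by
    intro x y l
    rw [cfgSet, place_false, place_false, discarded, two_mul]
    simp only [union_empty]
    ac_rfl
  have hpick : ∀ (x y : Fin m → Bits m) (l : Bool) (t' : Bits m),
      pick (2 * (m * m) + 1 + m * m) t (ket (cfgSet (m * m) m (2 * (m * m) + 1) ∅ (flatEquiv m x) l
        (flatEquiv m y) (fun j => !t' j) (fun _ => false))) =
      if t' = (fun j => !t j) then ket (discarded (x, y) ∪ place (2 * (m * m)) fun _ : Fin 1 => l)
        else 0 := by
    intro x y l t'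
    have h1 := clearAt_coin (x := flatEquiv m x) (l := l) (y := flatEquiv m y)
      (t := fun j => !t' j) (z := fun _ => false) haY hout (fun _ => false)
    rw [place_false, union_empty] at h1
    rw [pick_ket, readAt_coin haY hout, h1, hcfg]
    refine if_congr ⟨?_, ?_⟩ rfl rfl
    · rintro rfl; simp
    · rintro rfl; simp
  have hflip : ∀ (f l : Bool) (i : (Fin m → Bits m) × (Fin m → Bits m)),
      gatesOp (if f then xGate (2 * (m * m)) else [])
        (ket (discarded i ∪ place (2 * (m * m)) fun _ : Fin 1 => l)) =
      ket (discarded i ∪ place (2 * (m * m)) fun _ : Fin 1 => xor l f) := by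
    rintro (_ | _) l ⟨x, y⟩
    · rw [Bool.xor_false]; rfl
    · rw [if_pos rfl, xGate_ket, ← hcfg, ← hcfg]
      congr 1
      have := cfgSet_flip (x := flatEquiv m x) (l := l) (y := flatEquiv m y)
        (t := fun _ => false) (z := fun _ => false) haY hout
      rw [← two_mul] at this
      rw [this, Bool.xor_true]
  generalize hf : (b && decide (κ * m ≤ ((univ.filter fun j => t j = false).card : ℝ))) = f
  have hK : ∀ (i : (Fin m → Bits m) × (Fin m → Bits m)) (y : Bits 1) (z : Bits (m * m + 1)),
      swapKraus κ b ψ (fun j => !t j, i) y z =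
        (∏ j, swapAmp (ψ j).1 (!t j) (i.1 j) (i.2 j) (block (fun i => z i.castSucc) j)) *
          if y = (fun _ => xor (z (Fin.last _)) f) then 1 else 0 := by
    intro i y z
    have h1 : y 0 = xor (z (Fin.last _)) f ↔ y = fun _ => xor (z (Fin.last _)) f :=
      ⟨fun h => funext fun i => by rw [Fin.eq_zero i, h], fun h => by rw [h]⟩
    rw [if_congr h1.symm rfl rfl, swapKraus, ← hf]
    simp only [Bool.not_eq_true']
  have hR : ∀ (i : (Fin m → Bits m) × (Fin m → Bits m)),
      ∑ y : Bits 1, (swapKraus κ b ψ (fun j => !t j, i)).mulVec v y •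
        ket (discarded i ∪ place (2 * (m * m)) y) =
      ∑ z, v z • (∏ j, swapAmp (ψ j).1 (!t j) (i.1 j) (i.2 j) (block (fun i => z i.castSucc) j)) •
        ket (discarded i ∪ place (2 * (m * m)) fun _ : Fin 1 => xor (z (Fin.last _)) f) := by
    intro i
    simp only [Matrix.mulVec, dotProduct, hK, sum_smul]
    rw [sum_comm]
    refine sum_congr rfl fun z _ => ?_
    rw [Fintype.sum_eq_single (fun _ => xor (z (Fin.last _)) f) fun y hy => by simp [hy],
      if_pos rfl, mul_one, smul_smul, mul_comm]
  simp only [hR]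
  rw [sum_comm, map_sum, map_sum]
  refine sum_congr rfl fun z _ => ?_
  rw [← smul_sum, map_smul, map_smul, map_sum, map_sum, Fintype.sum_prod_type,
    Fintype.sum_eq_single (fun j => !t j)]
  · simp only [map_smul, hpick, if_true, hflip]
  · intro t' ht'
    simp [hpick, ht']

theorem wireDensity_sum {ι : Type} [Fintype ι] (A : ι → Bits 1 → ℂ) {ρ : ι → Finset ℕ}
    (hρ : Function.Injective ρ) {a : ℕ} (ha : ∀ i, a ∉ ρ i) :
    wireDensity (∑ i, ∑ y, A i y • ket (ρ i ∪ place a y)) a =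
      ∑ i, Matrix.vecMulVec (A i) (star (A i)) := by
  classical
  have hclear : ∀ (i : ι) (y : Bits 1), clearAt a 1 (ρ i ∪ place a y) = ρ i := by
    intro i y
    rw [union_comm]
    exact clearAt_place_union (fun u hu => by
      have : u ≠ a := fun h => ha i (h ▸ hu)
      omega) y
  have hread : ∀ (i : ι) (y : Bits 1), readAt a 1 (ρ i ∪ place a y) = y := by
    intro i y
    rw [union_comm]
    exact readAt_place_union (fun u hu => by
      have : u ≠ a := fun h => ha i (h ▸ hu)
      omega) y
  set W := ∑ i, ∑ y, A i y • ket (ρ i ∪ place a y) with hW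
  have hval : ∀ (s : Finset ℕ), W s = ∑ i, ∑ y, if ρ i ∪ place a y = s then A i y else 0 := by
    intro s
    simp [hW, Finsupp.finsetSum_apply, ket_apply]
  have hval' : ∀ i y, W (ρ i ∪ place a y) = A i y := by
    intro i y
    rw [hval, Fintype.sum_eq_single i, Fintype.sum_eq_single y, if_pos rfl]
    · exact fun y' hy' => if_neg fun h => hy' (by rw [← hread i y', h, hread])
    · exact fun i' hi' => sum_eq_zero fun y' _ => if_neg fun h =>
        hi' (hρ (by rw [← hclear i' y', h, hclear]))
  have hsub : W.support.image (clearAt a 1) ⊆ univ.image ρ := by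
    intro u hu
    obtain ⟨s, hs, rfl⟩ := mem_image.1 hu
    rw [Finsupp.mem_support_iff, hval] at hs
    obtain ⟨i, _, hi⟩ := exists_ne_zero_of_sum_ne_zero hs
    obtain ⟨y, _, hy⟩ := exists_ne_zero_of_sum_ne_zero hi
    have h := (ite_ne_right_iff.1 hy).1
    exact mem_image.2 ⟨i, mem_univ _, by rw [← h, hclear]⟩
  funext y y'
  rw [wireDensity, sum_subset hsub, sum_image hρ.injOn, Matrix.sum_apply]
  · simp [hval', Matrix.vecMulVec_apply]
  · intro u hu hu'
    obtain ⟨i, _, rfl⟩ := mem_image.1 hu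
    have : W (ρ i ∪ place a y) = 0 := by
      by_contra h
      exact hu' (mem_image.2 ⟨_, Finsupp.mem_support_iff.2 h, hclear i y⟩)
    rw [this, zero_mul]

theorem discarded_injective {m : ℕ} : Function.Injective (discarded (m := m)) := by
  rintro ⟨x, y⟩ ⟨x', y'⟩ h
  have h1 : ∀ x y : Fin m → Bits m, readAt (m * m) (m * m) (discarded (x, y)) = flatEquiv m x :=
    fun x y => readAt_place_union (fun u hu => by
      obtain ⟨h, _⟩ := mem_place_iff.1 hu; omega) _
  have h2 : ∀ x y : Fin m → Bits m,
      readAt (2 * (m * m) + 1) (m * m) (discarded (x, y)) = flatEquiv m y := fun x y => by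
    rw [discarded, union_comm]
    exact readAt_place_union (fun u hu => by obtain ⟨h, _⟩ := mem_place_iff.1 hu; omega) _
  rw [(flatEquiv m).injective ((h1 x y).symm.trans ((congrArg _ h).trans (h1 x' y'))),
    (flatEquiv m).injective ((h2 x y).symm.trans ((congrArg _ h).trans (h2 x' y')))]

theorem notMem_discarded {m : ℕ} (i : (Fin m → Bits m) × (Fin m → Bits m)) :
    2 * (m * m) ∉ discarded i := by
  rw [discarded, mem_union, not_or]
  exact ⟨notMem_place (by omega), notMem_place (by omega)⟩

theorem sum_wireDensity_eq_apply {m : ℕ} (κ : ℝ) (b : Bool) (ψ : Fin m → PureState m)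
    (v : Bits (m * m + 1) → ℂ) :
    ∑ t : Bits m, wireDensity (∑ i, ∑ y : Bits 1,
      (swapKraus κ b ψ (fun j => !t j, i)).mulVec v y • ket (discarded i ∪ place (2 * (m * m)) y))
        (2 * (m * m)) = (swapChannel κ b ψ).apply (Matrix.vecMulVec v (star v)) := by
  have hnot : Function.Involutive fun (t : Bits m) j => !t j := fun t => by simp
  have h : ∀ e, swapKraus κ b ψ e * Matrix.vecMulVec v (star v) *
      (swapKraus κ b ψ e).conjTranspose = Matrix.vecMulVec ((swapKraus κ b ψ e).mulVec v)
        (star ((swapKraus κ b ψ e).mulVec v)) := fun e => by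
    rw [Matrix.mul_vecMulVec, Matrix.vecMulVec_mul, Matrix.star_mulVec]
  simp only [wireDensity_sum _ discarded_injective notMem_discarded]
  refine (Equiv.sum_comp (hnot.toPerm _) fun t => ∑ i, Matrix.vecMulVec
    ((swapKraus κ b ψ (t, i)).mulVec v) (star ((swapKraus κ b ψ (t, i)).mulVec v))).trans ?_
  rw [← Fintype.sum_prod_type']
  exact sum_congr rfl fun e _ => (h e).symm

theorem swapLayer_eq (a m Y : ℕ) : swapLayer a m Y =
    (List.range m).flatMap fun j => (List.range m).flatMap fun i =>
      cswapGate (Y + m * m + j) (a + m * j + i) (Y + m * j + i) := by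
  have h : ∀ j i : Fin m, ((finProdFinEquiv (j, i) : Fin (m * m)) : ℕ) = m * j + i := fun j i => by
    rw [finProdFinEquiv_apply_val, add_comm]
  simp only [swapLayer, SProd.sprod, List.product, List.flatMap_assoc, List.flatMap_map, h,
    ← List.map_coe_finRange_eq_range, ← add_assoc]

namespace Prog
variable {M : ℕ} {v : Workspace} {o : List Bool} {n b p q : ℕ}

/-- Subtract register `r` from register `t`. -/
def subFrom (t r : ℕ) : Prog := loop r (dec t)

theorem det_subFrom {l : List ℕ} {t r k : ℕ} (ht : t < l.length) (hr : l.getD r 0 = k)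
    (hk : k ≤ M) :
    (subFrom t r).Det M (rg l, v, o) (rg (l.set t (l.getD t 0 - k)), v, o) := by
  have h0 : l = l.set t (l.getD t 0 - 0) := by simp [ht]
  have := det_loop (M := M) (p := dec t) (r := r) (k := k)
    (fun i => (rg (l.set t (l.getD t 0 - i)), v, o)) (by rw [← h0]; exact hr) hk fun i _ => by
      have h2 : t < (l.set t (l.getD t 0 - i)).length := by rwa [List.length_set]
      have h3 := det_dec (M := M) (v := v) (o := o) h2
      rwa [List.set_set, List.getD_eq_getElem _ 0 h2, List.getElem_set_self, Nat.sub_sub] at h3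
  rwa [← h0] at this

/-- Move the marked states out of the way of the input, whose first wire is then in register `4`;
register `3` holds the first wire of the marked states, register `5` the first scratch wire. -/
def chanInit : Prog := (loop 0 (addTo 2 0)).seq <|
  ((addTo 3 2).seq <| (addTo 3 2).seq <| (inc 3).seq <| addTo 5 3).seq <|
  (loop 2 ((gates [.cnot 4 5, .cnot 5 4]).seq ((inc 4).seq (inc 5)))).seq (addTo 6 5)

theorem det_chanInit (hM : 3 * (n * n) + n + 1 ≤ M) :
    chanInit.Det M (rg (n :: b :: List.replicate 8 0), v, o)
      (rg [n, b, n * n, 2 * (n * n) + 1, n * n, 2 * (n * n) + 1 + n * n,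
        2 * (n * n) + 1 + n * n, 0, 0, 0],
        gatesOp (moveBlock 0 (2 * (n * n) + 1) (n * n)) v, o) := by
  have h1 := det_loop (M := M) (p := addTo 2 0) (r := 0) (k := n) (fun i =>
    (rg [n, b, n * i, 0, 0, 0, 0, 0, 0, 0], v, o)) rfl (by omega) fun i _ =>
      det_addTo (k := n) (by simp) rfl (by omega)
  have h2 := det_gateLoop (M := M) (p := (gates [.cnot 4 5, .cnot 5 4]).seq ((inc 4).seq (inc 5)))
    (r := 2) (k := n * n) (v := v) (o := o)
    (fun i => [n, b, n * n, 2 * (n * n) + 1, 0 + i, 2 * (n * n) + 1 + i, 0, 0, 0, 0])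
    (fun i => [.cnot (0 + i) (2 * (n * n) + 1 + i), .cnot (2 * (n * n) + 1 + i) (0 + i)])
    rfl (by omega) fun i hi v => by
      refine Det.seq (det_gates ?_) (Det.seq (det_inc (by simp)) (det_inc (by simp)))
      have h1 : i ≤ M := by omega
      have h2 : 2 * (n * n) + 1 + i ≤ M := by omega
      simp [Gate.map, Gate.Below, rg, Nat.lt_succ_iff, h1, h2]
  have h3 : ((addTo 3 2).seq ((addTo 3 2).seq ((inc 3).seq (addTo 5 3)))).Det M
      (rg [n, b, n * n, 0, 0, 0, 0, 0, 0, 0], v, o)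
      (rg [n, b, n * n, 2 * (n * n) + 1, 0, 2 * (n * n) + 1, 0, 0, 0, 0], v, o) := by
    refine Spec.equiv ((det_addTo (k := n * n) (by simp) rfl (by omega)).seq
      ((det_addTo (k := n * n) (by simp) rfl (by omega)).seq ((det_inc (by simp)).seq
      (det_addTo (k := 0 + n * n + n * n + 1) (by simp) rfl (by omega))))) (Equiv.refl _)
      fun _ => ?_
    simp [two_mul]
  have h4 : (addTo 6 5).Det M (rg [n, b, n * n, 2 * (n * n) + 1, 0 + n * n,
      2 * (n * n) + 1 + n * n, 0, 0, 0, 0],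
      gatesOp (moveBlock 0 (2 * (n * n) + 1) (n * n)) v, o)
      (rg [n, b, n * n, 2 * (n * n) + 1, n * n, 2 * (n * n) + 1 + n * n,
        2 * (n * n) + 1 + n * n, 0, 0, 0],
        gatesOp (moveBlock 0 (2 * (n * n) + 1) (n * n)) v, o) := by
    refine (det_addTo (k := 2 * (n * n) + 1 + n * n) (by simp) rfl (by omega)).equiv (Equiv.refl _)
      fun _ => ?_
    simp
  exact h1.seq (h3.seq (h2.seq h4))

/-- Hadamard gates on the wires of the coins, which start with the one in register `6`. -/
def coinFlips : Prog := (loop 0 ((gates [.had 6]).seq (inc 6))).seq ((const 6 0).seq (addTo 6 5))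

theorem det_coinFlips {r₂ r₃ r₄ C r₇ r₈ r₉ : ℕ} (hM : C + n ≤ M) :
    coinFlips.Det M (rg [n, b, r₂, r₃, r₄, C, C, r₇, r₈, r₉], v, o)
      (rg [n, b, r₂, r₃, r₄, C, C, r₇, r₈, r₉], gatesOp (hadBlock C n) v, o) := by
  have h1 := det_gateLoop (M := M) (p := (gates [.had 6]).seq (inc 6)) (r := 0) (k := n) (v := v)
    (o := o) (fun i => [n, b, r₂, r₃, r₄, C, C + i, r₇, r₈, r₉]) (fun i => [.had (C + i)])
    rfl (by omega) fun i hi v => by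
      refine Det.seq (det_gates ?_) (det_inc (by simp))
      have h1 : C + i ≤ M := by omega
      simp [Gate.map, Gate.Below, rg, Nat.lt_succ_iff, h1]
  rw [show (List.range n).flatMap (fun i => [Gate.had (C + i)]) = hadBlock C n by
    rw [hadBlock, List.map_eq_flatMap]] at h1
  refine (h1.seq ((det_set (by simp)).seq (det_addTo (k := C) (by simp) rfl
    (by omega)))).equiv (Equiv.refl _) fun _ => ?_
  simp

theorem cswapGate_map (c x y : ℕ) (f : ℕ → ℕ) :
    (cswapGate c x y).map (Gate.map f) = cswapGate (f c) (f x) (f y) := rfl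

theorem det_cswap {R : ℕ → ℕ} {c x y : ℕ} (hc : R c ≤ M) (hx : R x ≤ M) (hy : R y ≤ M) :
    (gates (cswapGate c x y)).Det M (R, v, o)
      (R, gatesOp (cswapGate (R c) (R x) (R y)) v, o) := by
  rw [← cswapGate_map]
  exact det_gates (cswapGate_below (by omega) (by omega) (by omega))

/-- The controlled swaps of one block. -/
def swapRow : Prog := loop 0 ((gates (cswapGate 6 4 3)).seq ((inc 4).seq (inc 3)))

/-- The controlled swaps. -/
def swaps : Prog :=
  (loop 0 (swapRow.seq (inc 6))).seq
    ((const 6 0).seq (addTo 6 5))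

theorem det_swaps {a r₂ Y r₇ r₈ r₉ : ℕ} (ha : a ≤ Y) (hM : Y + n * n + n ≤ M) :
    swaps.Det M (rg [n, b, r₂, Y, a, Y + n * n, Y + n * n, r₇, r₈, r₉], v, o)
      (rg [n, b, r₂, Y + n * n, a + n * n, Y + n * n, Y + n * n, r₇, r₈, r₉],
        gatesOp (swapLayer a n Y) v, o) := by
  have h1 : ∀ j < n, ∀ v : Workspace, swapRow.Det M
      (rg [n, b, r₂, Y + n * j, a + n * j, Y + n * n, Y + n * n + j, r₇, r₈, r₉], v, o)
      (rg [n, b, r₂, Y + n * j + n, a + n * j + n, Y + n * n, Y + n * n + j, r₇, r₈, r₉],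
        gatesOp ((List.range n).flatMap fun i =>
          cswapGate (Y + n * n + j) (a + n * j + i) (Y + n * j + i)) v, o) := by
    intro j hj v
    refine det_gateLoop (fun i => [n, b, r₂, Y + n * j + i, a + n * j + i, Y + n * n,
      Y + n * n + j, r₇, r₈, r₉]) _ rfl (by omega) fun i hi v => ?_
    have h2 : n * j + i ≤ n * n := by nlinarith
    exact Det.seq (det_cswap (show Y + n * n + j ≤ M by omega) (show a + n * j + i ≤ M by omega)
      (show Y + n * j + i ≤ M by omega)) (Det.seq (det_inc (by simp)) (det_inc (by simp)))
  have h2 := det_gateLoop (M := M) (p := swapRow.seq (inc 6)) (r := 0) (k := n) (v := v) (o := o)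
    (fun i => [n, b, r₂, Y + n * i, a + n * i, Y + n * n, Y + n * n + i, r₇, r₈, r₉])
    (fun j => (List.range n).flatMap fun i =>
      cswapGate (Y + n * n + j) (a + n * j + i) (Y + n * j + i)) rfl (by omega)
    fun j hj v => by
      simp only [Nat.mul_succ, ← Nat.add_assoc]
      exact (h1 j hj v).seq (det_inc (l := [n, b, r₂, Y + n * j + n, a + n * j + n,
      Y + n * n, Y + n * n + j, r₇, r₈, r₉]) (r := 6) (by simp))
  rw [← swapLayer_eq] at h2
  refine (h2.seq ((det_set (by simp)).seq (det_addTo (k := Y + n * n) (by simp) rfl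
    (by omega)))).equiv (Equiv.refl _) fun _ => ?_
  simp

/-- Measure the coins and subtract `q` from register `7`, which starts with `p n`, for every test
that is passed. -/
def countTests (p q : ℕ) : Prog :=
  (const 8 p).seq <| (loop 0 (addTo 7 8)).seq <| (const 8 q).seq <|
    loop 0 ((measReset 9 6).seq ((ifZero 9 (subFrom 7 8) skip).seq ((const 9 0).seq (inc 6))))

theorem spec_countTests {r₂ r₃ r₄ C : ℕ} (hp : p ≤ M) (hq : q ≤ M) (hM : C + n ≤ M) :
    (countTests p q).Spec M (rg [n, b, r₂, r₃, r₄, C, C, 0, 0, 0], v, o) fun t : Bits n =>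
      (rg [n, b, r₂, r₃, r₄, C, C + n, p * n - q * (univ.filter fun j => t j = false).card, q, 0],
        pick C t v, o) := by
  have h1 := det_loop (M := M) (p := addTo 7 8) (r := 0) (k := n) (fun i =>
    (rg [n, b, r₂, r₃, r₄, C, C, p * i, p, 0], v, o)) rfl (by omega) fun i _ =>
      det_addTo (k := p) (by simp) rfl hp
  let T : List Bool → Core := fun xs =>
    (rg [n, b, r₂, r₃, r₄, C, C + xs.length, p * n - q * xs.count false, q, 0], readOff C xs v, o)
  have hT : T [] = (rg [n, b, r₂, r₃, r₄, C, C, p * n, q, 0], v, o) := by simp [T, readOff_nil]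
  have h2 : ((measReset 9 6).seq ((ifZero 9 (subFrom 7 8) skip).seq
      ((const 9 0).seq (inc 6)))).Reps M n 1 T := by
    refine .one fun xs hxs => ?_
    refine (spec_measReset (l := [n, b, r₂, r₃, r₄, C, C + xs.length, p * n - q * xs.count false,
      q, 0]) (a := 6) (r := 9) (by simp) (by norm_num) rfl (by omega)).det fun x => ?_
    refine Det.seq (s' := (rg [n, b, r₂, r₃, r₄, C, C + xs.length,
      p * n - q * (xs ++ [x]).count false, q, x.toNat], readOff C (xs ++ [x]) v, o)) ?_
      (Det.seq (det_set (by simp)) ((det_inc (by simp)).equiv (Equiv.refl _) fun _ => ?_))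
    · cases x
      · refine Spec.ifZero_pos ((det_subFrom (k := q) (by simp) rfl hq).equiv (Equiv.refl _)
          fun _ => ?_) rfl
        simp [Nat.mul_succ, Nat.sub_sub]
      · refine Spec.ifZero_neg (det_skip.equiv (Equiv.refl _) fun _ => ?_) one_ne_zero
        simp
    · simp [T, add_assoc]
  have h3 := h2.loop (r := 0) (k := n) (fun _ _ => rfl) (by omega) [] (by simp)
  rw [mul_one, hT] at h3
  refine (Spec.after (det_set (by simp)) (Spec.after h1 (Spec.after (det_set (by simp)) h3))).equiv
    (Equiv.refl _) fun t => ?_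
  have hc : (List.ofFn t).count false = (univ.filter fun j => t j = false).card := by
    have := Fin.card_filter_univ_eq_vector_get_eq_count false (List.Vector.ofFn t)
    simp only [List.Vector.get_ofFn, List.Vector.toList_ofFn] at this
    exact this.symm
  simp [T, readOff_ofFn, hc]

/-- Flip the wire with number in register `4` if register `1` is set and register `7` is not. -/
def flipOutput : Prog := ifZero 7 (ifZero 1 skip (gates (xGate 4))) skip

theorem det_flipOutput {R : ℕ → ℕ} {c : Bool} {P : Prop} [Decidable P] (h1 : R 1 = c.toNat)
    (h7 : R 7 = 0 ↔ P) (h4 : R 4 ≤ M) : flipOutput.Det M (R, v, o)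
      (R, gatesOp (if c && decide P then xGate (R 4) else []) v, o) := by
  by_cases hP : P
  · refine Spec.ifZero_pos ?_ (h7.2 hP)
    cases c
    · exact (Spec.ifZero_pos det_skip h1)
    · refine (Spec.ifZero_neg ?_ (h1.trans_ne one_ne_zero))
      simp only [hP, decide_true, Bool.and_true, if_true, ← xGate_map]
      refine det_gates ?_
      rw [xGate_map]
      exact xGate_below (Nat.lt_succ_of_le h4)
  · refine Spec.ifZero_neg ?_ fun h => hP (h7.1 h)
    simpa [hP] using det_skip

theorem exists_channelProgram {κ : ℚ} (hκ : 0 ≤ κ) :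
    ∃ (P : Prog) (T : Polynomial ℕ), AppliesChannel κ P T := by
  classical
  let Q : Polynomial ℕ := 3 * (Polynomial.X * Polynomial.X) + Polynomial.X + 1 +
    Polynomial.C κ.num.toNat + Polynomial.C κ.den
  have hQ : ∀ n, Q.eval n = 3 * (n * n) + n + 1 + κ.num.toNat + κ.den := fun n => by simp [Q]
  let P := chanInit.seq <| coinFlips.seq <| swaps.seq <| coinFlips.seq <|
    (countTests κ.num.toNat κ.den).seq flipOutput
  refine ⟨P, P.cost.comp Q + Q + 1, fun n b ψ v => ?_⟩
  intro β
  have hlin : ∀ k : ℕ, κ.num.toNat * n - κ.den * k = 0 ↔ (κ : ℝ) * n ≤ k := by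
    intro k
    have h1 : (κ : ℝ) = κ.num.toNat / κ.den := by
      conv_lhs => rw [← Rat.num_div_den κ]
      have : ((κ.num.toNat : ℤ) : ℝ) = κ.num := by
        rw [Int.toNat_of_nonneg (Rat.num_nonneg.2 hκ)]
      push_cast
      rw [← this]
      rfl
    have h2 : (0 : ℝ) < κ.den := by exact_mod_cast κ.den_pos
    rw [Nat.sub_eq_zero_iff_le, h1, div_mul_eq_mul_div, div_le_iff₀ h2, mul_comm (k : ℝ)]
    exact_mod_cast Iff.rfl
  have hM := hQ n
  generalize hQM : Q.eval n = M at hM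
  have h : P.Spec M β.core fun t : Bits n => (rg [n, b.toNat, n * n, 2 * (n * n) + 1 + n * n,
      n * n + n * n, 2 * (n * n) + 1 + n * n, 2 * (n * n) + 1 + n * n + n,
      κ.num.toNat * n - κ.den * (univ.filter fun j => t j = false).card, κ.den, 0],
      ∑ i, ∑ y : Bits 1, (swapKraus κ b ψ (fun j => !t j, i)).mulVec v y •
        ket (discarded i ∪ place (2 * (n * n)) y), []) := by
    rw [show β.core = _ from rfl, Config.core, startConfig_regs n b.toNat 8]
    refine (Spec.after (det_chanInit (by omega)) <| Spec.after (det_coinFlips (by omega)) <|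
      Spec.after (det_swaps (by omega) (by omega)) <| Spec.after (det_coinFlips (by omega)) <|
      (spec_countTests (by omega) (by omega) (by omega)).det fun t =>
        det_flipOutput rfl (hlin _) ?_).equiv (Equiv.refl _) fun t => ?_
    · show n * n + n * n ≤ M
      omega
    · rw [← output_test, ← gatesOp_test_input, testGates, gatesOp_append_apply,
        gatesOp_append_apply, two_mul]
      rfl
  subst hQM
  refine ⟨h.bounded rfl rfl, ?_⟩
  rw [← sum_wireDensity_eq_apply]
  funext y y'
  have key : ∀ l : List Config, ((l.map fun β' => wireDensity β'.vec (2 * (n * n))).sum) y y' =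
      (l.map fun β' => wireDensity β'.vec (2 * (n * n)) y y').sum := by
    intro l
    induction l with
    | nil => rfl
    | cons β' l ih => rw [List.map_cons, List.map_cons, List.sum_cons, List.sum_cons, ← ih]; rfl
  rw [key, Matrix.sum_apply]
  exact h.sum β rfl fun c => wireDensity c.2.1 (2 * (n * n)) y y'

end Prog

theorem exists_programs (s : Polynomial ℕ) {κ : ℚ} (hκ : 1 / 2 < κ) :
    ∃ (G P : Prog) (T : Polynomial ℕ), GeneratesInstances s G T ∧ AppliesChannel κ P T := by
  obtain ⟨G, T, hG⟩ := Prog.exists_generator s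
  obtain ⟨P, T', hP⟩ := Prog.exists_channelProgram (κ := κ) (by linarith)
  have hle : ∀ {p : Prog} {β : Config} {a b : ℕ}, a ≤ b → p.Bounded β a → p.Bounded β b :=
    fun hab h β' hβ' => ⟨(h β' hβ').1.trans hab, (h β' hβ').2.trans hab⟩
  refine ⟨G, P, T + T', fun n => ⟨hle ?_ (hG n).1, (hG n).2⟩,
    fun n b ψ v => ⟨hle ?_ (hP n b ψ v).1, (hP n b ψ v).2⟩⟩ <;> rw [Polynomial.eval_add] <;> omega

end ChannelOracles

open ChannelOracles
theorem mainTheorem4 :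
    (∀ κ : ℝ, 1 / 2 < κ → κ < 1 →
      ∃ (L : Set ℕ) (ψ : ∀ n, Fin n → PureState n),
        Separates anyLength (swapOracle κ L ψ) noInfo L) ∧
    (∀ (s : Polynomial ℕ) (κ : ℚ), 1 / 2 < κ → κ < 1 →
      (∃ (G P : Prog) (T : Polynomial ℕ), GeneratesInstances s G T ∧ AppliesChannel κ P T) ∧
      (∃ T : Polynomial ℕ, ∀ (n : ℕ) (d : Fin n → Descr s n),
        (publicInfo d).length ≤ T.eval n) ∧
      (∀ n : ℕ, Function.Injective (publicInfo : (Fin n → Descr s n) → List Bool)) ∧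
      (GeneratesComplexStates s → ∀ S : Set ℕ, S.Infinite →
        (∀ᵐ ω ∂(oracleLaw s),
          Separates ownLength (oracleOf κ S ω) noInfo (langOf S ω) ∧
          Separates ownLength (oracleOf κ S ω) (infoOf ω) (langOf S ω)) ∧
        (Sparse S → ∀ᵐ ω ∂(oracleLaw s),
          Separates anyLength (oracleOf κ S ω) noInfo (langOf S ω) ∧
          Separates anyLength (oracleOf κ S ω) (infoOf ω) (langOf S ω)))) := by
  refine ⟨fun κ hκ hκ1 => exists_separating hκ hκ1, fun s κ hκ hκ1 =>
    ⟨exists_programs s hκ, ⟨infoBound s, fun n d => publicInfo_length_le d⟩,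
      publicInfo_injective s, fun hs S hS => ?_⟩⟩
  have h1 : (1 : ℝ) / 2 < κ := by
    have := (Rat.cast_lt (K := ℝ)).2 hκ
    push_cast at this
    exact this
  have h2 : (κ : ℝ) < 1 := by exact_mod_cast hκ1
  refine ⟨ae_separates_both hs h1 h2 hS (fun _ => rfl) ?_, fun hsp =>
    ae_separates_both hs h1 h2 hS (fun _ => trivial) fun m hm n hn _ =>
      ⟨fun h => hsp m hm n hn h, fun h => hsp n hn m hm h⟩⟩
  rintro m - n - rfl
  exact ⟨fun h => absurd h (lt_irrefl _), fun h => absurd h (lt_irrefl _)⟩
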